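/- Let $\langle x,y\rangle=-x_0y_0+\sum_{j=1}^7x_jy_j$ on $\mathbb R^8_1$, and identify a point $y\in S^6\subset\mathbb R^7$ with the null line $[(1,y)]$; so $[Y]=\frac1{y_0}(y_1,\dots,y_7)$ for a null vector $Y=(y_0,\dots,y_7)$ with $y_0\ne0$. Write $r=|z|$, $\sigma=1-\frac{r^4}{4}-\frac{2r^6}{9}$, $\varsigma=|\sigma|$, and let $$\eta=\lambda^{-1}\begin{pmatrix}0&\hat B_1\\-\hat B_1^tI_{1,1}&0\end{pmatrix}dz,\qquad \hat B_1=\frac12\begin{pmatrix}-i&1&i&-1&-2iz&2z\\ i&-1&i&-1&2iz&-2z\end{pmatrix},\qquad I_{1,1}=\mathrm{diag}(-1,1).$$ For $|\lambda|=1$ put $$Y=-\frac{\sqrt2}{2\varsigma}\begin{pmatrix}-1-r^2-\frac{r^4}4-\frac{r^6}9\\1-r^2+\frac{r^4}4+\frac{r^6}9\\ \frac{ir^2}2(\lambda^{-1}z-\lambda\bar z)\\-\frac{r^2}2(\lambda^{-1}z+\lambda\bar z)\\-i(\lambda^{-1}z-\lambda\bar z)\\ \lambda^{-1}z+\lambda\bar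 z\\ \frac{ir^2}3(\lambda^{-1}z^2-\lambda\bar z^2)\\-\frac{r^2}3(\lambda^{-1}z^2+\lambda\bar z^2)\end{pmatrix},\quad \hat Y=\frac{\sqrt2}{2\varsigma}\begin{pmatrix}1+r^2+\frac{5r^4}4+\frac{4r^6}9+\frac{r^8}{36}\\1-r^2-\frac{3r^4}4+\frac{4r^6}9-\frac{r^8}{36}\\-i(\lambda^{-1}z-\lambda\bar z)(1+\frac{r^6}9)\\(\lambda^{-1}z+\lambda\bar z)(1+\frac{r^6}9)\\ \frac{ir^2}2(\lambda^{-1}z-\lambda\bar z)(1+\frac{4r^2}3)\\-\frac{r^2}2(\lambda^{-1}z+\lambda\bar z)(1+\frac{4r^2}3)\\-i(\lambda^{-1}z^2-\lambda\bar z^2)(1-\frac{r^4}{12})\\(\lambda^{-1}z^2+\lambda\bar z^2)(1-\frac{r^4}{12})\end{pmatrix}.$$ Then, on $\{z\in\mathbb C:\sigma(z)\neq0\}$, the associated family of isotropic harmonic maps into $SO^+(1,7)/(SO^+(1,1)\times SO(6))$ obtained from the normalized potential $\eta$ is $Y\wedge\hat Y$. That is: if $F_-$ solves $F_-^{-1}dF_-=\eta$,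 $F_-(0,\lambda)=I$, then there is an extended frame $F(z,\lambda)=(e_0,\hat e_0,\psi_1,\dots,\psi_6)$, smooth in $z$ with $F(0,\lambda)=I$, such that $F_-=F\cdot F_+$ is an Iwasawa decomposition ($F$ a twisted loop in $SO^+(1,7)$; $F_+$ a twisted loop in $SO(1,7,\mathbb C)$ extending holomorphically to the disk $|\lambda|\le1$, with value at $\lambda=0$ in the solvable factor $\mathfrak B$ of $K^{\mathbb C}=K\cdot\mathfrak B$), and $Y=\frac{\sqrt2}2(e_0-\hat e_0)$, $\hat Y=\frac{\sqrt2}2(e_0+\hat e_0)$; for each $\lambda$ the map with frame $F(\cdot,\lambda)$ is harmonic, its Maurer–Cartan form is $\alpha_\lambda=\lambda^{-1}\alpha_1'+\alpha_0+\lambda\alpha_1''$ with $\alpha=\alpha_0+\alpha_1$ the form at $\lambda=1$, and the upper right $2\times6$ block $B_1$ of $F^{-1}F_z$ satisfies $B_1B_1^t=0$. Moreover, for each $\lambda$ with $|\lambda|=1$, $y=[Y]$ and $\hat y=[\hat Y]$ extend to smooth maps from all of $S^2=\mathbb C\cup\{\infty\}$ to $S^6$, and: 1. $\hat y$ is an H-totally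 isotropic, conformal Willmore immersion from $S^2$ to $S^6$, with $$|\hat y_z|^2|dz|^2=\frac{2\left(1+4r^2+\frac{r^4}4+\frac{2r^6}9+\frac{4r^8}9+\frac{r^{10}}{36}+\frac{r^{12}}{81}\right)}{\left(1+r^2+\frac{5r^4}4+\frac{4r^6}9+\frac{r^8}{36}\right)^2}|dz|^2 ,$$ and $\hat y$ has no dual surface, not even on a non-empty open subset of $S^2$. 2. $y$ restricts to an H-totally isotropic, conformal Willmore immersion from $\mathbb C$ to $S^6$, with $$|y_z|^2|dz|^2=\frac{2\left(1+\frac{r^4}4+\frac{4r^6}9\right)}{\left(1+r^2+\frac{r^4}4+\frac{r^6}9\right)^2}|dz|^2 ,$$ and $z=\infty$ is a branch point of $y:S^2\to S^6$. On $\mathbb C\setminus\{0\}$, $y$ is conformally (Möbius) equivalent to the immersed minimal surface in $\mathbb R^6$ $$x=\Big(i(\lambda^{-1}z-\lambda\bar z),\,-(\lambda^{-1}z+\lambda\bar z),\,-\tfrac{2i}{r^2}(\lambda^{-1}z-\lambda\bar z),\,\tfrac2{r^2}(\lambda^{-1}z+\lambda\bar z),\,\tfrac{2i}3(\lambda^{-1}z^2-\lambda\bar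 z^2),\,-\tfrac23(\lambda^{-1}z^2+\lambda\bar z^2)\Big)^t .$$ 3. $Y\wedge\hat Y$ has no definition on the curve $1-\frac{r^4}4-\frac{2r^6}9=0$: at each point $z_0$ of the curve $y(z_0)=\hat y(z_0)$, and $Y\wedge\hat Y$ has no limit as $z\to z_0$, $\sigma(z)\ne0$. Here a conformally immersed surface with light cone lift $Y$ has $V=\mathrm{Span}\{Y,\mathrm{Re}\,Y_z,\mathrm{Im}\,Y_z,Y_{z\bar z}\}$ as the value of its conformal Gauss map. It is *H-totally isotropic* if $\langle Y_z^{(j)},Y_z^{(l)}\rangle=0$ for all $j,l\ge1$ and there are local smooth isotropic frames $E_1,E_2,E_3$ with $\langle E_j,\bar E_l\rangle=2\delta_{jl}$ and $Y_z^{(j)}\in\mathrm{Span}\{Y,E_1,\dots,E_j\}$, such that $E_2,E_3,\bar E_2,\bar E_3$ is a basis of $V^\perp_{\mathbb C}$ and the normal derivatives $D_{\bar z}E_2,D_{\bar z}E_3$ lie in $\mathrm{Span}\{E_2,E_3\}$. It is *Willmore* if it is critical for the Willmore functional $2i\int\langle\kappa,\bar\kappa\rangle\,dz\wedge d\bar z$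 ($\kappa$ the conformal Hopf differential), which equals $\frac12\int|\mathring{II}|^2dA$ ($\mathring{II}$ the trace-free second fundamental form), under all compactly supported smooth variations in $S^6$. A *dual surface* of it is a smooth map to $S^6$ with values on its mean curvature spheres (null line in $V$) and different from it at each point, weakly conformal for the same complex coordinate, and with the same conformal Gauss map where it is immersed; it may degenerate to a point. -/

import Mathlib

open scoped ContDiff Topology

noncomputable section

namespace WillmoreSphere

/-! ### Wirtinger derivatives and the Lorentzian form -/

/-- `∂f/∂z = (f_u - i f_v) / 2`, where `z = u + i v`. -/
def dz {E : Type*} [NormedAddCommGroup E] [NormedSpace ℂ E] (f : ℂ → E) (z : ℂ) : E :=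
  (2 : ℂ)⁻¹ • (fderiv ℝ f z 1 - Complex.I • fderiv ℝ f z Complex.I)

/-- `∂f/∂z̄ = (f_u + i f_v) / 2`, where `z = u + i v`. -/
def dzbar {E : Type*} [NormedAddCommGroup E] [NormedSpace ℂ E] (f : ℂ → E) (z : ℂ) : E :=
  (2 : ℂ)⁻¹ • (fderiv ℝ f z 1 + Complex.I • fderiv ℝ f z Complex.I)

/-- The bilinear form `-x₀ y₀ + x₁ y₁ + ⋯ + x₇ y₇` (over `ℝ`, or its complex bilinear extension). -/
def lor {R : Type*} [CommRing R] (x y : Fin 8 → R) : R :=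
  -(x 0 * y 0) + ∑ i : Fin 7, x i.succ * y i.succ

/-- Complex conjugation of vectors in `ℂ⁸`. -/
def conjVec (x : Fin 8 → ℂ) : Fin 8 → ℂ := fun i => (starRingEnd ℂ) (x i)

/-! ### The Riemann sphere and surfaces in the unit sphere of `ℝ⁷` -/

/-- The coordinate `z` of the Riemann sphere, as a parametrisation of the complement of `∞`. -/
def coordZero (z : ℂ) : OnePoint ℂ := (z : OnePoint ℂ)

/-- The coordinate `w = 1 / z` of the Riemann sphere, as a parametrisation of the complement
of `0`; `w = 0` is the point `∞`. -/
def coordInfty (w : ℂ) : OnePoint ℂ := if w = 0 then OnePoint.infty else ((w⁻¹ : ℂ) : OnePoint ℂ)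

/-- The two standard complex coordinates of `S² = ℂ ∪ {∞}`. -/
def coords : Set (ℂ → OnePoint ℂ) := {coordZero, coordInfty}

/-- `f` maps the open subset `Ω` of the Riemann sphere smoothly into `S⁶ ⊆ ℝ⁷`. -/
def IsSmoothIntoSphereOn (Ω : Set (OnePoint ℂ)) (f : OnePoint ℂ → EuclideanSpace ℝ (Fin 7)) :
    Prop :=
  (∀ c ∈ coords, ContDiffOn ℝ ∞ (f ∘ c) (c ⁻¹' Ω)) ∧ ∀ p ∈ Ω, ‖f p‖ = 1

/-- The light cone lift `Y = (1, f)` (in complexified Minkowski space) of a map `f` into `S⁶`. -/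
def lightLift (f : ℂ → EuclideanSpace ℝ (Fin 7)) (z : ℂ) : Fin 8 → ℂ :=
  Fin.cons 1 (fun i : Fin 7 => ((f z i : ℝ) : ℂ))

/-- `f` is a conformal immersion of `Ω`: `⟨Y_z, Y_z⟩ = 0` and the differential is injective. -/
def IsConformalImmersionOn (Ω : Set (OnePoint ℂ)) (f : OnePoint ℂ → EuclideanSpace ℝ (Fin 7)) :
    Prop :=
  ∀ c ∈ coords, ∀ z : ℂ, c z ∈ Ω →
    lor (dz (lightLift (f ∘ c)) z) (dz (lightLift (f ∘ c)) z) = 0 ∧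
      Function.Injective (fderiv ℝ (f ∘ c) z)

/-- `p` is an (isolated) branch point of `f`: the differential vanishes at `p`, and `f` is
immersed at the other points near `p`. -/
def IsBranchPoint (f : OnePoint ℂ → EuclideanSpace ℝ (Fin 7)) (p : OnePoint ℂ) : Prop :=
  ∀ c ∈ coords, ∀ z : ℂ, c z = p →
    fderiv ℝ (f ∘ c) z = 0 ∧ ∀ᶠ ζ in 𝓝[≠] z, Function.Injective (fderiv ℝ (f ∘ c) ζ)

/-- `⟨f_z, f_z̄⟩ = |f_z|²`, the coefficient of `|dz|²`. -/
def metricCoeff (f : ℂ → EuclideanSpace ℝ (Fin 7)) (z : ℂ) : ℝ :=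
  ∑ i : Fin 7, ‖dz (fun ζ => ((f ζ i : ℝ) : ℂ)) z‖ ^ 2

/-! ### Second fundamental form, mean curvature and the Willmore functional -/

section Curvature

variable {E : Type*} [NormedAddCommGroup E] [InnerProductSpace ℝ E]

/-- The partial derivatives `∂/∂u` (`i = 0`) and `∂/∂v` (`i = 1`), where `z = u + i v`. -/
def pd (i : Fin 2) (f : ℂ → E) (z : ℂ) : E :=
  fderiv ℝ f z ((![1, Complex.I] : Fin 2 → ℂ) i)

/-- The first fundamental form `g_ij = ⟨f_i, f_j⟩`. -/
def firstForm (f : ℂ → E) (z : ℂ) : Matrix (Fin 2) (Fin 2) ℝ :=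
  Matrix.of fun i j => inner ℝ (pd i f z) (pd j f z)

/-- The second fundamental form: the component of `f_ij` normal to the tangent plane,
`f_ij - ∑ g^{kl} ⟨f_ij, f_l⟩ f_k`. -/
def secondForm (f : ℂ → E) (z : ℂ) (i j : Fin 2) : E :=
  pd i (pd j f) z -
    ∑ k, ∑ l, ((firstForm f z)⁻¹ k l * inner ℝ (pd i (pd j f) z) (pd l f z)) • pd k f z

/-- The mean curvature vector `(1/2) ∑ g^{ij} II_ij`. -/
def meanCurvature (f : ℂ → E) (z : ℂ) : E :=
  (2 : ℝ)⁻¹ • ∑ i, ∑ j, (firstForm f z)⁻¹ i j • secondForm f z i j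

/-- The trace-free second fundamental form `II_ij - g_ij H`. (For a surface in the unit sphere it
is the same in the sphere as in the ambient Euclidean space.) -/
def traceFreeForm (f : ℂ → E) (z : ℂ) (i j : Fin 2) : E :=
  secondForm f z i j - firstForm f z i j • meanCurvature f z

/-- The density, with respect to `du dv`, of the Willmore functional `(1/2) ∫ |II - g H|² dA`.
In a conformal coordinate `z = u + i v` it equals `4 ⟨κ, κ̄⟩`, so that the functional is
`2i ∫ ⟨κ, κ̄⟩ dz ∧ dz̄` for the conformal Hopf differential `κ`. -/
def willmoreDensity (f : ℂ → E) (z : ℂ) : ℝ :=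
  2⁻¹ * (∑ i, ∑ j, ∑ k, ∑ l, (firstForm f z)⁻¹ i k * (firstForm f z)⁻¹ j l *
    inner ℝ (traceFreeForm f z i j) (traceFreeForm f z k l)) * Real.sqrt (firstForm f z).det

/-- `f` is an immersed minimal surface on the open set `U ⊆ ℂ`. -/
def IsMinimalSurfaceOn (U : Set ℂ) (f : ℂ → E) : Prop :=
  ContDiffOn ℝ ∞ f U ∧ ∀ z ∈ U, Function.Injective (fderiv ℝ f z) ∧ meanCurvature f z = 0

end Curvature

/-- `f : Ω → S⁶` is Willmore: it is critical for the Willmore functional with respect to all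
smooth variations `Φ` of the map `f : Ω → S⁶` with compact support `K ⊆ Ω` (all smooth variations
if `Ω` is the whole sphere). The functional is integrated in the coordinate `z`, which
misses only the point `∞`. -/
def IsWillmoreOn (Ω : Set (OnePoint ℂ)) (f : OnePoint ℂ → EuclideanSpace ℝ (Fin 7)) : Prop :=
  ∀ (Φ : ℝ → OnePoint ℂ → EuclideanSpace ℝ (Fin 7)) (K : Set (OnePoint ℂ)),
    IsCompact K → K ⊆ Ω →
    (∀ c ∈ coords,
      ContDiffOn ℝ ∞ (fun p : ℝ × ℂ => Φ p.1 (c p.2)) (Set.univ ×ˢ (c ⁻¹' Ω))) →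
    (∀ t, ∀ p ∈ Ω, ‖Φ t p‖ = 1) →
    (∀ p ∈ Ω, Φ 0 p = f p) →
    (∀ t, ∀ p ∈ Ω, p ∉ K → Φ t p = f p) →
    HasDerivAt
      (fun t => ∫ z in coordZero ⁻¹' K, willmoreDensity (Φ t ∘ coordZero) z) 0 0

/-! ### Conformal Gauss map, H-totally isotropic surfaces, dual surfaces -/

/-- The complexification of the fibre `V = Span {Y, Re Y_z, Im Y_z, Y_zz̄}` of the conformal
Gauss map (it does not depend on the choice of the lift). -/
def gaussSpace (f : ℂ → EuclideanSpace ℝ (Fin 7)) (z : ℂ) : Submodule ℂ (Fin 8 → ℂ) :=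
  Submodule.span ℂ {lightLift f z, dz (lightLift f) z, dzbar (lightLift f) z,
    dzbar (dz (lightLift f)) z}

/-- `E₁, E₂, E₃` (here `E 0, E 1, E 2`) is a smooth isotropic frame on `U`, adapted to the
`z`-derivatives of the lift, with the property that makes a totally isotropic surface in `S⁶`
H-totally isotropic. -/
structure IsHIsotropicFrame (f : ℂ → EuclideanSpace ℝ (Fin 7)) (U : Set ℂ)
    (E : Fin 3 → ℂ → Fin 8 → ℂ) : Prop where
  smooth : ∀ j, ContDiffOn ℝ ∞ (E j) U
  isotropic : ∀ z ∈ U, ∀ j l, lor (E j z) (E l z) = 0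
  unitary : ∀ z ∈ U, ∀ j l, lor (E j z) (conjVec (E l z)) = if j = l then 2 else 0
  /-- `Y_z^{(j)} ∈ Span {E_j}` modulo `Span {Y, E_1, …, E_{j-1}}` for `j = 1, 2, 3`. -/
  adapted : ∀ z ∈ U, ∀ j : Fin 3, (dz^[(j : ℕ) + 1] (lightLift f)) z ∈
    Submodule.span ℂ (insert (lightLift f z) ((fun l => E l z) '' {l | l ≤ j}))
  /-- `{E_j, Ē_j}`, `j = 2, 3`, is a basis of the complexified normal bundle `V^⊥`. -/
  normal_indep : ∀ z ∈ U, LinearIndependent ℂ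
    ![E 1 z, E 2 z, conjVec (E 1 z), conjVec (E 2 z)]
  normal_span : ∀ z ∈ U, ∀ x : Fin 8 → ℂ,
    x ∈ Submodule.span ℂ {E 1 z, E 2 z, conjVec (E 1 z), conjVec (E 2 z)} ↔
      ∀ v ∈ gaussSpace f z, lor x v = 0
  /-- `D_z̄ E_j ∈ Span {E_2, E_3}` for `j = 2, 3`, where `D` is the normal connection, that is,
  the derivative modulo `V`. -/
  horizontal : ∀ z ∈ U, ∀ j : Fin 3, j ≠ 0 →
    dzbar (E j) z ∈ Submodule.span ℂ {E 1 z, E 2 z} ⊔ gaussSpace f z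

/-- `f : Ω → S⁶` is H-totally isotropic: all `z`-derivatives of a light cone lift are isotropic
and mutually orthogonal, and there are local frames as above. -/
def IsHTotallyIsotropicOn (Ω : Set (OnePoint ℂ)) (f : OnePoint ℂ → EuclideanSpace ℝ (Fin 7)) :
    Prop :=
  ∀ c ∈ coords, ∀ z₀ : ℂ, c z₀ ∈ Ω →
    (∀ j l : ℕ, 1 ≤ j → 1 ≤ l →
      lor ((dz^[j] (lightLift (f ∘ c))) z₀) ((dz^[l] (lightLift (f ∘ c))) z₀) = 0) ∧
    ∃ U ∈ 𝓝 z₀, ∃ E : Fin 3 → ℂ → Fin 8 → ℂ, IsHIsotropicFrame (f ∘ c) U E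

/-- `g` is a dual surface of `f` on `Ω`: a smooth map into `S⁶` that lies on the mean curvature
spheres of `f`, differs from `f` at each point, is (weakly) conformal for the same complex
coordinates, and has the same conformal Gauss map as `f` where it is immersed. (It may have branch
points or degenerate to a point.) -/
def IsDualSurfaceOn (Ω : Set (OnePoint ℂ)) (f g : OnePoint ℂ → EuclideanSpace ℝ (Fin 7)) : Prop :=
  IsSmoothIntoSphereOn Ω g ∧ (∀ p ∈ Ω, g p ≠ f p) ∧
    ∀ c ∈ coords, ∀ z : ℂ, c z ∈ Ω →
      lightLift (g ∘ c) z ∈ gaussSpace (f ∘ c) z ∧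
      lor (dz (lightLift (g ∘ c)) z) (dz (lightLift (g ∘ c)) z) = 0 ∧
      (Function.Injective (fderiv ℝ (g ∘ c) z) →
        gaussSpace (g ∘ c) z = gaussSpace (f ∘ c) z)

/-! ### Normalized potentials, Iwasawa decomposition, isotropic harmonic maps -/

/-- Row and column indices of `8 × 8` matrices in block form `2 + 6`. -/
abbrev Idx : Type := Fin 2 ⊕ Fin 6

/-- `I_{1,1} = diag(-1, 1)`. -/
def I11 (R : Type*) [CommRing R] : Matrix (Fin 2) (Fin 2) R := Matrix.diagonal ![-1, 1]

/-- `I_{1,7} = diag(-1, 1, …, 1)`. -/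
def I17 (R : Type*) [CommRing R] : Matrix Idx Idx R := Matrix.fromBlocks (I11 R) 0 0 1

/-- `D = diag(-1, -1, 1, …, 1)`; the involution is `σ(A) = D A D⁻¹`, and `D⁻¹ = D`. -/
def invD (R : Type*) [CommRing R] : Matrix Idx Idx R := Matrix.fromBlocks (-1) 0 0 1

/-- `A ∈ SO⁺(1,7)`. -/
def IsSOPlus (A : Matrix Idx Idx ℝ) : Prop :=
  A.transpose * I17 ℝ * A = I17 ℝ ∧ A.det = 1 ∧ 0 < A (Sum.inl 0) (Sum.inl 0)

/-- `A ∈ SO(1,7,ℂ)`. -/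
def IsSOComplex (A : Matrix Idx Idx ℂ) : Prop :=
  A.transpose * I17 ℂ * A = I17 ℂ ∧ A.det = 1

/-- The isotropic vectors `e_{2j-1} + i e_{2j}` of `ℂ⁶`, `j = 1, 2, 3`. -/
def isoVec (j : Fin 3) : Fin 6 → ℂ := fun k =>
  if (k : ℕ) = 2 * (j : ℕ) then 1 else if (k : ℕ) = 2 * (j : ℕ) + 1 then Complex.I else 0

/-- The solvable factor `𝔅₂` of the Iwasawa decomposition `SO(6,ℂ) = SO(6) · 𝔅₂`: the elements that
are upper triangular with positive diagonal on the flag of isotropic subspaces spanned by the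
vectors `isoVec j`. -/
def IsSolvableFactor (b : Matrix (Fin 6) (Fin 6) ℂ) : Prop :=
  b.transpose * b = 1 ∧ b.det = 1 ∧
    ∀ j : Fin 3, ∃ d : ℝ, 0 < d ∧
      b.mulVec (isoVec j) - (d : ℂ) • isoVec j ∈ Submodule.span ℂ (isoVec '' {l | l < j})

/-- `A ∈ 𝔅`, the solvable factor of the Iwasawa decomposition `K^ℂ = K · 𝔅`. -/
def IsInB (A : Matrix Idx Idx ℂ) : Prop :=
  ∃ (θ : ℝ) (b : Matrix (Fin 6) (Fin 6) ℂ), IsSolvableFactor b ∧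
    A = Matrix.fromBlocks
      !![(Real.cos θ : ℂ), Complex.I * (Real.sin θ : ℂ);
        Complex.I * (Real.sin θ : ℂ), (Real.cos θ : ℂ)] 0 0 b

/-- `F ∈ ΛG_σ` for `G = SO⁺(1,7)`; only the values on the unit circle matter. -/
structure IsTwistedLoop (F : ℂ → Matrix Idx Idx ℝ) : Prop where
  continuous : ContinuousOn F (Metric.sphere 0 1)
  mem : ∀ l : ℂ, ‖l‖ = 1 → IsSOPlus (F l)
  twisted : ∀ l : ℂ, ‖l‖ = 1 → F (-l) = invD ℝ * F l * invD ℝ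

/-- `P ∈ Λ⁺_B G^ℂ_σ`: twisted loops in `SO(1,7,ℂ)` that extend holomorphically to the unit disk
(and continuously to its closure), with value at `0` in `𝔅`. -/
structure IsPositiveLoop (P : ℂ → Matrix Idx Idx ℂ) : Prop where
  holomorphic : ∀ i j, DiffContOnCl ℂ (fun l => P l i j) (Metric.ball 0 1)
  mem : ∀ l : ℂ, ‖l‖ ≤ 1 → IsSOComplex (P l)
  twisted : ∀ l : ℂ, ‖l‖ ≤ 1 → P (-l) = invD ℂ * P l * invD ℂ
  value_zero : IsInB (P 0)

/-- The matrix `η₋₁ = (0, B̂; -B̂ᵗ I_{1,1}, 0)`; the normalized potential is `λ⁻¹ η₋₁ dz`. -/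
def etaOf (B : Matrix (Fin 2) (Fin 6) ℂ) : Matrix Idx Idx ℂ :=
  Matrix.fromBlocks 0 B (-(B.transpose * I11 ℂ)) 0

/-- `F₋` solves `F₋⁻¹ dF₋ = λ⁻¹ η₋₁ dz`, `F₋(0, λ) = I`, for `λ` on the unit circle. -/
def IsMeromorphicFrame (B : ℂ → Matrix (Fin 2) (Fin 6) ℂ) (Fm : ℂ → ℂ → Matrix Idx Idx ℂ) : Prop :=
  ∀ l : ℂ, ‖l‖ = 1 → Fm 0 l = 1 ∧
    ∀ z : ℂ, ∀ i j, HasDerivAt (fun ζ => Fm ζ l i j) ((l⁻¹ • (Fm z l * etaOf (B z))) i j) z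

/-- `F(z, λ)` is, on `U`, the extended frame obtained from the normalized potential with matrix `B̂`
through the Iwasawa decomposition `F₋ = F · F₊`. -/
structure IsExtendedFrame (B : ℂ → Matrix (Fin 2) (Fin 6) ℂ) (U : Set ℂ)
    (F : ℂ → ℂ → Matrix Idx Idx ℝ) : Prop where
  smooth : ∀ l : ℂ, ‖l‖ = 1 → ∀ i j, ContDiffOn ℝ ∞ (fun z => F z l i j) U
  base : ∀ l : ℂ, ‖l‖ = 1 → F 0 l = 1
  loop : ∀ z ∈ U, IsTwistedLoop (F z)
  iwasawa : ∃ Fm : ℂ → ℂ → Matrix Idx Idx ℂ, IsMeromorphicFrame B Fm ∧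
    ∀ z ∈ U, ∃ P : ℂ → Matrix Idx Idx ℂ, IsPositiveLoop P ∧
      ∀ l : ℂ, ‖l‖ = 1 → Fm z l = (F z l).map Complex.ofReal * P l

/-- Entrywise `∂/∂z` of a matrix valued map. -/
def dzMat (M : ℂ → Matrix Idx Idx ℂ) (z : ℂ) : Matrix Idx Idx ℂ :=
  Matrix.of fun i j => dz (fun ζ => M ζ i j) z

/-- Entrywise `∂/∂z̄` of a matrix valued map. -/
def dzbarMat (M : ℂ → Matrix Idx Idx ℂ) (z : ℂ) : Matrix Idx Idx ℂ :=
  Matrix.of fun i j => dzbar (fun ζ => M ζ i j) z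

/-- The `dz`-coefficient `α'(∂/∂z) = F⁻¹ F_z` of the Maurer-Cartan form of a real frame `F`;
the `dz̄`-coefficient is its complex conjugate. -/
def mcForm (F : ℂ → Matrix Idx Idx ℝ) (z : ℂ) : Matrix Idx Idx ℂ :=
  ((F z).map Complex.ofReal)⁻¹ * dzMat (fun ζ => (F ζ).map Complex.ofReal) z

/-- The component in `𝔨^ℂ` (diagonal blocks). -/
def kPart (A : Matrix Idx Idx ℂ) : Matrix Idx Idx ℂ :=
  Matrix.fromBlocks A.toBlocks₁₁ 0 0 A.toBlocks₂₂

/-- The component in `𝔭^ℂ` (off-diagonal blocks). -/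
def pPart (A : Matrix Idx Idx ℂ) : Matrix Idx Idx ℂ :=
  Matrix.fromBlocks 0 A.toBlocks₁₂ A.toBlocks₂₁ 0

/-- The `dz`-coefficient of `α_μ = μ⁻¹ α₁' + α₀ + μ α₁''`. -/
def loopForm' (F : ℂ → Matrix Idx Idx ℝ) (μ z : ℂ) : Matrix Idx Idx ℂ :=
  kPart (mcForm F z) + μ⁻¹ • pPart (mcForm F z)

/-- The `dz̄`-coefficient of `α_μ = μ⁻¹ α₁' + α₀ + μ α₁''`. -/
def loopForm'' (F : ℂ → Matrix Idx Idx ℝ) (μ z : ℂ) : Matrix Idx Idx ℂ :=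
  (kPart (mcForm F z)).map (starRingEnd ℂ) + μ • (pPart (mcForm F z)).map (starRingEnd ℂ)

/-- The map into `SO⁺(1,7) / (SO⁺(1,1) × SO(6))` with frame `F` is harmonic on `U`:
`dα_μ + (1/2) [α_μ ∧ α_μ] = 0` for all `μ` on the unit circle. -/
def IsHarmonicFrame (U : Set ℂ) (F : ℂ → Matrix Idx Idx ℝ) : Prop :=
  ∀ z ∈ U, ∀ μ : ℂ, ‖μ‖ = 1 →
    dzMat (loopForm'' F μ) z - dzbarMat (loopForm' F μ) z +
      (loopForm' F μ z * loopForm'' F μ z - loopForm'' F μ z * loopForm' F μ z) = 0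

/-- The isotropy condition `B₁ B₁ᵗ = 0` for the upper right block `B₁` of `F⁻¹ F_z`. -/
def IsIsotropicFrame (U : Set ℂ) (F : ℂ → Matrix Idx Idx ℝ) : Prop :=
  ∀ z ∈ U, (mcForm F z).toBlocks₁₂ * (mcForm F z).toBlocks₁₂.transpose = 0

/-! ### The data of the example -/

/-- The matrix `B̂₁(z)` of the normalized potential. -/
def potential (z : ℂ) : Matrix (Fin 2) (Fin 6) ℂ :=
  (2 : ℂ)⁻¹ •
    !![-Complex.I, 1, Complex.I, -1, -2 * Complex.I * z, 2 * z;
      Complex.I, -1, Complex.I, -1, 2 * Complex.I * z, -2 * z]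

/-- `1 - r⁴/4 - 2 r⁶/9`, `r = |z|`. -/
def sigma (z : ℂ) : ℝ := 1 - ‖z‖ ^ 4 / 4 - 2 * ‖z‖ ^ 6 / 9

/-- The vector `Y`, for the parameter `l = λ` and `ς = |1 - r⁴/4 - 2 r⁶/9| ≠ 0`.
(Its entries are real if `|λ| = 1`.) -/
def Yvec (l z : ℂ) : Fin 8 → ℂ :=
  let r : ℂ := (‖z‖ : ℂ)
  let w : ℂ := (starRingEnd ℂ) z
  (-((Real.sqrt 2 / (2 * |sigma z|) : ℝ) : ℂ)) •
    ![-1 - r ^ 2 - r ^ 4 / 4 - r ^ 6 / 9,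
      1 - r ^ 2 + r ^ 4 / 4 + r ^ 6 / 9,
      Complex.I * r ^ 2 / 2 * (l⁻¹ * z - l * w),
      -(r ^ 2 / 2) * (l⁻¹ * z + l * w),
      -Complex.I * (l⁻¹ * z - l * w),
      l⁻¹ * z + l * w,
      Complex.I * r ^ 2 / 3 * (l⁻¹ * z ^ 2 - l * w ^ 2),
      -(r ^ 2 / 3) * (l⁻¹ * z ^ 2 + l * w ^ 2)]

/-- The vector `Ŷ`, for the parameter `l = λ` and `ς = |1 - r⁴/4 - 2 r⁶/9| ≠ 0`.
(Its entries are real if `|λ| = 1`.) -/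
def Yhat (l z : ℂ) : Fin 8 → ℂ :=
  let r : ℂ := (‖z‖ : ℂ)
  let w : ℂ := (starRingEnd ℂ) z
  ((Real.sqrt 2 / (2 * |sigma z|) : ℝ) : ℂ) •
    ![1 + r ^ 2 + 5 * r ^ 4 / 4 + 4 * r ^ 6 / 9 + r ^ 8 / 36,
      1 - r ^ 2 - 3 * r ^ 4 / 4 + 4 * r ^ 6 / 9 - r ^ 8 / 36,
      -Complex.I * (l⁻¹ * z - l * w) * (1 + r ^ 6 / 9),
      (l⁻¹ * z + l * w) * (1 + r ^ 6 / 9),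
      Complex.I * r ^ 2 / 2 * (l⁻¹ * z - l * w) * (1 + 4 * r ^ 2 / 3),
      -(r ^ 2 / 2) * (l⁻¹ * z + l * w) * (1 + 4 * r ^ 2 / 3),
      -Complex.I * (l⁻¹ * z ^ 2 - l * w ^ 2) * (1 - r ^ 4 / 12),
      (l⁻¹ * z ^ 2 + l * w ^ 2) * (1 - r ^ 4 / 12)]

/-- `Y ∧ Ŷ`, as a skew-symmetric array. -/
def wedge (Y Z : Fin 8 → ℂ) : Fin 8 → Fin 8 → ℂ := fun i j => Y i * Z j - Y j * Z i

/-- The components of the minimal surface `x` in `ℝ⁶`, for the parameter `l = λ` and `z ≠ 0`.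
(They are real if `|λ| = 1`.) -/
def xvec (l z : ℂ) : Fin 6 → ℂ :=
  let r : ℂ := (‖z‖ : ℂ)
  let w : ℂ := (starRingEnd ℂ) z
  ![Complex.I * (l⁻¹ * z - l * w),
    -(l⁻¹ * z + l * w),
    -(2 * Complex.I / r ^ 2) * (l⁻¹ * z - l * w),
    2 / r ^ 2 * (l⁻¹ * z + l * w),
    2 * Complex.I / 3 * (l⁻¹ * z ^ 2 - l * w ^ 2),
    -(2 / 3) * (l⁻¹ * z ^ 2 + l * w ^ 2)]

/-- A point of `S⁶` as a point of the projective light cone, represented by `(1, y)`. -/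
def conePoint (y : EuclideanSpace ℝ (Fin 7)) : Fin 8 → ℝ := Fin.cons 1 (fun i : Fin 7 => y i)

/-- The embedding `ℝ⁶ → S⁶` by inverse stereographic projection,
`x ↦ [(|x|² + 1)/2 : (|x|² - 1)/2 : x]`, in the projective light cone. -/
def coneOfEuclidean (x : EuclideanSpace ℝ (Fin 6)) : Fin 8 → ℝ :=
  Fin.cons ((‖x‖ ^ 2 + 1) / 2) (Fin.cons ((‖x‖ ^ 2 - 1) / 2) (fun i : Fin 6 => x i))

/-- The map `y` into `S⁶` is conformally (Möbius) equivalent on `U` to the map `x` into `ℝ⁶`: some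
`T ∈ O(1,7)`, acting on the projective light cone, takes `[(1, y)]` to the image of `x`. -/
def IsMoebiusEquivalentOn (U : Set ℂ) (y : ℂ → EuclideanSpace ℝ (Fin 7))
    (x : ℂ → EuclideanSpace ℝ (Fin 6)) : Prop :=
  ∃ T : Matrix (Fin 8) (Fin 8) ℝ, (∀ a b : Fin 8 → ℝ, lor (T.mulVec a) (T.mulVec b) = lor a b) ∧
    ∀ z ∈ U, ∃ k : ℝ, k ≠ 0 ∧ T.mulVec (conePoint (y z)) = k • coneOfEuclidean (x z)

end WillmoreSphere

end

/-!
**Polynomial lifts.** In the null coordinates of `nullVec` the parameter `λ` of the associated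
family acts by a rotation, and up to the scalar `√2 / ς` the vectors `Y` and `Ŷ` become vectors
`liftY` and `liftH` of polynomials in `z` and `z̄` which do not depend on `λ`. The rescaled lifts
have no singularity on the curve `σ = 0`, and with a second pair of polynomial lifts in the
coordinate `1 / z` they define `y` and `ŷ` on the whole sphere.

**Isotropy.** Each lift `P` comes with two antiholomorphic sections `v₁`, `v₂` of the complexified
normal bundle which span an isotropic subbundle, with `⟨∂_z̄ v₁, v₂⟩ = 0`, and `P_zz` lies in the
span of `P`, `P_z`, `v₁`, `v₂`. These are finitely many polynomial identities (`PolyData`); they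
make the subbundle stable under `D_z̄` and hold all derivatives `Y_z^(j)` in one isotropic space,
whence conformality and H-total isotropy (`isHIsotropicFrame`).

**The Willmore property.** Horizontality keeps the `z̄`-derivatives of the Hopf differential in the
isotropic subbundle or its conjugate, and `L_zzz̄z̄` is real; together they make the real part of
the Willmore operator a multiple of the light cone lift (`willmoreOp_real`). This is the
Euler-Lagrange equation. For its solutions the first variation of the Willmore density is a
divergence, so its integral against a compactly supported variation vanishes
(`integral_firstVariation_eq_zero`). The density is invariant under changes of the coordinate
(`willmoreDensity_comp`), and a partition of unity subordinate to the coordinates `z` and `1 / z`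
gives criticality on the sphere (`isWillmoreOn_of_isCritical`).

**Dual surfaces.** If `G` is the lift of a dual surface of `ŷ`, then `G` and `G_z̄` lie in the mean
curvature spheres and are orthogonal to `v₁`, `v₂`; hence `G` is orthogonal to `∂_z̄ v₁`, `∂_z̄ v₂`.
These pairings are nondegenerate modulo `L`, `L_z`, so that `G`, real and null, is a multiple of `L`
(`eq_surfH_of_mem_gaussSpace`).

**The minimal surface.** It is the real part of a holomorphic isotropic curve
(`isMinimalSurfaceOn_doubleRe`), and an explicit linear isometry `moebius` of `ℝ⁸₁` carries the lift
of its inverse stereographic projection to that of `y`.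

**The curve `σ = 0`.** The scalar product of the polynomial lifts is `-σ² / 2`, and real null
vectors with scalar product zero are parallel: `y = ŷ` on the curve. A combination of components of
`Y ∧ Ŷ` equals `λ z z̄² / σ` (`wedge_component`), and is unbounded near each point of the curve.

**The extended frame.** Gram-Schmidt orthonormalization completes `Y`, `Ŷ` to a frame `frameVec`,
real and orthonormal. For the grading of the null coordinates by their weights under `λ`, the
`dz`-part of its Maurer-Cartan form has components of degrees `0` and `-1` only (`IsGradedFrame`);
harmonicity, the shape of `α_λ`, and `B₁ B₁ᵗ = 0` follow. The solution `F₋` for the potential `η` is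
the polynomial frame `meroCol`. Both frames are adapted to the same flag, so `F₊ = F⁻¹ F₋` is upper
triangular for the order `rank`, which lists the null coordinates by decreasing degree. Hence `F₊`
is polynomial in `λ` (`posLoop`), with value in `𝔅` at `λ = 0` (`isInB_posLoop`), which is the
Iwasawa decomposition (`isExtendedFrame`).
-/

open scoped ContDiff Topology

noncomputable section

namespace WillmoreSphere

/-! ### Wirtinger calculus -/

section Wirtinger

variable {E F : Type*} [NormedAddCommGroup E] [NormedSpace ℂ E] [NormedAddCommGroup F]
  [NormedSpace ℂ F]

/-- The operator `(∂_u + s ∂_v) / 2`; it is `∂/∂z` for `s = -i` and `∂/∂z̄` for `s = i`. -/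
def wd (s : ℂ) (f : ℂ → E) (z : ℂ) : E :=
  (2 : ℂ)⁻¹ • (fderiv ℝ f z 1 + s • fderiv ℝ f z Complex.I)

theorem dz_eq_wd (f : ℂ → E) : dz f = wd (-Complex.I) f := by
  ext z; simp [dz, wd, sub_eq_add_neg]

theorem dzbar_eq_wd (f : ℂ → E) : dzbar f = wd Complex.I f := rfl

theorem wd_congr {s : ℂ} {f g : ℂ → E} {z : ℂ} (h : f =ᶠ[𝓝 z] g) : wd s f z = wd s g z := by
  simp only [wd, h.fderiv_eq]

theorem wd_congr_of_isOpen {s : ℂ} {f g : ℂ → E} {U : Set ℂ} (hU : IsOpen U)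
    (h : ∀ z ∈ U, f z = g z) {z : ℂ} (hz : z ∈ U) : wd s f z = wd s g z :=
  wd_congr (Filter.eventually_of_mem (hU.mem_nhds hz) h)

theorem wd_const (s : ℂ) (c : E) (z : ℂ) : wd s (fun _ => c) z = 0 := by
  simp [wd]

theorem wd_add {s : ℂ} {f g : ℂ → E} {z : ℂ} (hf : DifferentiableAt ℝ f z)
    (hg : DifferentiableAt ℝ g z) : wd s (fun ζ => f ζ + g ζ) z = wd s f z + wd s g z := by
  simp only [wd, fderiv_fun_add hf hg, add_apply]
  module

theorem wd_sub {s : ℂ} {f g : ℂ → E} {z : ℂ} (hf : DifferentiableAt ℝ f z)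
    (hg : DifferentiableAt ℝ g z) : wd s (fun ζ => f ζ - g ζ) z = wd s f z - wd s g z := by
  simp only [wd, fderiv_fun_sub hf hg, sub_apply]
  module

theorem wd_smul {s : ℂ} {c : ℂ → ℂ} {f : ℂ → E} {z : ℂ} (hc : DifferentiableAt ℝ c z)
    (hf : DifferentiableAt ℝ f z) :
    wd s (fun ζ => c ζ • f ζ) z = c z • wd s f z + wd s c z • f z := by
  have := fderiv_fun_smul hc hf
  simp only [wd, this, add_apply, smul_apply,
    ContinuousLinearMap.smulRight_apply, smul_eq_mul]
  module

theorem wd_mul {s : ℂ} {c d : ℂ → ℂ} {z : ℂ} (hc : DifferentiableAt ℝ c z)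
    (hd : DifferentiableAt ℝ d z) :
    wd s (fun ζ => c ζ * d ζ) z = c z * wd s d z + wd s c z * d z := by
  simpa using wd_smul (s := s) hc hd

theorem wd_clm {s : ℂ} (L : E →L[ℂ] F) {f : ℂ → E} {z : ℂ} (hf : DifferentiableAt ℝ f z) :
    wd s (fun ζ => L (f ζ)) z = L (wd s f z) := by
  have h : HasFDerivAt (fun ζ => L (f ζ)) ((L.restrictScalars ℝ).comp (fderiv ℝ f z)) z :=
    (L.restrictScalars ℝ).hasFDerivAt.comp z hf.hasFDerivAt
  simp [wd, h.fderiv]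

theorem wd_apply {ι : Type*} [Fintype ι] {s : ℂ} {f : ℂ → ι → ℂ} {z : ℂ}
    (hf : DifferentiableAt ℝ f z) (i : ι) : wd s f z i = wd s (fun ζ => f ζ i) z :=
  (wd_clm (s := s) (ContinuousLinearMap.proj (R := ℂ) (φ := fun _ : ι => ℂ) i) hf).symm

theorem wd_conj {s : ℂ} {f : ℂ → ℂ} {z : ℂ} (hf : DifferentiableAt ℝ f z) :
    wd s (fun ζ => (starRingEnd ℂ) (f ζ)) z =
      (starRingEnd ℂ) (wd ((starRingEnd ℂ) s) f z) := by
  have h : HasFDerivAt (fun ζ => (starRingEnd ℂ) (f ζ))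
      (Complex.conjCLE.toContinuousLinearMap.comp (fderiv ℝ f z)) z :=
    Complex.conjCLE.toContinuousLinearMap.hasFDerivAt.comp z hf.hasFDerivAt
  simp only [wd, h.fderiv, ContinuousLinearMap.comp_apply, ContinuousLinearEquiv.coe_coe,
    Complex.conjCLE_apply, smul_eq_mul, map_mul, map_add, map_inv₀, map_ofNat, Complex.conj_conj]

theorem wd_lor {s : ℂ} {f g : ℂ → Fin 8 → ℂ} {z : ℂ} (hf : DifferentiableAt ℝ f z)
    (hg : DifferentiableAt ℝ g z) :
    wd s (fun ζ => lor (f ζ) (g ζ)) z = lor (wd s f z) (g z) + lor (f z) (wd s g z) := by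
  have hf' : ∀ i, DifferentiableAt ℝ (fun ζ => f ζ i) z := differentiableAt_pi.1 hf
  have hg' : ∀ i, DifferentiableAt ℝ (fun ζ => g ζ i) z := differentiableAt_pi.1 hg
  have key : HasFDerivAt (fun ζ => lor (f ζ) (g ζ))
      (-(f z 0 • fderiv ℝ (fun ζ => g ζ 0) z + g z 0 • fderiv ℝ (fun ζ => f ζ 0) z) +
        ∑ i : Fin 7, (f z i.succ • fderiv ℝ (fun ζ => g ζ i.succ) z +
          g z i.succ • fderiv ℝ (fun ζ => f ζ i.succ) z)) z := by
    unfold lor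
    refine HasFDerivAt.add ?_ ?_
    · exact ((hf' 0).hasFDerivAt.mul (hg' 0).hasFDerivAt).neg
    · exact HasFDerivAt.fun_sum fun i _ => (hf' _).hasFDerivAt.mul (hg' _).hasFDerivAt
  have e : ∀ v, fderiv ℝ f z v = fun i => fderiv ℝ (fun ζ => f ζ i) z v := fun v => by
    ext i; rw [fderiv_pi hf']; rfl
  have e' : ∀ v, fderiv ℝ g z v = fun i => fderiv ℝ (fun ζ => g ζ i) z v := fun v => by
    ext i; rw [fderiv_pi hg']; rfl
  simp only [wd, key.fderiv, e, e']
  simp only [lor, Pi.add_apply, Pi.smul_apply, smul_eq_mul,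
    Fin.sum_univ_succ, add_apply, neg_apply,
    smul_apply, Finset.univ_eq_empty, Finset.sum_empty,
    zero_apply]
  ring

theorem wd_id (s : ℂ) (z : ℂ) : wd s (fun ζ : ℂ => ζ) z = (1 + s * Complex.I) / 2 := by
  simp [wd]; ring

theorem wd_star (s : ℂ) (z : ℂ) :
    wd s (fun ζ : ℂ => (starRingEnd ℂ) ζ) z = (1 - s * Complex.I) / 2 := by
  rw [wd_conj differentiableAt_fun_id, wd_id]
  simp only [map_div₀, map_add, map_mul, map_one, map_ofNat, Complex.conj_conj, Complex.conj_I]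
  ring

theorem contDiffOn_wd {s : ℂ} {f : ℂ → E} {U : Set ℂ} (hU : IsOpen U)
    (hf : ContDiffOn ℝ ∞ f U) : ContDiffOn ℝ ∞ (wd s f) U := by
  have h : ContDiffOn ℝ ∞ (fderiv ℝ f) U := hf.fderiv_of_isOpen hU (by simp)
  have h' : ∀ v : ℂ, ContDiffOn ℝ ∞ (fun z => fderiv ℝ f z v) U := fun v =>
    h.clm_apply contDiffOn_const
  exact ((h' 1).add ((h' Complex.I).const_smul s)).const_smul _

theorem differentiableAt_of_smoothOn {X F : Type*} [NormedAddCommGroup X] [NormedSpace ℝ X]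
    [NormedAddCommGroup F] [NormedSpace ℝ F] {f : X → F}
    {U : Set X} (hf : ContDiffOn ℝ ∞ f U) (hU : IsOpen U) {z : X} (hz : z ∈ U) :
    DifferentiableAt ℝ f z :=
  (hf.contDiffAt (hU.mem_nhds hz)).differentiableAt (by simp)

/-- The second derivative in terms of iterated first derivatives is symmetric. -/
theorem fderiv_fderiv_apply_comm {X F : Type*} [NormedAddCommGroup X] [NormedSpace ℝ X]
    [NormedAddCommGroup F] [NormedSpace ℝ F]
    {f : X → F} {U : Set X} (hU : IsOpen U) (hf : ContDiffOn ℝ ∞ f U) {z : X} (hz : z ∈ U)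
    (v w : X) :
    fderiv ℝ (fun ζ => fderiv ℝ f ζ v) z w = fderiv ℝ (fun ζ => fderiv ℝ f ζ w) z v := by
  have h : ContDiffOn ℝ ∞ (fderiv ℝ f) U := hf.fderiv_of_isOpen hU (by simp)
  have h1 : DifferentiableAt ℝ (fderiv ℝ f) z := differentiableAt_of_smoothOn h hU hz
  have hs : IsSymmSndFDerivAt ℝ f z :=
    (hf.contDiffAt (hU.mem_nhds hz)).isSymmSndFDerivAt (by
      rw [minSmoothness_of_isRCLikeNormedField]; exact WithTop.coe_le_coe.2 le_top)
  rw [fderiv_clm_apply h1 (differentiableAt_const v),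
    fderiv_clm_apply h1 (differentiableAt_const w)]
  simpa using hs w v

theorem wd_comm {s t : ℂ} {f : ℂ → E} {U : Set ℂ} (hU : IsOpen U) (hf : ContDiffOn ℝ ∞ f U)
    {z : ℂ} (hz : z ∈ U) : wd s (wd t f) z = wd t (wd s f) z := by
  have h : ContDiffOn ℝ ∞ (fderiv ℝ f) U := hf.fderiv_of_isOpen hU (by simp)
  have h' : ∀ v : ℂ, DifferentiableAt ℝ (fun z => fderiv ℝ f z v) z := fun v =>
    differentiableAt_of_smoothOn (h.clm_apply contDiffOn_const) hU hz
  have key : ∀ t v, fderiv ℝ (wd t f) z v = (2 : ℂ)⁻¹ •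
      (fderiv ℝ (fun ζ => fderiv ℝ f ζ 1) z v +
        t • fderiv ℝ (fun ζ => fderiv ℝ f ζ Complex.I) z v) := by
    intro t v
    have : HasFDerivAt (wd t f) ((2 : ℂ)⁻¹ • (fderiv ℝ (fun ζ => fderiv ℝ f ζ 1) z +
        t • fderiv ℝ (fun ζ => fderiv ℝ f ζ Complex.I) z)) z :=
      ((h' 1).hasFDerivAt.add ((h' Complex.I).hasFDerivAt.const_smul t)).const_smul _
    rw [this.fderiv]; rfl
  have hc := fderiv_fderiv_apply_comm hU hf hz 1 Complex.I
  rw [wd, wd, key, key, key, key, hc]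
  module

end Wirtinger

local notation "δz" => wd (-Complex.I)
local notation "δw" => wd Complex.I

/-! ### Linear algebra of the Lorentzian form -/

section LorAlgebra

theorem lor_comm {R : Type*} [CommRing R] (x y : Fin 8 → R) : lor x y = lor y x := by
  simp only [lor, mul_comm]

theorem lor_add_left {R : Type*} [CommRing R] (x y z : Fin 8 → R) :
    lor (x + y) z = lor x z + lor y z := by
  simp only [lor, Fin.sum_univ_succ, Pi.add_apply, Finset.univ_eq_empty, Finset.sum_empty]
  ring

theorem lor_smul_left {R : Type*} [CommRing R] (c : R) (x z : Fin 8 → R) :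
    lor (c • x) z = c * lor x z := by
  simp only [lor, Fin.sum_univ_succ, Pi.smul_apply, smul_eq_mul, Finset.univ_eq_empty,
    Finset.sum_empty]
  ring

theorem lor_add_right {R : Type*} [CommRing R] (x y z : Fin 8 → R) :
    lor x (y + z) = lor x y + lor x z := by
  rw [lor_comm, lor_add_left, lor_comm y, lor_comm z]

theorem lor_smul_right {R : Type*} [CommRing R] (c : R) (x z : Fin 8 → R) :
    lor x (c • z) = c * lor x z := by
  rw [lor_comm, lor_smul_left, lor_comm]

theorem lor_sub_left {R : Type*} [CommRing R] (x y z : Fin 8 → R) :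
    lor (x - y) z = lor x z - lor y z := by
  rw [sub_eq_add_neg, ← neg_one_smul R y, lor_add_left, lor_smul_left]; ring

theorem lor_sub_right {R : Type*} [CommRing R] (x y z : Fin 8 → R) :
    lor x (y - z) = lor x y - lor x z := by
  rw [lor_comm, lor_sub_left, lor_comm y, lor_comm z]

theorem lor_zero_left {R : Type*} [CommRing R] (x : Fin 8 → R) : lor 0 x = 0 := by
  simp [lor]

theorem lor_zero_right {R : Type*} [CommRing R] (x : Fin 8 → R) : lor x 0 = 0 := by
  simp [lor]

theorem lor_conjVec (x y : Fin 8 → ℂ) :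
    lor (conjVec x) (conjVec y) = (starRingEnd ℂ) (lor x y) := by
  simp [lor, conjVec]

theorem conjVec_conjVec (x : Fin 8 → ℂ) : conjVec (conjVec x) = x := by
  ext i; simp [conjVec]

theorem conjVec_add (x y : Fin 8 → ℂ) : conjVec (x + y) = conjVec x + conjVec y := by
  ext i; simp [conjVec]

theorem conjVec_smul (c : ℂ) (x : Fin 8 → ℂ) :
    conjVec (c • x) = (starRingEnd ℂ) c • conjVec x := by
  ext i; simp [conjVec]

theorem eq_zero_of_forall_lor {x : Fin 8 → ℂ} (h : ∀ y, lor x y = 0) : x = 0 := by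
  ext i
  refine Fin.cases ?_ (fun j => ?_) i
  · have := h (Pi.single 0 1)
    simpa [lor, Pi.single_apply] using this
  · have := h (Pi.single j.succ 1)
    simpa [lor, Pi.single_apply] using this

/-- The span of vectors all orthogonal to `x` is orthogonal to `x`. -/
theorem lor_eq_zero_of_mem_span {x y : Fin 8 → ℂ} {s : Set (Fin 8 → ℂ)}
    (h : ∀ v ∈ s, lor x v = 0) (hy : y ∈ Submodule.span ℂ s) : lor x y = 0 := by
  induction hy using Submodule.span_induction with
  | mem v hv => exact h v hv
  | zero => exact lor_zero_right x
  | add a b _ _ ha hb => rw [lor_add_right, ha, hb, add_zero]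
  | smul c a _ ha => rw [lor_smul_right, ha, mul_zero]

/-- A null basis of `ℂ⁸` of the kind attached to a conformal surface: `l, d, d', h` stand for the
light cone lift `L` and `L_z`, `L_z̄`, `L_zz̄`, and `s₁, s₂, t₁, t₂` is an isotropic basis of the
complexified normal bundle. -/
structure IsAdaptedBasis (e : ℂ) (l d d' h s₁ s₂ t₁ t₂ : Fin 8 → ℂ) : Prop where
  e_ne : e ≠ 0
  ll : lor l l = 0
  ld : lor l d = 0
  ld' : lor l d' = 0
  lh : lor l h = -e
  dd : lor d d = 0
  dd' : lor d d' = e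
  dh : lor d h = 0
  d'd' : lor d' d' = 0
  d'h : lor d' h = 0
  s₁v : lor s₁ l = 0 ∧ lor s₁ d = 0 ∧ lor s₁ d' = 0 ∧ lor s₁ h = 0
  s₂v : lor s₂ l = 0 ∧ lor s₂ d = 0 ∧ lor s₂ d' = 0 ∧ lor s₂ h = 0
  t₁v : lor t₁ l = 0 ∧ lor t₁ d = 0 ∧ lor t₁ d' = 0 ∧ lor t₁ h = 0
  t₂v : lor t₂ l = 0 ∧ lor t₂ d = 0 ∧ lor t₂ d' = 0 ∧ lor t₂ h = 0
  ss : lor s₁ s₁ = 0 ∧ lor s₁ s₂ = 0 ∧ lor s₂ s₂ = 0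
  tt : lor t₁ t₁ = 0 ∧ lor t₁ t₂ = 0 ∧ lor t₂ t₂ = 0
  st : lor s₁ t₁ = 2 ∧ lor s₁ t₂ = 0 ∧ lor s₂ t₁ = 0 ∧ lor s₂ t₂ = 2

namespace IsAdaptedBasis

variable {e : ℂ} {l d d' h s₁ s₂ t₁ t₂ : Fin 8 → ℂ}

theorem eq_zero (H : IsAdaptedBasis e l d d' h s₁ s₂ t₁ t₂) {x : Fin 8 → ℂ} (hl : lor x l = 0)
    (hd : lor x d = 0) (hd' : lor x d' = 0) (hh : lor x h = 0) (h1 : lor x s₁ = 0)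
    (h2 : lor x s₂ = 0) (h3 : lor x t₁ = 0) (h4 : lor x t₂ = 0) : x = 0 := by
  have hli : LinearIndependent ℂ ![l, d, d', h, s₁, s₂, t₁, t₂] := by
    rw [Fintype.linearIndependent_iff]
    intro g hg
    have hg' : ∀ y, lor (∑ i, g i • ![l, d, d', h, s₁, s₂, t₁, t₂] i) y = 0 := by
      intro y; rw [hg, lor_zero_left]
    simp only [Fin.sum_univ_succ, Fin.sum_univ_zero, lor_add_left, lor_smul_left,
      Matrix.cons_val_zero, Matrix.cons_val_succ, add_zero] at hg'
    have e_ne := H.e_ne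
    obtain ⟨a1, a2, a3, a4⟩ := H.s₁v
    obtain ⟨b1, b2, b3, b4⟩ := H.s₂v
    obtain ⟨c1, c2, c3, c4⟩ := H.t₁v
    obtain ⟨d1, d2, d3, d4⟩ := H.t₂v
    obtain ⟨x1, x2, x3⟩ := H.ss
    obtain ⟨y1, y2, y3⟩ := H.tt
    obtain ⟨z1, z2, z3, z4⟩ := H.st
    have q1 := hg' l
    have q2 := hg' d
    have q3 := hg' d'
    have q4 := hg' h
    have q5 := hg' s₁
    have q6 := hg' s₂
    have q7 := hg' t₁
    have q8 := hg' t₂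
    rw [H.ll, lor_comm d l, H.ld, lor_comm d' l, H.ld', lor_comm h l, H.lh, a1, b1, c1, d1] at q1
    rw [H.ld, H.dd, lor_comm d' d, H.dd', lor_comm h d, H.dh, a2, b2, c2, d2] at q2
    rw [H.ld', H.dd', H.d'd', lor_comm h d', H.d'h, a3, b3, c3, d3] at q3
    rw [H.lh, H.dh, H.d'h, a4, b4, c4, d4] at q4
    rw [lor_comm l, a1, lor_comm d, a2, lor_comm d', a3, lor_comm h, a4, x1, lor_comm s₂, x2,
      lor_comm t₁, z1, lor_comm t₂, z2] at q5
    rw [lor_comm l, b1, lor_comm d, b2, lor_comm d', b3, lor_comm h, b4, x2, x3,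
      lor_comm t₁, z3, lor_comm t₂, z4] at q6
    rw [lor_comm l, c1, lor_comm d, c2, lor_comm d', c3, lor_comm h, c4, z1, z3, y1,
      lor_comm t₂, y2] at q7
    rw [lor_comm l, d1, lor_comm d, d2, lor_comm d', d3, lor_comm h, d4, z2, z4, y2, y3] at q8
    have g3 : g (Fin.succ (Fin.succ (Fin.succ 0))) = 0 := by
      have : e * g (Fin.succ (Fin.succ (Fin.succ 0))) = 0 := by linear_combination -q1
      simpa [e_ne] using this
    have g2 : g (Fin.succ (Fin.succ 0)) = 0 := by
      have : e * g (Fin.succ (Fin.succ 0)) = 0 := by linear_combination q2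
      simpa [e_ne] using this
    have g1 : g (Fin.succ 0) = 0 := by
      have : e * g (Fin.succ 0) = 0 := by linear_combination q3
      simpa [e_ne] using this
    have g0 : g 0 = 0 := by
      rw [g3] at q4
      have : e * g 0 = 0 := by linear_combination -q4
      simpa [e_ne] using this
    intro i
    fin_cases i
    · exact g0
    · exact g1
    · exact g2
    · exact g3
    · exact (by linear_combination (1 / 2 : ℂ) * q7
        : g (Fin.succ (Fin.succ (Fin.succ (Fin.succ 0)))) = 0)
    · exact (by linear_combination (1 / 2 : ℂ) * q8
        : g (Fin.succ (Fin.succ (Fin.succ (Fin.succ (Fin.succ 0))))) = 0)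
    · exact (by linear_combination (1 / 2 : ℂ) * q5
        : g (Fin.succ (Fin.succ (Fin.succ (Fin.succ (Fin.succ (Fin.succ 0)))))) = 0)
    · exact (by linear_combination (1 / 2 : ℂ) * q6
        : g (Fin.succ (Fin.succ (Fin.succ (Fin.succ (Fin.succ (Fin.succ (Fin.succ 0))))))) = 0)
  have hspan := hli.span_eq_top_of_card_eq_finrank (by simp)
  refine eq_zero_of_forall_lor fun y => ?_
  refine lor_eq_zero_of_mem_span (s := Set.range ![l, d, d', h, s₁, s₂, t₁, t₂]) ?_
    (hspan ▸ Submodule.mem_top)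
  rintro _ ⟨i, rfl⟩
  fin_cases i <;> assumption

/-- The expansion of a vector in an adapted basis. -/
theorem expand (H : IsAdaptedBasis e l d d' h s₁ s₂ t₁ t₂) (x : Fin 8 → ℂ) :
    x = ((-(lor x h) - lor x l * lor h h / e) / e) • l + (lor x d' / e) • d + (lor x d / e) • d' +
      (-(lor x l) / e) • h + (lor x t₁ / 2) • s₁ + (lor x t₂ / 2) • s₂ + (lor x s₁ / 2) • t₁ +
      (lor x s₂ / 2) • t₂ := by
  have e_ne := H.e_ne
  obtain ⟨a1, a2, a3, a4⟩ := H.s₁v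
  obtain ⟨b1, b2, b3, b4⟩ := H.s₂v
  obtain ⟨c1, c2, c3, c4⟩ := H.t₁v
  obtain ⟨d1, d2, d3, d4⟩ := H.t₂v
  obtain ⟨x1, x2, x3⟩ := H.ss
  obtain ⟨y1, y2, y3⟩ := H.tt
  obtain ⟨z1, z2, z3, z4⟩ := H.st
  rw [← sub_eq_zero]
  apply H.eq_zero <;> simp only [lor_sub_left, lor_add_left, lor_smul_left]
  · rw [H.ll, lor_comm d l, H.ld, lor_comm d' l, H.ld', lor_comm h l, H.lh, a1, b1, c1, d1]
    field_simp; ring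
  · rw [H.ld, H.dd, lor_comm d' d, H.dd', lor_comm h d, H.dh, a2, b2, c2, d2]
    field_simp; ring
  · rw [H.ld', H.dd', H.d'd', lor_comm h d', H.d'h, a3, b3, c3, d3]
    field_simp; ring
  · rw [H.lh, H.dh, H.d'h, a4, b4, c4, d4]
    field_simp; ring
  · rw [lor_comm l, a1, lor_comm d, a2, lor_comm d', a3, lor_comm h s₁, a4, x1, lor_comm s₂, x2,
      lor_comm t₁, z1, lor_comm t₂, z2]
    ring
  · rw [lor_comm l, b1, lor_comm d, b2, lor_comm d', b3, lor_comm h s₂, b4, x2, x3,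
      lor_comm t₁, z3, lor_comm t₂, z4]
    ring
  · rw [lor_comm l, c1, lor_comm d, c2, lor_comm d', c3, lor_comm h t₁, c4, z1, z3, y1,
      lor_comm t₂, y2]
    ring
  · rw [lor_comm l, d1, lor_comm d, d2, lor_comm d', d3, lor_comm h t₂, d4, z2, z4, y2, y3]
    ring

end IsAdaptedBasis

/-- The Hermitian form `⟨x, x̄⟩` is real, and positive semidefinite on the orthogonal complement
of a real null vector `(1, f)`, which spans its kernel there. -/
theorem lor_conjVec_self_of_orthogonal {f : Fin 7 → ℝ} (hf : ∑ i, f i ^ 2 = 1) {x : Fin 8 → ℂ}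
    (hx : lor (Fin.cons 1 (fun i => (f i : ℂ))) x = 0) :
    lor x (conjVec x) = ((∑ i : Fin 7, ‖x i.succ - x 0 * f i‖ ^ 2 : ℝ) : ℂ) := by
  have h0 : x 0 = ∑ i : Fin 7, (f i : ℂ) * x i.succ := by
    have : -(1 * x 0) + ∑ i : Fin 7, (f i : ℂ) * x i.succ = 0 := by simpa [lor] using hx
    linear_combination -this
  have h0' : (starRingEnd ℂ) (x 0) = ∑ i : Fin 7, (f i : ℂ) * (starRingEnd ℂ) (x i.succ) := by
    rw [h0]; simp
  have hfc : ∑ i, (f i : ℂ) ^ 2 = 1 := by exact_mod_cast hf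
  have : ∀ i : Fin 7, ((‖x i.succ - x 0 * f i‖ ^ 2 : ℝ) : ℂ) =
      x i.succ * (starRingEnd ℂ) (x i.succ) - x 0 * ((f i : ℂ) * (starRingEnd ℂ) (x i.succ)) -
      (starRingEnd ℂ) (x 0) * ((f i : ℂ) * x i.succ) +
      x 0 * (starRingEnd ℂ) (x 0) * (f i : ℂ) ^ 2 := by
    intro i
    rw [Complex.ofReal_pow, ← Complex.mul_conj']
    simp; ring
  rw [Complex.ofReal_sum, Finset.sum_congr rfl fun i _ => this i, Finset.sum_add_distrib,
    Finset.sum_sub_distrib, Finset.sum_sub_distrib, ← Finset.mul_sum, ← Finset.mul_sum,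
    ← Finset.mul_sum, hfc, ← h0, ← h0']
  simp only [lor, conjVec]
  ring

end LorAlgebra

/-! ### Conformal surfaces and their light cone lift -/

/-- `f` is a smooth conformal immersion of the open set `U ⊆ ℂ` into `S⁶`. -/
structure IsConformalSurface (f : ℂ → EuclideanSpace ℝ (Fin 7)) (U : Set ℂ) : Prop where
  isOpen : IsOpen U
  smooth : ContDiffOn ℝ ∞ f U
  norm_eq : ∀ z ∈ U, ‖f z‖ = 1
  conformal : ∀ z ∈ U, lor (δz (lightLift f) z) (δz (lightLift f) z) = 0
  immersed : ∀ z ∈ U, Function.Injective (fderiv ℝ f z)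

theorem conjVec_lightLift (f : ℂ → EuclideanSpace ℝ (Fin 7)) (z : ℂ) :
    conjVec (lightLift f z) = lightLift f z := by
  ext i
  refine Fin.cases ?_ (fun j => ?_) i <;> simp [conjVec, lightLift]

theorem wd_conjVec {s : ℂ} {f : ℂ → Fin 8 → ℂ} {z : ℂ} (hf : DifferentiableAt ℝ f z) :
    wd s (fun ζ => conjVec (f ζ)) z = conjVec (wd ((starRingEnd ℂ) s) f z) := by
  have hf' : ∀ i, DifferentiableAt ℝ (fun ζ => f ζ i) z := differentiableAt_pi.1 hf
  have hg : DifferentiableAt ℝ (fun ζ => conjVec (f ζ)) z :=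
    differentiableAt_pi.2 fun i =>
      Complex.conjCLE.toContinuousLinearMap.differentiableAt.comp z (hf' i)
  ext i
  rw [wd_apply hg, conjVec, wd_apply hf, ← wd_conj (hf' i)]
  rfl

theorem contDiffOn_conjVec {f : ℂ → Fin 8 → ℂ} {U : Set ℂ} (hf : ContDiffOn ℝ ∞ f U) :
    ContDiffOn ℝ ∞ (fun z => conjVec (f z)) U :=
  contDiffOn_pi.2 fun i =>
    Complex.conjCLE.toContinuousLinearMap.contDiff.comp_contDiffOn (contDiffOn_pi.1 hf i)

theorem contDiffOn_lor {f g : ℂ → Fin 8 → ℂ} {U : Set ℂ} (hf : ContDiffOn ℝ ∞ f U)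
    (hg : ContDiffOn ℝ ∞ g U) : ContDiffOn ℝ ∞ (fun z => lor (f z) (g z)) U := by
  have hf' := contDiffOn_pi.1 hf
  have hg' := contDiffOn_pi.1 hg
  exact ((hf' 0).mul (hg' 0)).neg.add (ContDiffOn.sum fun i _ => (hf' _).mul (hg' _))

theorem contDiffOn_lightLift {f : ℂ → EuclideanSpace ℝ (Fin 7)} {U : Set ℂ}
    (hf : ContDiffOn ℝ ∞ f U) : ContDiffOn ℝ ∞ (lightLift f) U := by
  refine contDiffOn_pi.2 fun i => ?_
  refine Fin.cases ?_ (fun j => ?_) i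
  · exact contDiffOn_const
  · have h1 : ContDiffOn ℝ ∞ (fun z => f z j) U := (contDiffOn_piLp 2).1 hf j
    exact Complex.ofRealCLM.contDiff.comp_contDiffOn h1

/-- The conformal factor `⟨L_z, L_z̄⟩`. -/
def confFactor (f : ℂ → EuclideanSpace ℝ (Fin 7)) (z : ℂ) : ℂ :=
  lor (δz (lightLift f) z) (δw (lightLift f) z)

namespace IsConformalSurface

variable {f : ℂ → EuclideanSpace ℝ (Fin 7)} {U : Set ℂ}

theorem contDiffOn_lift (H : IsConformalSurface f U) : ContDiffOn ℝ ∞ (lightLift f) U :=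
  contDiffOn_lightLift H.smooth

theorem contDiffOn_lift_z (H : IsConformalSurface f U) : ContDiffOn ℝ ∞ (δz (lightLift f)) U :=
  contDiffOn_wd H.isOpen H.contDiffOn_lift

theorem contDiffOn_lift_w (H : IsConformalSurface f U) : ContDiffOn ℝ ∞ (δw (lightLift f)) U :=
  contDiffOn_wd H.isOpen H.contDiffOn_lift

theorem dAt (H : IsConformalSurface f U) {E : Type*} [NormedAddCommGroup E] [NormedSpace ℝ E]
    {g : ℂ → E} (hg : ContDiffOn ℝ ∞ g U) {z : ℂ} (hz : z ∈ U) : DifferentiableAt ℝ g z :=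
  differentiableAt_of_smoothOn hg H.isOpen hz

/-- The product rule for two orthogonal vector fields. -/
theorem lor_deriv_of_const (H : IsConformalSurface f U) {X Y : ℂ → Fin 8 → ℂ}
    (hX : ContDiffOn ℝ ∞ X U) (hY : ContDiffOn ℝ ∞ Y U) {c : ℂ}
    (h : ∀ z ∈ U, lor (X z) (Y z) = c) {s z : ℂ} (hz : z ∈ U) :
    lor (wd s X z) (Y z) + lor (X z) (wd s Y z) = 0 := by
  rw [← wd_lor (H.dAt hX hz) (H.dAt hY hz),
    wd_congr_of_isOpen H.isOpen (g := fun _ => c) h hz, wd_const]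

theorem lift_w_eq (H : IsConformalSurface f U) {z : ℂ} (hz : z ∈ U) :
    δw (lightLift f) z = conjVec (δz (lightLift f) z) := by
  have := wd_conjVec (s := Complex.I) (H.dAt H.contDiffOn_lift hz)
  simp only [conjVec_lightLift, Complex.conj_I] at this
  exact this

theorem conj_lift_zw (H : IsConformalSurface f U) {z : ℂ} (hz : z ∈ U) :
    conjVec (δw (δz (lightLift f)) z) = δw (δz (lightLift f)) z := by
  have h := wd_conjVec (s := -Complex.I) (H.dAt H.contDiffOn_lift_z hz)
  rw [map_neg, Complex.conj_I, neg_neg] at h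
  rw [← h, wd_congr_of_isOpen H.isOpen (fun ζ hζ => (H.lift_w_eq hζ).symm) hz,
    wd_comm H.isOpen H.contDiffOn_lift hz]

theorem lor_l_l (H : IsConformalSurface f U) {z : ℂ} (hz : z ∈ U) :
    lor (lightLift f z) (lightLift f z) = 0 := by
  have h := H.norm_eq z hz
  have h2 : ∑ i : Fin 7, (f z i) ^ 2 = 1 := by
    have := EuclideanSpace.norm_sq_eq (f z)
    rw [h] at this; simpa using this.symm
  have h3 : ∑ i : Fin 7, ((f z i : ℝ) : ℂ) ^ 2 = 1 := by exact_mod_cast h2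
  simp only [lor, lightLift, Fin.cons_zero, Fin.cons_succ, ← pow_two, h3]
  ring

theorem lor_l_d (H : IsConformalSurface f U) (s : ℂ) {z : ℂ} (hz : z ∈ U) :
    lor (lightLift f z) (wd s (lightLift f) z) = 0 := by
  have := H.lor_deriv_of_const (s := s) H.contDiffOn_lift H.contDiffOn_lift
    (fun _ h => H.lor_l_l h) hz
  rw [lor_comm (wd s _ z)] at this
  linear_combination (1 / 2 : ℂ) * this

theorem lor_w_w (H : IsConformalSurface f U) {z : ℂ} (hz : z ∈ U) :
    lor (δw (lightLift f) z) (δw (lightLift f) z) = 0 := by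
  rw [H.lift_w_eq hz, lor_conjVec, H.conformal z hz, map_zero]

theorem lor_l_zw (H : IsConformalSurface f U) {z : ℂ} (hz : z ∈ U) :
    lor (lightLift f z) (δw (δz (lightLift f)) z) = -confFactor f z := by
  have := H.lor_deriv_of_const (s := Complex.I) H.contDiffOn_lift H.contDiffOn_lift_z
    (fun _ h => H.lor_l_d _ h) hz
  rw [lor_comm (δw _ z)] at this
  unfold confFactor
  linear_combination this

theorem lor_z_zw (H : IsConformalSurface f U) {z : ℂ} (hz : z ∈ U) :
    lor (δz (lightLift f) z) (δw (δz (lightLift f)) z) = 0 := by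
  have := H.lor_deriv_of_const (s := Complex.I) H.contDiffOn_lift_z H.contDiffOn_lift_z
    (fun _ h => H.conformal _ h) hz
  rw [lor_comm (δw _ z)] at this
  linear_combination (1 / 2 : ℂ) * this

theorem lor_w_zw (H : IsConformalSurface f U) {z : ℂ} (hz : z ∈ U) :
    lor (δw (lightLift f) z) (δw (δz (lightLift f)) z) = 0 := by
  rw [wd_comm H.isOpen H.contDiffOn_lift hz]
  have := H.lor_deriv_of_const (s := -Complex.I) H.contDiffOn_lift_w H.contDiffOn_lift_w
    (fun _ h => H.lor_w_w h) hz
  rw [lor_comm (δz _ z)] at this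
  linear_combination (1 / 2 : ℂ) * this

theorem lor_l_zz (H : IsConformalSurface f U) {z : ℂ} (hz : z ∈ U) :
    lor (lightLift f z) (δz (δz (lightLift f)) z) = 0 := by
  have := H.lor_deriv_of_const (s := -Complex.I) H.contDiffOn_lift H.contDiffOn_lift_z
    (fun _ h => H.lor_l_d _ h) hz
  rw [H.conformal z hz] at this
  linear_combination this

theorem lor_z_zz (H : IsConformalSurface f U) {z : ℂ} (hz : z ∈ U) :
    lor (δz (lightLift f) z) (δz (δz (lightLift f)) z) = 0 := by
  have := H.lor_deriv_of_const (s := -Complex.I) H.contDiffOn_lift_z H.contDiffOn_lift_z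
    (fun _ h => H.conformal _ h) hz
  rw [lor_comm (δz (δz _) z)] at this
  linear_combination (1 / 2 : ℂ) * this

theorem sum_sq (H : IsConformalSurface f U) {z : ℂ} (hz : z ∈ U) : ∑ i, (f z i) ^ 2 = 1 := by
  have := EuclideanSpace.norm_sq_eq (f z)
  rw [H.norm_eq z hz] at this; simpa using this.symm

/-- On `L^⊥` the Hermitian form is positive semidefinite, with kernel spanned by `L`. -/
theorem exists_pos_of_ne (H : IsConformalSurface f U) {z : ℂ} (hz : z ∈ U) {x : Fin 8 → ℂ}
    (hx : lor (lightLift f z) x = 0) (hne : x ≠ x 0 • lightLift f z) :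
    0 < (lor x (conjVec x)).re ∧ ((lor x (conjVec x)).re : ℂ) = lor x (conjVec x) := by
  have h := lor_conjVec_self_of_orthogonal (H.sum_sq hz) hx
  rw [h, Complex.ofReal_re]
  refine ⟨lt_of_le_of_ne (Finset.sum_nonneg fun i _ => by positivity) fun h0 => hne ?_, rfl⟩
  have h1 := (Finset.sum_eq_zero_iff_of_nonneg fun i _ => by positivity).1 h0.symm
  ext i
  refine Fin.cases ?_ (fun j => ?_) i
  · simp [lightLift]
  · have := h1 j (Finset.mem_univ _)
    simp only [ne_eq, OfNat.ofNat_ne_zero, not_false_eq_true, pow_eq_zero_iff, norm_eq_zero,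
      sub_eq_zero] at this
    simpa [lightLift] using this

theorem lift_z_zero (H : IsConformalSurface f U) (s : ℂ) {z : ℂ} (hz : z ∈ U) :
    wd s (lightLift f) z 0 = 0 := by
  rw [wd_apply (H.dAt H.contDiffOn_lift hz)]
  simp [lightLift, wd_const]

/-- The components of `L_z` are the `z`-derivatives of the components of `f`. -/
theorem lift_z_succ (H : IsConformalSurface f U) (s : ℂ) {z : ℂ} (hz : z ∈ U) (i : Fin 7) :
    wd s (lightLift f) z i.succ =
      (2 : ℂ)⁻¹ * ((fderiv ℝ f z 1 i : ℝ) + s * (fderiv ℝ f z Complex.I i : ℝ)) := by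
  rw [wd_apply (H.dAt H.contDiffOn_lift hz)]
  have h1 : HasFDerivAt (fun ζ => ((f ζ i : ℝ) : ℂ))
      (Complex.ofRealCLM.comp ((EuclideanSpace.proj i).comp (fderiv ℝ f z))) z :=
    (Complex.ofRealCLM.comp (EuclideanSpace.proj (𝕜 := ℝ) i)).hasFDerivAt.comp z
      (H.dAt H.smooth hz).hasFDerivAt
  simp only [lightLift, Fin.cons_succ, wd, h1.fderiv, smul_eq_mul]
  rfl

theorem lift_z_ne_zero (H : IsConformalSurface f U) {z : ℂ} (hz : z ∈ U) :
    δz (lightLift f) z ≠ 0 := by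
  intro h
  have h1 : fderiv ℝ f z 1 = 0 := by
    ext i
    have := congrArg Complex.re (H.lift_z_succ (-Complex.I) hz i)
    rw [h] at this
    simpa using this.symm
  have := H.immersed z hz (h1.trans (map_zero _).symm)
  exact one_ne_zero this

theorem factor_eq_conj (H : IsConformalSurface f U) {z : ℂ} (hz : z ∈ U) :
    confFactor f z = lor (δz (lightLift f) z) (conjVec (δz (lightLift f) z)) := by
  rw [confFactor, H.lift_w_eq hz]

theorem factor_pos (H : IsConformalSurface f U) {z : ℂ} (hz : z ∈ U) :
    0 < (confFactor f z).re ∧ ((confFactor f z).re : ℂ) = confFactor f z := by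
  rw [H.factor_eq_conj hz]
  refine H.exists_pos_of_ne hz (H.lor_l_d _ hz) ?_
  rw [H.lift_z_zero _ hz, zero_smul]
  exact H.lift_z_ne_zero hz

theorem factor_ne_zero (H : IsConformalSurface f U) {z : ℂ} (hz : z ∈ U) : confFactor f z ≠ 0 := by
  rw [← (H.factor_pos hz).2]
  exact_mod_cast (H.factor_pos hz).1.ne'

theorem contDiffOn_factor (H : IsConformalSurface f U) : ContDiffOn ℝ ∞ (confFactor f) U :=
  contDiffOn_lor H.contDiffOn_lift_z H.contDiffOn_lift_w

theorem lor_w_zz (H : IsConformalSurface f U) {z : ℂ} (hz : z ∈ U) :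
    lor (δw (lightLift f) z) (δz (δz (lightLift f)) z) = δz (confFactor f) z := by
  have h := wd_lor (s := -Complex.I) (H.dAt H.contDiffOn_lift_z hz) (H.dAt H.contDiffOn_lift_w hz)
  rw [wd_comm (s := -Complex.I) (t := Complex.I) H.isOpen H.contDiffOn_lift hz, H.lor_z_zw hz,
    add_zero] at h
  rw [lor_comm, ← h]; rfl

/-- Vectors orthogonal to `L` and `L_zz̄` on which the Hermitian form is positive. -/
theorem pos_of_ne_zero (H : IsConformalSurface f U) {z : ℂ} (hz : z ∈ U) {x : Fin 8 → ℂ}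
    (hx : lor (lightLift f z) x = 0) (hx' : lor x (δw (δz (lightLift f)) z) = 0) (hne : x ≠ 0) :
    0 < (lor x (conjVec x)).re ∧ ((lor x (conjVec x)).re : ℂ) = lor x (conjVec x) := by
  refine H.exists_pos_of_ne hz hx fun h => hne ?_
  rw [h, lor_smul_left, H.lor_l_zw hz] at hx'
  have : x 0 = 0 := by
    rcases mul_eq_zero.1 hx' with h' | h'
    · exact h'
    · exact absurd (neg_eq_zero.1 h') (H.factor_ne_zero hz)
  rw [h, this, zero_smul]

/-- An isotropic orthonormal pair in the normal bundle gives an adapted basis. -/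
theorem adaptedBasis (H : IsConformalSurface f U) {z : ℂ} (hz : z ∈ U) {s₁ s₂ : Fin 8 → ℂ}
    (h1 : lor s₁ (lightLift f z) = 0 ∧ lor s₁ (δz (lightLift f) z) = 0 ∧
      lor s₁ (δw (lightLift f) z) = 0 ∧ lor s₁ (δw (δz (lightLift f)) z) = 0)
    (h2 : lor s₂ (lightLift f z) = 0 ∧ lor s₂ (δz (lightLift f) z) = 0 ∧
      lor s₂ (δw (lightLift f) z) = 0 ∧ lor s₂ (δw (δz (lightLift f)) z) = 0)
    (hss : lor s₁ s₁ = 0 ∧ lor s₁ s₂ = 0 ∧ lor s₂ s₂ = 0)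
    (hst : lor s₁ (conjVec s₁) = 2 ∧ lor s₁ (conjVec s₂) = 0 ∧ lor s₂ (conjVec s₁) = 0 ∧
      lor s₂ (conjVec s₂) = 2) :
    IsAdaptedBasis (confFactor f z) (lightLift f z) (δz (lightLift f) z) (δw (lightLift f) z)
      (δw (δz (lightLift f)) z) s₁ s₂ (conjVec s₁) (conjVec s₂) := by
  have hw : conjVec (δw (lightLift f) z) = δz (lightLift f) z := by
    rw [H.lift_w_eq hz, conjVec_conjVec]
  have key : ∀ s : Fin 8 → ℂ, (lor s (lightLift f z) = 0 ∧ lor s (δz (lightLift f) z) = 0 ∧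
      lor s (δw (lightLift f) z) = 0 ∧ lor s (δw (δz (lightLift f)) z) = 0) →
      (lor (conjVec s) (lightLift f z) = 0 ∧ lor (conjVec s) (δz (lightLift f) z) = 0 ∧
      lor (conjVec s) (δw (lightLift f) z) = 0 ∧
      lor (conjVec s) (δw (δz (lightLift f)) z) = 0) := by
    rintro s ⟨a, b, c, d⟩
    refine ⟨?_, ?_, ?_, ?_⟩
    · rw [← conjVec_lightLift, lor_conjVec, a, map_zero]
    · rw [← hw, lor_conjVec, c, map_zero]
    · rw [H.lift_w_eq hz, lor_conjVec, b, map_zero]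
    · rw [← H.conj_lift_zw hz, lor_conjVec, d, map_zero]
  exact
  { e_ne := H.factor_ne_zero hz
    ll := H.lor_l_l hz
    ld := H.lor_l_d _ hz
    ld' := H.lor_l_d _ hz
    lh := H.lor_l_zw hz
    dd := H.conformal z hz
    dd' := rfl
    dh := H.lor_z_zw hz
    d'd' := H.lor_w_w hz
    d'h := H.lor_w_zw hz
    s₁v := h1
    s₂v := h2
    t₁v := key _ h1
    t₂v := key _ h2
    ss := hss
    tt := by
      refine ⟨?_, ?_, ?_⟩ <;> rw [lor_conjVec]
      · rw [hss.1, map_zero]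
      · rw [hss.2.1, map_zero]
      · rw [hss.2.2, map_zero]
    st := hst }

end IsConformalSurface

/-! ### Isotropic frames from antiholomorphic sections -/

/-- Data from which the H-total isotropy of a conformal surface is read off: two antiholomorphic
isotropic sections `v₁, v₂` spanning a horizontal isotropic subbundle of the normal bundle, and a
nowhere vanishing combination `α v₁ + β v₂` such that `L_zz` lies in the span of `L`, `L_z` and
`α v₁ + β v₂`. -/
structure IsotropicData (f : ℂ → EuclideanSpace ℝ (Fin 7)) (U : Set ℂ) (v₁ v₂ : ℂ → Fin 8 → ℂ)
    (α β n p q : ℂ → ℂ) : Prop where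
  surf : IsConformalSurface f U
  sv₁ : ContDiffOn ℝ ∞ v₁ U
  sv₂ : ContDiffOn ℝ ∞ v₂ U
  sα : ContDiffOn ℝ ∞ α U
  sβ : ContDiffOn ℝ ∞ β U
  sn : ContDiffOn ℝ ∞ n U
  sp : ContDiffOn ℝ ∞ p U
  sq : ContDiffOn ℝ ∞ q U
  anti₁ : ∀ z ∈ U, δz v₁ z = 0
  anti₂ : ∀ z ∈ U, δz v₂ z = 0
  iso₁₁ : ∀ z ∈ U, lor (v₁ z) (v₁ z) = 0
  iso₁₂ : ∀ z ∈ U, lor (v₁ z) (v₂ z) = 0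
  iso₂₂ : ∀ z ∈ U, lor (v₂ z) (v₂ z) = 0
  orth₁ : ∀ z ∈ U, lor (lightLift f z) (v₁ z) = 0
  orth₂ : ∀ z ∈ U, lor (lightLift f z) (v₂ z) = 0
  orth₁' : ∀ z ∈ U, lor (δw (lightLift f) z) (v₁ z) = 0
  orth₂' : ∀ z ∈ U, lor (δw (lightLift f) z) (v₂ z) = 0
  horiz : ∀ z ∈ U, lor (δw v₁ z) (v₂ z) = 0
  indep : ∀ z ∈ U, ∀ a b : ℂ, a • v₁ z + b • v₂ z = 0 → a = 0 ∧ b = 0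
  ne : ∀ z ∈ U, α z ≠ 0 ∨ β z ≠ 0
  lift_zz : ∀ z ∈ U, δz (δz (lightLift f)) z =
    p z • lightLift f z + q z • δz (lightLift f) z + n z • (α z • v₁ z + β z • v₂ z)

namespace IsotropicData

variable {f : ℂ → EuclideanSpace ℝ (Fin 7)} {U : Set ℂ} {v₁ v₂ : ℂ → Fin 8 → ℂ}
  {α β n p q : ℂ → ℂ}

/-- Sections of the maximal isotropic bundle spanned by `L, L_z, v₁, v₂`. -/
def IsSection (f : ℂ → EuclideanSpace ℝ (Fin 7)) (U : Set ℂ) (v₁ v₂ : ℂ → Fin 8 → ℂ)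
    (X : ℂ → Fin 8 → ℂ) : Prop :=
  ∃ a b c d : ℂ → ℂ, ContDiffOn ℝ ∞ a U ∧ ContDiffOn ℝ ∞ b U ∧ ContDiffOn ℝ ∞ c U ∧
    ContDiffOn ℝ ∞ d U ∧ ∀ z ∈ U, X z =
      a z • lightLift f z + b z • δz (lightLift f) z + c z • v₁ z + d z • v₂ z

theorem IsSection.deriv (D : IsotropicData f U v₁ v₂ α β n p q) {X : ℂ → Fin 8 → ℂ}
    (hX : IsSection f U v₁ v₂ X) : IsSection f U v₁ v₂ (δz X) := by
  obtain ⟨a, b, c, d, ha, hb, hc, hd, h⟩ := hX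
  have hU := D.surf.isOpen
  refine ⟨fun z => δz a z + b z * p z, fun z => a z + δz b z + b z * q z,
    fun z => b z * (n z * α z) + δz c z, fun z => b z * (n z * β z) + δz d z, ?_, ?_, ?_, ?_, ?_⟩
  · exact (contDiffOn_wd hU ha).add (hb.mul D.sp)
  · exact (ha.add (contDiffOn_wd hU hb)).add (hb.mul D.sq)
  · exact (hb.mul (D.sn.mul D.sα)).add (contDiffOn_wd hU hc)
  · exact (hb.mul (D.sn.mul D.sβ)).add (contDiffOn_wd hU hd)
  · intro z hz
    have dA := fun {E : Type} [NormedAddCommGroup E] [NormedSpace ℝ E] {g : ℂ → E}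
      (hg : ContDiffOn ℝ ∞ g U) => D.surf.dAt hg hz
    rw [wd_congr_of_isOpen hU h hz]
    have dl := dA D.surf.contDiffOn_lift
    have dl' := dA D.surf.contDiffOn_lift_z
    rw [wd_add, wd_add, wd_add, wd_smul (dA ha) dl, wd_smul (dA hb) dl',
      wd_smul (dA hc) (dA D.sv₁), wd_smul (dA hd) (dA D.sv₂), D.anti₁ z hz, D.anti₂ z hz,
      D.lift_zz z hz]
    · module
    · exact (dA ha).smul dl
    · exact (dA hb).smul dl'
    · exact ((dA ha).smul dl).add ((dA hb).smul dl')
    · exact (dA hc).smul (dA D.sv₁)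
    · exact (((dA ha).smul dl).add ((dA hb).smul dl')).add ((dA hc).smul (dA D.sv₁))
    · exact (dA hd).smul (dA D.sv₂)

/-- All `z`-derivatives of the lift stay in the isotropic bundle. -/
theorem isSection_iterate (D : IsotropicData f U v₁ v₂ α β n p q) (j : ℕ) :
    IsSection f U v₁ v₂ (δz^[j] (lightLift f)) := by
  induction j with
  | zero =>
    refine ⟨1, 0, 0, 0, contDiffOn_const, contDiffOn_const, contDiffOn_const, contDiffOn_const,
      fun z _ => ?_⟩
    simp
  | succ j ih =>
    rw [Function.iterate_succ_apply']
    exact ih.deriv D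

theorem lor_z_v₁ (D : IsotropicData f U v₁ v₂ α β n p q) {z : ℂ} (hz : z ∈ U) :
    lor (δz (lightLift f) z) (v₁ z) = 0 := by
  have := D.surf.lor_deriv_of_const (s := -Complex.I) D.surf.contDiffOn_lift D.sv₁ D.orth₁ hz
  rwa [D.anti₁ z hz, lor_zero_right, add_zero] at this

theorem lor_z_v₂ (D : IsotropicData f U v₁ v₂ α β n p q) {z : ℂ} (hz : z ∈ U) :
    lor (δz (lightLift f) z) (v₂ z) = 0 := by
  have := D.surf.lor_deriv_of_const (s := -Complex.I) D.surf.contDiffOn_lift D.sv₂ D.orth₂ hz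
  rwa [D.anti₂ z hz, lor_zero_right, add_zero] at this

theorem lor_zw_v₁ (D : IsotropicData f U v₁ v₂ α β n p q) {z : ℂ} (hz : z ∈ U) :
    lor (δw (δz (lightLift f)) z) (v₁ z) = 0 := by
  rw [wd_comm D.surf.isOpen D.surf.contDiffOn_lift hz]
  have := D.surf.lor_deriv_of_const (s := -Complex.I) D.surf.contDiffOn_lift_w D.sv₁ D.orth₁' hz
  rwa [D.anti₁ z hz, lor_zero_right, add_zero] at this

theorem lor_zw_v₂ (D : IsotropicData f U v₁ v₂ α β n p q) {z : ℂ} (hz : z ∈ U) :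
    lor (δw (δz (lightLift f)) z) (v₂ z) = 0 := by
  rw [wd_comm D.surf.isOpen D.surf.contDiffOn_lift hz]
  have := D.surf.lor_deriv_of_const (s := -Complex.I) D.surf.contDiffOn_lift_w D.sv₂ D.orth₂' hz
  rwa [D.anti₂ z hz, lor_zero_right, add_zero] at this

/-- Two sections of the isotropic bundle are orthogonal. -/
theorem IsSection.lor_eq_zero (D : IsotropicData f U v₁ v₂ α β n p q) {X Y : ℂ → Fin 8 → ℂ}
    (hX : IsSection f U v₁ v₂ X) (hY : IsSection f U v₁ v₂ Y) {z : ℂ} (hz : z ∈ U) :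
    lor (X z) (Y z) = 0 := by
  obtain ⟨a, b, c, d, -, -, -, -, h⟩ := hX
  obtain ⟨a', b', c', d', -, -, -, -, h'⟩ := hY
  rw [h z hz, h' z hz]
  simp only [lor_add_left, lor_add_right, lor_smul_left, lor_smul_right]
  rw [D.surf.lor_l_l hz, lor_comm (δz _ z) (lightLift f z), D.surf.lor_l_d _ hz,
    D.surf.conformal z hz, D.orth₁ z hz, D.orth₂ z hz, lor_comm (v₁ z) (lightLift f z),
    lor_comm (v₂ z) (lightLift f z), D.orth₁ z hz, D.orth₂ z hz, D.lor_z_v₁ hz, D.lor_z_v₂ hz,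
    lor_comm (v₁ z) (δz _ z), lor_comm (v₂ z) (δz _ z), D.lor_z_v₁ hz, D.lor_z_v₂ hz,
    lor_comm (v₂ z) (v₁ z), D.iso₁₁ z hz, D.iso₁₂ z hz, D.iso₂₂ z hz]
  ring

theorem lor_combo (D : IsotropicData f U v₁ v₂ α β n p q) {z : ℂ} (hz : z ∈ U) (a b c d : ℂ) :
    lor (a • v₁ z + b • v₂ z) (c • v₁ z + d • v₂ z) = 0 := by
  simp only [lor_add_left, lor_add_right, lor_smul_left, lor_smul_right]
  rw [lor_comm (v₂ z) (v₁ z), D.iso₁₁ z hz, D.iso₁₂ z hz, D.iso₂₂ z hz]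
  ring

theorem normal_combo (D : IsotropicData f U v₁ v₂ α β n p q) {z : ℂ} (hz : z ∈ U) (a b : ℂ) :
    lor (a • v₁ z + b • v₂ z) (lightLift f z) = 0 ∧
    lor (a • v₁ z + b • v₂ z) (δz (lightLift f) z) = 0 ∧
    lor (a • v₁ z + b • v₂ z) (δw (lightLift f) z) = 0 ∧
    lor (a • v₁ z + b • v₂ z) (δw (δz (lightLift f)) z) = 0 := by
  refine ⟨?_, ?_, ?_, ?_⟩ <;> rw [lor_comm, lor_add_right, lor_smul_right, lor_smul_right]
  · rw [D.orth₁ z hz, D.orth₂ z hz]; ring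
  · rw [D.lor_z_v₁ hz, D.lor_z_v₂ hz]; ring
  · rw [D.orth₁' z hz, D.orth₂' z hz]; ring
  · rw [D.lor_zw_v₁ hz, D.lor_zw_v₂ hz]; ring

theorem lor_w_combo (D : IsotropicData f U v₁ v₂ α β n p q) {z : ℂ} (hz : z ∈ U) {a b : ℂ → ℂ}
    (ha : ContDiffOn ℝ ∞ a U) (hb : ContDiffOn ℝ ∞ b U) (c d : ℂ) :
    lor (δw (fun ζ => a ζ • v₁ ζ + b ζ • v₂ ζ) z) (c • v₁ z + d • v₂ z) = 0 := by
  have dA := fun {E : Type} [NormedAddCommGroup E] [NormedSpace ℝ E] {g : ℂ → E}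
    (hg : ContDiffOn ℝ ∞ g U) => D.surf.dAt hg hz
  have h11 := D.surf.lor_deriv_of_const (s := Complex.I) D.sv₁ D.sv₁ D.iso₁₁ hz
  have h12 := D.surf.lor_deriv_of_const (s := Complex.I) D.sv₁ D.sv₂ D.iso₁₂ hz
  have h22 := D.surf.lor_deriv_of_const (s := Complex.I) D.sv₂ D.sv₂ D.iso₂₂ hz
  rw [lor_comm (v₁ z)] at h11
  rw [lor_comm (v₂ z)] at h22
  rw [D.horiz z hz, lor_comm (v₁ z)] at h12
  have h11' : lor (δw v₁ z) (v₁ z) = 0 := by linear_combination (1 / 2 : ℂ) * h11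
  have h22' : lor (δw v₂ z) (v₂ z) = 0 := by linear_combination (1 / 2 : ℂ) * h22
  have h12' : lor (δw v₂ z) (v₁ z) = 0 := by linear_combination h12
  rw [wd_add (f := fun ζ => a ζ • v₁ ζ) (g := fun ζ => b ζ • v₂ ζ) ((dA ha).smul (dA D.sv₁))
    ((dA hb).smul (dA D.sv₂)), wd_smul (dA ha) (dA D.sv₁),
    wd_smul (dA hb) (dA D.sv₂)]
  simp only [lor_add_left, lor_add_right, lor_smul_left, lor_smul_right]
  rw [h11', h22', h12', D.horiz z hz, lor_comm (v₂ z) (v₁ z), D.iso₁₁ z hz, D.iso₁₂ z hz,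
    D.iso₂₂ z hz]
  ring

/-- The section `α v₁ + β v₂` spanned by the normal part of `L_zz`. -/
def umb (v₁ v₂ : ℂ → Fin 8 → ℂ) (α β : ℂ → ℂ) (z : ℂ) : Fin 8 → ℂ := α z • v₁ z + β z • v₂ z

/-- The combination of `v₁, v₂` that is Hermitian orthogonal to `α v₁ + β v₂`. -/
def perp (v₁ v₂ : ℂ → Fin 8 → ℂ) (α β : ℂ → ℂ) (z : ℂ) : Fin 8 → ℂ :=
  lor (v₂ z) (conjVec (umb v₁ v₂ α β z)) • v₁ z + (-lor (v₁ z) (conjVec (umb v₁ v₂ α β z))) • v₂ z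

theorem umb_pos (D : IsotropicData f U v₁ v₂ α β n p q) {z : ℂ} (hz : z ∈ U) :
    0 < (lor (umb v₁ v₂ α β z) (conjVec (umb v₁ v₂ α β z))).re ∧
      ((lor (umb v₁ v₂ α β z) (conjVec (umb v₁ v₂ α β z))).re : ℂ) =
        lor (umb v₁ v₂ α β z) (conjVec (umb v₁ v₂ α β z)) := by
  obtain ⟨h1, -, -, h4⟩ := D.normal_combo hz (α z) (β z)
  rw [lor_comm] at h1
  refine D.surf.pos_of_ne_zero hz h1 h4 fun h => ?_
  obtain ⟨ha, hb⟩ := D.indep z hz _ _ h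
  exact (D.ne z hz).elim (fun h => h ha) (fun h => h hb)

theorem perp_ne_zero (D : IsotropicData f U v₁ v₂ α β n p q) {z : ℂ} (hz : z ∈ U) :
    perp v₁ v₂ α β z ≠ 0 := by
  intro h
  obtain ⟨ha, hb⟩ := D.indep z hz _ _ h
  obtain ⟨h1, h2⟩ := D.umb_pos hz
  have : lor (umb v₁ v₂ α β z) (conjVec (umb v₁ v₂ α β z)) = 0 := by
    conv_lhs => arg 1; rw [umb]
    rw [lor_add_left, lor_smul_left, lor_smul_left, ha, neg_eq_zero.1 hb]; ring
  rw [this] at h1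
  simp at h1

theorem perp_pos (D : IsotropicData f U v₁ v₂ α β n p q) {z : ℂ} (hz : z ∈ U) :
    0 < (lor (perp v₁ v₂ α β z) (conjVec (perp v₁ v₂ α β z))).re ∧
      ((lor (perp v₁ v₂ α β z) (conjVec (perp v₁ v₂ α β z))).re : ℂ) =
        lor (perp v₁ v₂ α β z) (conjVec (perp v₁ v₂ α β z)) := by
  obtain ⟨h1, -, -, h4⟩ := D.normal_combo hz (lor (v₂ z) (conjVec (umb v₁ v₂ α β z)))
    (-lor (v₁ z) (conjVec (umb v₁ v₂ α β z)))
  rw [lor_comm] at h1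
  exact D.surf.pos_of_ne_zero hz h1 h4 (D.perp_ne_zero hz)

theorem lor_perp_umb (v₁ v₂ : ℂ → Fin 8 → ℂ) (α β : ℂ → ℂ) (z : ℂ) :
    lor (perp v₁ v₂ α β z) (conjVec (umb v₁ v₂ α β z)) = 0 := by
  rw [perp, lor_add_left, lor_smul_left, lor_smul_left]; ring

/-- The factor that normalises `⟨X, X̄⟩` to `2`. -/
def nrm (X : ℂ → Fin 8 → ℂ) (z : ℂ) : ℂ :=
  ((Real.sqrt (2 / (lor (X z) (conjVec (X z))).re) : ℝ) : ℂ)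

theorem nrm_mul {X : ℂ → Fin 8 → ℂ} {z : ℂ} (h : 0 < (lor (X z) (conjVec (X z))).re)
    (h' : ((lor (X z) (conjVec (X z))).re : ℂ) = lor (X z) (conjVec (X z))) :
    nrm X z * nrm X z * lor (X z) (conjVec (X z)) = 2 := by
  have : Real.sqrt (2 / (lor (X z) (conjVec (X z))).re) *
      Real.sqrt (2 / (lor (X z) (conjVec (X z))).re) * (lor (X z) (conjVec (X z))).re = 2 := by
    rw [Real.mul_self_sqrt (by positivity), div_mul_cancel₀ _ h.ne']
  rw [nrm]
  conv_lhs => arg 2; rw [← h']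
  exact_mod_cast this

theorem nrm_ne_zero {X : ℂ → Fin 8 → ℂ} {z : ℂ} (h : 0 < (lor (X z) (conjVec (X z))).re) :
    nrm X z ≠ 0 := by
  have : 0 < Real.sqrt (2 / (lor (X z) (conjVec (X z))).re) := Real.sqrt_pos.2 (by positivity)
  exact Complex.ofReal_ne_zero.2 this.ne'

theorem conj_nrm (X : ℂ → Fin 8 → ℂ) (z : ℂ) : (starRingEnd ℂ) (nrm X z) = nrm X z :=
  Complex.conj_ofReal _

theorem contDiffOn_nrm {X : ℂ → Fin 8 → ℂ} {U : Set ℂ} (hX : ContDiffOn ℝ ∞ X U)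
    (h : ∀ z ∈ U, 0 < (lor (X z) (conjVec (X z))).re) : ContDiffOn ℝ ∞ (nrm X) U := by
  have h1 : ContDiffOn ℝ ∞ (fun z => (lor (X z) (conjVec (X z))).re) U :=
    Complex.reCLM.contDiff.comp_contDiffOn (contDiffOn_lor hX (contDiffOn_conjVec hX))
  have h2 : ContDiffOn ℝ ∞ (fun z => Real.sqrt (2 / (lor (X z) (conjVec (X z))).re)) U :=
    (contDiffOn_const.div h1 fun z hz => (h z hz).ne').sqrt fun z hz =>
      (div_pos two_pos (h z hz)).ne'
  exact Complex.ofRealCLM.contDiff.comp_contDiffOn h2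

/-- The Hermitian orthonormalisation of `L_z, α v₁ + β v₂` and the section orthogonal to them. -/
def frame (f : ℂ → EuclideanSpace ℝ (Fin 7)) (v₁ v₂ : ℂ → Fin 8 → ℂ) (α β : ℂ → ℂ) :
    Fin 3 → ℂ → Fin 8 → ℂ :=
  ![fun z => nrm (δz (lightLift f)) z • δz (lightLift f) z,
    fun z => nrm (umb v₁ v₂ α β) z • umb v₁ v₂ α β z,
    fun z => nrm (perp v₁ v₂ α β) z • perp v₁ v₂ α β z]

theorem contDiffOn_umb (D : IsotropicData f U v₁ v₂ α β n p q) :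
    ContDiffOn ℝ ∞ (umb v₁ v₂ α β) U := (D.sα.smul D.sv₁).add (D.sβ.smul D.sv₂)

theorem contDiffOn_perp_coeff (D : IsotropicData f U v₁ v₂ α β n p q) {v : ℂ → Fin 8 → ℂ}
    (hv : ContDiffOn ℝ ∞ v U) :
    ContDiffOn ℝ ∞ (fun z => lor (v z) (conjVec (umb v₁ v₂ α β z))) U :=
  contDiffOn_lor hv (contDiffOn_conjVec D.contDiffOn_umb)

theorem contDiffOn_perp (D : IsotropicData f U v₁ v₂ α β n p q) :
    ContDiffOn ℝ ∞ (perp v₁ v₂ α β) U :=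
  ((D.contDiffOn_perp_coeff D.sv₂).smul D.sv₁).add
    ((D.contDiffOn_perp_coeff D.sv₁).neg.smul D.sv₂)

theorem z_pos (D : IsotropicData f U v₁ v₂ α β n p q) {z : ℂ} (hz : z ∈ U) :
    0 < (lor (δz (lightLift f) z) (conjVec (δz (lightLift f) z))).re ∧
      ((lor (δz (lightLift f) z) (conjVec (δz (lightLift f) z))).re : ℂ) =
        lor (δz (lightLift f) z) (conjVec (δz (lightLift f) z)) := by
  rw [← D.surf.factor_eq_conj hz]
  exact D.surf.factor_pos hz

theorem lor_scaled_conj (a b : ℂ) (x y : Fin 8 → ℂ) :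
    lor (a • x) (conjVec (b • y)) = a * (starRingEnd ℂ) b * lor x (conjVec y) := by
  rw [conjVec_smul, lor_smul_left, lor_smul_right]; ring

theorem frame_adaptedBasis (D : IsotropicData f U v₁ v₂ α β n p q) {z : ℂ} (hz : z ∈ U) :
    IsAdaptedBasis (confFactor f z) (lightLift f z) (δz (lightLift f) z) (δw (lightLift f) z)
      (δw (δz (lightLift f)) z) (frame f v₁ v₂ α β 1 z) (frame f v₁ v₂ α β 2 z)
      (conjVec (frame f v₁ v₂ α β 1 z)) (conjVec (frame f v₁ v₂ α β 2 z)) := by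
  have e1 : frame f v₁ v₂ α β 1 z = nrm (umb v₁ v₂ α β) z • umb v₁ v₂ α β z := rfl
  have e2 : frame f v₁ v₂ α β 2 z = nrm (perp v₁ v₂ α β) z • perp v₁ v₂ α β z := rfl
  have hpu := lor_perp_umb v₁ v₂ α β z
  have hup : lor (umb v₁ v₂ α β z) (conjVec (perp v₁ v₂ α β z)) = 0 := by
    have := lor_conjVec (perp v₁ v₂ α β z) (conjVec (umb v₁ v₂ α β z))
    rw [hpu, map_zero, conjVec_conjVec, lor_comm] at this
    exact this
  have c1 : ∀ k : ℂ, k • umb v₁ v₂ α β z = (k * α z) • v₁ z + (k * β z) • v₂ z := fun k => by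
    rw [umb]; module
  have c2 : ∀ k : ℂ, k • perp v₁ v₂ α β z =
      (k * lor (v₂ z) (conjVec (umb v₁ v₂ α β z))) • v₁ z +
      (k * (-lor (v₁ z) (conjVec (umb v₁ v₂ α β z)))) • v₂ z := fun k => by rw [perp]; module
  refine D.surf.adaptedBasis hz ?_ ?_ ⟨?_, ?_, ?_⟩ ⟨?_, ?_, ?_, ?_⟩
  · rw [e1, c1]; exact D.normal_combo hz _ _
  · rw [e2, c2]; exact D.normal_combo hz _ _
  · rw [e1, c1]; exact D.lor_combo hz _ _ _ _
  · rw [e1, e2, c1, c2]; exact D.lor_combo hz _ _ _ _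
  · rw [e2, c2]; exact D.lor_combo hz _ _ _ _
  · rw [e1, lor_scaled_conj, conj_nrm]
    exact nrm_mul (D.umb_pos hz).1 (D.umb_pos hz).2
  · rw [e1, e2, lor_scaled_conj, hup, mul_zero]
  · rw [e1, e2, lor_scaled_conj, hpu, mul_zero]
  · rw [e2, lor_scaled_conj, conj_nrm]
    exact nrm_mul (D.perp_pos hz).1 (D.perp_pos hz).2

/-- The orthonormalised frame has all the properties required of an H-isotropic frame. -/
theorem isHIsotropicFrame (D : IsotropicData f U v₁ v₂ α β n p q) :
    IsHIsotropicFrame f U (frame f v₁ v₂ α β) := by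
  have gs : ∀ z, gaussSpace f z = Submodule.span ℂ {lightLift f z, δz (lightLift f) z,
      δw (lightLift f) z, δw (δz (lightLift f)) z} := fun z => by
    rw [gaussSpace, dz_eq_wd, dzbar_eq_wd, dzbar_eq_wd]
  have e0 : ∀ z, frame f v₁ v₂ α β 0 z = nrm (δz (lightLift f)) z • δz (lightLift f) z :=
    fun z => rfl
  have e1 : ∀ z, frame f v₁ v₂ α β 1 z = (nrm (umb v₁ v₂ α β) z * α z) • v₁ z +
      (nrm (umb v₁ v₂ α β) z * β z) • v₂ z := fun z => by
    change nrm (umb v₁ v₂ α β) z • umb v₁ v₂ α β z = _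
    rw [umb]; module
  have e2 : ∀ z, frame f v₁ v₂ α β 2 z =
      (nrm (perp v₁ v₂ α β) z * lor (v₂ z) (conjVec (umb v₁ v₂ α β z))) • v₁ z +
      (nrm (perp v₁ v₂ α β) z * (-lor (v₁ z) (conjVec (umb v₁ v₂ α β z)))) • v₂ z := fun z => by
    change nrm (perp v₁ v₂ α β) z • perp v₁ v₂ α β z = _
    rw [perp]; module
  have sn0 := contDiffOn_nrm D.surf.contDiffOn_lift_z fun z hz => (D.z_pos hz).1
  have sn1 := contDiffOn_nrm D.contDiffOn_umb fun z hz => (D.umb_pos hz).1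
  have sn2 := contDiffOn_nrm D.contDiffOn_perp fun z hz => (D.perp_pos hz).1
  have sc1 := D.contDiffOn_perp_coeff D.sv₁
  have sc2 := D.contDiffOn_perp_coeff D.sv₂
  have orth0 : ∀ z ∈ U, ∀ s : Fin 8 → ℂ, lor s (δz (lightLift f) z) = 0 →
      lor s (δw (lightLift f) z) = 0 → lor s (frame f v₁ v₂ α β 0 z) = 0 ∧
      lor s (conjVec (frame f v₁ v₂ α β 0 z)) = 0 := by
    intro z hz s h h'
    rw [e0, lor_smul_right, h, conjVec_smul, lor_smul_right, ← D.surf.lift_w_eq hz, h']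
    simp
  constructor
  · intro j
    fin_cases j
    · exact sn0.smul D.surf.contDiffOn_lift_z
    · exact sn1.smul D.contDiffOn_umb
    · exact sn2.smul D.contDiffOn_perp
  · intro z hz j l
    have B := D.frame_adaptedBasis hz
    have z0 : lor (frame f v₁ v₂ α β 0 z) (frame f v₁ v₂ α β 0 z) = 0 := by
      rw [e0, lor_smul_left, lor_smul_right, D.surf.conformal z hz]; ring
    have z1 := (orth0 z hz _ B.s₁v.2.1 B.s₁v.2.2.1).1
    have z2 := (orth0 z hz _ B.s₂v.2.1 B.s₂v.2.2.1).1
    have h21 : lor (frame f v₁ v₂ α β 2 z) (frame f v₁ v₂ α β 1 z) = 0 := by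
      rw [lor_comm]; exact B.ss.2.1
    fin_cases j <;> fin_cases l
    · exact z0
    · exact (lor_comm _ _).trans z1
    · exact (lor_comm _ _).trans z2
    · exact z1
    · exact B.ss.1
    · exact B.ss.2.1
    · exact z2
    · exact h21
    · exact B.ss.2.2
  · intro z hz j l
    have B := D.frame_adaptedBasis hz
    have z1 := (orth0 z hz _ B.s₁v.2.1 B.s₁v.2.2.1).2
    have z2 := (orth0 z hz _ B.s₂v.2.1 B.s₂v.2.2.1).2
    have y1 := (orth0 z hz _ B.t₁v.2.1 B.t₁v.2.2.1).1
    have y2 := (orth0 z hz _ B.t₂v.2.1 B.t₂v.2.2.1).1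
    have z0 : lor (frame f v₁ v₂ α β 0 z) (conjVec (frame f v₁ v₂ α β 0 z)) = 2 := by
      rw [e0, lor_scaled_conj, conj_nrm]
      exact nrm_mul (D.z_pos hz).1 (D.z_pos hz).2
    fin_cases j <;> fin_cases l
    · exact z0
    · exact (lor_comm _ _).trans y1
    · exact (lor_comm _ _).trans y2
    · exact z1
    · exact B.st.1
    · exact B.st.2.1
    · exact z2
    · exact B.st.2.2.1
    · exact B.st.2.2.2
  · intro z hz j
    have B := D.frame_adaptedBasis hz
    rw [show dz (E := Fin 8 → ℂ) = δz from funext dz_eq_wd]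
    have sec := D.isSection_iterate
    -- membership of `L` and of the frame vectors in the relevant spans
    have hl : ∀ k : Fin 3, lightLift f z ∈ Submodule.span ℂ
        (insert (lightLift f z) ((fun l => frame f v₁ v₂ α β l z) '' {l | l ≤ k})) := fun k =>
      Submodule.subset_span (Set.mem_insert _ _)
    have hm : ∀ l k : Fin 3, l ≤ k → frame f v₁ v₂ α β l z ∈ Submodule.span ℂ
        (insert (lightLift f z) ((fun l => frame f v₁ v₂ α β l z) '' {l | l ≤ k})) :=
      fun l k hlk => Submodule.subset_span (Set.mem_insert_of_mem _ ⟨l, hlk, rfl⟩)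
    have hd : ∀ k : Fin 3, δz (lightLift f) z ∈ Submodule.span ℂ
        (insert (lightLift f z) ((fun l => frame f v₁ v₂ α β l z) '' {l | l ≤ k})) := by
      intro k
      have h0 := Submodule.smul_mem _ (nrm (δz (lightLift f)) z)⁻¹ (hm 0 k (Fin.zero_le _))
      rwa [e0, smul_smul, inv_mul_cancel₀ (nrm_ne_zero (D.z_pos hz).1), one_smul] at h0
    fin_cases j
    · exact hd 0
    · change δz (δz (lightLift f)) z ∈ _
      rw [D.lift_zz z hz]
      refine Submodule.add_mem _ (Submodule.add_mem _ (Submodule.smul_mem _ _ (hl 1))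
        (Submodule.smul_mem _ _ (hd 1))) (Submodule.smul_mem _ _ ?_)
      have h1 := Submodule.smul_mem _ (nrm (umb v₁ v₂ α β) z)⁻¹ (hm 1 1 le_rfl)
      change (nrm (umb v₁ v₂ α β) z)⁻¹ • (nrm (umb v₁ v₂ α β) z • umb v₁ v₂ α β z) ∈ _ at h1
      rwa [smul_smul, inv_mul_cancel₀ (nrm_ne_zero (D.umb_pos hz).1), one_smul] at h1
    · have s3 := sec 3
      have s0 : IsSection f U v₁ v₂ (lightLift f) := sec 0
      have s1 : IsSection f U v₁ v₂ (δz (lightLift f)) := sec 1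
      have sf : ∀ a b : ℂ → ℂ, ContDiffOn ℝ ∞ a U → ContDiffOn ℝ ∞ b U →
          IsSection f U v₁ v₂ (fun z => a z • v₁ z + b z • v₂ z) := fun a b ha hb =>
        ⟨0, 0, a, b, contDiffOn_const, contDiffOn_const, ha, hb, fun z _ => by simp⟩
      have f1 := (sf _ _ (sn1.mul D.sα) (sn1.mul D.sβ))
      have f2 := (sf _ _ (sn2.mul sc2) (sn2.mul sc1.neg))
      have o0 := IsSection.lor_eq_zero D s3 s0 hz
      have o1 := IsSection.lor_eq_zero D s3 s1 hz
      have o2 := IsSection.lor_eq_zero D s3 f1 hz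
      have o3 := IsSection.lor_eq_zero D s3 f2 hz
      change δz^[3] (lightLift f) z ∈ _
      rw [B.expand (δz^[3] (lightLift f) z)]
      have o2' : lor (δz^[3] (lightLift f) z) (frame f v₁ v₂ α β 1 z) = 0 := by rw [e1]; exact o2
      have o3' : lor (δz^[3] (lightLift f) z) (frame f v₁ v₂ α β 2 z) = 0 := by rw [e2]; exact o3
      rw [o0, o1, o2', o3']
      simp only [zero_div, neg_zero, zero_smul, add_zero]
      exact Submodule.add_mem _ (Submodule.add_mem _ (Submodule.add_mem _
        (Submodule.smul_mem _ _ (hl 2)) (Submodule.smul_mem _ _ (hd 2)))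
        (Submodule.smul_mem _ _ (hm 1 2 (by decide)))) (Submodule.smul_mem _ _ (hm 2 2 le_rfl))
  · intro z hz
    have B := D.frame_adaptedBasis hz
    rw [Fintype.linearIndependent_iff]
    intro g hg
    have hg' : ∀ y, lor (∑ i, g i • ![frame f v₁ v₂ α β 1 z, frame f v₁ v₂ α β 2 z,
        conjVec (frame f v₁ v₂ α β 1 z), conjVec (frame f v₁ v₂ α β 2 z)] i) y = 0 := by
      intro y; rw [hg, lor_zero_left]
    simp only [Fin.sum_univ_four, lor_add_left, lor_smul_left, Matrix.cons_val_zero,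
      Matrix.cons_val_one, Matrix.cons_val] at hg'
    have q1 := hg' (frame f v₁ v₂ α β 1 z)
    have q2 := hg' (frame f v₁ v₂ α β 2 z)
    have q3 := hg' (conjVec (frame f v₁ v₂ α β 1 z))
    have q4 := hg' (conjVec (frame f v₁ v₂ α β 2 z))
    have c := lor_comm (R := ℂ)
    rw [B.ss.1, c (frame f v₁ v₂ α β 2 z), B.ss.2.1, c (conjVec _), B.st.1,
      c (conjVec (frame f v₁ v₂ α β 2 z)), B.st.2.1] at q1
    rw [B.ss.2.1, B.ss.2.2, c (conjVec _), B.st.2.2.1, c (conjVec (frame f v₁ v₂ α β 2 z)),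
      B.st.2.2.2] at q2
    rw [B.st.1, B.st.2.2.1, B.tt.1, c (conjVec (frame f v₁ v₂ α β 2 z)), B.tt.2.1] at q3
    rw [B.st.2.1, B.st.2.2.2, B.tt.2.1, B.tt.2.2] at q4
    intro i
    fin_cases i
    · exact (by linear_combination (1 / 2 : ℂ) * q3 : g 0 = 0)
    · exact (by linear_combination (1 / 2 : ℂ) * q4 : g 1 = 0)
    · exact (by linear_combination (1 / 2 : ℂ) * q1 : g 2 = 0)
    · exact (by linear_combination (1 / 2 : ℂ) * q2 : g 3 = 0)
  · intro z hz x
    have B := D.frame_adaptedBasis hz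
    rw [gs]
    constructor
    · intro hx v hv
      refine lor_eq_zero_of_mem_span (fun u hu => ?_) hv
      rw [lor_comm]
      refine lor_eq_zero_of_mem_span (fun y hy => ?_) hx
      rw [lor_comm]
      obtain ⟨a1, a2, a3, a4⟩ := B.s₁v
      obtain ⟨b1, b2, b3, b4⟩ := B.s₂v
      obtain ⟨c1, c2, c3, c4⟩ := B.t₁v
      obtain ⟨d1, d2, d3, d4⟩ := B.t₂v
      rcases hu with rfl | rfl | rfl | rfl <;> rcases hy with rfl | rfl | rfl | rfl <;> assumption
    · intro h
      have o1 := h (lightLift f z) (Submodule.subset_span (by simp))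
      have o2 := h (δz (lightLift f) z) (Submodule.subset_span (by simp))
      have o3 := h (δw (lightLift f) z) (Submodule.subset_span (by simp))
      have o4 := h (δw (δz (lightLift f)) z) (Submodule.subset_span (by simp))
      rw [B.expand x, o1, o2, o3, o4]
      simp only [zero_div, neg_zero, zero_smul, zero_mul, sub_zero, zero_add]
      refine Submodule.add_mem _ (Submodule.add_mem _ (Submodule.add_mem _ ?_ ?_) ?_) ?_ <;>
        exact Submodule.smul_mem _ _ (Submodule.subset_span (by simp))
  · intro z hz j hj
    have B := D.frame_adaptedBasis hz
    rw [gs, dzbar_eq_wd]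
    -- it suffices that the derivative is orthogonal to both isotropic normal sections
    have key : ∀ x : Fin 8 → ℂ, lor x (frame f v₁ v₂ α β 1 z) = 0 →
        lor x (frame f v₁ v₂ α β 2 z) = 0 → x ∈ Submodule.span ℂ
          {frame f v₁ v₂ α β 1 z, frame f v₁ v₂ α β 2 z} ⊔ Submodule.span ℂ {lightLift f z,
            δz (lightLift f) z, δw (lightLift f) z, δw (δz (lightLift f)) z} := by
      intro x o1 o2
      rw [B.expand x, o1, o2]
      simp only [zero_div, zero_smul, add_zero]
      rw [add_assoc, add_comm]
      refine Submodule.add_mem_sup (Submodule.add_mem _ ?_ ?_)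
        (Submodule.add_mem _ (Submodule.add_mem _ (Submodule.add_mem _ ?_ ?_) ?_) ?_) <;>
        exact Submodule.smul_mem _ _ (Submodule.subset_span (by simp))
    fin_cases j
    · exact absurd rfl hj
    · refine key _ ?_ ?_
      · rw [e1 z, show frame f v₁ v₂ α β ((fun i => i) ⟨1, by decide⟩) = _ from funext e1]
        exact D.lor_w_combo hz (sn1.mul D.sα) (sn1.mul D.sβ) _ _
      · rw [e2 z, show frame f v₁ v₂ α β ((fun i => i) ⟨1, by decide⟩) = _ from funext e1]
        exact D.lor_w_combo hz (sn1.mul D.sα) (sn1.mul D.sβ) _ _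
    · refine key _ ?_ ?_
      · rw [e1 z, show frame f v₁ v₂ α β ((fun i => i) ⟨2, by decide⟩) = _ from funext e2]
        exact D.lor_w_combo hz (sn2.mul sc2) (sn2.mul sc1.neg) _ _
      · rw [e2 z, show frame f v₁ v₂ α β ((fun i => i) ⟨2, by decide⟩) = _ from funext e2]
        exact D.lor_w_combo hz (sn2.mul sc2) (sn2.mul sc1.neg) _ _

theorem jets_isotropic (D : IsotropicData f U v₁ v₂ α β n p q) {z : ℂ} (hz : z ∈ U) (j l : ℕ) :
    lor ((dz^[j] (lightLift f)) z) ((dz^[l] (lightLift f)) z) = 0 := by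
  rw [show dz (E := Fin 8 → ℂ) = δz from funext dz_eq_wd]
  exact IsSection.lor_eq_zero D (D.isSection_iterate j) (D.isSection_iterate l) hz

end IsotropicData

/-! ### The Euler-Lagrange equation for H-isotropic surfaces -/

/-- The coefficient of `L_z` in `L_zz`. -/
def liftQ (f : ℂ → EuclideanSpace ℝ (Fin 7)) (z : ℂ) : ℂ := δz (confFactor f) z / confFactor f z

/-- The coefficient of `L` in `L_zz` (essentially the Schwarzian). -/
def liftA (f : ℂ → EuclideanSpace ℝ (Fin 7)) (z : ℂ) : ℂ :=
  -lor (δz (δz (lightLift f)) z) (δw (δz (lightLift f)) z) / confFactor f z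

/-- The component of `L_zz` orthogonal to `V`, a multiple of the conformal Hopf differential. -/
def hopf (f : ℂ → EuclideanSpace ℝ (Fin 7)) (z : ℂ) : Fin 8 → ℂ :=
  δz (δz (lightLift f)) z - liftQ f z • δz (lightLift f) z - liftA f z • lightLift f z

/-- The square length `⟨N, N̄⟩` of the Hopf differential. -/
def hopfSq (f : ℂ → EuclideanSpace ℝ (Fin 7)) (z : ℂ) : ℂ := lor (hopf f z) (conjVec (hopf f z))

/-- The current whose divergence is the Willmore operator. -/
def current (f : ℂ → EuclideanSpace ℝ (Fin 7)) (z : ℂ) : Fin 8 → ℂ :=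
  (confFactor f z)⁻¹ • (δz (fun ζ => conjVec (hopf f ζ)) z +
    (hopfSq f z / confFactor f z) • δw (lightLift f) z)

/-- The Willmore operator: a conformal surface is Willmore when its real part is a multiple of
`L`. -/
def willmoreOp (f : ℂ → EuclideanSpace ℝ (Fin 7)) (z : ℂ) : Fin 8 → ℂ :=
  δz (current f) z - (liftA f z / confFactor f z) • conjVec (hopf f z)

theorem wd_add_smul_smul {s : ℂ} {a b : ℂ → ℂ} {X Y : ℂ → Fin 8 → ℂ} {z : ℂ}
    (ha : DifferentiableAt ℝ a z) (hX : DifferentiableAt ℝ X z) (hb : DifferentiableAt ℝ b z)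
    (hY : DifferentiableAt ℝ Y z) :
    wd s (fun ζ => a ζ • X ζ + b ζ • Y ζ) z =
      (a z • wd s X z + wd s a z • X z) + (b z • wd s Y z + wd s b z • Y z) := by
  rw [wd_add (f := fun ζ => a ζ • X ζ) (g := fun ζ => b ζ • Y ζ) (ha.smul hX) (hb.smul hY),
    wd_smul ha hX, wd_smul hb hY]

namespace IsConformalSurface

variable {f : ℂ → EuclideanSpace ℝ (Fin 7)} {U : Set ℂ}

theorem contDiffOn_inv_factor (H : IsConformalSurface f U) :
    ContDiffOn ℝ ∞ (fun z => (confFactor f z)⁻¹) U :=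
  H.contDiffOn_factor.inv fun _ hz => H.factor_ne_zero hz

theorem contDiffOn_lift_zz (H : IsConformalSurface f U) :
    ContDiffOn ℝ ∞ (δz (δz (lightLift f))) U := contDiffOn_wd H.isOpen H.contDiffOn_lift_z

theorem contDiffOn_lift_zw (H : IsConformalSurface f U) :
    ContDiffOn ℝ ∞ (δw (δz (lightLift f))) U := contDiffOn_wd H.isOpen H.contDiffOn_lift_z

theorem contDiffOn_liftQ (H : IsConformalSurface f U) : ContDiffOn ℝ ∞ (liftQ f) U :=
  (contDiffOn_wd H.isOpen H.contDiffOn_factor).mul H.contDiffOn_inv_factor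

theorem contDiffOn_liftA (H : IsConformalSurface f U) : ContDiffOn ℝ ∞ (liftA f) U :=
  (contDiffOn_lor H.contDiffOn_lift_zz H.contDiffOn_lift_zw).neg.mul H.contDiffOn_inv_factor

theorem contDiffOn_hopf (H : IsConformalSurface f U) : ContDiffOn ℝ ∞ (hopf f) U :=
  (H.contDiffOn_lift_zz.sub (H.contDiffOn_liftQ.smul H.contDiffOn_lift_z)).sub
    (H.contDiffOn_liftA.smul H.contDiffOn_lift)

theorem contDiffOn_conj_hopf (H : IsConformalSurface f U) :
    ContDiffOn ℝ ∞ (fun z => conjVec (hopf f z)) U := contDiffOn_conjVec H.contDiffOn_hopf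

theorem contDiffOn_hopfSq (H : IsConformalSurface f U) : ContDiffOn ℝ ∞ (hopfSq f) U :=
  contDiffOn_lor H.contDiffOn_hopf H.contDiffOn_conj_hopf

theorem contDiffOn_current (H : IsConformalSurface f U) : ContDiffOn ℝ ∞ (current f) U :=
  H.contDiffOn_inv_factor.smul ((contDiffOn_wd H.isOpen H.contDiffOn_conj_hopf).add
    ((H.contDiffOn_hopfSq.mul H.contDiffOn_inv_factor).smul H.contDiffOn_lift_w))

theorem lift_zz_eq (f : ℂ → EuclideanSpace ℝ (Fin 7)) (z : ℂ) : δz (δz (lightLift f)) z =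
    liftQ f z • δz (lightLift f) z + liftA f z • lightLift f z + hopf f z := by
  rw [hopf]; module

theorem hopf_orth (H : IsConformalSurface f U) {z : ℂ} (hz : z ∈ U) :
    lor (hopf f z) (lightLift f z) = 0 ∧ lor (hopf f z) (δz (lightLift f) z) = 0 ∧
    lor (hopf f z) (δw (lightLift f) z) = 0 ∧
    lor (hopf f z) (δw (δz (lightLift f)) z) = 0 := by
  have e := H.factor_ne_zero hz
  refine ⟨?_, ?_, ?_, ?_⟩ <;> simp only [hopf, lor_sub_left, lor_smul_left]
  · rw [lor_comm, H.lor_l_zz hz, lor_comm, H.lor_l_d _ hz, H.lor_l_l hz]; ring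
  · rw [lor_comm, H.lor_z_zz hz, H.conformal z hz, H.lor_l_d _ hz]; ring
  · rw [lor_comm, H.lor_w_zz hz, H.lor_l_d _ hz, liftQ]
    change _ - _ / _ * confFactor f z - _ = _
    field_simp; ring
  · rw [H.lor_z_zw hz, H.lor_l_zw hz, liftA]
    field_simp; ring

theorem conj_lift_zz (H : IsConformalSurface f U) {z : ℂ} (hz : z ∈ U) :
    conjVec (δz (δz (lightLift f)) z) = δw (δw (lightLift f)) z := by
  have h := wd_conjVec (s := Complex.I) (H.dAt H.contDiffOn_lift_z hz)
  rw [Complex.conj_I] at h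
  rw [← h]
  exact wd_congr_of_isOpen H.isOpen (fun ζ hζ => (H.lift_w_eq hζ).symm) hz

theorem lift_ww_eq (H : IsConformalSurface f U) {z : ℂ} (hz : z ∈ U) :
    δw (δw (lightLift f)) z = (starRingEnd ℂ) (liftQ f z) • δw (lightLift f) z +
      (starRingEnd ℂ) (liftA f z) • lightLift f z + conjVec (hopf f z) := by
  rw [← H.conj_lift_zz hz, lift_zz_eq, conjVec_add, conjVec_add, conjVec_smul, conjVec_smul,
    ← H.lift_w_eq hz, conjVec_lightLift]

theorem conj_hopf_orth (H : IsConformalSurface f U) {z : ℂ} (hz : z ∈ U) :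
    lor (conjVec (hopf f z)) (lightLift f z) = 0 ∧
    lor (conjVec (hopf f z)) (δz (lightLift f) z) = 0 ∧
    lor (conjVec (hopf f z)) (δw (lightLift f) z) = 0 ∧
    lor (conjVec (hopf f z)) (δw (δz (lightLift f)) z) = 0 := by
  obtain ⟨a, b, c, d⟩ := H.hopf_orth hz
  have hw : conjVec (δw (lightLift f) z) = δz (lightLift f) z := by
    rw [H.lift_w_eq hz, conjVec_conjVec]
  refine ⟨?_, ?_, ?_, ?_⟩
  · rw [← conjVec_lightLift, lor_conjVec, a, map_zero]
  · rw [← hw, lor_conjVec, c, map_zero]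
  · rw [H.lift_w_eq hz, lor_conjVec, b, map_zero]
  · rw [← H.conj_lift_zw hz, lor_conjVec, d, map_zero]

end IsConformalSurface

/-- The isotropic space spanned by `l, d, s₁, s₂` is its own orthogonal complement, so that vectors
orthogonal to it are orthogonal to each other. -/
theorem IsAdaptedBasis.lor_eq_zero {e : ℂ} {l d d' h s₁ s₂ t₁ t₂ : Fin 8 → ℂ}
    (B : IsAdaptedBasis e l d d' h s₁ s₂ t₁ t₂) {x y : Fin 8 → ℂ}
    (hx : lor x l = 0 ∧ lor x d = 0 ∧ lor x s₁ = 0 ∧ lor x s₂ = 0)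
    (hy : lor y l = 0 ∧ lor y d = 0 ∧ lor y s₁ = 0 ∧ lor y s₂ = 0) : lor x y = 0 := by
  obtain ⟨a1, a2, a3, a4⟩ := hx
  obtain ⟨b1, b2, b3, b4⟩ := hy
  rw [lor_comm, B.expand x, a1, a2, a3, a4]
  simp only [lor_add_right, lor_smul_right, b1, b2, b3, b4]
  ring

namespace IsHIsotropicFrame

variable {f : ℂ → EuclideanSpace ℝ (Fin 7)} {U : Set ℂ} {E : Fin 3 → ℂ → Fin 8 → ℂ}

theorem gaussSpace_eq (f : ℂ → EuclideanSpace ℝ (Fin 7)) (z : ℂ) :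
    gaussSpace f z = Submodule.span ℂ {lightLift f z, δz (lightLift f) z,
      δw (lightLift f) z, δw (δz (lightLift f)) z} := by
  rw [gaussSpace, dz_eq_wd, dzbar_eq_wd, dzbar_eq_wd]

theorem normal (F : IsHIsotropicFrame f U E) {z : ℂ} (hz : z ∈ U) {j : Fin 3} (hj : j ≠ 0) :
    lor (E j z) (lightLift f z) = 0 ∧ lor (E j z) (δz (lightLift f) z) = 0 ∧
    lor (E j z) (δw (lightLift f) z) = 0 ∧ lor (E j z) (δw (δz (lightLift f)) z) = 0 := by
  have h := (F.normal_span z hz (E j z)).1 (by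
    fin_cases j
    · exact absurd rfl hj
    · exact Submodule.subset_span (by simp)
    · exact Submodule.subset_span (by simp))
  rw [gaussSpace_eq] at h
  refine ⟨h _ ?_, h _ ?_, h _ ?_, h _ ?_⟩ <;> exact Submodule.subset_span (by simp)

theorem adaptedBasis (F : IsHIsotropicFrame f U E) (H : IsConformalSurface f U) {z : ℂ}
    (hz : z ∈ U) :
    IsAdaptedBasis (confFactor f z) (lightLift f z) (δz (lightLift f) z) (δw (lightLift f) z)
      (δw (δz (lightLift f)) z) (E 1 z) (E 2 z) (conjVec (E 1 z)) (conjVec (E 2 z)) :=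
  H.adaptedBasis hz (F.normal hz (by decide)) (F.normal hz (by decide))
    ⟨F.isotropic z hz _ _, F.isotropic z hz _ _, F.isotropic z hz _ _⟩
    ⟨by simpa using F.unitary z hz 1 1, by simpa using F.unitary z hz 1 2,
      by simpa using F.unitary z hz 2 1, by simpa using F.unitary z hz 2 2⟩

theorem hopf_orth (F : IsHIsotropicFrame f U E) {z : ℂ}
    (hz : z ∈ U) {j : Fin 3} (hj : j ≠ 0) : lor (hopf f z) (E j z) = 0 := by
  obtain ⟨a, b, -, -⟩ := F.normal hz hj
  have h := F.adapted z hz 1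
  rw [show dz (E := Fin 8 → ℂ) = δz from funext dz_eq_wd] at h
  have h2 : lor (E j z) (δz (δz (lightLift f)) z) = 0 := by
    refine lor_eq_zero_of_mem_span (fun v hv => ?_) h
    rcases hv with rfl | ⟨l, -, rfl⟩
    · exact a
    · exact F.isotropic z hz _ _
  rw [lor_comm, hopf, lor_sub_right, lor_sub_right, lor_smul_right, lor_smul_right, a, b, h2]
  ring

/-- The horizontality of the isotropic normal bundle. -/
theorem w_orth (F : IsHIsotropicFrame f U E) {z : ℂ} (hz : z ∈ U) {j k : Fin 3}
    (hj : j ≠ 0) (hk : k ≠ 0) : lor (δw (E j) z) (E k z) = 0 := by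
  have h := F.horizontal z hz j hj
  rw [dzbar_eq_wd, gaussSpace_eq, ← Submodule.span_union] at h
  rw [lor_comm]
  refine lor_eq_zero_of_mem_span (fun v hv => ?_) h
  obtain ⟨a, b, c, d⟩ := F.normal hz hk
  rcases hv with (rfl | rfl) | (rfl | rfl | rfl | rfl)
  · exact F.isotropic z hz _ _
  · exact F.isotropic z hz _ _
  all_goals assumption

/-- **The Euler-Lagrange equation.** The real part of the Willmore operator of an H-isotropic
surface is a multiple of `L`: its isotropic normal components vanish because the mixed derivative
`L_zzz̄z̄` is real, while horizontality keeps the `z̄`-derivatives of the Hopf differential in one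
of two complementary conjugate subbundles. -/
theorem willmoreOp_real (F : IsHIsotropicFrame f U E) (H : IsConformalSurface f U) {z : ℂ}
    (hz : z ∈ U) : ∃ k : ℂ, willmoreOp f z + conjVec (willmoreOp f z) = k • lightLift f z := by
  have hU := H.isOpen
  have dA := fun {E : Type} [NormedAddCommGroup E] [NormedSpace ℝ E] {g : ℂ → E}
    (hg : ContDiffOn ℝ ∞ g U) {ζ : ℂ} (hζ : ζ ∈ U) => H.dAt hg hζ
  set L := lightLift f with hL
  set Nc : ℂ → Fin 8 → ℂ := fun ζ => conjVec (hopf f ζ) with hNc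
  have sL := H.contDiffOn_lift
  have sLz := H.contDiffOn_lift_z
  have sLw := H.contDiffOn_lift_w
  have sN := H.contDiffOn_hopf
  have sNc : ContDiffOn ℝ ∞ Nc U := H.contDiffOn_conj_hopf
  have sNw := contDiffOn_wd (s := Complex.I) hU sN
  have sT := H.contDiffOn_current
  have e := H.factor_ne_zero hz
  -- derivatives of orthogonality relations
  have DL := fun {X Y : ℂ → Fin 8 → ℂ} (hX : ContDiffOn ℝ ∞ X U) (hY : ContDiffOn ℝ ∞ Y U)
    (s : ℂ) (h : ∀ z ∈ U, lor (X z) (Y z) = 0) {ζ : ℂ} (hζ : ζ ∈ U) =>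
    H.lor_deriv_of_const (s := s) hX hY h hζ
  have conjδ : ∀ ζ ∈ U, δz Nc ζ = conjVec (δw (hopf f) ζ) := fun ζ hζ => by
    have := wd_conjVec (s := -Complex.I) (dA sN hζ)
    rwa [map_neg, Complex.conj_I, neg_neg] at this
  -- the Hopf differential
  have Nw_E : ∀ ζ ∈ U, ∀ k : Fin 3, k ≠ 0 → lor (δw (hopf f) ζ) (E k ζ) = 0 := by
    intro ζ hζ k hk
    have h1 := DL sN (F.smooth k) Complex.I (fun ζ hζ => F.hopf_orth hζ hk) hζ
    have B := F.adaptedBasis H hζ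
    obtain ⟨a, b, c, d⟩ := H.hopf_orth hζ
    have h2 : lor (hopf f ζ) (δw (E k) ζ) = 0 := by
      rw [lor_comm, B.expand (hopf f ζ), a, b, c, d, F.hopf_orth hζ (j := 1) (by decide),
        F.hopf_orth hζ (j := 2) (by decide)]
      simp only [lor_add_right, lor_smul_right, F.w_orth hζ hk (k := 1) (by decide),
        F.w_orth hζ hk (k := 2) (by decide)]
      ring
    rw [h2, add_zero] at h1
    exact h1
  have Nw_l : ∀ ζ ∈ U, lor (δw (hopf f) ζ) (L ζ) = 0 := fun ζ hζ => by
    have := DL sN sL Complex.I (fun ζ hζ => (H.hopf_orth hζ).1) hζ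
    rwa [(H.hopf_orth hζ).2.2.1, add_zero] at this
  have Nw_z : ∀ ζ ∈ U, lor (δw (hopf f) ζ) (δz L ζ) = 0 := fun ζ hζ => by
    have := DL sN sLz Complex.I (fun ζ hζ => (H.hopf_orth hζ).2.1) hζ
    rwa [(H.hopf_orth hζ).2.2.2, add_zero] at this
  have Ew_l : ∀ ζ ∈ U, ∀ k : Fin 3, k ≠ 0 → lor (δw (E k) ζ) (L ζ) = 0 := fun ζ hζ k hk => by
    have := DL (F.smooth k) sL Complex.I (fun ζ hζ => (F.normal hζ hk).1) hζ
    rwa [(F.normal hζ hk).2.2.1, add_zero] at this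
  have Ew_z : ∀ ζ ∈ U, ∀ k : Fin 3, k ≠ 0 → lor (δw (E k) ζ) (δz L ζ) = 0 := fun ζ hζ k hk => by
    have := DL (F.smooth k) sLz Complex.I (fun ζ hζ => (F.normal hζ hk).2.1) hζ
    rwa [(F.normal hζ hk).2.2.2, add_zero] at this
  have one : (1 : Fin 3) ≠ 0 := by decide
  have two : (2 : Fin 3) ≠ 0 := by decide
  have Ew_iso : ∀ k : Fin 3, k ≠ 0 → lor (δw (E k) z) (L z) = 0 ∧ lor (δw (E k) z) (δz L z) = 0 ∧
      lor (δw (E k) z) (E 1 z) = 0 ∧ lor (δw (E k) z) (E 2 z) = 0 := fun k hk =>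
    ⟨Ew_l z hz k hk, Ew_z z hz k hk, F.w_orth hz hk one, F.w_orth hz hk two⟩
  have B := F.adaptedBasis H hz
  have NwEw : ∀ k : Fin 3, k ≠ 0 → lor (δw (hopf f) z) (δw (E k) z) = 0 := fun k hk =>
    B.lor_eq_zero ⟨Nw_l z hz, Nw_z z hz, Nw_E z hz 1 one, Nw_E z hz 2 two⟩ (Ew_iso k hk)
  -- third derivatives of the lift
  have sQ := H.contDiffOn_liftQ
  have sA := H.contDiffOn_liftA
  have sQc : ContDiffOn ℝ ∞ (fun ζ => (starRingEnd ℂ) (liftQ f ζ)) U :=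
    Complex.conjCLE.toContinuousLinearMap.contDiff.comp_contDiffOn sQ
  have sAc : ContDiffOn ℝ ∞ (fun ζ => (starRingEnd ℂ) (liftA f ζ)) U :=
    Complex.conjCLE.toContinuousLinearMap.contDiff.comp_contDiffOn sA
  have sLzz := H.contDiffOn_lift_zz
  have sLzw := H.contDiffOn_lift_zw
  have sLww : ContDiffOn ℝ ∞ (δw (δw L)) U := contDiffOn_wd hU sLw
  have sLzzw : ContDiffOn ℝ ∞ (δw (δz (δz L))) U := contDiffOn_wd hU sLzz
  have comm1 : ∀ ζ ∈ U, δz (δw L) ζ = δw (δz L) ζ := fun ζ hζ => wd_comm hU sL hζ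
  have Lzzw : ∀ ζ ∈ U, δw (δz (δz L)) ζ = δw (liftQ f) ζ • δz L ζ + liftQ f ζ • δw (δz L) ζ +
      (δw (liftA f) ζ • L ζ + liftA f ζ • δw L ζ) + δw (hopf f) ζ := by
    intro ζ hζ
    rw [wd_congr_of_isOpen hU (fun ζ _ => IsConformalSurface.lift_zz_eq f ζ) hζ]
    rw [wd_add (f := fun ζ => liftQ f ζ • δz (lightLift f) ζ + liftA f ζ • lightLift f ζ)
      (((dA sQ hζ).smul (dA sLz hζ)).add ((dA sA hζ).smul (dA sL hζ))) (dA sN hζ),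
      wd_add_smul_smul (dA sQ hζ) (dA sLz hζ) (dA sA hζ) (dA sL hζ)]
    module
  have Lzww : ∀ ζ ∈ U, δz (δw (δw L)) ζ =
      δz (fun ζ => (starRingEnd ℂ) (liftQ f ζ)) ζ • δw L ζ +
      (starRingEnd ℂ) (liftQ f ζ) • δw (δz L) ζ +
      (δz (fun ζ => (starRingEnd ℂ) (liftA f ζ)) ζ • L ζ + (starRingEnd ℂ) (liftA f ζ) • δz L ζ) +
      δz Nc ζ := by
    intro ζ hζ
    rw [wd_congr_of_isOpen hU (fun ζ hζ => H.lift_ww_eq hζ) hζ]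
    rw [wd_add (f := fun ζ => (starRingEnd ℂ) (liftQ f ζ) • δw (lightLift f) ζ +
        (starRingEnd ℂ) (liftA f ζ) • lightLift f ζ)
      (((dA sQc hζ).smul (dA sLw hζ)).add ((dA sAc hζ).smul (dA sL hζ))) (dA sNc hζ),
      wd_add_smul_smul (dA sQc hζ) (dA sLw hζ) (dA sAc hζ) (dA sL hζ), comm1 ζ hζ]
    module
  have Lzw_comm : δz (δw (δw L)) z = δw (δw (δz L)) z := by
    rw [wd_comm hU sLw hz]
    exact wd_congr_of_isOpen hU comm1 hz
  have Lzzww_comm : δz (δz (δw (δw L))) z = δw (δw (δz (δz L))) z := by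
    have h1 : ∀ ζ ∈ U, δz (δw (δw L)) ζ = δw (δw (δz L)) ζ := fun ζ hζ => by
      rw [wd_comm hU sLw hζ]
      exact wd_congr_of_isOpen hU comm1 hζ
    rw [wd_congr_of_isOpen hU h1 hz, wd_comm hU sLzw hz]
    refine wd_congr_of_isOpen hU (fun ζ hζ => ?_) hz
    rw [wd_comm hU sLz hζ]
  -- the component of `L_zww` along the normal bundle
  have Lzww_E : ∀ k : Fin 3, k ≠ 0 → lor (δz (δw (δw L)) z) (E k z) = lor (δz Nc z) (E k z) := by
    intro k hk
    obtain ⟨a, b, c, d⟩ := F.normal hz hk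
    rw [lor_comm] at a b c d
    rw [Lzww z hz]
    simp only [lor_add_left, lor_smul_left]
    rw [a, b, c, d]; ring
  -- the key symmetry of the fourth derivative
  have key : ∀ k : Fin 3, k ≠ 0 → lor (δz (δz Nc) z) (E k z) =
      liftQ f z * lor (δz Nc z) (E k z) + liftA f z * lor (Nc z) (E k z) := by
    intro k hk
    have n := fun {ζ : ℂ} (hζ : ζ ∈ U) => F.normal hζ hk
    have sE := F.smooth k
    -- computation from `L_zz`
    have Lzz_E : ∀ ζ ∈ U, lor (δz (δz L) ζ) (E k ζ) = 0 := fun ζ hζ => by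
      rw [hL, IsConformalSurface.lift_zz_eq, lor_add_left, lor_add_left, lor_smul_left,
        lor_smul_left, lor_comm _ (E k ζ), (n hζ).2.1, lor_comm _ (E k ζ), (n hζ).1,
        F.hopf_orth hζ hk]
      ring
    have Lzz_Ew : ∀ ζ ∈ U, lor (δz (δz L) ζ) (δw (E k) ζ) = 0 := fun ζ hζ => by
      have h2 : lor (hopf f ζ) (δw (E k) ζ) = 0 := by
        have h1 := DL sN sE Complex.I (fun ζ hζ => F.hopf_orth hζ hk) hζ
        rwa [Nw_E ζ hζ k hk, zero_add] at h1
      rw [hL, IsConformalSurface.lift_zz_eq, lor_add_left, lor_add_left, lor_smul_left,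
        lor_smul_left, lor_comm _ (δw (E k) ζ), Ew_z ζ hζ k hk, lor_comm _ (δw (E k) ζ),
        Ew_l ζ hζ k hk, h2]
      ring
    have Lzzw_E : ∀ ζ ∈ U, lor (δw (δz (δz L)) ζ) (E k ζ) = 0 := fun ζ hζ => by
      have := DL sLzz sE Complex.I Lzz_E hζ
      rwa [Lzz_Ew ζ hζ, add_zero] at this
    have c1 : lor (δw (δw (δz (δz L))) z) (E k z) =
        liftQ f z * lor (δz Nc z) (E k z) + liftA f z * lor (Nc z) (E k z) := by
      have h1 := DL sLzzw sE Complex.I Lzzw_E hz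
      have h2 : lor (δw (δz (δz L)) z) (δw (E k) z) =
          liftQ f z * lor (δw (δz L) z) (δw (E k) z) + liftA f z * lor (δw L z) (δw (E k) z) := by
        rw [Lzzw z hz]
        simp only [lor_add_left, lor_smul_left]
        rw [NwEw k hk, lor_comm (δz L z), Ew_z z hz k hk, lor_comm (L z), Ew_l z hz k hk]
        ring
      have h3 := DL sLzw sE Complex.I (fun ζ hζ => by rw [lor_comm]; exact (n hζ).2.2.2) hz
      have h4 := DL sLw sE Complex.I (fun ζ hζ => by rw [lor_comm]; exact (n hζ).2.2.1) hz
      rw [← Lzw_comm, Lzww_E k hk] at h3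
      have h5 : lor (δw (δw L) z) (E k z) = lor (Nc z) (E k z) := by
        rw [hL, H.lift_ww_eq hz]
        simp only [lor_add_left, lor_smul_left]
        rw [lor_comm (δw (lightLift f) z), (n hz).2.2.1, lor_comm (lightLift f z), (n hz).1]
        ring
      rw [h5] at h4
      linear_combination h1 - h2 - liftQ f z * h3 - liftA f z * h4
    -- computation from `L_ww`
    have c2 : lor (δz (δz (δw (δw L))) z) (E k z) = lor (δz (δz Nc) z) (E k z) := by
      rw [wd_congr_of_isOpen hU Lzww hz]
      have s1 := contDiffOn_wd (s := -Complex.I) hU sQc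
      have s2 := contDiffOn_wd (s := -Complex.I) hU sAc
      have s3 := contDiffOn_wd (s := -Complex.I) hU sNc
      have t1 := (dA s1 hz).smul (dA sLw hz)
      have t2 := (dA sQc hz).smul (dA sLzw hz)
      have t3 := (dA s2 hz).smul (dA sL hz)
      have t4 := (dA sAc hz).smul (dA sLz hz)
      rw [wd_add (f := fun ζ => δz (fun ζ => (starRingEnd ℂ) (liftQ f ζ)) ζ • δw L ζ +
        (starRingEnd ℂ) (liftQ f ζ) • δw (δz L) ζ +
        (δz (fun ζ => (starRingEnd ℂ) (liftA f ζ)) ζ • L ζ +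
          (starRingEnd ℂ) (liftA f ζ) • δz L ζ)) ((t1.add t2).add (t3.add t4)) (dA s3 hz),
        wd_add (f := fun ζ => δz (fun ζ => (starRingEnd ℂ) (liftQ f ζ)) ζ • δw L ζ +
        (starRingEnd ℂ) (liftQ f ζ) • δw (δz L) ζ)
        (g := fun ζ => δz (fun ζ => (starRingEnd ℂ) (liftA f ζ)) ζ • L ζ +
          (starRingEnd ℂ) (liftA f ζ) • δz L ζ) (t1.add t2) (t3.add t4),
        wd_add_smul_smul (dA s1 hz) (dA sLw hz) (dA sQc hz) (dA sLzw hz),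
        wd_add_smul_smul (dA s2 hz) (dA sL hz) (dA sAc hz) (dA sLz hz), comm1 z hz,
        wd_comm hU sLz hz]
      simp only [lor_add_left, lor_smul_left]
      obtain ⟨a, b, c, d⟩ := n hz
      rw [lor_comm] at a b c d
      rw [a, b, c, d, Lzzw_E z hz, Lzz_E z hz]; ring
    rw [← c2, Lzzww_comm, c1]
  -- orthogonality relations of the current
  have cN := fun {ζ : ℂ} (hζ : ζ ∈ U) => H.conj_hopf_orth hζ
  have Ncz_l : ∀ ζ ∈ U, lor (δz Nc ζ) (L ζ) = 0 := fun ζ hζ => by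
    have := DL sNc sL (-Complex.I) (fun ζ hζ => (cN hζ).1) hζ
    rwa [(cN hζ).2.1, add_zero] at this
  have Ncz_w : ∀ ζ ∈ U, lor (δz Nc ζ) (δw L ζ) = 0 := fun ζ hζ => by
    have := DL sNc sLw (-Complex.I) (fun ζ hζ => (cN hζ).2.2.1) hζ
    rwa [comm1 ζ hζ, (cN hζ).2.2.2, add_zero] at this
  have Nc_zz : ∀ ζ ∈ U, lor (Nc ζ) (δz (δz L) ζ) = hopfSq f ζ := fun ζ hζ => by
    rw [hL, IsConformalSurface.lift_zz_eq, lor_add_right, lor_add_right, lor_smul_right,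
      lor_smul_right, (cN hζ).2.1, (cN hζ).1, hopfSq, lor_comm]
    ring
  have Ncz_z : ∀ ζ ∈ U, lor (δz Nc ζ) (δz L ζ) = -hopfSq f ζ := fun ζ hζ => by
    have := DL sNc sLz (-Complex.I) (fun ζ hζ => (cN hζ).2.1) hζ
    rw [Nc_zz ζ hζ] at this
    linear_combination this
  have T_eq : ∀ ζ, current f ζ = (confFactor f ζ)⁻¹ • (δz Nc ζ +
    (hopfSq f ζ / confFactor f ζ) • δw L ζ) := fun ζ => rfl
  have T_l : ∀ ζ ∈ U, lor (current f ζ) (L ζ) = 0 := fun ζ hζ => by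
    rw [T_eq, lor_smul_left, lor_add_left, lor_smul_left, Ncz_l ζ hζ, lor_comm (δw L ζ),
      H.lor_l_d _ hζ]
    ring
  have T_z : ∀ ζ ∈ U, lor (current f ζ) (δz L ζ) = 0 := fun ζ hζ => by
    have e := H.factor_ne_zero hζ
    rw [T_eq, lor_smul_left, lor_add_left, lor_smul_left, Ncz_z ζ hζ, lor_comm (δw L ζ)]
    change _ * (_ + _ * confFactor f ζ) = 0
    field_simp; ring
  have T_w : ∀ ζ ∈ U, lor (current f ζ) (δw L ζ) = 0 := fun ζ hζ => by
    rw [T_eq, lor_smul_left, lor_add_left, lor_smul_left, Ncz_w ζ hζ, H.lor_w_w hζ]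
    ring
  have T_Ec : ∀ ζ ∈ U, ∀ k : Fin 3, k ≠ 0 → lor (current f ζ) (conjVec (E k ζ)) = 0 := by
    intro ζ hζ k hk
    have h1 : lor (δw L ζ) (conjVec (E k ζ)) = 0 := by
      rw [hL, H.lift_w_eq hζ, lor_conjVec, lor_comm, (F.normal hζ hk).2.1, map_zero]
    rw [T_eq, lor_smul_left, lor_add_left, lor_smul_left, h1, conjδ ζ hζ, lor_conjVec,
      Nw_E ζ hζ k hk, map_zero]
    ring
  -- pairings of the Willmore operator
  have K_l : lor (willmoreOp f z) (L z) = 0 := by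
    have := DL sT sL (-Complex.I) T_l hz
    rw [T_z z hz, add_zero] at this
    rw [willmoreOp, lor_sub_left, lor_smul_left, this, (cN hz).1]; ring
  have K_z : lor (willmoreOp f z) (δz L z) =
      -((confFactor f z)⁻¹ * lor (δz Nc z) (hopf f z)) := by
    have h1 := DL sT sLz (-Complex.I) T_z hz
    have h2 : lor (current f z) (δz (δz L) z) =
        (confFactor f z)⁻¹ * lor (δz Nc z) (hopf f z) := by
      rw [hL, IsConformalSurface.lift_zz_eq, lor_add_right, lor_add_right, lor_smul_right,
        lor_smul_right, T_z z hz, T_l z hz, T_eq, lor_smul_left, lor_add_left, lor_smul_left,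
        lor_comm (δw L z), (H.hopf_orth hz).2.2.1]
      ring
    rw [h2] at h1
    rw [willmoreOp, lor_sub_left, lor_smul_left, (cN hz).2.1]
    linear_combination h1
  have K_w : lor (willmoreOp f z) (δw L z) =
      -((confFactor f z)⁻¹ * lor (δz Nc z) (δw (δz L) z)) := by
    have h1 := DL sT sLw (-Complex.I) T_w hz
    have h2 : lor (current f z) (δz (δw L) z) =
        (confFactor f z)⁻¹ * lor (δz Nc z) (δw (δz L) z) := by
      rw [comm1 z hz, T_eq, lor_smul_left, lor_add_left, lor_smul_left, H.lor_w_zw hz]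
      ring
    rw [h2] at h1
    rw [willmoreOp, lor_sub_left, lor_smul_left, (cN hz).2.2.1]
    linear_combination h1
  have K_E : ∀ k : Fin 3, k ≠ 0 → lor (willmoreOp f z) (E k z) = 0 := by
    intro k hk
    obtain ⟨a, b, c, d⟩ := F.normal hz hk
    rw [lor_comm] at a b c d
    have s1 : ContDiffOn ℝ ∞ (fun ζ => hopfSq f ζ / confFactor f ζ) U :=
      H.contDiffOn_hopfSq.mul H.contDiffOn_inv_factor
    have s2 := contDiffOn_wd (s := -Complex.I) hU sNc
    have s3 : ContDiffOn ℝ ∞ (fun ζ => (hopfSq f ζ / confFactor f ζ) • δw L ζ) U := s1.smul sLw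
    have dinv : δz (fun ζ => (confFactor f ζ)⁻¹) z =
        -(liftQ f z * (confFactor f z)⁻¹) := by
      have h := wd_mul (s := -Complex.I) (dA H.contDiffOn_factor hz) (dA H.contDiffOn_inv_factor hz)
      rw [wd_congr_of_isOpen hU (g := fun _ => (1 : ℂ))
        (fun ζ hζ => mul_inv_cancel₀ (H.factor_ne_zero hζ)) hz, wd_const] at h
      rw [liftQ]
      field_simp
      field_simp at h
      linear_combination -h
    have hT : δz (current f) z = (confFactor f z)⁻¹ • (δz (δz Nc) z +
        ((hopfSq f z / confFactor f z) • δw (δz L) z +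
          δz (fun ζ => hopfSq f ζ / confFactor f ζ) z • δw L z)) +
        (-(liftQ f z * (confFactor f z)⁻¹)) • (δz Nc z +
          (hopfSq f z / confFactor f z) • δw L z) := by
      rw [wd_congr_of_isOpen hU (fun ζ _ => T_eq ζ) hz,
        wd_smul (f := fun ζ => δz Nc ζ + (hopfSq f ζ / confFactor f ζ) • δw L ζ)
          (dA H.contDiffOn_inv_factor hz) ((dA s2 hz).add (dA s3 hz)), dinv,
        wd_add (g := fun ζ => (hopfSq f ζ / confFactor f ζ) • δw L ζ) (dA s2 hz) (dA s3 hz),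
        wd_smul (dA s1 hz) (dA sLw hz), comm1 z hz]
    rw [willmoreOp, hT]
    simp only [lor_add_left, lor_sub_left, lor_smul_left]
    rw [key k hk, c, d]
    change _ - _ * lor (Nc z) (E k z) = 0
    field_simp; ring
  have K_Ec : ∀ k : Fin 3, k ≠ 0 → lor (willmoreOp f z) (conjVec (E k z)) = 0 := by
    intro k hk
    have sE := contDiffOn_conjVec (F.smooth k)
    have h1 := DL sT sE (-Complex.I) (fun ζ hζ => T_Ec ζ hζ k hk) hz
    have h2 : δz (fun ζ => conjVec (E k ζ)) z = conjVec (δw (E k) z) := by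
      have := wd_conjVec (s := -Complex.I) (dA (F.smooth k) hz)
      rwa [map_neg, Complex.conj_I, neg_neg] at this
    have h3 : lor (current f z) (conjVec (δw (E k) z)) = 0 := by
      have cT : lor (conjVec (current f z)) (δw (E k) z) = 0 := by
        refine B.lor_eq_zero ⟨?_, ?_, ?_, ?_⟩ (Ew_iso k hk)
        · have := lor_conjVec (current f z) (L z)
          rwa [conjVec_lightLift, T_l z hz, map_zero] at this
        · have := lor_conjVec (current f z) (δw L z)
          rwa [hL, H.lift_w_eq hz, conjVec_conjVec, ← H.lift_w_eq hz, T_w z hz, map_zero] at this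
        · have := lor_conjVec (current f z) (conjVec (E 1 z))
          rwa [conjVec_conjVec, T_Ec z hz 1 one, map_zero] at this
        · have := lor_conjVec (current f z) (conjVec (E 2 z))
          rwa [conjVec_conjVec, T_Ec z hz 2 two, map_zero] at this
      have := lor_conjVec (conjVec (current f z)) (δw (E k) z)
      rwa [conjVec_conjVec, cT, map_zero] at this
    rw [h2, h3, add_zero] at h1
    have h4 : lor (conjVec (hopf f z)) (conjVec (E k z)) = 0 := by
      rw [lor_conjVec, F.hopf_orth hz hk, map_zero]
    rw [willmoreOp, lor_sub_left, lor_smul_left, h4]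
    change lor (δz (current f) z) _ - _ = 0
    rw [h1]; ring
  -- the Gauss equation makes the tangential components vanish
  have gauss : lor (δw (hopf f) z) (δw (δz L) z) = -lor (hopf f z) (δz Nc z) := by
    have h1 := DL sN sLzw Complex.I (fun ζ hζ => (H.hopf_orth hζ).2.2.2) hz
    obtain ⟨a, b, c, d⟩ := H.hopf_orth hz
    have h2 : lor (hopf f z) (δw (δw (δz L)) z) = lor (hopf f z) (δz Nc z) := by
      rw [← Lzw_comm, Lzww z hz]
      simp only [lor_add_right, lor_smul_right]
      rw [a, b, c, d]; ring
    rw [h2] at h1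
    linear_combination h1
  have cK : ∀ x : Fin 8 → ℂ, lor (conjVec (willmoreOp f z)) x =
      (starRingEnd ℂ) (lor (willmoreOp f z) (conjVec x)) := fun x => by
    rw [← lor_conjVec, conjVec_conjVec]
  have fe : (starRingEnd ℂ) (confFactor f z) = confFactor f z := by
    rw [← (H.factor_pos hz).2, Complex.conj_ofReal]
  have R_l : lor (willmoreOp f z + conjVec (willmoreOp f z)) (L z) = 0 := by
    rw [lor_add_left, cK, conjVec_lightLift, K_l, map_zero, add_zero]
  have R_z : lor (willmoreOp f z + conjVec (willmoreOp f z)) (δz L z) = 0 := by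
    rw [lor_add_left, cK, ← H.lift_w_eq hz, K_w, K_z, map_neg, map_mul, map_inv₀, fe, conjδ z hz,
      ← lor_conjVec, conjVec_conjVec, H.conj_lift_zw hz, gauss, conjδ z hz, lor_comm (hopf f z)]
    ring
  have R_real : conjVec (willmoreOp f z + conjVec (willmoreOp f z)) =
      willmoreOp f z + conjVec (willmoreOp f z) := by
    rw [conjVec_add, conjVec_conjVec, add_comm]
  have R_conj : ∀ x, lor (willmoreOp f z + conjVec (willmoreOp f z)) x = 0 →
      lor (willmoreOp f z + conjVec (willmoreOp f z)) (conjVec x) = 0 := fun x hx => by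
    rw [← R_real, lor_conjVec, hx, map_zero]
  have R_w : lor (willmoreOp f z + conjVec (willmoreOp f z)) (δw L z) = 0 := by
    rw [hL, H.lift_w_eq hz]; exact R_conj _ R_z
  have R_E : ∀ k : Fin 3, k ≠ 0 →
      lor (willmoreOp f z + conjVec (willmoreOp f z)) (E k z) = 0 := fun k hk => by
    rw [lor_add_left, cK, K_E k hk, K_Ec k hk, map_zero, add_zero]
  have hx := B.expand (willmoreOp f z + conjVec (willmoreOp f z))
  rw [R_l, R_z, R_w, R_E 1 one, R_E 2 two, R_conj _ (R_E 1 one), R_conj _ (R_E 2 two)] at hx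
  simp only [zero_div, neg_zero, zero_smul, add_zero] at hx
  exact ⟨_, hx⟩

end IsHIsotropicFrame

/-! ### The Willmore density as a function of the 2-jet -/

section Jets

variable {E : Type*} [NormedAddCommGroup E] [InnerProductSpace ℝ E]

local notation "⟪" x "," y "⟫" => inner ℝ x y

/-- The determinant of the first fundamental form with tangent vectors `a, b`. -/
def gramDet (a b : E) : ℝ := ⟪a, a⟫ * ⟪b, b⟫ - ⟪a, b⟫ * ⟪a, b⟫

/-- The component of `x` normal to the plane spanned by `a, b`. -/
def normalPart (a b x : E) : E :=
  x - ((gramDet a b)⁻¹ * (⟪b, b⟫ * ⟪x, a⟫ - ⟪a, b⟫ * ⟪x, b⟫)) • a -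
    ((gramDet a b)⁻¹ * (⟪a, a⟫ * ⟪x, b⟫ - ⟪a, b⟫ * ⟪x, a⟫)) • b

/-- `det g` times the trace of the second fundamental form. -/
def traceVec (a b p q s : E) : E :=
  ⟪b, b⟫ • normalPart a b p - (2 * ⟪a, b⟫) • normalPart a b q + ⟪a, a⟫ • normalPart a b s

/-- The Willmore density in terms of the derivatives `a = f_u`, `b = f_v`, `p = f_uu`, `q = f_uv`,
`s = f_vv`: it is `(|H|² - det II / det g) √(det g)`. -/
def jetDensity (a b p q s : E) : ℝ :=
  Real.sqrt (gramDet a b) *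
    (4⁻¹ * ((gramDet a b)⁻¹ * (gramDet a b)⁻¹) * ⟪traceVec a b p q s, traceVec a b p q s⟫ -
      (gramDet a b)⁻¹ * (⟪normalPart a b p, normalPart a b s⟫ -
        ⟪normalPart a b q, normalPart a b q⟫))

theorem normalPart_inner_left {a b : E} (h : gramDet a b ≠ 0) (x : E) :
    ⟪normalPart a b x, a⟫ = 0 := by
  simp only [normalPart, inner_sub_left, real_inner_smul_left, real_inner_comm a b]
  field_simp
  rw [gramDet]; ring

theorem normalPart_inner_right {a b : E} (h : gramDet a b ≠ 0) (x : E) :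
    ⟪normalPart a b x, b⟫ = 0 := by
  simp only [normalPart, inner_sub_left, real_inner_smul_left]
  field_simp
  rw [gramDet]; ring

theorem firstForm_eq (f : ℂ → E) (z : ℂ) : firstForm f z =
    !![⟪pd 0 f z, pd 0 f z⟫, ⟪pd 0 f z, pd 1 f z⟫; ⟪pd 0 f z, pd 1 f z⟫, ⟪pd 1 f z, pd 1 f z⟫] := by
  ext i j
  fin_cases i <;> fin_cases j <;> simp [firstForm, real_inner_comm]

theorem firstForm_inv (f : ℂ → E) (z : ℂ) : (firstForm f z)⁻¹ =
    !![(gramDet (pd 0 f z) (pd 1 f z))⁻¹ * ⟪pd 1 f z, pd 1 f z⟫,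
      -((gramDet (pd 0 f z) (pd 1 f z))⁻¹ * ⟪pd 0 f z, pd 1 f z⟫);
      -((gramDet (pd 0 f z) (pd 1 f z))⁻¹ * ⟪pd 0 f z, pd 1 f z⟫),
      (gramDet (pd 0 f z) (pd 1 f z))⁻¹ * ⟪pd 0 f z, pd 0 f z⟫] := by
  rw [firstForm_eq, Matrix.inv_def, Matrix.det_fin_two_of, Matrix.adjugate_fin_two_of,
    Ring.inverse_eq_inv', gramDet]
  ext i j
  fin_cases i <;> fin_cases j <;> simp

theorem secondForm_eq (f : ℂ → E) (z : ℂ) (i j : Fin 2) :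
    secondForm f z i j = normalPart (pd 0 f z) (pd 1 f z) (pd i (pd j f) z) := by
  rw [secondForm, firstForm_inv, normalPart]
  simp only [Fin.sum_univ_two, Matrix.of_apply, Matrix.cons_val', Matrix.cons_val_zero,
    Matrix.cons_val_one, Matrix.cons_val_fin_one]
  module

theorem meanCurvature_eq (f : ℂ → E) (z : ℂ) (hs : pd 1 (pd 0 f) z = pd 0 (pd 1 f) z) :
    meanCurvature f z = (2⁻¹ * (gramDet (pd 0 f z) (pd 1 f z))⁻¹) •
      traceVec (pd 0 f z) (pd 1 f z) (pd 0 (pd 0 f) z) (pd 0 (pd 1 f) z) (pd 1 (pd 1 f) z) := by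
  rw [meanCurvature, firstForm_inv, traceVec]
  simp only [Fin.sum_univ_two, Matrix.of_apply, Matrix.cons_val', Matrix.cons_val_zero,
    Matrix.cons_val_one, Matrix.cons_val_fin_one, secondForm_eq, hs]
  module

theorem willmoreDensity_eq (f : ℂ → E) (z : ℂ) (hs : pd 1 (pd 0 f) z = pd 0 (pd 1 f) z) :
    willmoreDensity f z = jetDensity (pd 0 f z) (pd 1 f z) (pd 0 (pd 0 f) z) (pd 0 (pd 1 f) z)
      (pd 1 (pd 1 f) z) := by
  have hdet : (firstForm f z).det = gramDet (pd 0 f z) (pd 1 f z) := by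
    rw [firstForm_eq, Matrix.det_fin_two_of, gramDet]
  rw [willmoreDensity, jetDensity, hdet]
  by_cases hΔ : gramDet (pd 0 f z) (pd 1 f z) = 0
  · rw [hΔ]; simp
  · have hm : traceFreeForm f z 0 0 = normalPart (pd 0 f z) (pd 1 f z) (pd 0 (pd 0 f) z) -
        ⟪pd 0 f z, pd 0 f z⟫ • meanCurvature f z ∧
      traceFreeForm f z 0 1 = normalPart (pd 0 f z) (pd 1 f z) (pd 0 (pd 1 f) z) -
        ⟪pd 0 f z, pd 1 f z⟫ • meanCurvature f z ∧
      traceFreeForm f z 1 0 = normalPart (pd 0 f z) (pd 1 f z) (pd 0 (pd 1 f) z) -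
        ⟪pd 0 f z, pd 1 f z⟫ • meanCurvature f z ∧
      traceFreeForm f z 1 1 = normalPart (pd 0 f z) (pd 1 f z) (pd 1 (pd 1 f) z) -
        ⟪pd 1 f z, pd 1 f z⟫ • meanCurvature f z := by
      refine ⟨?_, ?_, ?_, ?_⟩ <;> simp [traceFreeForm, secondForm_eq, firstForm_eq, hs]
    obtain ⟨h00, h01, h10, h11⟩ := hm
    rw [mul_comm]
    simp only [Fin.sum_univ_two, h00, h01, h10, h11, firstForm_inv, Matrix.of_apply,
      Matrix.cons_val', Matrix.cons_val_zero, Matrix.cons_val_one, Matrix.cons_val_fin_one,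
      meanCurvature_eq f z hs]
    congr 1
    rw [mul_comm, ← eq_div_iff (by norm_num)]
    generalize hn1 : normalPart (pd 0 f z) (pd 1 f z) (pd 0 (pd 0 f) z) = n₁
    generalize hn2 : normalPart (pd 0 f z) (pd 1 f z) (pd 0 (pd 1 f) z) = n₂
    generalize hn3 : normalPart (pd 0 f z) (pd 1 f z) (pd 1 (pd 1 f) z) = n₃
    simp only [traceVec, hn1, hn2, hn3, inner_sub_left, inner_sub_right, inner_add_left,
      inner_add_right, real_inner_smul_left, real_inner_smul_right, real_inner_comm n₁ n₂,
      real_inner_comm n₁ n₃, real_inner_comm n₂ n₃]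
    rw [gramDet] at hΔ ⊢
    generalize ⟪pd 0 f z, pd 0 f z⟫ = A at *
    generalize ⟪pd 0 f z, pd 1 f z⟫ = B at *
    generalize ⟪pd 1 f z, pd 1 f z⟫ = C at *
    have hΔ' : A * C - B ^ 2 ≠ 0 := by rwa [pow_two]
    field_simp
    ring

theorem exists_hasDerivAt_normalPart {a b x : ℝ → E} {a' b' x' : E} {t ε : ℝ}
    (ha : HasDerivAt a a' t) (hb : HasDerivAt b b' t) (hx : HasDerivAt x x' t) (hε : 0 < ε)
    (haa : ⟪a t, a t⟫ = ε) (hbb : ⟪b t, b t⟫ = ε) (hab : ⟪a t, b t⟫ = 0) :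
    ∃ k l : ℝ, HasDerivAt (fun t => normalPart (a t) (b t) (x t))
      (x' - (⟪x t, a t⟫ / ε) • a' - (⟪x t, b t⟫ / ε) • b' - k • a t - l • b t) t := by
  have hΔ : gramDet (a t) (b t) = ε * ε := by rw [gramDet, haa, hbb, hab]; ring
  have hd : HasDerivAt (fun t => gramDet (a t) (b t)) _ t :=
    ((ha.inner ℝ ha).mul (hb.inner ℝ hb)).sub ((ha.inner ℝ hb).mul (ha.inner ℝ hb))
  have hi := hd.inv (by rw [hΔ]; positivity)
  obtain ⟨k, h₁⟩ : ∃ k, HasDerivAt (fun t => (gramDet (a t) (b t))⁻¹ *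
      (⟪b t, b t⟫ * ⟪x t, a t⟫ - ⟪a t, b t⟫ * ⟪x t, b t⟫)) k t :=
    ⟨_, hi.mul (((hb.inner ℝ hb).mul (hx.inner ℝ ha)).sub ((ha.inner ℝ hb).mul (hx.inner ℝ hb)))⟩
  obtain ⟨l, h₂⟩ : ∃ l, HasDerivAt (fun t => (gramDet (a t) (b t))⁻¹ *
      (⟪a t, a t⟫ * ⟪x t, b t⟫ - ⟪a t, b t⟫ * ⟪x t, a t⟫)) l t :=
    ⟨_, hi.mul (((ha.inner ℝ ha).mul (hx.inner ℝ hb)).sub ((ha.inner ℝ hb).mul (hx.inner ℝ ha)))⟩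
  refine ⟨k, l, ((hx.sub (h₁.smul ha)).sub (h₂.smul hb)).congr_deriv ?_⟩
  rw [hΔ, haa, hbb, hab]
  have e₁ : (ε * ε)⁻¹ * (ε * ⟪x t, a t⟫ - 0 * ⟪x t, b t⟫) = ⟪x t, a t⟫ / ε := by field_simp; ring
  have e₂ : (ε * ε)⁻¹ * (ε * ⟪x t, b t⟫ - 0 * ⟪x t, a t⟫) = ⟪x t, b t⟫ / ε := by field_simp; ring
  rw [e₁, e₂]
  abel

/-- The derivative of the density along a path of 2-jets that starts at a conformal one: with
`P, Q, S` the second fundamental form, and `P', Q', S'` its derivative up to tangential terms. -/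
theorem hasDerivAt_jetDensity {a b p q s : ℝ → E} {a' b' p' q' s' : E} {t ε : ℝ}
    (ha : HasDerivAt a a' t) (hb : HasDerivAt b b' t) (hp : HasDerivAt p p' t)
    (hq : HasDerivAt q q' t) (hs : HasDerivAt s s' t) (hε : 0 < ε)
    (haa : ⟪a t, a t⟫ = ε) (hbb : ⟪b t, b t⟫ = ε) (hab : ⟪a t, b t⟫ = 0) {P Q S P' Q' S' : E}
    (hP : P = p t - (⟪p t, a t⟫ / ε) • a t - (⟪p t, b t⟫ / ε) • b t)
    (hQ : Q = q t - (⟪q t, a t⟫ / ε) • a t - (⟪q t, b t⟫ / ε) • b t)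
    (hS : S = s t - (⟪s t, a t⟫ / ε) • a t - (⟪s t, b t⟫ / ε) • b t)
    (hP' : P' = p' - (⟪p t, a t⟫ / ε) • a' - (⟪p t, b t⟫ / ε) • b')
    (hQ' : Q' = q' - (⟪q t, a t⟫ / ε) • a' - (⟪q t, b t⟫ / ε) • b')
    (hS' : S' = s' - (⟪s t, a t⟫ / ε) • a' - (⟪s t, b t⟫ / ε) • b') :
    HasDerivAt (fun t => jetDensity (a t) (b t) (p t) (q t) (s t))
      ((2 * ε)⁻¹ * (⟪P - S, P' - S'⟫ + 4 * ⟪Q, Q'⟫) -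
        (4 * ε ^ 2)⁻¹ * (⟪a t, a'⟫ + ⟪b t, b'⟫) * (⟪P - S, P - S⟫ + 4 * ⟪Q, Q⟫) +
        (2 * ε ^ 2)⁻¹ * ((⟪b t, b'⟫ - ⟪a t, a'⟫) * ⟪P + S, P - S⟫ -
          2 * (⟪a t, b'⟫ + ⟪b t, a'⟫) * ⟪P + S, Q⟫)) t := by
  have hΔ : gramDet (a t) (b t) = ε ^ 2 := by rw [gramDet, haa, hbb, hab]; ring
  have hΔ0 : gramDet (a t) (b t) ≠ 0 := by rw [hΔ]; positivity
  have hn : ∀ x : E, normalPart (a t) (b t) x = x - (⟪x, a t⟫ / ε) • a t -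
      (⟪x, b t⟫ / ε) • b t := by
    intro x
    rw [normalPart, hΔ, haa, hbb, hab]
    have e₁ : (ε ^ 2)⁻¹ * (ε * ⟪x, a t⟫ - 0 * ⟪x, b t⟫) = ⟪x, a t⟫ / ε := by field_simp; ring
    have e₂ : (ε ^ 2)⁻¹ * (ε * ⟪x, b t⟫ - 0 * ⟪x, a t⟫) = ⟪x, b t⟫ / ε := by field_simp; ring
    rw [e₁, e₂]
  have hn₁ : normalPart (a t) (b t) (p t) = P := by rw [hP, hn]
  have hn₂ : normalPart (a t) (b t) (q t) = Q := by rw [hQ, hn]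
  have hn₃ : normalPart (a t) (b t) (s t) = S := by rw [hS, hn]
  obtain ⟨k₁, l₁, d₁⟩ := exists_hasDerivAt_normalPart ha hb hp hε haa hbb hab
  obtain ⟨k₂, l₂, d₂⟩ := exists_hasDerivAt_normalPart ha hb hq hε haa hbb hab
  obtain ⟨k₃, l₃, d₃⟩ := exists_hasDerivAt_normalPart ha hb hs hε haa hbb hab
  rw [← hP'] at d₁
  rw [← hQ'] at d₂
  rw [← hS'] at d₃
  have hd : HasDerivAt (fun t => gramDet (a t) (b t)) _ t :=
    ((ha.inner ℝ ha).mul (hb.inner ℝ hb)).sub ((ha.inner ℝ hb).mul (ha.inner ℝ hb))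
  have hi := hd.inv hΔ0
  have hr := hd.sqrt hΔ0
  have hX := (((hb.inner ℝ hb).smul d₁).sub (((ha.inner ℝ hb).const_mul 2).smul d₂)).add
    ((ha.inner ℝ ha).smul d₃)
  have hall := hr.mul ((((hi.mul hi).const_mul (4⁻¹ : ℝ)).mul (hX.inner ℝ hX)).sub
    (hi.mul ((d₁.inner ℝ d₃).sub (d₂.inner ℝ d₂))))
  refine hall.congr_deriv ?_
  have hsq : Real.sqrt (ε ^ 2) = ε := Real.sqrt_sq hε.le
  have oP : ⟪P, a t⟫ = 0 ∧ ⟪P, b t⟫ = 0 := by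
    rw [← hn₁]
    exact ⟨normalPart_inner_left hΔ0 _, normalPart_inner_right hΔ0 _⟩
  have oP' : ⟪a t, P⟫ = 0 ∧ ⟪b t, P⟫ = 0 := by
    rwa [real_inner_comm, real_inner_comm _ (b t)]
  have oQ : ⟪Q, a t⟫ = 0 ∧ ⟪Q, b t⟫ = 0 := by
    rw [← hn₂]
    exact ⟨normalPart_inner_left hΔ0 _, normalPart_inner_right hΔ0 _⟩
  have oQ' : ⟪a t, Q⟫ = 0 ∧ ⟪b t, Q⟫ = 0 := by
    rwa [real_inner_comm, real_inner_comm _ (b t)]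
  have oS : ⟪S, a t⟫ = 0 ∧ ⟪S, b t⟫ = 0 := by
    rw [← hn₃]
    exact ⟨normalPart_inner_left hΔ0 _, normalPart_inner_right hΔ0 _⟩
  have oS' : ⟪a t, S⟫ = 0 ∧ ⟪b t, S⟫ = 0 := by
    rwa [real_inner_comm, real_inner_comm _ (b t)]
  simp only [Pi.mul_apply, Pi.sub_apply, Pi.inv_apply, Pi.add_apply, Pi.smul_apply', hΔ, haa, hbb,
    hab, hn₁, hn₂, hn₃, hsq, inner_sub_left, inner_sub_right, inner_add_left,
    inner_add_right, real_inner_smul_left, real_inner_smul_right, oP, oQ, oS, oP', oQ', oS',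
  
  
    real_inner_comm (a t) a', real_inner_comm (b t) b', real_inner_comm (b t) a',
    real_inner_comm P P', real_inner_comm Q Q', real_inner_comm S S', real_inner_comm P Q',
    real_inner_comm P S', real_inner_comm Q P', real_inner_comm Q S', real_inner_comm S P',
    real_inner_comm S Q', real_inner_comm P Q, real_inner_comm P S, real_inner_comm Q S]
  field_simp
  ring

end Jets

local notation "⟪" x "," y "⟫" => inner ℝ x y

/-! ### The first variation of the Willmore density -/

/-- The inclusion of `ℝ⁷` in complexified Minkowski space as the complement of the time axis. -/
def spaceVec : EuclideanSpace ℝ (Fin 7) →L[ℝ] (Fin 8 → ℂ) :=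
  ContinuousLinearMap.pi (Fin.cases 0 fun i : Fin 7 =>
    Complex.ofRealCLM.comp (EuclideanSpace.proj i))

@[simp] theorem spaceVec_zero (x : EuclideanSpace ℝ (Fin 7)) : spaceVec x 0 = 0 := rfl

@[simp] theorem spaceVec_succ (x : EuclideanSpace ℝ (Fin 7)) (i : Fin 7) :
    spaceVec x i.succ = (x i : ℂ) := rfl

theorem lor_spaceVec (x y : EuclideanSpace ℝ (Fin 7)) :
    lor (spaceVec x) (spaceVec y) = (⟪x, y⟫ : ℝ) := by
  simp [lor, PiLp.inner_apply, mul_comm]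

theorem conjVec_spaceVec (x : EuclideanSpace ℝ (Fin 7)) : conjVec (spaceVec x) = spaceVec x := by
  ext i
  refine Fin.cases ?_ (fun j => ?_) i <;> simp [conjVec]

theorem lightLift_eq (f : ℂ → EuclideanSpace ℝ (Fin 7)) :
    lightLift f = fun z => Pi.single 0 1 + spaceVec (f z) := by
  ext z i
  refine Fin.cases ?_ (fun j => ?_) i <;> simp [lightLift]

theorem lor_spaceVec_lightLift (f : ℂ → EuclideanSpace ℝ (Fin 7)) (z : ℂ)
    (x : EuclideanSpace ℝ (Fin 7)) : lor (spaceVec x) (lightLift f z) = (⟪x, f z⟫ : ℝ) := by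
  simp [lor, PiLp.inner_apply, mul_comm, lightLift]

theorem wd_lightLift (s : ℂ) (f : ℂ → EuclideanSpace ℝ (Fin 7)) :
    wd s (lightLift f) = wd s (fun ζ => spaceVec (f ζ)) := by
  ext1 z
  rw [lightLift_eq, wd, wd, fderiv_const_add]

theorem wd_spaceVec (s : ℂ) {f : ℂ → EuclideanSpace ℝ (Fin 7)} {z : ℂ}
    (hf : DifferentiableAt ℝ f z) : wd s (fun ζ => spaceVec (f ζ)) z =
      (2 : ℂ)⁻¹ • (spaceVec (pd 0 f z) + s • spaceVec (pd 1 f z)) := by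
  have : fderiv ℝ (fun ζ => spaceVec (f ζ)) z = spaceVec.comp (fderiv ℝ f z) :=
    (spaceVec.hasFDerivAt.comp z hf.hasFDerivAt).fderiv
  rw [wd, this]
  rfl

theorem contDiffOn_pd {X : Type*} [NormedAddCommGroup X] [InnerProductSpace ℝ X]
    {f : ℂ → X} {U : Set ℂ} (hU : IsOpen U) (hf : ContDiffOn ℝ ∞ f U)
    (i : Fin 2) : ContDiffOn ℝ ∞ (pd i f) U :=
  (hf.fderiv_of_isOpen hU (m := ∞) (by simp)).clm_apply
    (contDiffOn_const (c := (![1, Complex.I] : Fin 2 → ℂ) i))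

theorem contDiffOn_spaceVec {f : ℂ → EuclideanSpace ℝ (Fin 7)} {U : Set ℂ}
    (hf : ContDiffOn ℝ ∞ f U) : ContDiffOn ℝ ∞ (fun z => spaceVec (f z)) U :=
  spaceVec.contDiff.comp_contDiffOn hf

theorem pd_comm {f : ℂ → EuclideanSpace ℝ (Fin 7)} {U : Set ℂ} (hU : IsOpen U)
    (hf : ContDiffOn ℝ ∞ f U) {z : ℂ} (hz : z ∈ U) : pd 1 (pd 0 f) z = pd 0 (pd 1 f) z :=
  fderiv_fderiv_apply_comm hU hf hz _ _

theorem wd_wd_spaceVec (s t : ℂ) {f : ℂ → EuclideanSpace ℝ (Fin 7)} {U : Set ℂ} (hU : IsOpen U)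
    (hf : ContDiffOn ℝ ∞ f U) {z : ℂ} (hz : z ∈ U) :
    wd s (wd t (fun ζ => spaceVec (f ζ))) z =
      (4 : ℂ)⁻¹ • (spaceVec (pd 0 (pd 0 f) z) + (s + t) • spaceVec (pd 0 (pd 1 f) z) +
        (s * t) • spaceVec (pd 1 (pd 1 f) z)) := by
  have h0 := differentiableAt_of_smoothOn (contDiffOn_pd hU hf 0) hU hz
  have h1 := differentiableAt_of_smoothOn (contDiffOn_pd hU hf 1) hU hz
  have k0 := spaceVec.differentiableAt.comp z h0
  have k1 := spaceVec.differentiableAt.comp z h1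
  rw [wd_congr_of_isOpen hU (g := fun ζ => (2 : ℂ)⁻¹ • spaceVec (pd 0 f ζ) +
      (2⁻¹ * t) • spaceVec (pd 1 f ζ)) (fun ζ hζ => by
        rw [wd_spaceVec t (differentiableAt_of_smoothOn hf hU hζ)]; module) hz,
    wd_add_smul_smul (a := fun _ => (2 : ℂ)⁻¹) (b := fun _ => 2⁻¹ * t)
      (X := fun ζ => spaceVec (pd 0 f ζ)) (Y := fun ζ => spaceVec (pd 1 f ζ))
      (differentiableAt_const _) k0 (differentiableAt_const _) k1, wd_const, wd_const,
    wd_spaceVec s h0, wd_spaceVec s h1, pd_comm hU hf hz]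
  module

/-- The derivative of the Willmore density in the direction of a vector field `V` tangent to the
sphere. -/
def firstVariation (f V : ℂ → EuclideanSpace ℝ (Fin 7)) (z : ℂ) : ℝ :=
  4 * (lor (δz (δz (fun ζ => spaceVec (V ζ))) z - liftQ f z • δz (fun ζ => spaceVec (V ζ)) z -
      liftA f z • spaceVec (V z)) (conjVec (hopf f z)) / confFactor f z -
    hopfSq f z / confFactor f z ^ 2 *
      lor (δz (fun ζ => spaceVec (V ζ)) z) (δw (lightLift f) z)).re

theorem conj_lor (x y : Fin 8 → ℂ) :
    (starRingEnd ℂ) (lor x y) = lor (conjVec x) (conjVec y) := (lor_conjVec x y).symm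

theorem confFactor_eq {f : ℂ → EuclideanSpace ℝ (Fin 7)} {z : ℂ} (hd : DifferentiableAt ℝ f z) :
    confFactor f z = (⟪pd 0 f z, pd 0 f z⟫ + ⟪pd 1 f z, pd 1 f z⟫ : ℝ) / 4 := by
  rw [confFactor, wd_lightLift, wd_lightLift, wd_spaceVec _ hd, wd_spaceVec _ hd]
  simp only [lor_smul_left, lor_smul_right, lor_add_left, lor_add_right, lor_spaceVec]
  rw [real_inner_comm (pd 0 f z) (pd 1 f z)]
  push_cast
  linear_combination (-(⟪pd 1 f z, pd 1 f z⟫ : ℂ) / 4) * Complex.I_sq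

theorem inner_pd_of_conformal {f : ℂ → EuclideanSpace ℝ (Fin 7)} {z : ℂ}
    (hd : DifferentiableAt ℝ f z) (h : lor (δz (lightLift f) z) (δz (lightLift f) z) = 0) :
    ⟪pd 1 f z, pd 1 f z⟫ = ⟪pd 0 f z, pd 0 f z⟫ ∧ ⟪pd 0 f z, pd 1 f z⟫ = 0 := by
  rw [wd_lightLift, wd_spaceVec _ hd] at h
  simp only [lor_smul_left, lor_smul_right, lor_add_left, lor_add_right, lor_spaceVec,
    real_inner_comm (pd 0 f z) (pd 1 f z)] at h
  generalize ⟪pd 0 f z, pd 0 f z⟫ = A at *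
  generalize ⟪pd 1 f z, pd 1 f z⟫ = B at *
  generalize ⟪pd 0 f z, pd 1 f z⟫ = C at *
  have hre := congrArg Complex.re h
  have him := congrArg Complex.im h
  simp at hre him
  exact ⟨by linarith, by linarith⟩

theorem injective_fderiv_of_confFactor_ne_zero {f : ℂ → EuclideanSpace ℝ (Fin 7)} {z : ℂ}
    (hd : DifferentiableAt ℝ f z) (h : lor (δz (lightLift f) z) (δz (lightLift f) z) = 0)
    (hne : confFactor f z ≠ 0) : Function.Injective (fderiv ℝ f z) := by
  obtain ⟨e1, e2⟩ := inner_pd_of_conformal hd h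
  rw [confFactor_eq hd, e1] at hne
  refine (injective_iff_map_eq_zero _).2 fun v hv => ?_
  have hv' : v.re • pd 0 f z + v.im • pd 1 f z = 0 := by
    rw [← hv, pd, pd, ← map_smul, ← map_smul, ← map_add]
    congr 1
    apply Complex.ext <;> simp
  have h1 : ⟪v.re • pd 0 f z + v.im • pd 1 f z, v.re • pd 0 f z + v.im • pd 1 f z⟫ = 0 := by
    rw [hv', inner_zero_left]
  simp only [inner_add_left, inner_add_right, real_inner_smul_left, real_inner_smul_right,
    real_inner_comm (pd 0 f z) (pd 1 f z), e1, e2] at h1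
  have h2 : ⟪pd 0 f z, pd 0 f z⟫ ≠ 0 := fun h0 => hne (by rw [h0]; simp)
  have h3 : (v.re ^ 2 + v.im ^ 2) * ⟪pd 0 f z, pd 0 f z⟫ = 0 := by linear_combination h1
  have h4 := (mul_eq_zero.1 h3).resolve_right h2
  apply Complex.ext
  · simp; nlinarith
  · simp; nlinarith

theorem fderiv_eq_zero_of_confFactor_eq_zero {f : ℂ → EuclideanSpace ℝ (Fin 7)} {z : ℂ}
    (hd : DifferentiableAt ℝ f z) (h : confFactor f z = 0) : fderiv ℝ f z = 0 := by
  rw [confFactor_eq hd] at h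
  have h0 : ⟪pd 0 f z, pd 0 f z⟫ + ⟪pd 1 f z, pd 1 f z⟫ = 0 := by
    have : ((⟪pd 0 f z, pd 0 f z⟫ + ⟪pd 1 f z, pd 1 f z⟫ : ℝ) : ℂ) = 0 := by
      linear_combination 4 * h
    exact_mod_cast this
  have n0 : 0 ≤ ⟪pd 0 f z, pd 0 f z⟫ := real_inner_self_nonneg
  have n1 : 0 ≤ ⟪pd 1 f z, pd 1 f z⟫ := real_inner_self_nonneg
  have a0 : pd 0 f z = 0 := inner_self_eq_zero.1 (by linarith : ⟪pd 0 f z, pd 0 f z⟫ = 0)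
  have a1 : pd 1 f z = 0 := inner_self_eq_zero.1 (by linarith : ⟪pd 1 f z, pd 1 f z⟫ = 0)
  ext1 v
  have : v = v.re • (1 : ℂ) + v.im • Complex.I := by apply Complex.ext <;> simp
  rw [this, map_add, map_smul, map_smul]
  simp only [pd, Matrix.cons_val_zero, Matrix.cons_val_one, Matrix.cons_val_fin_one] at a0 a1
  rw [a0, a1]
  simp

namespace IsConformalSurface

variable {f V : ℂ → EuclideanSpace ℝ (Fin 7)} {U : Set ℂ}

theorem jet_relations (H : IsConformalSurface f U) {z : ℂ} (hz : z ∈ U) :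
    0 < ⟪pd 0 f z, pd 0 f z⟫ ∧ ⟪pd 1 f z, pd 1 f z⟫ = ⟪pd 0 f z, pd 0 f z⟫ ∧
    ⟪pd 0 f z, pd 1 f z⟫ = 0 ∧ confFactor f z = (⟪pd 0 f z, pd 0 f z⟫ / 2 : ℝ) := by
  have hd := differentiableAt_of_smoothOn H.smooth H.isOpen hz
  have h := H.conformal z hz
  have hne := H.factor_ne_zero hz
  have h0 : 0 ≤ ⟪pd 0 f z, pd 0 f z⟫ := real_inner_self_nonneg
  have e := confFactor_eq hd
  obtain ⟨e1, e2⟩ := inner_pd_of_conformal hd h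
  refine ⟨lt_of_le_of_ne h0 fun h0 => hne ?_, e1, e2, ?_⟩
  · rw [e, e1, ← h0]; simp
  · rw [e, e1]; push_cast; ring

/-- The tangential part of the Hessian of a conformal immersion. -/
theorem hessian_relations (H : IsConformalSurface f U) {z : ℂ} (hz : z ∈ U) :
    ⟪pd 0 (pd 0 f) z, pd 0 f z⟫ = -⟪pd 1 (pd 1 f) z, pd 0 f z⟫ ∧
    ⟪pd 0 (pd 0 f) z, pd 1 f z⟫ = -⟪pd 1 (pd 1 f) z, pd 1 f z⟫ ∧
    ⟪pd 0 (pd 1 f) z, pd 1 f z⟫ = -⟪pd 1 (pd 1 f) z, pd 0 f z⟫ ∧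
    ⟪pd 0 (pd 1 f) z, pd 0 f z⟫ = ⟪pd 1 (pd 1 f) z, pd 1 f z⟫ ∧
    liftQ f z = (-⟪pd 1 (pd 1 f) z, pd 0 f z⟫ - Complex.I * ⟪pd 1 (pd 1 f) z, pd 1 f z⟫) /
      ⟪pd 0 f z, pd 0 f z⟫ := by
  have hd := differentiableAt_of_smoothOn H.smooth H.isOpen hz
  obtain ⟨ε0, -, -, hε⟩ := H.jet_relations hz
  have h1 := H.lor_z_zw hz
  have h2 := H.lor_z_zz hz
  have h3 := H.lor_w_zz hz
  simp only [wd_lightLift, wd_wd_spaceVec _ _ H.isOpen H.smooth hz, wd_spaceVec _ hd] at h1 h2 h3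
  rw [liftQ, ← h3, hε]
  simp only [lor_smul_left, lor_smul_right, lor_add_left, lor_add_right, lor_spaceVec,
    real_inner_comm _ (pd 0 f z), real_inner_comm _ (pd 1 f z)] at h1 h2 ⊢
  generalize ⟪pd 0 f z, pd 0 f z⟫ = ε at *
  generalize ⟪pd 0 (pd 0 f) z, pd 0 f z⟫ = pa at *
  generalize ⟪pd 0 (pd 0 f) z, pd 1 f z⟫ = pb at *
  generalize ⟪pd 0 (pd 1 f) z, pd 0 f z⟫ = qa at *
  generalize ⟪pd 0 (pd 1 f) z, pd 1 f z⟫ = qb at *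
  generalize ⟪pd 1 (pd 1 f) z, pd 0 f z⟫ = sa at *
  generalize ⟪pd 1 (pd 1 f) z, pd 1 f z⟫ = sb at *
  have r1 := congrArg Complex.re h1
  have i1 := congrArg Complex.im h1
  have r2 := congrArg Complex.re h2
  have i2 := congrArg Complex.im h2
  simp at r1 i1 r2 i2
  have e1 : pa = -sa := by linarith
  have e2 : pb = -sb := by linarith
  have e3 : qb = -sa := by linarith
  have e4 : qa = sb := by linarith
  refine ⟨e1, e2, e3, e4, ?_⟩
  have : (ε : ℂ) ≠ 0 := by exact_mod_cast ε0.ne'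
  rw [e1, e2, e3, e4]
  push_cast
  field_simp
  ring_nf
  simp only [Complex.I_sq, Complex.I_pow_three]
  ring

/-- `L_zz - q L_z` for the lift and for a variation field, in terms of the second fundamental form
and its derivative. -/
theorem zz_sub_q (H : IsConformalSurface f U) {W : ℂ → EuclideanSpace ℝ (Fin 7)}
    (hW : ContDiffOn ℝ ∞ W U) {z : ℂ} (hz : z ∈ U)
    {ε : ℝ} (hε : ⟪pd 0 f z, pd 0 f z⟫ = ε) {P Q S : EuclideanSpace ℝ (Fin 7)}
    (hP : P = pd 0 (pd 0 W) z - (⟪pd 0 (pd 0 f) z, pd 0 f z⟫ / ε) • pd 0 W z -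
      (⟪pd 0 (pd 0 f) z, pd 1 f z⟫ / ε) • pd 1 W z)
    (hQ : Q = pd 0 (pd 1 W) z - (⟪pd 0 (pd 1 f) z, pd 0 f z⟫ / ε) • pd 0 W z -
      (⟪pd 0 (pd 1 f) z, pd 1 f z⟫ / ε) • pd 1 W z)
    (hS : S = pd 1 (pd 1 W) z - (⟪pd 1 (pd 1 f) z, pd 0 f z⟫ / ε) • pd 0 W z -
      (⟪pd 1 (pd 1 f) z, pd 1 f z⟫ / ε) • pd 1 W z) :
    δz (δz (fun ζ => spaceVec (W ζ))) z - liftQ f z • δz (fun ζ => spaceVec (W ζ)) z =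
      (4 : ℂ)⁻¹ • (spaceVec (P - S) - (2 * Complex.I) • spaceVec Q) ∧
    δw (δz (fun ζ => spaceVec (W ζ))) z = (4 : ℂ)⁻¹ • spaceVec (P + S) := by
  have hd := differentiableAt_of_smoothOn hW H.isOpen hz
  obtain ⟨ε0, -, -, -⟩ := H.jet_relations hz
  obtain ⟨e1, e2, e3, e4, e5⟩ := H.hessian_relations hz
  rw [hε] at ε0 e5
  have : (ε : ℂ) ≠ 0 := by exact_mod_cast ε0.ne'
  rw [wd_wd_spaceVec _ _ H.isOpen hW hz, wd_wd_spaceVec _ _ H.isOpen hW hz, wd_spaceVec _ hd, hP,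
    hQ, hS, e1, e2, e3, e4, e5]
  constructor
  · ext i
    refine Fin.cases ?_ (fun i => ?_) i
    · simp
    · simp only [map_sub, map_smul, Pi.sub_apply, Pi.smul_apply, Pi.add_apply, spaceVec_succ,
        smul_eq_mul, Complex.real_smul]
      push_cast
      field_simp
      ring_nf
      simp only [Complex.I_sq]
      ring
  · ext i
    refine Fin.cases ?_ (fun i => ?_) i
    · simp
    · simp only [map_add, map_sub, map_smul, Pi.sub_apply, Pi.smul_apply, Pi.add_apply,
        spaceVec_succ, smul_eq_mul, Complex.real_smul]
      push_cast
      field_simp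
      ring_nf
      simp only [Complex.I_sq]
      ring

/-- The first variation of the Willmore density at a conformal immersion `f`, along any path of
2-jets whose velocity is the 2-jet of a vector field `V` that is orthogonal to `f`. -/
theorem hasDerivAt_jetDensity (H : IsConformalSurface f U) (hV : ContDiffOn ℝ ∞ V U)
    (ho : ∀ z ∈ U, ⟪V z, f z⟫ = 0) {z : ℂ} (hz : z ∈ U) {a b p q s : ℝ → EuclideanSpace ℝ (Fin 7)}
    {t : ℝ} (ha : HasDerivAt a (pd 0 V z) t) (hb : HasDerivAt b (pd 1 V z) t)
    (hp : HasDerivAt p (pd 0 (pd 0 V) z) t) (hq : HasDerivAt q (pd 0 (pd 1 V) z) t)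
    (hs : HasDerivAt s (pd 1 (pd 1 V) z) t) (a0 : a t = pd 0 f z) (b0 : b t = pd 1 f z)
    (p0 : p t = pd 0 (pd 0 f) z) (q0 : q t = pd 0 (pd 1 f) z) (s0 : s t = pd 1 (pd 1 f) z) :
    HasDerivAt (fun t => jetDensity (a t) (b t) (p t) (q t) (s t)) (firstVariation f V z) t := by
  obtain ⟨ε0, hbb, hab, he⟩ := H.jet_relations hz
  obtain ⟨ε, hε⟩ : ∃ ε, ⟪pd 0 f z, pd 0 f z⟫ = ε := ⟨_, rfl⟩
  obtain ⟨P, hP⟩ : ∃ P, P = pd 0 (pd 0 f) z - (⟪pd 0 (pd 0 f) z, pd 0 f z⟫ / ε) • pd 0 f z -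
      (⟪pd 0 (pd 0 f) z, pd 1 f z⟫ / ε) • pd 1 f z := ⟨_, rfl⟩
  obtain ⟨Q, hQ⟩ : ∃ Q, Q = pd 0 (pd 1 f) z - (⟪pd 0 (pd 1 f) z, pd 0 f z⟫ / ε) • pd 0 f z -
      (⟪pd 0 (pd 1 f) z, pd 1 f z⟫ / ε) • pd 1 f z := ⟨_, rfl⟩
  obtain ⟨S, hS⟩ : ∃ S, S = pd 1 (pd 1 f) z - (⟪pd 1 (pd 1 f) z, pd 0 f z⟫ / ε) • pd 0 f z -
      (⟪pd 1 (pd 1 f) z, pd 1 f z⟫ / ε) • pd 1 f z := ⟨_, rfl⟩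
  obtain ⟨P', hP'⟩ : ∃ P, P = pd 0 (pd 0 V) z - (⟪pd 0 (pd 0 f) z, pd 0 f z⟫ / ε) • pd 0 V z -
      (⟪pd 0 (pd 0 f) z, pd 1 f z⟫ / ε) • pd 1 V z := ⟨_, rfl⟩
  obtain ⟨Q', hQ'⟩ : ∃ Q, Q = pd 0 (pd 1 V) z - (⟪pd 0 (pd 1 f) z, pd 0 f z⟫ / ε) • pd 0 V z -
      (⟪pd 0 (pd 1 f) z, pd 1 f z⟫ / ε) • pd 1 V z := ⟨_, rfl⟩
  obtain ⟨S', hS'⟩ : ∃ S, S = pd 1 (pd 1 V) z - (⟪pd 1 (pd 1 f) z, pd 0 f z⟫ / ε) • pd 0 V z -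
      (⟪pd 1 (pd 1 f) z, pd 1 f z⟫ / ε) • pd 1 V z := ⟨_, rfl⟩
  rw [hε] at ε0 hbb he
  have hε' : (ε : ℂ) ≠ 0 := by exact_mod_cast ε0.ne'
  refine (WillmoreSphere.hasDerivAt_jetDensity ha hb hp hq hs ε0 (by rw [a0, hε])
    (by rw [b0, hbb]) (by rw [a0, b0, hab]) (P := P) (Q := Q) (S := S) (P' := P') (Q' := Q')
    (S' := S') (by rw [a0, b0, p0, hP]) (by rw [a0, b0, q0, hQ]) (by rw [a0, b0, s0, hS])
    (by rw [a0, b0, p0, hP']) (by rw [a0, b0, q0, hQ']) (by rw [a0, b0, s0, hS'])).congr_deriv ?_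
  rw [a0, b0]
  obtain ⟨hM, hLzw⟩ := H.zz_sub_q H.smooth hz hε hP hQ hS
  obtain ⟨hW, -⟩ := H.zz_sub_q hV hz hε hP' hQ' hS'
  have hd := differentiableAt_of_smoothOn H.smooth H.isOpen hz
  have hdV := differentiableAt_of_smoothOn hV H.isOpen hz
  have cv := contDiffOn_spaceVec hV
  have cvz : ContDiffOn ℝ ∞ (δz (fun ζ => spaceVec (V ζ))) U := contDiffOn_wd H.isOpen cv
  -- the orthogonality of the variation field to `L`, differentiated twice
  have o0 : ∀ ζ ∈ U, lor (spaceVec (V ζ)) (lightLift f ζ) = 0 := fun ζ hζ => by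
    rw [lor_spaceVec_lightLift, ho ζ hζ, Complex.ofReal_zero]
  have o1 : ∀ ζ ∈ U, lor (δz (fun ζ => spaceVec (V ζ)) ζ) (lightLift f ζ) +
      lor (spaceVec (V ζ)) (δz (lightLift f) ζ) = 0 := fun ζ hζ =>
    H.lor_deriv_of_const cv H.contDiffOn_lift o0 hζ
  have o2 : lor (δz (δz (fun ζ => spaceVec (V ζ))) z) (lightLift f z) +
      lor (δz (fun ζ => spaceVec (V ζ)) z) (δz (lightLift f) z) +
      (lor (δz (fun ζ => spaceVec (V ζ)) z) (δz (lightLift f) z) +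
      lor (spaceVec (V z)) (δz (δz (lightLift f)) z)) = 0 := by
    rw [← wd_lor (H.dAt cvz hz) (H.dAt H.contDiffOn_lift hz),
      ← wd_lor (H.dAt cv hz) (H.dAt H.contDiffOn_lift_z hz),
      ← wd_add (f := fun ζ => lor (δz (fun ζ => spaceVec (V ζ)) ζ) (lightLift f ζ))
        (g := fun ζ => lor (spaceVec (V ζ)) (δz (lightLift f) ζ))
        (H.dAt (contDiffOn_lor cvz H.contDiffOn_lift) hz)
        (H.dAt (contDiffOn_lor cv H.contDiffOn_lift_z) hz),
      wd_congr_of_isOpen H.isOpen (g := fun _ => 0) o1 hz, wd_const]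
  obtain ⟨n1, n2, n3, n4⟩ := H.hopf_orth hz
  obtain ⟨c1, c2, c3, c4⟩ := H.conj_hopf_orth hz
  have hMN : δz (δz (fun ζ => spaceVec (f ζ))) z - liftQ f z • δz (fun ζ => spaceVec (f ζ)) z =
      hopf f z + liftA f z • lightLift f z := by
    rw [← wd_lightLift, hopf]; module
  rw [hM] at hMN
  rw [← wd_lightLift] at hLzw
  have hzz := lift_zz_eq f z
  rw [firstVariation, he]
  set v := spaceVec (V z) with hv
  set vz := δz (fun ζ => spaceVec (V ζ)) z with hvz
  set W := δz (δz (fun ζ => spaceVec (V ζ))) z - liftQ f z • vz with hWdef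
  have cN : lor v (hopf f z) = (starRingEnd ℂ) (lor v (conjVec (hopf f z))) := by
    rw [conj_lor, conjVec_conjVec, hv, conjVec_spaceVec]
  have kWL : lor W (lightLift f z) = -2 * lor vz (δz (lightLift f) z) -
      (starRingEnd ℂ) (lor v (conjVec (hopf f z))) := by
    have e1 := o1 z hz
    rw [hzz, lor_add_right, lor_add_right, lor_smul_right, lor_smul_right, o0 z hz] at o2
    rw [← cN, hWdef, lor_sub_left, lor_smul_left]
    linear_combination o2 - liftQ f z * e1
  have hcM : conjVec ((4 : ℂ)⁻¹ • (spaceVec (P - S) - (2 * Complex.I) • spaceVec Q)) =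
      (4 : ℂ)⁻¹ • (spaceVec (P - S) + (2 * Complex.I) • spaceVec Q) := by
    rw [conjVec_smul, sub_eq_add_neg, ← neg_smul, conjVec_add, conjVec_smul, conjVec_spaceVec,
      conjVec_spaceVec]
    simp [map_ofNat]
  have t1 : lor W (conjVec (hopf f z)) + (starRingEnd ℂ) (liftA f z) * (-2 *
      lor vz (δz (lightLift f) z) - (starRingEnd ℂ) (lor v (conjVec (hopf f z)))) =
      (16 : ℂ)⁻¹ * ((⟪P - S, P' - S'⟫ + 4 * ⟪Q, Q'⟫ : ℝ) +
        Complex.I * (2 * ⟪Q, P' - S'⟫ - 2 * ⟪P - S, Q'⟫ : ℝ)) := by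
    rw [← kWL, ← lor_smul_right, ← lor_add_right, show conjVec (hopf f z) +
      (starRingEnd ℂ) (liftA f z) • lightLift f z =
        conjVec (hopf f z + liftA f z • lightLift f z) by
        rw [conjVec_add, conjVec_smul, conjVec_lightLift], ← hMN, hcM, hW]
    simp only [lor_smul_left, lor_smul_right, lor_add_right, lor_sub_left, lor_spaceVec,
      real_inner_comm _ (P' - S'), real_inner_comm _ Q']
    push_cast
    linear_combination (-(4 : ℂ)⁻¹ * ⟪Q, Q'⟫) * Complex.I_sq
  have t2 : hopfSq f z = (16⁻¹ * (⟪P - S, P - S⟫ + 4 * ⟪Q, Q⟫) : ℝ) := by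
    have : hopfSq f z = lor (hopf f z + liftA f z • lightLift f z)
        (conjVec (hopf f z + liftA f z • lightLift f z)) := by
      rw [conjVec_add, conjVec_smul, conjVec_lightLift, hopfSq]
      simp only [lor_add_left, lor_add_right, lor_smul_left, lor_smul_right, n1,
        lor_comm (lightLift f z) (conjVec _), c1, H.lor_l_l hz]
      ring
    rw [this, ← hMN, hcM]
    simp only [lor_smul_left, lor_smul_right, lor_add_right, lor_sub_left, lor_spaceVec,
      real_inner_comm (P - S) Q]
    push_cast
    linear_combination (-(4 : ℂ)⁻¹ * ⟪Q, Q⟫) * Complex.I_sq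
  have t3 : lor vz (δw (lightLift f) z) = 4⁻¹ * ((⟪pd 0 f z, pd 0 V z⟫ +
      ⟪pd 1 f z, pd 1 V z⟫ : ℝ) + Complex.I *
      (⟪pd 1 f z, pd 0 V z⟫ - ⟪pd 0 f z, pd 1 V z⟫ : ℝ)) := by
    rw [hvz, wd_lightLift, wd_spaceVec _ hd, wd_spaceVec _ hdV]
    simp only [lor_smul_left, lor_smul_right, lor_add_right, lor_add_left, lor_spaceVec,
      real_inner_comm _ (pd 0 V z), real_inner_comm _ (pd 1 V z)]
    push_cast
    linear_combination (-(4 : ℂ)⁻¹ * ⟪pd 1 f z, pd 1 V z⟫) * Complex.I_sq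
  have t4 : lor vz (δz (lightLift f) z) = 4⁻¹ * ((⟪pd 0 f z, pd 0 V z⟫ -
      ⟪pd 1 f z, pd 1 V z⟫ : ℝ) - Complex.I *
        (⟪pd 0 f z, pd 1 V z⟫ + ⟪pd 1 f z, pd 0 V z⟫ : ℝ)) := by
    rw [hvz, wd_lightLift, wd_spaceVec _ hd, wd_spaceVec _ hdV]
    simp only [lor_smul_left, lor_smul_right, lor_add_right, lor_add_left, lor_spaceVec,
      real_inner_comm _ (pd 0 V z), real_inner_comm _ (pd 1 V z)]
    push_cast
    linear_combination ((4 : ℂ)⁻¹ * ⟪pd 1 f z, pd 1 V z⟫) * Complex.I_sq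
  have t5 : liftA f z * ε = -(8 : ℂ)⁻¹ * ((⟪P + S, P - S⟫ : ℝ) -
      Complex.I * (2 * ⟪P + S, Q⟫ : ℝ)) := by
    have : lor (δw (δz (lightLift f)) z) (hopf f z + liftA f z • lightLift f z) =
        -(liftA f z * (ε / 2 : ℝ)) := by
      rw [lor_add_right, lor_smul_right, lor_comm, n4, lor_comm, H.lor_l_zw hz, he]; ring
    rw [← hMN, hLzw] at this
    simp only [lor_smul_left, lor_smul_right, lor_sub_right, lor_spaceVec] at this
    push_cast at this ⊢
    linear_combination 2 * this
  have t6 : liftA f z = ((-(8 * ε)⁻¹ * ⟪P + S, P - S⟫ : ℝ) : ℂ) +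
      ((4 * ε)⁻¹ * ⟪P + S, Q⟫ : ℝ) * Complex.I := by
    push_cast at t5 ⊢
    field_simp
    linear_combination 32 * t5
  rw [lor_sub_left, lor_smul_left]
  rw [t4] at t1
  rw [t2, t3]
  generalize lor v (conjVec (hopf f z)) = n at *
  generalize lor W (conjVec (hopf f z)) = k at *
  have r1 := congrArg Complex.re t1
  have e1 : (k - liftA f z * n) / ((ε / 2 : ℝ) : ℂ) = ((2 / ε : ℝ) : ℂ) * (k - liftA f z * n) := by
    push_cast; field_simp
  generalize liftA f z = A at *
  have hAr := congrArg Complex.re t6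
  have hAi := congrArg Complex.im t6
  simp only [Complex.add_re, Complex.mul_re, Complex.ofReal_re, Complex.ofReal_im,
    Complex.I_re, Complex.I_im, Complex.add_im, Complex.mul_im] at hAr hAi
  rw [e1, show ((16⁻¹ * (⟪P - S, P - S⟫ + 4 * ⟪Q, Q⟫) : ℝ) : ℂ) / ((ε / 2 : ℝ) : ℂ) ^ 2 =
    ((16⁻¹ * (⟪P - S, P - S⟫ + 4 * ⟪Q, Q⟫) / (ε / 2) ^ 2 : ℝ) : ℂ) by push_cast; rfl,
    show (4 : ℂ)⁻¹ = ((4⁻¹ : ℝ) : ℂ) by push_cast; rfl] at *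
  rw [show (16 : ℂ)⁻¹ = ((16⁻¹ : ℝ) : ℂ) by push_cast; rfl] at r1
  rw [show (-2 : ℂ) = ((-2 : ℝ) : ℂ) by push_cast; rfl] at r1
  simp only [Complex.add_re, Complex.sub_re, Complex.mul_re, Complex.ofReal_re, Complex.ofReal_im,
    Complex.I_re, Complex.I_im, Complex.add_im, Complex.sub_im, Complex.mul_im, Complex.conj_re,
    Complex.conj_im] at r1 ⊢
  simp only [hAr, hAi] at r1 ⊢
  generalize ⟪P - S, P' - S'⟫ + 4 * ⟪Q, Q'⟫ = X1 at *
  generalize ⟪P - S, P - S⟫ + 4 * ⟪Q, Q⟫ = X2 at *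
  field_simp at r1 ⊢
  linear_combination (-4 : ℝ) * r1

end IsConformalSurface

/-! ### The first variation is a divergence -/

open MeasureTheory

/-- The flux `φ` with `firstVariation f V = 4 Re φ_z` for `f` which solves the Euler-Lagrange
equation. -/
def variationFlux (f V : ℂ → EuclideanSpace ℝ (Fin 7)) (z : ℂ) : ℂ :=
  lor (δz (fun ζ => spaceVec (V ζ)) z) (conjVec (hopf f z)) * (confFactor f z)⁻¹ -
    lor (spaceVec (V z)) (current f z)

/-- `f` solves the Euler-Lagrange equation of the Willmore functional on `U`. -/
def IsCritical (f : ℂ → EuclideanSpace ℝ (Fin 7)) (U : Set ℂ) : Prop :=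
  ∀ z ∈ U, ∃ k : ℂ, willmoreOp f z + conjVec (willmoreOp f z) = k • lightLift f z

theorem integral_fderiv_eq_zero {φ : ℂ → ℂ} (hφ : ContDiff ℝ ∞ φ) (hc : HasCompactSupport φ)
    (v : ℂ) : ∫ z, fderiv ℝ φ z v = 0 := by
  have h1 : Continuous fun z => fderiv ℝ φ z v :=
    (hφ.continuous_fderiv (by simp)).clm_apply continuous_const
  have := integral_smul_fderiv_eq_neg_fderiv_smul_of_integrable (μ := (volume : Measure ℂ))
    (𝕜 := ℝ) (f := fun _ : ℂ => (1 : ℝ)) (g := φ) (v := v) (by simp)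
    (by simpa using h1.integrable_of_hasCompactSupport (hc.fderiv_apply (𝕜 := ℝ) v))
    (by simpa using hφ.continuous.integrable_of_hasCompactSupport hc)
    (fun _ _ => differentiableAt_const _) (fun z _ => hφ.differentiable (by simp) z)
  simpa using this

theorem integral_wd_eq_zero {φ : ℂ → ℂ} (hφ : ContDiff ℝ ∞ φ) (hc : HasCompactSupport φ)
    (s : ℂ) : Integrable (wd s φ) ∧ ∫ z, wd s φ z = 0 := by
  have h1 : ∀ v : ℂ, Integrable fun z => fderiv ℝ φ z v := fun v =>
    ((hφ.continuous_fderiv (by simp)).clm_apply continuous_const).integrable_of_hasCompactSupport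
      (hc.fderiv_apply (𝕜 := ℝ) v)
  have h2 : Integrable fun z => s • fderiv ℝ φ z Complex.I := (h1 Complex.I).smul s
  constructor
  · exact ((h1 1).add (h2)).smul (2 : ℂ)⁻¹
  · simp only [wd]
    rw [integral_smul, integral_add (h1 1) h2, integral_smul,
      integral_fderiv_eq_zero hφ hc, integral_fderiv_eq_zero hφ hc]
    simp

namespace IsConformalSurface

variable {f V : ℂ → EuclideanSpace ℝ (Fin 7)} {U : Set ℂ}

theorem contDiffOn_variationFlux (H : IsConformalSurface f U) (hV : ContDiffOn ℝ ∞ V U) :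
    ContDiffOn ℝ ∞ (variationFlux f V) U :=
  ((contDiffOn_lor (contDiffOn_wd H.isOpen (contDiffOn_spaceVec hV)) H.contDiffOn_conj_hopf).mul
    H.contDiffOn_inv_factor).sub (contDiffOn_lor (contDiffOn_spaceVec hV) H.contDiffOn_current)

theorem firstVariation_eq_flux (H : IsConformalSurface f U) (hc : IsCritical f U)
    (hV : ContDiffOn ℝ ∞ V U) (ho : ∀ z ∈ U, ⟪V z, f z⟫ = 0) {z : ℂ} (hz : z ∈ U) :
    firstVariation f V z = 4 * (δz (variationFlux f V) z).re := by
  have he := H.factor_ne_zero hz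
  have cv := contDiffOn_spaceVec hV
  have cvz : ContDiffOn ℝ ∞ (δz (fun ζ => spaceVec (V ζ))) U := contDiffOn_wd H.isOpen cv
  have clor := contDiffOn_lor cvz H.contDiffOn_conj_hopf
  have hinv : δz (fun ζ => (confFactor f ζ)⁻¹) z =
      -(δz (confFactor f) z) * (confFactor f z)⁻¹ ^ 2 := by
    have h1 := wd_mul (s := -Complex.I) (H.dAt H.contDiffOn_factor hz)
      (H.dAt H.contDiffOn_inv_factor hz)
    rw [wd_congr_of_isOpen H.isOpen (g := fun _ => (1 : ℂ))
      (fun ζ hζ => mul_inv_cancel₀ (H.factor_ne_zero hζ)) hz, wd_const] at h1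
    field_simp
    field_simp at h1
    linear_combination -h1
  have hk : (lor (spaceVec (V z)) (willmoreOp f z)).re = 0 := by
    obtain ⟨k, hk⟩ := hc z hz
    have h0 : lor (spaceVec (V z)) (lightLift f z) = 0 := by
      rw [lor_spaceVec_lightLift, ho z hz, Complex.ofReal_zero]
    have h1 : lor (spaceVec (V z)) (willmoreOp f z) +
        (starRingEnd ℂ) (lor (spaceVec (V z)) (willmoreOp f z)) = 0 := by
      rw [conj_lor, conjVec_spaceVec, ← lor_add_right, hk, lor_smul_right, h0, mul_zero]
    have := congrArg Complex.re h1
    simp at this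
    linarith
  have hcur : lor (spaceVec (V z)) (δz (current f) z) = lor (spaceVec (V z)) (willmoreOp f z) +
      liftA f z / confFactor f z * lor (spaceVec (V z)) (conjVec (hopf f z)) := by
    rw [willmoreOp, lor_sub_right, lor_smul_right]; ring
  rw [firstVariation, show variationFlux f V = fun ζ => lor (δz (fun ζ => spaceVec (V ζ)) ζ)
    (conjVec (hopf f ζ)) * (confFactor f ζ)⁻¹ - lor (spaceVec (V ζ)) (current f ζ) from rfl,
    wd_sub (f := fun ζ => lor (δz (fun ζ => spaceVec (V ζ)) ζ)
    (conjVec (hopf f ζ)) * (confFactor f ζ)⁻¹) (g := fun ζ => lor (spaceVec (V ζ)) (current f ζ))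
    (H.dAt (clor.mul H.contDiffOn_inv_factor) hz)
      (H.dAt (contDiffOn_lor cv H.contDiffOn_current) hz),
    wd_mul (c := fun ζ => lor (δz (fun ζ => spaceVec (V ζ)) ζ) (conjVec (hopf f ζ)))
      (H.dAt clor hz) (H.dAt H.contDiffOn_inv_factor hz), hinv,
    wd_lor (H.dAt cvz hz) (H.dAt H.contDiffOn_conj_hopf hz),
    wd_lor (H.dAt cv hz) (H.dAt H.contDiffOn_current hz), hcur]
  have hq : δz (confFactor f) z = liftQ f z * confFactor f z := by
    rw [liftQ]; field_simp
  rw [hq, current, lor_smul_right, lor_add_right, lor_smul_right, lor_sub_left, lor_sub_left,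
    lor_smul_left, lor_smul_left]
  generalize lor (spaceVec (V z)) (willmoreOp f z) = κ at *
  have key : ∀ X Y : ℂ, X = Y + κ → 4 * X.re = 4 * Y.re := by
    rintro X Y rfl; rw [Complex.add_re, hk, add_zero]
  refine key _ _ ?_
  field_simp
  ring

/-- The first variation of the Willmore functional vanishes for variation fields of compact
support. -/
theorem integral_firstVariation_eq_zero (H : IsConformalSurface f U) (hc : IsCritical f U)
    (hV : ContDiffOn ℝ ∞ V U) (ho : ∀ z ∈ U, ⟪V z, f z⟫ = 0) {K : Set ℂ} (hK : IsCompact K)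
    (hKU : K ⊆ U) (h0 : ∀ z, z ∉ K → V z = 0) :
    Integrable (firstVariation f V) ∧ ∫ z, firstVariation f V z = 0 := by
  have hKo : IsOpen Kᶜ := hK.isClosed.isOpen_compl
  have hv0 : ∀ z ∈ Kᶜ, spaceVec (V z) = 0 := fun z hz => by rw [h0 z hz, map_zero]
  have hd0 : ∀ s, ∀ z ∈ Kᶜ, wd s (fun ζ => spaceVec (V ζ)) z = 0 := fun s z hz => by
    rw [wd_congr_of_isOpen hKo (g := fun _ => 0) hv0 hz, wd_const]
  have hdd0 : ∀ s t, ∀ z ∈ Kᶜ, wd t (wd s (fun ζ => spaceVec (V ζ))) z = 0 := fun s t z hz => by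
    rw [wd_congr_of_isOpen hKo (g := fun _ => 0) (hd0 s) hz, wd_const]
  have hf0 : ∀ z ∈ Kᶜ, variationFlux f V z = 0 := fun z hz => by
    rw [variationFlux, hd0 _ z hz, hv0 z hz, lor_zero_left, lor_zero_left]; simp
  have hφ : ContDiff ℝ ∞ (variationFlux f V) := contDiff_iff_contDiffAt.2 fun z => by
    by_cases hz : z ∈ K
    · exact (H.contDiffOn_variationFlux hV).contDiffAt (H.isOpen.mem_nhds (hKU hz))
    · exact contDiffAt_const.congr_of_eventuallyEq
        (Filter.eventually_of_mem (hKo.mem_nhds hz) hf0)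
  have hs : HasCompactSupport (variationFlux f V) := HasCompactSupport.intro hK hf0
  obtain ⟨hi, h1⟩ := integral_wd_eq_zero hφ hs (-Complex.I)
  have heq : firstVariation f V = fun z => 4 * (δz (variationFlux f V) z).re := by
    ext z
    by_cases hz : z ∈ K
    · exact H.firstVariation_eq_flux hc hV ho (hKU hz)
    · rw [wd_congr_of_isOpen hKo (g := fun _ => 0) hf0 hz, wd_const, firstVariation, hdd0 _ _ z hz,
        hd0 _ z hz, hv0 z hz]
      simp [lor_zero_left]
  rw [heq]
  refine ⟨hi.re.const_mul 4, ?_⟩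
  rw [integral_const_mul]
  have := integral_re hi
  simp only [RCLike.re_eq_complex_re] at this
  rw [this, h1]
  simp

end IsConformalSurface

/-! ### Conformal invariance of the Willmore density -/

section Transform

variable {E : Type*} [NormedAddCommGroup E] [InnerProductSpace ℝ E]

theorem normalPart_add (a b x y : E) :
    normalPart a b (x + y) = normalPart a b x + normalPart a b y := by
  simp only [normalPart, inner_add_left]; module

theorem normalPart_smul (a b : E) (c : ℝ) (x : E) :
    normalPart a b (c • x) = c • normalPart a b x := by
  simp only [normalPart, real_inner_smul_left]; module

theorem normalPart_left {a b : E} (h : gramDet a b ≠ 0) : normalPart a b a = 0 := by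
  have e1 : (gramDet a b)⁻¹ * (⟪b, b⟫ * ⟪a, a⟫ - ⟪a, b⟫ * ⟪a, b⟫) = 1 := by
    rw [mul_comm ⟪b, b⟫, ← gramDet, inv_mul_cancel₀ h]
  have e2 : (gramDet a b)⁻¹ * (⟪a, a⟫ * ⟪a, b⟫ - ⟪a, b⟫ * ⟪a, a⟫) = 0 := by ring
  rw [normalPart, e1, e2]; module

theorem normalPart_right {a b : E} (h : gramDet a b ≠ 0) : normalPart a b b = 0 := by
  have e1 : (gramDet a b)⁻¹ * (⟪b, b⟫ * ⟪b, a⟫ - ⟪a, b⟫ * ⟪b, b⟫) = 0 := by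
    rw [real_inner_comm a b]; ring
  have e2 : (gramDet a b)⁻¹ * (⟪a, a⟫ * ⟪b, b⟫ - ⟪a, b⟫ * ⟪b, a⟫) = 1 := by
    rw [real_inner_comm a b, ← gramDet, inv_mul_cancel₀ h]
  rw [normalPart, e1, e2]; module

theorem gramDet_rotate (a b : E) (x y : ℝ) :
    gramDet (x • a + y • b) (x • b - y • a) = (x ^ 2 + y ^ 2) ^ 2 * gramDet a b := by
  simp only [gramDet, inner_add_left, inner_add_right, inner_sub_left, inner_sub_right,
    real_inner_smul_left, real_inner_smul_right, real_inner_comm a b]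
  ring

theorem normalPart_rotate {a b : E} (h : gramDet a b ≠ 0) {x y : ℝ} (hxy : x ^ 2 + y ^ 2 ≠ 0)
    (u : E) : normalPart (x • a + y • b) (x • b - y • a) u = normalPart a b u := by
  rw [normalPart, normalPart, gramDet_rotate]
  simp only [inner_add_left, inner_add_right, inner_sub_left, inner_sub_right,
    real_inner_smul_left, real_inner_smul_right, real_inner_comm a b]
  match_scalars
  · rfl
  · field_simp; ring
  · field_simp; ring

/-- The density of a 2-jet after a conformal change of the parameter with derivative `x + i y`. The
second derivative of the change of parameter contributes tangential terms only. -/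
theorem jetDensity_rotate (a b p q s : E) {x y : ℝ} (hxy : x ^ 2 + y ^ 2 ≠ 0)
    (m₁ m₂ m₃ n₁ n₂ n₃ : ℝ) :
    jetDensity (x • a + y • b) (x • b - y • a)
      (x ^ 2 • p + (2 * x * y) • q + y ^ 2 • s + m₁ • a + n₁ • b)
      ((x ^ 2 - y ^ 2) • q + (x * y) • s - (x * y) • p + m₂ • a + n₂ • b)
      (y ^ 2 • p - (2 * x * y) • q + x ^ 2 • s + m₃ • a + n₃ • b) =
    (x ^ 2 + y ^ 2) * jetDensity a b p q s := by
  have hpos : 0 ≤ x ^ 2 + y ^ 2 := by positivity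
  by_cases h : gramDet a b = 0
  · simp [jetDensity, gramDet_rotate, h]
  have l1 : normalPart a b (x ^ 2 • p + (2 * x * y) • q + y ^ 2 • s + m₁ • a + n₁ • b) =
      x ^ 2 • normalPart a b p + (2 * x * y) • normalPart a b q + y ^ 2 • normalPart a b s := by
    simp only [normalPart_add, normalPart_smul, normalPart_left h, normalPart_right h]; module
  have l2 : normalPart a b ((x ^ 2 - y ^ 2) • q + (x * y) • s - (x * y) • p + m₂ • a + n₂ • b) =
      (x ^ 2 - y ^ 2) • normalPart a b q + (x * y) • normalPart a b s -
        (x * y) • normalPart a b p := by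
    simp only [sub_eq_add_neg, ← neg_smul, normalPart_add, normalPart_smul, normalPart_left h,
      normalPart_right h]
    module
  have l3 : normalPart a b (y ^ 2 • p - (2 * x * y) • q + x ^ 2 • s + m₃ • a + n₃ • b) =
      y ^ 2 • normalPart a b p - (2 * x * y) • normalPart a b q + x ^ 2 • normalPart a b s := by
    simp only [sub_eq_add_neg, ← neg_smul, normalPart_add, normalPart_smul, normalPart_left h,
      normalPart_right h]
    module
  have hX : traceVec (x • a + y • b) (x • b - y • a)
      (x ^ 2 • p + (2 * x * y) • q + y ^ 2 • s + m₁ • a + n₁ • b)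
      ((x ^ 2 - y ^ 2) • q + (x * y) • s - (x * y) • p + m₂ • a + n₂ • b)
      (y ^ 2 • p - (2 * x * y) • q + x ^ 2 • s + m₃ • a + n₃ • b) =
      (x ^ 2 + y ^ 2) ^ 2 • traceVec a b p q s := by
    simp only [traceVec, normalPart_rotate h hxy, l1, l2, l3]
    simp only [inner_add_left, inner_add_right, inner_sub_left, inner_sub_right,
      real_inner_smul_left, real_inner_smul_right, real_inner_comm a b]
    module
  have hsq : Real.sqrt ((x ^ 2 + y ^ 2) ^ 2 * gramDet a b) =
      (x ^ 2 + y ^ 2) * Real.sqrt (gramDet a b) := by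
    rw [Real.sqrt_mul (by positivity), Real.sqrt_sq hpos]
  rw [jetDensity, jetDensity, hX]
  simp only [normalPart_rotate h hxy, l1, l2, l3, gramDet_rotate, hsq]
  generalize normalPart a b p = P
  generalize normalPart a b q = Q
  generalize normalPart a b s = S
  generalize traceVec a b p q s = T
  simp only [inner_add_left, inner_add_right, inner_sub_left, inner_sub_right,
    real_inner_smul_left, real_inner_smul_right, real_inner_comm P Q, real_inner_comm P S,
    real_inner_comm Q S]
  field_simp
  ring

theorem pd_comp {h : ℂ → E} {φ : ℂ → ℂ} {φ' ζ : ℂ} (hφ : HasDerivAt φ φ' ζ)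
    (hh : DifferentiableAt ℝ h (φ ζ)) :
    pd 0 (fun ξ => h (φ ξ)) ζ = φ'.re • pd 0 h (φ ζ) + φ'.im • pd 1 h (φ ζ) ∧
    pd 1 (fun ξ => h (φ ξ)) ζ = φ'.re • pd 1 h (φ ζ) - φ'.im • pd 0 h (φ ζ) := by
  have e : HasFDerivAt (fun ξ => h (φ ξ)) ((fderiv ℝ h (φ ζ)).comp
      ((ContinuousLinearMap.toSpanSingleton ℂ φ').restrictScalars ℝ)) ζ :=
    hh.hasFDerivAt.comp ζ (hφ.hasFDerivAt.restrictScalars ℝ)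
  have d1 : φ' = (φ'.re : ℝ) • (1 : ℂ) + (φ'.im : ℝ) • Complex.I := by
    apply Complex.ext <;> simp
  have d2 : Complex.I * φ' = (φ'.re : ℝ) • Complex.I - (φ'.im : ℝ) • (1 : ℂ) := by
    apply Complex.ext <;> simp
  simp only [pd, e.fderiv]
  constructor
  · simp only [ContinuousLinearMap.comp_apply, ContinuousLinearMap.coe_restrictScalars',
      ContinuousLinearMap.toSpanSingleton_apply, Matrix.cons_val_zero, Matrix.cons_val_one,
      smul_eq_mul, one_mul, Matrix.cons_val_fin_one]
    conv_lhs => rw [d1]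
    rw [map_add, map_smul, map_smul]
  · simp only [ContinuousLinearMap.comp_apply, ContinuousLinearMap.coe_restrictScalars',
      ContinuousLinearMap.toSpanSingleton_apply, Matrix.cons_val_zero, Matrix.cons_val_one,
      smul_eq_mul, Matrix.cons_val_fin_one]
    rw [d2, map_sub, map_smul, map_smul]

theorem pd_smul_add {x y : ℂ → ℝ} {A B : ℂ → E} {ζ : ℂ} (hx : DifferentiableAt ℝ x ζ)
    (hy : DifferentiableAt ℝ y ζ) (hA : DifferentiableAt ℝ A ζ) (hB : DifferentiableAt ℝ B ζ)
    (i : Fin 2) : pd i (fun ξ => x ξ • A ξ + y ξ • B ξ) ζ =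
      x ζ • pd i A ζ + y ζ • pd i B ζ + pd i x ζ • A ζ + pd i y ζ • B ζ := by
  have : HasFDerivAt (fun ξ => x ξ • A ξ + y ξ • B ξ) _ ζ :=
    (hx.hasFDerivAt.smul hA.hasFDerivAt).add (hy.hasFDerivAt.smul hB.hasFDerivAt)
  simp only [pd, this.fderiv]
  simp
  abel

/-- The Willmore density is a density: it scales by the Jacobian under conformal changes of the
parameter. -/
theorem willmoreDensity_comp {h : ℂ → E} {U W : Set ℂ} (hU : IsOpen U) (hW : IsOpen W)
    (hh : ContDiffOn ℝ ∞ h W) {φ φ' : ℂ → ℂ} (hm : ∀ ζ ∈ U, φ ζ ∈ W)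
    (hφs : ContDiffOn ℝ ∞ φ U) (hφ : ∀ ζ ∈ U, HasDerivAt φ (φ' ζ) ζ)
    (hφ' : ∀ ζ ∈ U, DifferentiableAt ℝ φ' ζ) {ζ : ℂ}
    (hζ : ζ ∈ U) (h0 : φ' ζ ≠ 0) :
    willmoreDensity (fun ξ => h (φ ξ)) ζ = Complex.normSq (φ' ζ) * willmoreDensity h (φ ζ) := by
  have dh := fun {X : ℂ → E} (hX : ContDiffOn ℝ ∞ X W) {ξ : ℂ} (hξ : ξ ∈ U) =>
    differentiableAt_of_smoothOn hX hW (hm ξ hξ)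
  have c0 := contDiffOn_pd hW hh 0
  have c1 := contDiffOn_pd hW hh 1
  have dφ : DifferentiableAt ℝ φ ζ := (hφ ζ hζ).differentiableAt.restrictScalars ℝ
  have dx : DifferentiableAt ℝ (fun ξ => (φ' ξ).re) ζ :=
    Complex.reCLM.differentiableAt.comp ζ (hφ' ζ hζ)
  have dy : DifferentiableAt ℝ (fun ξ => (φ' ξ).im) ζ :=
    Complex.imCLM.differentiableAt.comp ζ (hφ' ζ hζ)
  have dA : DifferentiableAt ℝ (fun ξ => pd 0 h (φ ξ)) ζ :=
    DifferentiableAt.comp ζ (dh c0 hζ) dφ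
  have dB : DifferentiableAt ℝ (fun ξ => pd 1 h (φ ξ)) ζ :=
    DifferentiableAt.comp ζ (dh c1 hζ) dφ
  have f0 : ∀ ξ ∈ U, pd 0 (fun ξ => h (φ ξ)) ξ =
      (φ' ξ).re • pd 0 h (φ ξ) + (φ' ξ).im • pd 1 h (φ ξ) := fun ξ hξ =>
    (pd_comp (hφ ξ hξ) (dh hh hξ)).1
  have f1 : ∀ ξ ∈ U, pd 1 (fun ξ => h (φ ξ)) ξ =
      (φ' ξ).re • pd 1 h (φ ξ) + (-(φ' ξ).im) • pd 0 h (φ ξ) := fun ξ hξ => by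
    rw [(pd_comp (hφ ξ hξ) (dh hh hξ)).2]; module
  have hpd : ∀ i, ∀ {X Y : ℂ → E}, (∀ ξ ∈ U, X ξ = Y ξ) → pd i X ζ = pd i Y ζ := fun i X Y hXY => by
    rw [pd, pd, (Filter.eventuallyEq_of_mem (hU.mem_nhds hζ) hXY).fderiv_eq]
  have s0 := pd_comp (hφ ζ hζ) (dh c0 hζ)
  have s1 := pd_comp (hφ ζ hζ) (dh c1 hζ)
  have hcm : pd 1 (pd 0 h) (φ ζ) = pd 0 (pd 1 h) (φ ζ) :=
    fderiv_fderiv_apply_comm hW hh (hm ζ hζ) _ _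
  have e00 := (hpd 0 f0).trans (pd_smul_add dx dy dA dB 0)
  have e01 := (hpd 0 f1).trans (pd_smul_add (y := fun ξ => -(φ' ξ).im) dx dy.neg dB dA 0)
  have e11 := (hpd 1 f1).trans (pd_smul_add (y := fun ξ => -(φ' ξ).im) dx dy.neg dB dA 1)
  have hin : ∀ i, pd i (fun ξ => -(φ' ξ).im) ζ = -pd i (fun ξ => (φ' ξ).im) ζ := fun i => by
    simp only [pd]; rw [fderiv_fun_neg]; rfl
  rw [s0.1, s1.1] at e00
  rw [s0.1, s1.1] at e01
  rw [s0.2, s1.2] at e11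
  have hsym : pd 1 (pd 0 (fun ξ => h (φ ξ))) ζ = pd 0 (pd 1 (fun ξ => h (φ ξ))) ζ :=
    fderiv_fderiv_apply_comm hU (hh.comp hφs hm) hζ _ _
  have hx2 : (φ' ζ).re ^ 2 + (φ' ζ).im ^ 2 ≠ 0 := by
    have := Complex.normSq_pos.2 h0
    rw [Complex.normSq_apply] at this
    nlinarith
  have key := jetDensity_rotate (pd 0 h (φ ζ)) (pd 1 h (φ ζ)) (pd 0 (pd 0 h) (φ ζ))
    (pd 0 (pd 1 h) (φ ζ)) (pd 1 (pd 1 h) (φ ζ)) hx2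
    (pd 0 (fun ξ => (φ' ξ).re) ζ) (-pd 0 (fun ξ => (φ' ξ).im) ζ)
    (-pd 1 (fun ξ => (φ' ξ).im) ζ) (pd 0 (fun ξ => (φ' ξ).im) ζ) (pd 0 (fun ξ => (φ' ξ).re) ζ)
    (pd 1 (fun ξ => (φ' ξ).re) ζ)
  rw [willmoreDensity_eq _ _ hsym, willmoreDensity_eq _ _ hcm, Complex.normSq_apply, ← pow_two,
    ← pow_two, ← key, e00, e01, e11, hin, hin, hcm, f0 ζ hζ, (pd_comp (hφ ζ hζ) (dh hh hζ)).2]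
  congr 1 <;> module

end Transform

/-! ### Variations depending smoothly on a parameter -/

section Variation

variable {E : Type*} [NormedAddCommGroup E] [InnerProductSpace ℝ E]

theorem contDiffAt_normalPart {X : Type*} [NormedAddCommGroup X] [NormedSpace ℝ X] {n : ℕ∞ω}
    {a b u : X → E} {x : X} (ha : ContDiffAt ℝ n a x) (hb : ContDiffAt ℝ n b x)
    (hu : ContDiffAt ℝ n u x) (h : gramDet (a x) (b x) ≠ 0) :
    ContDiffAt ℝ n (fun x => normalPart (a x) (b x) (u x)) x := by
  have hd : ContDiffAt ℝ n (fun x => gramDet (a x) (b x)) x :=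
    ((ha.inner ℝ ha).mul (hb.inner ℝ hb)).sub ((ha.inner ℝ hb).mul (ha.inner ℝ hb))
  have hi := hd.inv h
  exact (hu.sub ((hi.mul (((hb.inner ℝ hb).mul (hu.inner ℝ ha)).sub
    ((ha.inner ℝ hb).mul (hu.inner ℝ hb)))).smul ha)).sub
    ((hi.mul (((ha.inner ℝ ha).mul (hu.inner ℝ hb)).sub
    ((ha.inner ℝ hb).mul (hu.inner ℝ ha)))).smul hb)

theorem contDiffAt_jetDensity {X : Type*} [NormedAddCommGroup X] [NormedSpace ℝ X] {n : ℕ∞ω}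
    {a b p q s : X → E} {x : X} (ha : ContDiffAt ℝ n a x) (hb : ContDiffAt ℝ n b x)
    (hp : ContDiffAt ℝ n p x) (hq : ContDiffAt ℝ n q x) (hs : ContDiffAt ℝ n s x)
    (h : gramDet (a x) (b x) ≠ 0) :
    ContDiffAt ℝ n (fun x => jetDensity (a x) (b x) (p x) (q x) (s x)) x := by
  have hd : ContDiffAt ℝ n (fun x => gramDet (a x) (b x)) x :=
    ((ha.inner ℝ ha).mul (hb.inner ℝ hb)).sub ((ha.inner ℝ hb).mul (ha.inner ℝ hb))
  have hi := hd.inv h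
  have np := contDiffAt_normalPart ha hb hp h
  have nq := contDiffAt_normalPart ha hb hq h
  have ns := contDiffAt_normalPart ha hb hs h
  have nt : ContDiffAt ℝ n (fun x => traceVec (a x) (b x) (p x) (q x) (s x)) x :=
    (((hb.inner ℝ hb).smul np).sub ((contDiffAt_const.mul (ha.inner ℝ hb)).smul nq)).add
      ((ha.inner ℝ ha).smul ns)
  exact (hd.sqrt h).mul (((contDiffAt_const.mul (hi.mul hi)).mul (nt.inner ℝ nt)).sub
    (hi.mul ((np.inner ℝ ns).sub (nq.inner ℝ nq))))

/-- Differentiation of an integral over a subset of a compact set, with respect to a parameter on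
which the integrand depends in a `C¹` way near the compact set. -/
theorem hasDerivAt_setIntegral_of_contDiffAt {D : ℝ × ℂ → ℝ} {A C : Set ℂ} (hC : IsCompact C)
    (hA : MeasurableSet A) (hAC : A ⊆ C) (h : ∀ z ∈ C, ContDiffAt ℝ 1 D (0, z)) :
    (∀ᶠ t in 𝓝 (0 : ℝ), IntegrableOn (fun z => D (t, z)) A) ∧
    IntegrableOn (fun z => fderiv ℝ D (0, z) (1, 0)) A ∧
    HasDerivAt (fun t => ∫ z in A, D (t, z)) (∫ z in A, fderiv ℝ D (0, z) (1, 0)) 0 := by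
  have hO : IsOpen {p | ContDiffAt ℝ 1 D p} := isOpen_iff_mem_nhds.2 fun p hp =>
    ContDiffAt.eventually hp (by simp)
  obtain ⟨u, v, hu, -, h0u, hCv, huv⟩ := generalized_tube_lemma (isCompact_singleton (x := (0 : ℝ)))
    hC hO (by rintro ⟨t, z⟩ ⟨ht, hz⟩; obtain rfl : t = 0 := ht; exact h z hz)
  obtain ⟨δ, hδ, hδu⟩ := Metric.nhds_basis_closedBall.mem_iff.1
    (hu.mem_nhds (h0u rfl))
  have hD : ∀ t ∈ Metric.closedBall (0 : ℝ) δ, ∀ z ∈ C, ContDiffAt ℝ 1 D (t, z) :=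
    fun t ht z hz => huv ⟨hδu ht, hCv hz⟩
  have hs : Metric.closedBall (0 : ℝ) δ ∈ 𝓝 (0 : ℝ) := Metric.closedBall_mem_nhds _ hδ
  have cont : ContinuousOn (fun p => fderiv ℝ D p (1, 0)) (Metric.closedBall (0 : ℝ) δ ×ˢ C) := by
    rintro ⟨t, z⟩ ⟨ht, hz⟩
    have := ((hD t ht z hz).fderiv_right (m := 0) (by simp)).continuousAt
    exact (this.clm_apply continuousAt_const).continuousWithinAt
  have c1 : ∀ t ∈ Metric.closedBall (0 : ℝ) δ, ContinuousOn (fun z => D (t, z)) C := by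
    intro t ht z hz
    exact ((hD t ht z hz).continuousAt.comp (f := fun z => (t, z))
      (by fun_prop)).continuousWithinAt
  have c2 : ContinuousOn (fun z => fderiv ℝ D (0, z) (1, 0)) C :=
    cont.comp (f := fun z : ℂ => ((0 : ℝ), z)) (by fun_prop)
      (fun z hz => ⟨Metric.mem_closedBall_self hδ.le, hz⟩)
  obtain ⟨M, hM⟩ := ((isCompact_closedBall (0 : ℝ) δ).prod hC).exists_bound_of_continuousOn cont
  have hfin : volume A < ⊤ := lt_of_le_of_lt (measure_mono hAC) hC.measure_lt_top
  have hint : ∀ t ∈ Metric.closedBall (0 : ℝ) δ, IntegrableOn (fun z => D (t, z)) A := fun t ht =>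
    ((c1 t ht).integrableOn_compact hC).mono_set hAC
  have := hasDerivAt_integral_of_dominated_loc_of_deriv_le (μ := volume.restrict A)
    (F := fun t z => D (t, z)) (F' := fun t z => fderiv ℝ D (t, z) (1, 0)) (bound := fun _ => M)
    (x₀ := (0 : ℝ)) hs (Filter.eventually_of_mem hs fun t ht => (hint t ht).aestronglyMeasurable)
    (hint 0 (Metric.mem_closedBall_self hδ.le))
    ((c2.integrableOn_compact hC).mono_set hAC).aestronglyMeasurable
    ((ae_restrict_iff' hA).2 (Filter.Eventually.of_forall fun z hz t ht =>
      hM (t, z) ⟨ht, hAC hz⟩)) (integrableOn_const hfin.ne)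
    ((ae_restrict_iff' hA).2 (Filter.Eventually.of_forall fun z hz t ht => by
      have h1 := ((hD t ht z (hAC hz)).differentiableAt (by simp)).hasFDerivAt
      exact h1.comp_hasDerivAt t ((hasDerivAt_id t).prodMk (hasDerivAt_const t z))))
  exact ⟨Filter.eventually_of_mem hs hint, this.1, this.2⟩

end Variation

namespace IsConformalSurface

variable {f : ℂ → EuclideanSpace ℝ (Fin 7)} {U : Set ℂ}

/-- For a smooth variation of a conformal immersion the Willmore density is a `C¹` function of the
parameter and the point, with derivative the first variation. -/
theorem exists_density (H : IsConformalSurface f U) {G : ℝ × ℂ → EuclideanSpace ℝ (Fin 7)}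
    (hG : ContDiffOn ℝ ∞ G (Set.univ ×ˢ U)) (h0 : ∀ z ∈ U, G (0, z) = f z)
    {V : ℂ → EuclideanSpace ℝ (Fin 7)} (hV : ∀ z ∈ U, V z = fderiv ℝ G (0, z) (1, 0))
    (ho : ∀ z ∈ U, ⟪V z, f z⟫ = 0) :
    ∃ D : ℝ × ℂ → ℝ, (∀ t, ∀ z ∈ U, willmoreDensity (fun ζ => G (t, ζ)) z = D (t, z)) ∧
      ∀ z ∈ U, ContDiffAt ℝ 1 D (0, z) ∧ fderiv ℝ D (0, z) (1, 0) = firstVariation f V z := by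
  have hW : IsOpen ((Set.univ : Set ℝ) ×ˢ U) := isOpen_univ.prod H.isOpen
  let e : Fin 2 → ℝ × ℂ := fun i => (0, (![1, Complex.I] : Fin 2 → ℂ) i)
  let dir : (ℝ × ℂ) → (ℝ × ℂ → EuclideanSpace ℝ (Fin 7)) → ℝ × ℂ → EuclideanSpace ℝ (Fin 7) :=
    fun v g p => fderiv ℝ g p v
  have cdir : ∀ v {g : ℝ × ℂ → EuclideanSpace ℝ (Fin 7)}, ContDiffOn ℝ ∞ g (Set.univ ×ˢ U) →
      ContDiffOn ℝ ∞ (dir v g) (Set.univ ×ˢ U) := fun v g hg =>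
    (hg.fderiv_of_isOpen hW (m := ∞) (by simp)).clm_apply contDiffOn_const
  have hm : ∀ t : ℝ, ∀ z ∈ U, (t, z) ∈ (Set.univ : Set ℝ) ×ˢ U := fun t z hz => ⟨trivial, hz⟩
  have hdir : ∀ (i : Fin 2) {g : ℝ × ℂ → EuclideanSpace ℝ (Fin 7)},
      ContDiffOn ℝ ∞ g (Set.univ ×ˢ U) → ∀ t, ∀ z ∈ U,
      pd i (fun ζ => g (t, ζ)) z = dir (e i) g (t, z) := fun i g hg t z hz => by
    have h1 := (differentiableAt_of_smoothOn hg hW (hm t z hz)).hasFDerivAt.comp z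
      (hasFDerivAt_prodMk_right t z)
    rw [pd, show (fun ζ => g (t, ζ)) = g ∘ fun ζ => (t, ζ) from rfl, h1.fderiv]
    rfl
  have hpath : ∀ {g : ℝ × ℂ → EuclideanSpace ℝ (Fin 7)},
      ContDiffOn ℝ ∞ g (Set.univ ×ˢ U) → ∀ z ∈ U,
      HasDerivAt (fun t => g (t, z)) (dir (1, 0) g (0, z)) 0 := fun {g} hg z hz =>
    (differentiableAt_of_smoothOn hg hW (hm 0 z hz)).hasFDerivAt.comp_hasDerivAt 0
      ((hasDerivAt_id (0 : ℝ)).prodMk (hasDerivAt_const _ z))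
  have hswap : ∀ i {g : ℝ × ℂ → EuclideanSpace ℝ (Fin 7)},
      ContDiffOn ℝ ∞ g (Set.univ ×ˢ U) → ∀ p ∈ (Set.univ : Set ℝ) ×ˢ U,
      dir (1, 0) (dir (e i) g) p = dir (e i) (dir (1, 0) g) p := fun i g hg p hp =>
    fderiv_fderiv_apply_comm hW hg hp _ _
  have hcongr : ∀ v {g k : ℝ × ℂ → EuclideanSpace ℝ (Fin 7)},
      (∀ p ∈ (Set.univ : Set ℝ) ×ˢ U, g p = k p) → ∀ p ∈ (Set.univ : Set ℝ) ×ˢ U,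
      dir v g p = dir v k p := fun v g k hgk p hp => by
    simp only [dir]
    rw [(Filter.eventuallyEq_of_mem (hW.mem_nhds hp) hgk).fderiv_eq]
  have pcongr : ∀ i {g k : ℂ → EuclideanSpace ℝ (Fin 7)}, (∀ z ∈ U, g z = k z) → ∀ z ∈ U,
      pd i g z = pd i k z := fun i g k hgk z hz => by
    rw [pd, pd, (Filter.eventuallyEq_of_mem (H.isOpen.mem_nhds hz) hgk).fderiv_eq]
  have c1 := fun i => cdir (e i) hG
  have c2 := fun i j => cdir (e i) (c1 j)
  have ct := cdir (1, 0) hG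
  -- the spatial jet of the variation
  have j2 : ∀ i j t, ∀ z ∈ U, pd i (pd j fun ζ => G (t, ζ)) z = dir (e i) (dir (e j) G) (t, z) :=
    fun i j t z hz => by
      rw [pcongr i (hdir j hG t) z hz, hdir i (c1 j) t z hz]
  -- the jet of the variation field
  have v0 : ContDiffOn ℝ ∞ V U :=
    (ct.comp (f := fun z : ℂ => ((0 : ℝ), z)) (by fun_prop) (fun z hz => hm 0 z hz)).congr hV
  have v1 : ∀ i, ∀ z ∈ U, pd i V z = dir (1, 0) (dir (e i) G) (0, z) := fun i z hz => by
    rw [pcongr i hV z hz, hswap i hG _ (hm 0 z hz), ← hdir i ct 0 z hz]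
  have v2 : ∀ i j, ∀ z ∈ U, pd i (pd j V) z = dir (1, 0) (dir (e i) (dir (e j) G)) (0, z) :=
    fun i j z hz => by
      rw [pcongr i (v1 j) z hz, hdir i (cdir _ (c1 j)) 0 z hz, hswap i (c1 j) _ (hm 0 z hz)]
  have f1 : ∀ i, ∀ z ∈ U, dir (e i) G (0, z) = pd i f z := fun i z hz => by
    rw [← hdir i hG 0 z hz, pcongr i h0 z hz]
  have f2 : ∀ i j, ∀ z ∈ U, dir (e i) (dir (e j) G) (0, z) = pd i (pd j f) z := fun i j z hz => by
    rw [← hdir i (c1 j) 0 z hz, pcongr i (f1 j) z hz]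
  refine ⟨fun p => jetDensity (dir (e 0) G p) (dir (e 1) G p) (dir (e 0) (dir (e 0) G) p)
    (dir (e 0) (dir (e 1) G) p) (dir (e 1) (dir (e 1) G) p), fun t z hz => ?_, fun z hz => ?_⟩
  · have cG : ContDiffOn ℝ ∞ (fun ζ => G (t, ζ)) U :=
      hG.comp (f := fun z : ℂ => (t, z)) (by fun_prop) (fun z hz => hm t z hz)
    rw [willmoreDensity_eq _ _ (pd_comm H.isOpen cG hz), hdir 0 hG t z hz, hdir 1 hG t z hz,
      j2 _ _ _ z hz, j2 _ _ _ z hz, j2 _ _ _ z hz]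
  · have hp := hW.mem_nhds (hm 0 z hz)
    have hd : ContDiffAt ℝ 1 (fun p => jetDensity (dir (e 0) G p) (dir (e 1) G p)
        (dir (e 0) (dir (e 0) G) p) (dir (e 0) (dir (e 1) G) p)
        (dir (e 1) (dir (e 1) G) p)) (0, z) := by
      have h1 : (1 : ℕ∞ω) ≤ ∞ := by simp
      refine contDiffAt_jetDensity (((c1 0).contDiffAt hp).of_le h1)
        (((c1 1).contDiffAt hp).of_le h1) (((c2 0 0).contDiffAt hp).of_le h1)
        (((c2 0 1).contDiffAt hp).of_le h1) (((c2 1 1).contDiffAt hp).of_le h1) ?_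
      obtain ⟨p0, p1, p2, -⟩ := H.jet_relations hz
      rw [f1 0 z hz, f1 1 z hz, gramDet, p1, p2]
      nlinarith
    refine ⟨hd, ?_⟩
    have hk := H.hasDerivAt_jetDensity v0 ho hz ((hpath (c1 0) z hz).congr_deriv (v1 0 z hz).symm)
      ((hpath (c1 1) z hz).congr_deriv (v1 1 z hz).symm)
      ((hpath (c2 0 0) z hz).congr_deriv (v2 0 0 z hz).symm)
      ((hpath (c2 0 1) z hz).congr_deriv (v2 0 1 z hz).symm)
      ((hpath (c2 1 1) z hz).congr_deriv (v2 1 1 z hz).symm) (f1 0 z hz) (f1 1 z hz)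
      (f2 0 0 z hz) (f2 0 1 z hz) (f2 1 1 z hz)
    have hk' := (hd.differentiableAt (by simp)).hasFDerivAt.comp_hasDerivAt (0 : ℝ)
      ((hasDerivAt_id (0 : ℝ)).prodMk (hasDerivAt_const _ z))
    exact hk'.unique hk

theorem hasDerivAt_setIntegral_density (H : IsConformalSurface f U)
    {G : ℝ × ℂ → EuclideanSpace ℝ (Fin 7)}
    (hG : ContDiffOn ℝ ∞ G (Set.univ ×ˢ U)) (h0 : ∀ z ∈ U, G (0, z) = f z)
    {V : ℂ → EuclideanSpace ℝ (Fin 7)} (hV : ∀ z ∈ U, V z = fderiv ℝ G (0, z) (1, 0))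
    (ho : ∀ z ∈ U, ⟪V z, f z⟫ = 0) {A C : Set ℂ} (hC : IsCompact C) (hCU : C ⊆ U)
    (hA : MeasurableSet A) (hAC : A ⊆ C) :
    (∀ᶠ t in 𝓝 (0 : ℝ), IntegrableOn (willmoreDensity fun ζ => G (t, ζ)) A) ∧
    IntegrableOn (firstVariation f V) A ∧
    HasDerivAt (fun t => ∫ z in A, willmoreDensity (fun ζ => G (t, ζ)) z)
      (∫ z in A, firstVariation f V z) 0 := by
  obtain ⟨D, hD, hD'⟩ := H.exists_density hG h0 hV ho
  obtain ⟨i1, i2, i3⟩ := hasDerivAt_setIntegral_of_contDiffAt hC hA hAC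
    (fun z hz => (hD' z (hCU hz)).1)
  have e1 : ∀ t, Set.EqOn (willmoreDensity fun ζ => G (t, ζ)) (fun z => D (t, z)) A :=
    fun t z hz => hD t z (hCU (hAC hz))
  have e2 : Set.EqOn (fun z => fderiv ℝ D (0, z) (1, 0)) (firstVariation f V) A :=
    fun z hz => (hD' z (hCU (hAC hz))).2
  refine ⟨i1.mono fun t ht => (integrableOn_congr_fun (e1 t) hA).2 ht,
    (integrableOn_congr_fun e2 hA).1 i2, ?_⟩
  rw [setIntegral_congr_fun hA e2] at i3
  simpa only [setIntegral_congr_fun hA (e1 _)] using i3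

/-- The first variation is the derivative of the density along the affine variation. -/
theorem hasDerivAt_density_affine (H : IsConformalSurface f U)
    {V : ℂ → EuclideanSpace ℝ (Fin 7)} (hV : ContDiffOn ℝ ∞ V U)
    (ho : ∀ z ∈ U, ⟪V z, f z⟫ = 0) {z : ℂ} (hz : z ∈ U) :
    HasDerivAt (fun t : ℝ => willmoreDensity (fun ζ => f ζ + t • V ζ) z)
      (firstVariation f V z) 0 := by
  have cV : ContDiffOn ℝ ∞ (fun p : ℝ × ℂ => V p.2) (Set.univ ×ˢ U) :=
    hV.comp contDiffOn_snd fun p hp => hp.2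
  have cf : ContDiffOn ℝ ∞ (fun p : ℝ × ℂ => f p.2) (Set.univ ×ˢ U) :=
    H.smooth.comp contDiffOn_snd fun p hp => hp.2
  have cG : ContDiffOn ℝ ∞ (fun p : ℝ × ℂ => f p.2 + p.1 • V p.2) (Set.univ ×ˢ U) :=
    cf.add (contDiffOn_fst.smul cV)
  have hW : IsOpen ((Set.univ : Set ℝ) ×ˢ U) := isOpen_univ.prod H.isOpen
  obtain ⟨D, hD, hD'⟩ := H.exists_density cG (fun z _ => by simp) (V := V) (fun z hz => by
    have h1 := (differentiableAt_of_smoothOn cG hW (z := (0, z)) ⟨trivial, hz⟩).hasFDerivAt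
    have h2 := h1.comp_hasDerivAt (0 : ℝ)
      ((hasDerivAt_id (0 : ℝ)).prodMk (hasDerivAt_const _ z))
    have h3 : HasDerivAt (fun t : ℝ => f z + t • V z) ((1 : ℝ) • V z) 0 :=
      ((hasDerivAt_id (0 : ℝ)).smul_const (V z)).const_add (f z)
    rw [one_smul] at h3
    exact h3.unique h2) ho
  have hk' := ((hD' z hz).1.differentiableAt (by simp)).hasFDerivAt.comp_hasDerivAt (0 : ℝ)
    ((hasDerivAt_id (0 : ℝ)).prodMk (hasDerivAt_const _ z))
  have : (fun t : ℝ => willmoreDensity (fun ζ => f ζ + t • V ζ) z) = fun t => D (t, z) :=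
    funext fun t => hD t z hz
  rw [this, ← (hD' z hz).2]
  exact hk'

end IsConformalSurface

/-! ### Critical conformal immersions of domains of the sphere are Willmore -/

theorem coordInfty_of_ne {ζ : ℂ} (h : ζ ≠ 0) : coordInfty ζ = coordZero ζ⁻¹ := by
  simp [coordInfty, coordZero, h]

theorem coordZero_inv_inv {z : ℂ} (h : z ≠ 0) : coordInfty z⁻¹ = coordZero z := by
  rw [coordInfty_of_ne (inv_ne_zero h), inv_inv]

theorem continuous_coordZero : Continuous coordZero := OnePoint.continuous_coe

theorem continuous_coordInfty : Continuous coordInfty := by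
  refine continuous_iff_continuousAt.2 fun ζ => ?_
  by_cases h : ζ = 0
  · subst h
    rw [continuousAt_iff_punctured_nhds]
    have h1 : Filter.Tendsto (fun ζ : ℂ => ((ζ⁻¹ : ℂ) : OnePoint ℂ)) (𝓝[≠] 0)
        (𝓝 OnePoint.infty) := by
      refine OnePoint.tendsto_coe_infty.comp ?_
      rw [Filter.coclosedCompact_eq_cocompact, ← Metric.cobounded_eq_cocompact]
      exact Filter.tendsto_inv₀_nhdsNE_zero
    have h2 : coordInfty 0 = OnePoint.infty := by simp [coordInfty]
    rw [h2]
    refine h1.congr' (eventually_nhdsWithin_of_forall fun ζ hζ => ?_)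
    exact (coordInfty_of_ne hζ).symm
  · have : ContinuousAt (fun ζ : ℂ => coordZero ζ⁻¹) ζ :=
      continuous_coordZero.continuousAt.comp (continuousAt_inv₀ h)
    exact this.congr (Filter.eventually_of_mem (isOpen_ne.mem_nhds h)
      fun ξ hξ => (coordInfty_of_ne hξ).symm)

theorem det_mul_complex (w : ℂ) :
    (((ContinuousLinearMap.toSpanSingleton ℂ w).restrictScalars ℝ : ℂ →L[ℝ] ℂ)).det =
      Complex.normSq w := by
  rw [← Algebra.norm_complex_apply, Algebra.norm_apply, ContinuousLinearMap.det]
  congr 1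
  ext x
  simp [mul_comm]

/-- The change of variables `z = 1 / ζ`. -/
theorem integral_inv_image {S : Set ℂ} (hS : MeasurableSet S) (h0 : ∀ ζ ∈ S, ζ ≠ 0) (g : ℂ → ℝ) :
    (IntegrableOn g (Inv.inv '' S) ↔
      IntegrableOn (fun ζ => Complex.normSq (-(ζ ^ 2)⁻¹) * g ζ⁻¹) S) ∧
    ∫ z in Inv.inv '' S, g z = ∫ ζ in S, Complex.normSq (-(ζ ^ 2)⁻¹) * g ζ⁻¹ := by
  have hd : ∀ ζ ∈ S, HasFDerivWithinAt (Inv.inv : ℂ → ℂ)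
      ((ContinuousLinearMap.toSpanSingleton ℂ (-(ζ ^ 2)⁻¹)).restrictScalars ℝ) S ζ := fun ζ hζ =>
    ((hasDerivAt_inv (h0 ζ hζ)).hasFDerivAt.restrictScalars ℝ).hasFDerivWithinAt
  have hi : Set.InjOn (Inv.inv : ℂ → ℂ) S := inv_injective.injOn
  have e : ∀ ζ : ℂ, |(((ContinuousLinearMap.toSpanSingleton ℂ (-(ζ ^ 2)⁻¹)).restrictScalars ℝ :
      ℂ →L[ℝ] ℂ)).det| • g ζ⁻¹ = Complex.normSq (-(ζ ^ 2)⁻¹) * g ζ⁻¹ := fun ζ => by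
    rw [det_mul_complex, abs_of_nonneg (Complex.normSq_nonneg _), smul_eq_mul]
  constructor
  · rw [integrableOn_image_iff_integrableOn_abs_det_fderiv_smul volume hS hd hi]
    simp only [e]
  · rw [integral_image_eq_integral_abs_det_fderiv_smul volume hS hd hi]
    simp only [e]

theorem pd_congr {E : Type*} [NormedAddCommGroup E] [InnerProductSpace ℝ E] {f g : ℂ → E}
    {U : Set ℂ} (hU : IsOpen U) (h : ∀ z ∈ U, f z = g z) (i : Fin 2) {z : ℂ} (hz : z ∈ U) :
    pd i f z = pd i g z := by
  rw [pd, pd, (Filter.eventuallyEq_of_mem (hU.mem_nhds hz) h).fderiv_eq]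

theorem willmoreDensity_congr {E : Type*} [NormedAddCommGroup E] [InnerProductSpace ℝ E]
    {f g : ℂ → E} {U : Set ℂ} (hU : IsOpen U) (h : ∀ z ∈ U, f z = g z) {z : ℂ} (hz : z ∈ U) :
    willmoreDensity f z = willmoreDensity g z := by
  have h1 : ∀ i, ∀ z ∈ U, pd i f z = pd i g z := fun i z hz => pd_congr hU h i hz
  have h2 : ∀ i j, pd i (pd j f) z = pd i (pd j g) z := fun i j => pd_congr hU (h1 j) i hz
  have h3 : firstForm f z = firstForm g z := by
    ext i j; simp only [firstForm, Matrix.of_apply, h1 _ z hz]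
  have h4 : secondForm f z = secondForm g z := by
    ext1 i; ext1 j; simp only [secondForm, h3, h2, h1 _ z hz]
  have h5 : traceFreeForm f z = traceFreeForm g z := by
    ext1 i; ext1 j; simp only [traceFreeForm, meanCurvature, h3, h4]
  rw [willmoreDensity, willmoreDensity, h3, h5]

theorem firstVariation_congr {f V W : ℂ → EuclideanSpace ℝ (Fin 7)} {U : Set ℂ} (hU : IsOpen U)
    (h : ∀ z ∈ U, V z = W z) {z : ℂ} (hz : z ∈ U) :
    firstVariation f V z = firstVariation f W z := by
  have h0 : ∀ z ∈ U, spaceVec (V z) = spaceVec (W z) := fun z hz => by rw [h z hz]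
  have h1 : ∀ z ∈ U, δz (fun ζ => spaceVec (V ζ)) z = δz (fun ζ => spaceVec (W ζ)) z :=
    fun z hz => wd_congr_of_isOpen hU h0 hz
  rw [firstVariation, firstVariation, wd_congr_of_isOpen hU h1 hz, h1 z hz, h z hz]

theorem firstVariation_zero (f : ℂ → EuclideanSpace ℝ (Fin 7)) (z : ℂ) :
    firstVariation f (fun _ => 0) z = 0 := by
  simp [firstVariation, wd_const, show wd (-Complex.I) (fun _ : ℂ => (0 : Fin 8 → ℂ)) = fun _ => 0
    from funext fun z => wd_const _ _ z, lor_zero_left]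

theorem firstVariation_sub {f V W : ℂ → EuclideanSpace ℝ (Fin 7)} {U : Set ℂ} (hU : IsOpen U)
    (hV : ContDiffOn ℝ ∞ V U) (hW : ContDiffOn ℝ ∞ W U) {z : ℂ} (hz : z ∈ U) :
    firstVariation f (fun ζ => V ζ - W ζ) z = firstVariation f V z - firstVariation f W z := by
  have cV := contDiffOn_spaceVec hV
  have cW := contDiffOn_spaceVec hW
  have h1 : ∀ z ∈ U, δz (fun ζ => spaceVec (V ζ - W ζ)) z =
      δz (fun ζ => spaceVec (V ζ)) z - δz (fun ζ => spaceVec (W ζ)) z := fun z hz => by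
    simp only [map_sub]
    exact wd_sub (f := fun ζ => spaceVec (V ζ)) (g := fun ζ => spaceVec (W ζ))
      (differentiableAt_of_smoothOn cV hU hz) (differentiableAt_of_smoothOn cW hU hz)
  rw [firstVariation, firstVariation, firstVariation, wd_congr_of_isOpen hU h1 hz, h1 z hz,
    wd_sub (differentiableAt_of_smoothOn (contDiffOn_wd hU cV) hU hz)
      (differentiableAt_of_smoothOn (contDiffOn_wd hU cW) hU hz), ← mul_sub, ← Complex.sub_re]
  congr 2
  simp only [lor_sub_left, lor_smul_left, map_sub]
  ring

section Sphere

variable {Ω : Set (OnePoint ℂ)} {f : OnePoint ℂ → EuclideanSpace ℝ (Fin 7)}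

theorem contDiffOn_inv_complex : ContDiffOn ℝ ∞ (Inv.inv : ℂ → ℂ) {ζ | ζ ≠ 0} := fun _ hζ =>
  (contDiffAt_inv ℝ hζ).contDiffWithinAt

/-- The Willmore density in the coordinates `z` and `ζ = 1 / z`. -/
theorem willmoreDensity_coordInfty {U₀ U₁ : Set ℂ} (h₀ : IsOpen U₀) (h₁ : IsOpen U₁)
    (hm : ∀ ζ ∈ U₁, ζ ≠ 0 → ζ⁻¹ ∈ U₀) {h k : ℂ → EuclideanSpace ℝ (Fin 7)}
    (hh : ContDiffOn ℝ ∞ h U₀) (hk : ∀ ζ ∈ U₁, ζ ≠ 0 → k ζ = h ζ⁻¹) {ζ : ℂ} (hζ : ζ ∈ U₁)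
    (h0 : ζ ≠ 0) :
    willmoreDensity k ζ = Complex.normSq (-(ζ ^ 2)⁻¹) * willmoreDensity h ζ⁻¹ := by
  have hU : IsOpen (U₁ ∩ {ζ | ζ ≠ 0}) := h₁.inter isOpen_ne
  rw [willmoreDensity_congr hU (g := fun ξ => h ξ⁻¹) (fun ξ hξ => hk ξ hξ.1 hξ.2) ⟨hζ, h0⟩]
  refine willmoreDensity_comp (φ := Inv.inv) (φ' := fun ξ => -(ξ ^ 2)⁻¹) hU h₀ hh
    (fun ξ hξ => hm ξ hξ.1 hξ.2) (contDiffOn_inv_complex.mono fun ξ hξ => hξ.2)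
    (fun ξ hξ => hasDerivAt_inv hξ.2) (fun ξ hξ => ?_) ⟨hζ, h0⟩
    (neg_ne_zero.2 (inv_ne_zero (pow_ne_zero 2 h0)))
  have : DifferentiableAt ℂ (fun ξ : ℂ => -(ξ ^ 2)⁻¹) ξ :=
    ((differentiableAt_id.pow 2).inv (pow_ne_zero 2 hξ.2)).neg
  exact this.restrictScalars ℝ

/-- The first variation in the coordinates `z` and `ζ = 1 / z`. -/
theorem firstVariation_coordInfty (H₀ : IsConformalSurface (f ∘ coordZero) (coordZero ⁻¹' Ω))
    (H₁ : IsConformalSurface (f ∘ coordInfty) (coordInfty ⁻¹' Ω))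
    {X W : ℂ → EuclideanSpace ℝ (Fin 7)} (hX : ContDiffOn ℝ ∞ X (coordZero ⁻¹' Ω))
    (ho : ∀ z ∈ coordZero ⁻¹' Ω, ⟪X z, (f ∘ coordZero) z⟫ = 0)
    (hW : ∀ ζ, ζ ≠ 0 → coordInfty ζ ∈ Ω → W ζ = X ζ⁻¹) {ζ : ℂ} (h0 : ζ ≠ 0)
    (hζ : coordInfty ζ ∈ Ω) :
    firstVariation (f ∘ coordInfty) W ζ =
      Complex.normSq (-(ζ ^ 2)⁻¹) * firstVariation (f ∘ coordZero) X ζ⁻¹ := by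
  have hU : IsOpen (coordInfty ⁻¹' Ω ∩ {ζ | ζ ≠ 0}) := H₁.isOpen.inter isOpen_ne
  have hm : ∀ ζ ∈ coordInfty ⁻¹' Ω, ζ ≠ 0 → ζ⁻¹ ∈ coordZero ⁻¹' Ω := fun ζ hζ h0 => by
    rwa [Set.mem_preimage, ← coordInfty_of_ne h0]
  have H₁' : IsConformalSurface (f ∘ coordInfty) (coordInfty ⁻¹' Ω ∩ {ζ | ζ ≠ 0}) :=
    ⟨hU, H₁.smooth.mono Set.inter_subset_left, fun z hz => H₁.norm_eq z hz.1,
      fun z hz => H₁.conformal z hz.1, fun z hz => H₁.immersed z hz.1⟩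
  have cW : ContDiffOn ℝ ∞ W (coordInfty ⁻¹' Ω ∩ {ζ | ζ ≠ 0}) :=
    (hX.comp (contDiffOn_inv_complex.mono Set.inter_subset_right)
      (fun ξ hξ => hm ξ hξ.1 hξ.2)).congr fun ξ hξ => hW ξ hξ.2 hξ.1
  have d0 := H₀.hasDerivAt_density_affine hX ho (hm ζ hζ h0)
  have d1 := H₁'.hasDerivAt_density_affine cW (fun ξ hξ => by
    rw [hW ξ hξ.2 hξ.1, Function.comp, coordInfty_of_ne hξ.2]; exact ho _ (hm ξ hξ.1 hξ.2)) ⟨hζ, h0⟩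
  refine d1.unique ((d0.const_mul (Complex.normSq (-(ζ ^ 2)⁻¹))).congr_of_eventuallyEq
    (Filter.Eventually.of_forall fun t => ?_))
  refine willmoreDensity_coordInfty H₀.isOpen H₁.isOpen hm (H₀.smooth.add (hX.const_smul t))
    (fun ξ hξ hξ0 => ?_) hζ h0
  rw [hW ξ hξ0 hξ, Function.comp, coordInfty_of_ne hξ0]
  rfl

end Sphere

/-- The velocity of a variation of maps of the sphere, in the coordinate `c`. -/
def velocity (Φ : ℝ → OnePoint ℂ → EuclideanSpace ℝ (Fin 7)) (c : ℂ → OnePoint ℂ) (z : ℂ) :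
    EuclideanSpace ℝ (Fin 7) :=
  fderiv ℝ (fun p : ℝ × ℂ => Φ p.1 (c p.2)) (0, z) (1, 0)

section Velocity

variable {Ω K : Set (OnePoint ℂ)} {f : OnePoint ℂ → EuclideanSpace ℝ (Fin 7)}
  {Φ : ℝ → OnePoint ℂ → EuclideanSpace ℝ (Fin 7)} {c : ℂ → OnePoint ℂ}

theorem hasDerivAt_velocity (hU : IsOpen (c ⁻¹' Ω))
    (hΦ : ContDiffOn ℝ ∞ (fun p : ℝ × ℂ => Φ p.1 (c p.2)) (Set.univ ×ˢ (c ⁻¹' Ω))) {z : ℂ}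
    (hz : c z ∈ Ω) : HasDerivAt (fun t => Φ t (c z)) (velocity Φ c z) 0 := by
  have h := (differentiableAt_of_smoothOn hΦ (isOpen_univ.prod hU) (z := (0, z))
    ⟨trivial, hz⟩).hasFDerivAt
  exact h.comp_hasDerivAt (0 : ℝ) ((hasDerivAt_id (0 : ℝ)).prodMk (hasDerivAt_const _ z))

theorem velocity_smooth (hU : IsOpen (c ⁻¹' Ω))
    (hΦ : ContDiffOn ℝ ∞ (fun p : ℝ × ℂ => Φ p.1 (c p.2)) (Set.univ ×ˢ (c ⁻¹' Ω))) :
    ContDiffOn ℝ ∞ (velocity Φ c) (c ⁻¹' Ω) :=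
  ((hΦ.fderiv_of_isOpen (isOpen_univ.prod hU) (m := ∞) (by simp)).clm_apply
    contDiffOn_const).comp (f := fun z : ℂ => ((0 : ℝ), z)) (by fun_prop)
      (fun _ hz => ⟨trivial, hz⟩)

theorem velocity_orth (hU : IsOpen (c ⁻¹' Ω))
    (hΦ : ContDiffOn ℝ ∞ (fun p : ℝ × ℂ => Φ p.1 (c p.2)) (Set.univ ×ˢ (c ⁻¹' Ω)))
    (hn : ∀ t, ∀ p ∈ Ω, ‖Φ t p‖ = 1) (h0 : ∀ p ∈ Ω, Φ 0 p = f p) {z : ℂ} (hz : c z ∈ Ω) :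
    ⟪velocity Φ c z, f (c z)⟫ = 0 := by
  have h1 := hasDerivAt_velocity hU hΦ hz
  have h2 : HasDerivAt (fun t => ⟪Φ t (c z), Φ t (c z)⟫) _ 0 := h1.inner ℝ h1
  have h3 : (fun t => ⟪Φ t (c z), Φ t (c z)⟫) = fun _ => (1 : ℝ) := by
    ext t; rw [real_inner_self_eq_norm_sq, hn t _ hz]; norm_num
  rw [h3] at h2
  have h4 := h2.unique (hasDerivAt_const _ _)
  rw [real_inner_comm (velocity Φ c z), h0 _ hz] at h4
  linarith [real_inner_comm (velocity Φ c z) (f (c z))]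

theorem velocity_eq_zero (hU : IsOpen (c ⁻¹' Ω))
    (hΦ : ContDiffOn ℝ ∞ (fun p : ℝ × ℂ => Φ p.1 (c p.2)) (Set.univ ×ˢ (c ⁻¹' Ω)))
    (hout : ∀ t, ∀ p ∈ Ω, p ∉ K → Φ t p = f p) {z : ℂ} (hz : c z ∈ Ω) (hK : c z ∉ K) :
    velocity Φ c z = 0 := by
  have h1 := hasDerivAt_velocity hU hΦ hz
  rw [show (fun t => Φ t (c z)) = fun _ => f (c z) from funext fun t => hout t _ hz hK] at h1
  exact h1.unique (hasDerivAt_const _ _)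

end Velocity

/-- A conformal immersion that solves the Euler-Lagrange equation in both coordinates is Willmore.
The variation is split along the unit circle, and Stokes' theorem is applied to the two parts of the
variation field given by a partition of unity. -/
theorem isWillmoreOn_of_isCritical {Ω : Set (OnePoint ℂ)}
    {f : OnePoint ℂ → EuclideanSpace ℝ (Fin 7)}
    (H₀ : IsConformalSurface (f ∘ coordZero) (coordZero ⁻¹' Ω))
    (H₁ : IsConformalSurface (f ∘ coordInfty) (coordInfty ⁻¹' Ω))
    (C₀ : IsCritical (f ∘ coordZero) (coordZero ⁻¹' Ω))
    (C₁ : IsCritical (f ∘ coordInfty) (coordInfty ⁻¹' Ω)) : IsWillmoreOn Ω f := by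
  intro Φ K hK hKΩ hΦ hn h0 hout
  have hΦ₀ := hΦ coordZero (by simp [coords])
  have hΦ₁ := hΦ coordInfty (by simp [coords])
  have U₀ := H₀.isOpen
  have U₁ := H₁.isOpen
  have K₀ : IsClosed (coordZero ⁻¹' K) := hK.isClosed.preimage continuous_coordZero
  have K₁ : IsClosed (coordInfty ⁻¹' K) := hK.isClosed.preimage continuous_coordInfty
  have sub₀ : coordZero ⁻¹' K ⊆ coordZero ⁻¹' Ω := fun z hz => hKΩ hz
  have sub₁ : coordInfty ⁻¹' K ⊆ coordInfty ⁻¹' Ω := fun z hz => hKΩ hz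
  have v₀ := velocity_smooth U₀ hΦ₀
  have v₁ := velocity_smooth U₁ hΦ₁
  have o₀ : ∀ z ∈ coordZero ⁻¹' Ω, ⟪velocity Φ coordZero z, (f ∘ coordZero) z⟫ = 0 :=
    fun z hz => velocity_orth U₀ hΦ₀ hn h0 hz
  have o₁ : ∀ z ∈ coordInfty ⁻¹' Ω, ⟪velocity Φ coordInfty z, (f ∘ coordInfty) z⟫ = 0 :=
    fun z hz => velocity_orth U₁ hΦ₁ hn h0 hz
  have hm : ∀ ζ ∈ coordInfty ⁻¹' Ω, ζ ≠ 0 → ζ⁻¹ ∈ coordZero ⁻¹' Ω := fun ζ hζ h0 => by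
    rwa [Set.mem_preimage, ← coordInfty_of_ne h0]
  have vel : ∀ ζ, ζ ≠ 0 → coordInfty ζ ∈ Ω → velocity Φ coordInfty ζ =
      velocity Φ coordZero ζ⁻¹ := by
    intro ζ hζ hΩ
    have h1 := hasDerivAt_velocity U₁ hΦ₁ hΩ
    have h2 := hasDerivAt_velocity U₀ hΦ₀ (hm ζ hΩ hζ)
    rw [← coordInfty_of_ne hζ] at h2
    exact h1.unique h2
  -- the partition of unity
  let χ : ContDiffBump (0 : ℂ) := ⟨2, 3, by norm_num, by norm_num⟩
  have χ1 : ∀ z : ℂ, ‖z‖ ≤ 2 → χ z = 1 := fun z hz =>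
    χ.one_of_mem_closedBall (by simpa [χ] using hz)
  have χ0 : ∀ z : ℂ, 3 ≤ ‖z‖ → χ z = 0 := fun z hz =>
    χ.zero_of_le_dist (by simpa [χ] using hz)
  let ψ : ℂ → ℝ := fun ζ => if ζ = 0 then 1 else 1 - χ ζ⁻¹
  have ψs : ContDiff ℝ ∞ ψ := contDiff_iff_contDiffAt.2 fun ζ => by
    by_cases hζ : ζ = 0
    · have : ∀ ξ ∈ Metric.ball (0 : ℂ) 3⁻¹, ψ ξ = 1 := fun ξ hξ => by
        by_cases h : ξ = 0
        · simp [ψ, h]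
        · have h1 : ‖ξ‖ < 3⁻¹ := by simpa using hξ
          have h2 : 3 ≤ ‖ξ⁻¹‖ := by
            rw [norm_inv]
            exact (le_inv_comm₀ (by norm_num) (norm_pos_iff.2 h)).2 h1.le
          simp [ψ, h, χ0 _ h2]
      subst hζ
      exact contDiffAt_const.congr_of_eventuallyEq (Filter.eventually_of_mem
        (Metric.ball_mem_nhds _ (by norm_num)) this)
    · have h1 : ContDiffAt ℝ ∞ (fun ζ : ℂ => 1 - χ ζ⁻¹) ζ :=
        contDiffAt_const.sub (χ.contDiff.contDiffAt.comp ζ (contDiffAt_inv ℝ hζ))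
      exact h1.congr_of_eventuallyEq (Filter.eventually_of_mem (isOpen_ne.mem_nhds hζ)
        fun ξ hξ => by simp only [ψ]; rw [if_neg hξ])
  let X₀ : ℂ → EuclideanSpace ℝ (Fin 7) :=
    (coordZero ⁻¹' Ω).indicator fun z => χ z • velocity Φ coordZero z
  let X₁ : ℂ → EuclideanSpace ℝ (Fin 7) :=
    (coordInfty ⁻¹' Ω).indicator fun z => ψ z • velocity Φ coordInfty z
  have x₀ : ∀ z ∈ coordZero ⁻¹' Ω, X₀ z = χ z • velocity Φ coordZero z := fun z hz =>
    Set.indicator_of_mem hz _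
  have x₁ : ∀ z ∈ coordInfty ⁻¹' Ω, X₁ z = ψ z • velocity Φ coordInfty z := fun z hz =>
    Set.indicator_of_mem hz _
  have s₀ : ContDiffOn ℝ ∞ X₀ (coordZero ⁻¹' Ω) := (χ.contDiff.contDiffOn.smul v₀).congr x₀
  have s₁ : ContDiffOn ℝ ∞ X₁ (coordInfty ⁻¹' Ω) := (ψs.contDiffOn.smul v₁).congr x₁
  have p₀ : ∀ z ∈ coordZero ⁻¹' Ω, ⟪X₀ z, (f ∘ coordZero) z⟫ = 0 := fun z hz => by
    rw [x₀ z hz, real_inner_smul_left, o₀ z hz, mul_zero]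
  have p₁ : ∀ z ∈ coordInfty ⁻¹' Ω, ⟪X₁ z, (f ∘ coordInfty) z⟫ = 0 := fun z hz => by
    rw [x₁ z hz, real_inner_smul_left, o₁ z hz, mul_zero]
  have z₀ : ∀ z, z ∉ coordZero ⁻¹' K ∩ Metric.closedBall 0 3 → X₀ z = 0 := fun z hz => by
    by_cases hΩ : z ∈ coordZero ⁻¹' Ω
    · rw [x₀ z hΩ]
      by_cases hzK : coordZero z ∈ K
      · have : ¬ ‖z‖ ≤ 3 := fun h => hz ⟨hzK, by simpa using h⟩
        rw [χ0 z (by linarith), zero_smul]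
      · rw [velocity_eq_zero U₀ hΦ₀ hout hΩ hzK, smul_zero]
    · exact Set.indicator_of_notMem hΩ _
  have z₁ : ∀ z, z ∉ coordInfty ⁻¹' K ∩ Metric.closedBall 0 2⁻¹ → X₁ z = 0 := fun z hz => by
    by_cases hΩ : z ∈ coordInfty ⁻¹' Ω
    · rw [x₁ z hΩ]
      by_cases hzK : coordInfty z ∈ K
      · have h1 : 2⁻¹ < ‖z‖ := not_le.1 fun h => hz ⟨hzK, by simpa using h⟩
        have h2 : z ≠ 0 := by rintro rfl; norm_num at h1
        have h3 : ‖z⁻¹‖ ≤ 2 := by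
          rw [norm_inv]
          exact (inv_le_comm₀ (norm_pos_iff.2 h2) (by norm_num)).2 h1.le
        have : ψ z = 0 := by simp [ψ, h2, χ1 _ h3]
        rw [this, zero_smul]
      · rw [velocity_eq_zero U₁ hΦ₁ hout hΩ hzK, smul_zero]
    · exact Set.indicator_of_notMem hΩ _
  have k₀ : IsCompact (coordZero ⁻¹' K ∩ Metric.closedBall 0 3) :=
    (isCompact_closedBall _ _).inter_left K₀
  have k₁ : IsCompact (coordInfty ⁻¹' K ∩ Metric.closedBall 0 2⁻¹) :=
    (isCompact_closedBall _ _).inter_left K₁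
  obtain ⟨i₀, I₀⟩ := H₀.integral_firstVariation_eq_zero C₀ s₀ p₀ k₀
    (fun z hz => sub₀ hz.1) z₀
  obtain ⟨i₁, I₁⟩ := H₁.integral_firstVariation_eq_zero C₁ s₁ p₁ k₁
    (fun z hz => sub₁ hz.1) z₁
  have w₀ : ∀ z, z ∉ coordZero ⁻¹' K ∩ Metric.closedBall 0 3 →
      firstVariation (f ∘ coordZero) X₀ z = 0 := fun z hz => by
    rw [firstVariation_congr k₀.isClosed.isOpen_compl (W := fun _ => 0) z₀ hz, firstVariation_zero]
  have w₁ : ∀ z, z ∉ coordInfty ⁻¹' K ∩ Metric.closedBall 0 2⁻¹ →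
      firstVariation (f ∘ coordInfty) X₁ z = 0 := fun z hz => by
    rw [firstVariation_congr k₁.isClosed.isOpen_compl (W := fun _ => 0) z₁ hz, firstVariation_zero]
  -- the two parts of the support
  set A : Set ℂ := coordZero ⁻¹' K ∩ Metric.closedBall 0 1 with hA
  set S : Set ℂ := coordInfty ⁻¹' K ∩ (Metric.ball 0 1 ∩ {ζ | ζ ≠ 0}) with hS
  have kA : IsCompact A := (isCompact_closedBall _ _).inter_left K₀
  have kS : IsCompact (coordInfty ⁻¹' K ∩ Metric.closedBall 0 1) :=
    (isCompact_closedBall _ _).inter_left K₁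
  have mS : MeasurableSet S :=
    K₁.measurableSet.inter (Metric.isOpen_ball.inter isOpen_ne).measurableSet
  have nS : ∀ ζ ∈ S, ζ ≠ 0 := fun ζ hζ => hζ.2.2
  have SΩ : ∀ ζ ∈ S, coordInfty ζ ∈ Ω := fun ζ hζ => hKΩ hζ.1
  have hT : Inv.inv '' S = coordZero ⁻¹' K ∩ (Metric.closedBall 0 1)ᶜ := by
    ext z
    constructor
    · rintro ⟨ζ, ⟨h1, h2, h3⟩, rfl⟩
      have h3' : ζ ≠ 0 := h3
      refine ⟨by rw [Set.mem_preimage, ← coordInfty_of_ne h3']; exact h1, ?_⟩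
      have : ‖ζ‖ < 1 := by simpa using h2
      simp only [Set.mem_compl_iff, Metric.mem_closedBall, dist_zero_right, norm_inv, not_le]
      exact (one_lt_inv₀ (norm_pos_iff.2 h3')).2 this
    · rintro ⟨h1, h2⟩
      have h3 : 1 < ‖z‖ := by simpa using h2
      have h4 : z ≠ 0 := by rintro rfl; norm_num at h3
      refine ⟨z⁻¹, ⟨by rw [Set.mem_preimage, coordZero_inv_inv h4]; exact h1, ?_,
        inv_ne_zero h4⟩, inv_inv z⟩
      simpa [norm_inv] using inv_lt_one_of_one_lt₀ h3
  have hAT : coordZero ⁻¹' K = A ∪ Inv.inv '' S := by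
    rw [hT, ← Set.inter_union_distrib_left, Set.union_compl_self, Set.inter_univ]
  have hdisj : Disjoint A (Inv.inv '' S) := by
    rw [hT]
    exact (disjoint_compl_right (a := Metric.closedBall (0 : ℂ) 1)).mono Set.inter_subset_right
      Set.inter_subset_right
  have mT : MeasurableSet (Inv.inv '' S) := by
    rw [hT]; exact K₀.measurableSet.inter Metric.isClosed_closedBall.measurableSet.compl
  -- the density of the variation near the two parts
  obtain ⟨a1, a2, a3⟩ := H₀.hasDerivAt_setIntegral_density hΦ₀ (fun z hz => h0 _ hz)
    (V := velocity Φ coordZero)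
    (fun z _ => rfl) o₀ kA (fun z hz => sub₀ hz.1) kA.measurableSet subset_rfl
  obtain ⟨b1, b2, b3⟩ := H₁.hasDerivAt_setIntegral_density hΦ₁ (fun z hz => h0 _ hz)
    (V := velocity Φ coordInfty)
    (fun z _ => rfl) o₁ kS (fun z hz => sub₁ hz.1) mS
    (fun z hz => ⟨hz.1, Metric.ball_subset_closedBall hz.2.1⟩)
  have hdens : ∀ t, Set.EqOn (willmoreDensity fun ζ => Φ t (coordInfty ζ))
      (fun ζ => Complex.normSq (-(ζ ^ 2)⁻¹) *
        willmoreDensity (fun ζ => Φ t (coordZero ζ)) ζ⁻¹) S := by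
    intro t ζ hζ
    refine willmoreDensity_coordInfty U₀ U₁ hm ?_ (fun ξ _ hξ => by rw [coordInfty_of_ne hξ])
      (SΩ ζ hζ) (nS ζ hζ)
    exact hΦ₀.comp (f := fun z : ℂ => (t, z)) (by fun_prop) (fun _ hz => ⟨trivial, hz⟩)
  have hsplit : ∀ᶠ t in 𝓝 (0 : ℝ), (∫ z in coordZero ⁻¹' K, willmoreDensity (Φ t ∘ coordZero) z) =
      (∫ z in A, willmoreDensity (fun ζ => Φ t (coordZero ζ)) z) +
      ∫ z in S, willmoreDensity (fun ζ => Φ t (coordInfty ζ)) z := by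
    filter_upwards [a1, b1] with t ht1 ht2
    obtain ⟨e1, e2⟩ := integral_inv_image mS nS (willmoreDensity fun ζ => Φ t (coordZero ζ))
    rw [integrableOn_congr_fun (hdens t) mS, ← e1] at ht2
    rw [hAT, setIntegral_congr_fun mS (hdens t), ← e2]
    exact setIntegral_union hdisj mT ht1 ht2
  -- Stokes' theorem
  have hvA : Set.EqOn (firstVariation (f ∘ coordZero) (velocity Φ coordZero))
      (firstVariation (f ∘ coordZero) X₀) A := fun z hz => by
    refine firstVariation_congr (U := coordZero ⁻¹' Ω ∩ Metric.ball 0 2)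
      (U₀.inter Metric.isOpen_ball) (fun ξ hξ => ?_) ⟨sub₀ hz.1, ?_⟩
    · have : ‖ξ‖ < 2 := by simpa using hξ.2
      rw [x₀ ξ hξ.1, χ1 ξ this.le, one_smul]
    · exact Metric.closedBall_subset_ball (by norm_num) hz.2
  have hvS : Set.EqOn (fun ζ => Complex.normSq (-(ζ ^ 2)⁻¹) *
      firstVariation (f ∘ coordZero) X₀ ζ⁻¹) (fun ζ => firstVariation (f ∘ coordInfty)
        (velocity Φ coordInfty) ζ - firstVariation (f ∘ coordInfty) X₁ ζ) S := fun ζ hζ => by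
    simp only
    rw [← firstVariation_sub U₁ v₁ s₁ (SΩ ζ hζ)]
    refine (firstVariation_coordInfty H₀ H₁ s₀ p₀ (fun ξ hξ hξΩ => ?_) (nS ζ hζ) (SΩ ζ hζ)).symm
    rw [x₁ ξ hξΩ, x₀ _ (hm ξ hξΩ hξ), vel ξ hξ hξΩ]
    simp only [ψ, if_neg hξ]
    module
  have hS1 : ∫ ζ in S, firstVariation (f ∘ coordInfty) X₁ ζ = 0 := by
    rw [setIntegral_eq_integral_of_ae_compl_eq_zero, I₁]
    have h1 : ∀ᵐ ζ : ℂ, ζ ≠ 0 := by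
      rw [ae_iff]; simp
    filter_upwards [h1] with ζ hζ hζS
    refine w₁ ζ fun h => hζS ⟨h.1, Metric.closedBall_subset_ball (by norm_num) h.2, hζ⟩
  have hA1 : (∫ z in A, firstVariation (f ∘ coordZero) X₀ z) +
      ∫ z in Inv.inv '' S, firstVariation (f ∘ coordZero) X₀ z = 0 := by
    rw [← setIntegral_union hdisj mT i₀.integrableOn i₀.integrableOn, ← hAT,
      setIntegral_eq_integral_of_forall_compl_eq_zero, I₀]
    exact fun z hz => w₀ z fun h => hz h.1
  rw [(integral_inv_image mS nS _).2, setIntegral_congr_fun mS hvS,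
    integral_sub b2 i₁.integrableOn, hS1, sub_zero, ← setIntegral_congr_fun kA.measurableSet hvA]
    at hA1
  have hfin := a3.add b3
  rw [hA1] at hfin
  exact hfin.congr_of_eventuallyEq hsplit

/-! ### Polynomials in `z` and `z̄` and null coordinates -/

/-- A polynomial in `z` and `z̄`: a list of monomials `c zⁱ z̄ʲ`. -/
abbrev BiPoly : Type := List (ℂ × ℕ × ℕ)

/-- The value of a polynomial in `z` and `z̄`. -/
def ev (l : BiPoly) (z : ℂ) : ℂ :=
  (l.map fun m => m.1 * z ^ m.2.1 * (starRingEnd ℂ) z ^ m.2.2).sum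

/-- The formal derivative with respect to `z`. -/
def dZ (l : BiPoly) : BiPoly := l.map fun m => (m.1 * m.2.1, m.2.1 - 1, m.2.2)

/-- The formal derivative with respect to `z̄`. -/
def dW (l : BiPoly) : BiPoly := l.map fun m => (m.1 * m.2.2, m.2.1, m.2.2 - 1)

theorem ev_nil (z : ℂ) : ev [] z = 0 := rfl

theorem ev_cons (c : ℂ) (i j : ℕ) (l : BiPoly) (z : ℂ) :
    ev ((c, i, j) :: l) z = c * z ^ i * (starRingEnd ℂ) z ^ j + ev l z := by
  simp [ev]

theorem dZ_nil : dZ [] = [] := rfl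

theorem dZ_cons (c : ℂ) (i j : ℕ) (l : BiPoly) :
    dZ ((c, i, j) :: l) = (c * i, i - 1, j) :: dZ l := rfl

theorem dW_nil : dW [] = [] := rfl

theorem dW_cons (c : ℂ) (i j : ℕ) (l : BiPoly) :
    dW ((c, i, j) :: l) = (c * j, i, j - 1) :: dW l := rfl

theorem contDiff_ev (l : BiPoly) : ContDiff ℝ ∞ (ev l) := by
  induction l with
  | nil => exact contDiff_const
  | cons m l ih =>
    obtain ⟨c, i, j⟩ := m
    rw [funext (ev_cons c i j l)]
    exact ((contDiff_const.mul (contDiff_id.pow i)).mul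
      (Complex.conjCLE.contDiff.pow j)).add ih

theorem wd_pow (s : ℂ) {g : ℂ → ℂ} {z : ℂ} (hg : DifferentiableAt ℝ g z) (n : ℕ) :
    wd s (fun ζ => g ζ ^ n) z = n * g z ^ (n - 1) * wd s g z := by
  induction n with
  | zero => simp [wd_const]
  | succ n ih =>
    simp only [pow_succ]
    rw [wd_mul (c := fun ζ => g ζ ^ n) (hg.pow n) hg, ih]
    cases n with
    | zero => simp
    | succ n => simp only [Nat.add_sub_cancel, pow_succ]; push_cast; ring

theorem wd_monomial (s c : ℂ) (i j : ℕ) (z : ℂ) :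
    wd s (fun ζ => c * ζ ^ i * (starRingEnd ℂ) ζ ^ j) z =
      (1 + s * Complex.I) / 2 * (c * i * z ^ (i - 1) * (starRingEnd ℂ) z ^ j) +
      (1 - s * Complex.I) / 2 * (c * j * z ^ i * (starRingEnd ℂ) z ^ (j - 1)) := by
  have d1 : DifferentiableAt ℝ (fun ζ : ℂ => ζ) z := differentiableAt_fun_id
  have d2 : DifferentiableAt ℝ (fun ζ : ℂ => (starRingEnd ℂ) ζ) z :=
    Complex.conjCLE.differentiableAt
  have d3 : DifferentiableAt ℝ (fun ζ : ℂ => c * ζ ^ i) z := (d1.pow i).const_mul c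
  rw [wd_mul (c := fun ζ => c * ζ ^ i) (d := fun ζ => (starRingEnd ℂ) ζ ^ j) d3 (d2.pow j),
    wd_pow s d2, wd_mul (c := fun _ => c) (d := fun ζ => ζ ^ i) (differentiableAt_const c)
      (d1.pow i),
    wd_const, wd_pow s d1, wd_id, wd_star]
  ring

theorem differentiableAt_ev (l : BiPoly) (z : ℂ) : DifferentiableAt ℝ (ev l) z :=
  (contDiff_ev l).differentiable (by simp) z

theorem differentiableAt_monomial (c : ℂ) (i j : ℕ) (z : ℂ) :
    DifferentiableAt ℝ (fun ζ => c * ζ ^ i * (starRingEnd ℂ) ζ ^ j) z := by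
  have d2 : DifferentiableAt ℝ (fun ζ : ℂ => (starRingEnd ℂ) ζ) z :=
    Complex.conjCLE.differentiableAt
  exact ((differentiableAt_fun_id.pow i).const_mul c).mul (d2.pow j)

theorem wd_ev (s : ℂ) (l : BiPoly) (z : ℂ) : wd s (ev l) z =
    (1 + s * Complex.I) / 2 * ev (dZ l) z + (1 - s * Complex.I) / 2 * ev (dW l) z := by
  induction l with
  | nil => rw [show ev [] = fun _ => 0 from rfl, wd_const]; simp [dZ_nil, dW_nil, ev_nil]
  | cons m l ih =>
    obtain ⟨c, i, j⟩ := m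
    rw [funext (ev_cons c i j l), wd_add (f := fun ζ => c * ζ ^ i * (starRingEnd ℂ) ζ ^ j)
      (differentiableAt_monomial c i j z) (differentiableAt_ev l z), ih, wd_monomial, dZ_cons,
      dW_cons, ev_cons, ev_cons]
    ring

theorem dz_ev (l : BiPoly) : δz (ev l) = ev (dZ l) := by
  ext z
  rw [wd_ev]
  linear_combination (-(ev (dZ l) z - ev (dW l) z) / 2) * Complex.I_sq

theorem dw_ev (l : BiPoly) : δw (ev l) = ev (dW l) := by
  ext z
  rw [wd_ev]
  linear_combination ((ev (dZ l) z - ev (dW l) z) / 2) * Complex.I_sq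

/-- The value of a vector of polynomials. -/
def evv (P : Fin 8 → BiPoly) (z : ℂ) : Fin 8 → ℂ := fun i => ev (P i) z

/-- The bilinear form of Minkowski space in the null coordinates `a, b, p₁, p₂, p₃, m₁, m₂, m₃`. -/
def nullForm (x y : Fin 8 → ℂ) : ℂ :=
  2⁻¹ * (-(x 0 * y 1) - x 1 * y 0 + x 2 * y 5 + x 3 * y 6 + x 4 * y 7 + x 5 * y 2 + x 6 * y 3 +
    x 7 * y 4)

/-- Complex conjugation in null coordinates. -/
def nullConj (x : Fin 8 → ℂ) : Fin 8 → ℂ :=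
  ![(starRingEnd ℂ) (x 0), (starRingEnd ℂ) (x 1), (starRingEnd ℂ) (x 5), (starRingEnd ℂ) (x 6),
    (starRingEnd ℂ) (x 7), (starRingEnd ℂ) (x 2), (starRingEnd ℂ) (x 3), (starRingEnd ℂ) (x 4)]

/-- The vector with given null coordinates: `x₀ ± x₁ = a, b`, and `(x₂ⱼ, x₂ⱼ₊₁)` is the vector with
the components `λ pⱼ`, `λ⁻¹ mⱼ` in a null basis of the plane. Rotating the three planes by `λ`
produces the associated family. -/
def nullVec (l : ℂ) : (Fin 8 → ℂ) →L[ℂ] (Fin 8 → ℂ) :=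
  LinearMap.toContinuousLinearMap
    { toFun := fun x => ![(x 0 + x 1) / 2, (x 0 - x 1) / 2,
        Complex.I * (l * x 2 - l⁻¹ * x 5) / 2, (l * x 2 + l⁻¹ * x 5) / 2,
        Complex.I * (l * x 3 - l⁻¹ * x 6) / 2, (l * x 3 + l⁻¹ * x 6) / 2,
        Complex.I * (l * x 4 - l⁻¹ * x 7) / 2, (l * x 4 + l⁻¹ * x 7) / 2]
      map_add' := fun x y => by ext i; fin_cases i <;> simp <;> ring
      map_smul' := fun c x => by ext i; fin_cases i <;> simp <;> ring }

theorem nullVec_apply (l : ℂ) (x : Fin 8 → ℂ) : nullVec l x =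
    ![(x 0 + x 1) / 2, (x 0 - x 1) / 2,
      Complex.I * (l * x 2 - l⁻¹ * x 5) / 2, (l * x 2 + l⁻¹ * x 5) / 2,
      Complex.I * (l * x 3 - l⁻¹ * x 6) / 2, (l * x 3 + l⁻¹ * x 6) / 2,
      Complex.I * (l * x 4 - l⁻¹ * x 7) / 2, (l * x 4 + l⁻¹ * x 7) / 2] := rfl

theorem lor_nullVec {l : ℂ} (hl : l ≠ 0) (x y : Fin 8 → ℂ) :
    lor (nullVec l x) (nullVec l y) = nullForm x y := by
  simp only [lor, nullVec_apply, nullForm, Fin.sum_univ_seven]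
  simp
  field_simp
  ring_nf
  simp only [Complex.I_sq]
  ring

theorem conj_eq_inv_of_norm {l : ℂ} (hl : ‖l‖ = 1) : (starRingEnd ℂ) l = l⁻¹ := by
  rw [Complex.inv_def, Complex.normSq_eq_norm_sq, hl]; simp

theorem ne_zero_of_norm {l : ℂ} (hl : ‖l‖ = 1) : l ≠ 0 := by
  rintro rfl; simp at hl

theorem conjVec_nullVec {l : ℂ} (hl : ‖l‖ = 1) (x : Fin 8 → ℂ) :
    conjVec (nullVec l x) = nullVec l (nullConj x) := by
  ext i
  fin_cases i <;> simp [conjVec, nullVec_apply, nullConj, conj_eq_inv_of_norm hl,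
    map_ofNat] <;> ring

theorem nullVec_injective {l : ℂ} (hl : l ≠ 0) {x : Fin 8 → ℂ} (h : nullVec l x = 0) : x = 0 := by
  have h1 : ∀ y, nullForm x y = 0 := fun y => by rw [← lor_nullVec hl, h, lor_zero_left]
  ext i
  fin_cases i
  · simpa [nullForm] using h1 (Pi.single 1 1)
  · simpa [nullForm] using h1 (Pi.single 0 1)
  · simpa [nullForm] using h1 (Pi.single 5 1)
  · simpa [nullForm] using h1 (Pi.single 6 1)
  · simpa [nullForm] using h1 (Pi.single 7 1)
  · simpa [nullForm] using h1 (Pi.single 2 1)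
  · simpa [nullForm] using h1 (Pi.single 3 1)
  · simpa [nullForm] using h1 (Pi.single 4 1)

/-! ### Surfaces given by an arbitrary real light cone lift -/

/-- The point of `S⁶` represented by the null vector `X z`. -/
def projPoint (X : ℂ → Fin 8 → ℂ) (z : ℂ) : EuclideanSpace ℝ (Fin 7) :=
  WithLp.toLp 2 fun i => (X z i.succ / X z 0).re

/-- `X` is a smooth real future-directed conformal light cone lift. -/
structure IsRealLift (X : ℂ → Fin 8 → ℂ) : Prop where
  smooth : ContDiff ℝ ∞ X
  real : ∀ z, conjVec (X z) = X z
  pos : ∀ z, 0 < (X z 0).re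
  null : ∀ z, lor (X z) (X z) = 0
  conf : ∀ z, lor (δz X z) (δz X z) = 0

namespace IsRealLift

variable {X : ℂ → Fin 8 → ℂ}

theorem ofReal_re (N : IsRealLift X) (z : ℂ) (i : Fin 8) : ((X z i).re : ℂ) = X z i :=
  Complex.conj_eq_iff_re.1 (congrFun (N.real z) i)

theorem time_ne_zero (N : IsRealLift X) (z : ℂ) : X z 0 ≠ 0 := fun h => by
  have := N.pos z
  rw [h] at this
  simp at this

theorem ofReal_projPoint (N : IsRealLift X) (z : ℂ) (i : Fin 7) :
    ((projPoint X z i : ℝ) : ℂ) = X z i.succ / X z 0 := by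
  change (((X z i.succ / X z 0).re : ℝ) : ℂ) = _
  rw [← N.ofReal_re z i.succ, ← N.ofReal_re z 0, ← Complex.ofReal_div, Complex.ofReal_re]

theorem lightLift_eq (N : IsRealLift X) : lightLift (projPoint X) = fun z => (X z 0)⁻¹ • X z := by
  ext z i
  refine Fin.cases ?_ (fun i => ?_) i
  · simp [lightLift, N.time_ne_zero z]
  · simp only [lightLift, Fin.cons_succ, N.ofReal_projPoint, Pi.smul_apply, smul_eq_mul]
    rw [div_eq_inv_mul]

theorem contDiff_scale (N : IsRealLift X) : ContDiff ℝ ∞ fun z => (X z 0)⁻¹ :=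
  (contDiff_pi.1 N.smooth 0).inv N.time_ne_zero

theorem contDiff_projPoint (N : IsRealLift X) : ContDiff ℝ ∞ (projPoint X) := by
  refine (contDiff_piLp 2).2 fun i => ?_
  have : ContDiff ℝ ∞ fun z => X z i.succ * (X z 0)⁻¹ :=
    (contDiff_pi.1 N.smooth i.succ).mul N.contDiff_scale
  exact Complex.reCLM.contDiff.comp this

theorem dX (N : IsRealLift X) (z : ℂ) : DifferentiableAt ℝ X z :=
  N.smooth.differentiable (by simp) z

theorem dρ (N : IsRealLift X) (z : ℂ) : DifferentiableAt ℝ (fun z => (X z 0)⁻¹) z :=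
  N.contDiff_scale.differentiable (by simp) z

theorem contDiff_wd {E : Type*} [NormedAddCommGroup E] [NormedSpace ℂ E] {g : ℂ → E}
    (hg : ContDiff ℝ ∞ g) (s : ℂ) : ContDiff ℝ ∞ (wd s g) :=
  contDiffOn_univ.1 (contDiffOn_wd isOpen_univ (contDiffOn_univ.2 hg))

theorem lor_self_wd (N : IsRealLift X) (s z : ℂ) : lor (X z) (wd s X z) = 0 := by
  have h := wd_lor (s := s) (N.dX z) (N.dX z)
  rw [show (fun ζ => lor (X ζ) (X ζ)) = fun _ => 0 from funext N.null, wd_const,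
    lor_comm (wd s X z)] at h
  linear_combination -(1 / 2 : ℂ) * h

theorem wd_lift (N : IsRealLift X) (s : ℂ) : wd s (lightLift (projPoint X)) =
    fun z => (X z 0)⁻¹ • wd s X z + wd s (fun z => (X z 0)⁻¹) z • X z := by
  ext1 z
  rw [N.lightLift_eq, wd_smul (N.dρ z) (N.dX z)]

theorem norm_projPoint (N : IsRealLift X) (z : ℂ) : ‖projPoint X z‖ = 1 := by
  have h0 : lor (lightLift (projPoint X) z) (lightLift (projPoint X) z) = 0 := by
    rw [N.lightLift_eq]
    simp only [lor_smul_left, lor_smul_right, N.null]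
    ring
  have h1 : ∑ i : Fin 7, ((projPoint X z i : ℝ) : ℂ) * (projPoint X z i : ℝ) = 1 := by
    simp only [lor, lightLift, Fin.cons_zero, Fin.cons_succ] at h0
    linear_combination h0
  have h2 : ∑ i : Fin 7, projPoint X z i * projPoint X z i = 1 := by exact_mod_cast h1
  have h3 := EuclideanSpace.norm_sq_eq (projPoint X z)
  simp only [← pow_two] at h2
  simp only [Real.norm_eq_abs, sq_abs, h2] at h3
  nlinarith [norm_nonneg (projPoint X z)]

theorem conformal (N : IsRealLift X) (z : ℂ) : lor (δz (lightLift (projPoint X)) z)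
    (δz (lightLift (projPoint X)) z) = 0 := by
  rw [N.wd_lift]
  simp only [lor_add_left, lor_add_right, lor_smul_left, lor_smul_right, N.null, N.conf,
    lor_comm (δz X z) (X z), N.lor_self_wd]
  ring

theorem confFactor_eq (N : IsRealLift X) (z : ℂ) : confFactor (projPoint X) z =
    (X z 0)⁻¹ ^ 2 * lor (δz X z) (δw X z) := by
  rw [confFactor, N.wd_lift, N.wd_lift]
  simp only [lor_add_left, lor_add_right, lor_smul_left, lor_smul_right, N.null,
    lor_comm (δz X z) (X z), N.lor_self_wd]
  ring

theorem surf (N : IsRealLift X) {U : Set ℂ} (hU : IsOpen U)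
    (hG : ∀ z ∈ U, lor (δz X z) (δw X z) ≠ 0) : IsConformalSurface (projPoint X) U where
  isOpen := hU
  smooth := N.contDiff_projPoint.contDiffOn
  norm_eq z _ := N.norm_projPoint z
  conformal z _ := N.conformal z
  immersed z hz := injective_fderiv_of_confFactor_ne_zero
    (N.contDiff_projPoint.differentiable (by simp) z) (N.conformal z) (by
      rw [N.confFactor_eq]
      exact mul_ne_zero (pow_ne_zero 2 (inv_ne_zero (N.time_ne_zero z))) (hG z hz))

/-- The isotropy data in terms of an arbitrary lift `X` instead of the normalized lift `(1, f)`. -/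
theorem isotropicData (N : IsRealLift X) {U : Set ℂ} (hU : IsOpen U) {v₁ v₂ : ℂ → Fin 8 → ℂ}
    {α β k e g : ℂ → ℂ} (sv₁ : ContDiff ℝ ∞ v₁) (sv₂ : ContDiff ℝ ∞ v₂) (sα : ContDiff ℝ ∞ α)
    (sβ : ContDiff ℝ ∞ β) (sk : ContDiff ℝ ∞ k) (se : ContDiff ℝ ∞ e) (sg : ContDiff ℝ ∞ g)
    (hg : ∀ z, lor (δz X z) (δw X z) = g z) (g0 : ∀ z ∈ U, g z ≠ 0)
    (anti₁ : ∀ z, δz v₁ z = 0) (anti₂ : ∀ z, δz v₂ z = 0)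
    (iso : ∀ z, lor (v₁ z) (v₁ z) = 0 ∧ lor (v₁ z) (v₂ z) = 0 ∧ lor (v₂ z) (v₂ z) = 0)
    (orth : ∀ z, lor (X z) (v₁ z) = 0 ∧ lor (X z) (v₂ z) = 0)
    (orth' : ∀ z, lor (δw X z) (v₁ z) = 0 ∧ lor (δw X z) (v₂ z) = 0)
    (horiz : ∀ z, lor (δw v₁ z) (v₂ z) = 0)
    (indep : ∀ z ∈ U, ∀ a b : ℂ, a • v₁ z + b • v₂ z = 0 → a = 0 ∧ b = 0)
    (ne : ∀ z ∈ U, α z ≠ 0 ∨ β z ≠ 0)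
    (key : ∀ z, g z • δz (δz X) z = δz g z • δz X z +
      k z • (α z • v₁ z + β z • v₂ z) - e z • X z) :
    ∃ n p q, IsotropicData (projPoint X) U v₁ v₂ α β n p q := by
  set ρ : ℂ → ℂ := fun z => (X z 0)⁻¹ with hρ
  have sρ := N.contDiff_scale
  have sρz := contDiff_wd sρ (-Complex.I)
  have sρi : ContDiff ℝ ∞ fun z => X z 0 := contDiff_pi.1 N.smooth 0
  have sgi : ContDiffOn ℝ ∞ (fun z => (g z)⁻¹) U := sg.contDiffOn.inv g0
  have sq : ContDiffOn ℝ ∞ (fun z => δz g z * (g z)⁻¹ + 2 * (δz ρ z * X z 0)) U :=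
    ((contDiff_wd sg _).contDiffOn.mul sgi).add
      (contDiff_const.mul (sρz.mul sρi)).contDiffOn
  refine ⟨fun z => ρ z * k z * (g z)⁻¹, fun z => (δz (δz ρ) z - ρ z * e z * (g z)⁻¹ -
    (δz g z * (g z)⁻¹ + 2 * (δz ρ z * X z 0)) * δz ρ z) * X z 0,
    fun z => δz g z * (g z)⁻¹ + 2 * (δz ρ z * X z 0),
    { surf := N.surf hU fun z hz => by rw [hg]; exact g0 z hz
      sv₁ := sv₁.contDiffOn
      sv₂ := sv₂.contDiffOn
      sα := sα.contDiffOn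
      sβ := sβ.contDiffOn
      sn := (sρ.mul sk).contDiffOn.mul sgi
      sp := (((contDiff_wd sρz _).contDiffOn.sub ((sρ.mul se).contDiffOn.mul sgi)).sub
        (sq.mul sρz.contDiffOn)).mul sρi.contDiffOn
      sq := sq
      anti₁ := fun z _ => anti₁ z
      anti₂ := fun z _ => anti₂ z
      iso₁₁ := fun z _ => (iso z).1
      iso₁₂ := fun z _ => (iso z).2.1
      iso₂₂ := fun z _ => (iso z).2.2
      orth₁ := fun z _ => by rw [N.lightLift_eq, lor_smul_left, (orth z).1, mul_zero]
      orth₂ := fun z _ => by rw [N.lightLift_eq, lor_smul_left, (orth z).2, mul_zero]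
      orth₁' := fun z _ => by
        rw [N.wd_lift, lor_add_left, lor_smul_left, lor_smul_left, (orth z).1, (orth' z).1]; ring
      orth₂' := fun z _ => by
        rw [N.wd_lift, lor_add_left, lor_smul_left, lor_smul_left, (orth z).2, (orth' z).2]; ring
      horiz := fun z _ => horiz z
      indep := indep
      ne := ne
      lift_zz := fun z hz => ?_ }⟩
  have dXz : DifferentiableAt ℝ (δz X) z :=
    (contDiff_wd N.smooth _).differentiable (by simp) z
  have dρz : DifferentiableAt ℝ (δz ρ) z := sρz.differentiable (by simp) z
  have e1 : δz (δz (lightLift (projPoint X))) z = ρ z • δz (δz X) z +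
      (2 * δz ρ z) • δz X z + δz (δz ρ) z • X z := by
    rw [N.wd_lift, wd_add_smul_smul (N.dρ z) dXz dρz (N.dX z)]
    module
  have e2 : δz (δz X) z = (g z)⁻¹ • (δz g z • δz X z +
      k z • (α z • v₁ z + β z • v₂ z) - e z • X z) := by
    rw [← key, smul_smul, inv_mul_cancel₀ (g0 z hz), one_smul]
  have e3 : X z 0 * ρ z = 1 := mul_inv_cancel₀ (N.time_ne_zero z)
  rw [e1, e2, N.wd_lift, N.lightLift_eq]
  ext i
  simp only [Pi.add_apply, Pi.smul_apply, Pi.sub_apply, smul_eq_mul]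
  change _ = _ * (ρ z * X z i) + _ * (ρ z * δz X z i + δz ρ z * X z i) + _
  linear_combination (-(δz (δz ρ) z - ρ z * e z * (g z)⁻¹ -
    (δz g z * (g z)⁻¹ + 2 * (δz ρ z * X z 0)) * δz ρ z) * X z i - 2 * δz ρ z * δz X z i) * e3

end IsRealLift

/-! ### Polynomial lifts -/

/-- Data of polynomials in `z, z̄` which certify, in null coordinates, that the lift `P` gives an
H-totally isotropic surface on `U`: antiholomorphic sections `v₁, v₂`, the metric coefficient `g`
and the identity `g P_zz - g_z P_z = k (α v₁ + β v₂) - e P`. -/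
structure PolyData (U : Set ℂ) (P v₁ v₂ : Fin 8 → BiPoly) (α β k e g : BiPoly) : Prop where
  real : ∀ z, nullConj (evv P z) = evv P z
  pos : ∀ z, ∃ r : ℝ, 0 < r ∧ (ev (P 0) z + ev (P 1) z) / 2 = r
  null : ∀ z, nullForm (evv P z) (evv P z) = 0
  conf : ∀ z, nullForm (evv (fun i => dZ (P i)) z) (evv (fun i => dZ (P i)) z) = 0
  metric : ∀ z, nullForm (evv (fun i => dZ (P i)) z) (evv (fun i => dW (P i)) z) = ev g z
  metric_ne : ∀ z ∈ U, ev g z ≠ 0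
  anti₁ : ∀ z, evv (fun i => dZ (v₁ i)) z = 0
  anti₂ : ∀ z, evv (fun i => dZ (v₂ i)) z = 0
  iso : ∀ z, nullForm (evv v₁ z) (evv v₁ z) = 0 ∧ nullForm (evv v₁ z) (evv v₂ z) = 0 ∧
    nullForm (evv v₂ z) (evv v₂ z) = 0
  orth : ∀ z, nullForm (evv P z) (evv v₁ z) = 0 ∧ nullForm (evv P z) (evv v₂ z) = 0
  orth' : ∀ z, nullForm (evv (fun i => dW (P i)) z) (evv v₁ z) = 0 ∧
    nullForm (evv (fun i => dW (P i)) z) (evv v₂ z) = 0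
  horiz : ∀ z, nullForm (evv (fun i => dW (v₁ i)) z) (evv v₂ z) = 0
  indep : ∀ z ∈ U, ∀ a b : ℂ, a • evv v₁ z + b • evv v₂ z = 0 → a = 0 ∧ b = 0
  ne : ∀ z ∈ U, ev α z ≠ 0 ∨ ev β z ≠ 0
  key : ∀ z, ev g z • evv (fun i => dZ (dZ (P i))) z = ev (dZ g) z • evv (fun i => dZ (P i)) z +
    ev k z • (ev α z • evv v₁ z + ev β z • evv v₂ z) - ev e z • evv P z

/-- The lift with null coordinates `P` and parameter `l`. -/
def polyLift (l : ℂ) (P : Fin 8 → BiPoly) (z : ℂ) : Fin 8 → ℂ := nullVec l (evv P z)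

theorem contDiff_evv (P : Fin 8 → BiPoly) : ContDiff ℝ ∞ (evv P) :=
  contDiff_pi.2 fun i => contDiff_ev (P i)

theorem contDiff_polyLift (l : ℂ) (P : Fin 8 → BiPoly) : ContDiff ℝ ∞ (polyLift l P) :=
  ((nullVec l).restrictScalars ℝ).contDiff.comp (contDiff_evv P)

theorem wd_polyLift (s l : ℂ) (P : Fin 8 → BiPoly) (z : ℂ) :
    wd s (polyLift l P) z = nullVec l (fun i => wd s (ev (P i)) z) := by
  have hd : DifferentiableAt ℝ (evv P) z := (contDiff_evv P).differentiable (by simp) z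
  unfold polyLift
  rw [wd_clm (nullVec l) hd]
  congr 1
  ext i
  exact wd_apply hd i

theorem dz_polyLift (l : ℂ) (P : Fin 8 → BiPoly) :
    δz (polyLift l P) = polyLift l (fun i => dZ (P i)) := by
  ext1 z
  rw [wd_polyLift]
  simp only [dz_ev]
  rfl

theorem dw_polyLift (l : ℂ) (P : Fin 8 → BiPoly) :
    δw (polyLift l P) = polyLift l (fun i => dW (P i)) := by
  ext1 z
  rw [wd_polyLift]
  simp only [dw_ev]
  rfl

namespace PolyData

variable {U : Set ℂ} {P v₁ v₂ : Fin 8 → BiPoly} {α β k e g : BiPoly} {l : ℂ}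

theorem isRealLift (D : PolyData U P v₁ v₂ α β k e g) (hl : ‖l‖ = 1) :
    IsRealLift (polyLift l P) where
  smooth := contDiff_polyLift l P
  real z := by rw [polyLift, conjVec_nullVec hl, D.real]
  pos z := by
    obtain ⟨r, hr, h⟩ := D.pos z
    have : polyLift l P z 0 = r := h
    rwa [this]
  null z := by rw [polyLift, lor_nullVec (ne_zero_of_norm hl), D.null]
  conf z := by rw [dz_polyLift, polyLift, lor_nullVec (ne_zero_of_norm hl), D.conf]

theorem isotropicData (D : PolyData U P v₁ v₂ α β k e g) (hl : ‖l‖ = 1) (hU : IsOpen U) :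
    ∃ n p q, IsotropicData (projPoint (polyLift l P)) U (polyLift l v₁) (polyLift l v₂)
      (ev α) (ev β) n p q := by
  have h0 := ne_zero_of_norm hl
  have z0 : ∀ {v : Fin 8 → BiPoly}, (∀ z, evv (fun i => dZ (v i)) z = 0) →
      ∀ z, δz (polyLift l v) z = 0 := fun {v} h z => by
    rw [dz_polyLift, polyLift, h, map_zero]
  refine (D.isRealLift hl).isotropicData hU (k := ev k) (e := ev e) (g := ev g)
    (contDiff_polyLift l _) (contDiff_polyLift l _) (contDiff_ev _) (contDiff_ev _) (contDiff_ev _)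
    (contDiff_ev _) (contDiff_ev _) (fun z => ?_) D.metric_ne (z0 D.anti₁) (z0 D.anti₂)
    (fun z => ?_) (fun z => ?_) (fun z => ?_) (fun z => ?_) (fun z hz a b hab => ?_) D.ne
    (fun z => ?_)
  · rw [dz_polyLift, dw_polyLift, polyLift, polyLift, lor_nullVec h0, D.metric]
  · simp only [polyLift, lor_nullVec h0]; exact D.iso z
  · simp only [polyLift, lor_nullVec h0]; exact D.orth z
  · simp only [dw_polyLift, polyLift, lor_nullVec h0]; exact D.orth' z
  · simp only [dw_polyLift, polyLift, lor_nullVec h0]; exact D.horiz z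
  · refine D.indep z hz a b (nullVec_injective h0 ?_)
    rw [← hab, polyLift, polyLift, map_add, map_smul, map_smul]
  · rw [dz_ev]
    simp only [dz_polyLift, polyLift]
    rw [← map_smul, D.key]
    simp only [map_add, map_sub, map_smul]

theorem confFactor_eq (D : PolyData U P v₁ v₂ α β k e g) (hl : ‖l‖ = 1) (z : ℂ) :
    confFactor (projPoint (polyLift l P)) z = ((ev (P 0) z + ev (P 1) z) / 2)⁻¹ ^ 2 * ev g z := by
  rw [(D.isRealLift hl).confFactor_eq, dz_polyLift, dw_polyLift, polyLift, polyLift, polyLift,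
    lor_nullVec (ne_zero_of_norm hl), D.metric]
  rfl

end PolyData

/-! ### The lifts of `y` and `ŷ` -/

/-- Null coordinates of the polynomial lift of `ŷ` in the coordinate `z`. -/
def liftH : Fin 8 → BiPoly :=
  ![[(1, 0, 0), (1 / 4, 2, 2), (4 / 9, 3, 3)], [(1, 1, 1), (1, 2, 2), (1 / 36, 4, 4)],
    [(1, 0, 1), (1 / 9, 3, 4)], [(-1 / 2, 1, 2), (-2 / 3, 2, 3)], [(1, 0, 2), (-1 / 12, 2, 4)],
    [(1, 1, 0), (1 / 9, 4, 3)], [(-1 / 2, 2, 1), (-2 / 3, 3, 2)], [(1, 2, 0), (-1 / 12, 4, 2)]]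

/-- The antiholomorphic section `v₁` of the complexified normal bundle of `ŷ`. -/
def secOneH : Fin 8 → BiPoly :=
  ![[(1, 0, 1)], [], [(1 / 2, 0, 2)], [], [(1 / 3, 0, 3)], [], [(-1, 0, 0)], []]

/-- The antiholomorphic section `v₂` of the complexified normal bundle of `ŷ`. -/
def secTwoH : Fin 8 → BiPoly :=
  ![[], [(-1, 0, 2)], [], [(1 / 3, 0, 3)], [], [(-2, 0, 1)], [], [(1, 0, 0)]]

/-- The coefficient `α` of `v₁` in the identity for `g P_zz` of `ŷ`. -/
def alphaH : BiPoly :=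
  [(1 / 2, 0, 1), (2, 1, 2), (4, 2, 3), (5 / 18, 3, 4), (2 / 9, 4, 5), (-1 / 324, 6, 7)]

/-- The coefficient `β` of `v₂` in the identity for `g P_zz` of `ŷ`. -/
def betaH : BiPoly :=
  [(1, 0, 0), (-1 / 2, 2, 2), (-10 / 9, 3, 3), (-1 / 16, 4, 4), (-1 / 18, 5, 5), (-2 / 81, 6, 6)]

/-- The common factor `k` of the normal part of `g P_zz` of `ŷ`. -/
def contentH : BiPoly := [(1, 0, 0)]

/-- The coefficient `e` of `P` in the identity for `g P_zz` of `ŷ`. -/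
def residH : BiPoly := [(1 / 4, 0, 2), (2 / 3, 1, 3), (4 / 3, 2, 4), (1 / 9, 3, 5), (2 / 27, 4, 6)]

/-- The metric coefficient `g = ⟨P_z, P_z̄⟩` of `ŷ`. -/
def metricH : BiPoly :=
  [(1 / 2, 0, 0), (2, 1, 1), (1 / 8, 2, 2), (1 / 9, 3, 3), (2 / 9, 4, 4), (1 / 72, 5, 5),
    (1 / 162, 6, 6)]

/-- Null coordinates of the polynomial lift of `ŷ` in the coordinate `1 / z`. -/
def liftHInf : Fin 8 → BiPoly :=
  ![[(4 / 9, 1, 1), (1 / 4, 2, 2), (1, 4, 4)], [(1 / 36, 0, 0), (1, 2, 2), (1, 3, 3)],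
    [(1 / 9, 1, 0), (1, 4, 3)], [(-2 / 3, 2, 1), (-1 / 2, 3, 2)], [(-1 / 12, 2, 0), (1, 4, 2)],
    [(1 / 9, 0, 1), (1, 3, 4)], [(-2 / 3, 1, 2), (-1 / 2, 2, 3)], [(-1 / 12, 0, 2), (1, 2, 4)]]

/-- The antiholomorphic section `v₁` of the complexified normal bundle of `ŷ` in `1 / z`. -/
def secOneHInf : Fin 8 → BiPoly :=
  ![[(1, 0, 2)], [], [(1 / 2, 0, 1)], [], [(1 / 3, 0, 0)], [], [(-1, 0, 3)], []]

/-- The antiholomorphic section `v₂` of the complexified normal bundle of `ŷ` in `1 / z`. -/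
def secTwoHInf : Fin 8 → BiPoly :=
  ![[], [(-1, 0, 1)], [], [(1 / 3, 0, 0)], [], [(-2, 0, 2)], [], [(1, 0, 3)]]

/-- The coefficient `α` of `v₁` in the identity for `g P_zz` of `ŷ` in `1 / z`. -/
def alphaHInf : BiPoly :=
  [(-1 / 324, 0, 0), (2 / 9, 2, 2), (5 / 18, 3, 3), (4, 4, 4), (2, 5, 5), (1 / 2, 6, 6)]

/-- The coefficient `β` of `v₂` in the identity for `g P_zz` of `ŷ` in `1 / z`. -/
def betaHInf : BiPoly :=
  [(-2 / 81, 0, 1), (-1 / 18, 1, 2), (-1 / 16, 2, 3), (-10 / 9, 3, 4), (-1 / 2, 4, 5), (1, 6, 7)]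

/-- The common factor `k` of the normal part of `g P_zz` of `ŷ` in `1 / z`. -/
def contentHInf : BiPoly := [(1, 0, 0)]

/-- The coefficient `e` of `P` in the identity for `g P_zz` of `ŷ` in `1 / z`. -/
def residHInf : BiPoly := [(4 / 9, 0, 2), (2 / 3, 1, 3), (3 / 4, 2, 4), (16, 3, 5), (6, 4, 6)]

/-- The metric coefficient `g = ⟨P_z, P_z̄⟩` of `ŷ` in `1 / z`. -/
def metricHInf : BiPoly :=
  [(1 / 162, 0, 0), (1 / 72, 1, 1), (2 / 9, 2, 2), (1 / 9, 3, 3), (1 / 8, 4, 4), (2, 5, 5),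
    (1 / 2, 6, 6)]

/-- Null coordinates of the polynomial lift of `y` in the coordinate `z`. -/
def liftY : Fin 8 → BiPoly :=
  ![[(1, 1, 1)], [(1, 0, 0), (1 / 4, 2, 2), (1 / 9, 3, 3)], [(1 / 2, 1, 2)], [(-1, 0, 1)],
    [(1 / 3, 1, 3)], [(1 / 2, 2, 1)], [(-1, 1, 0)], [(1 / 3, 3, 1)]]

/-- The antiholomorphic section `v₁` of the complexified normal bundle of `y`. -/
def secOneY : Fin 8 → BiPoly :=
  ![[], [(1, 0, 1)], [], [(-1 / 2, 0, 2)], [], [(1, 0, 0)], [], []]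

/-- The antiholomorphic section `v₂` of the complexified normal bundle of `y`. -/
def secTwoY : Fin 8 → BiPoly :=
  ![[], [(1, 0, 2)], [], [(-2 / 3, 0, 3)], [], [], [], [(1, 0, 0)]]

/-- The coefficient `α` of `v₁` in the identity for `g P_zz` of `y`. -/
def alphaY : BiPoly := [(1 / 2, 0, 0), (-1 / 9, 3, 3)]

/-- The coefficient `β` of `v₂` in the identity for `g P_zz` of `y`. -/
def betaY : BiPoly := [(1, 1, 0), (1 / 12, 3, 2)]

/-- The common factor `k` of the normal part of `g P_zz` of `y`. -/
def contentY : BiPoly := [(1, 0, 1)]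

/-- The coefficient `e` of `P` in the identity for `g P_zz` of `y`. -/
def residY : BiPoly := [(1 / 4, 0, 2), (2 / 3, 1, 3)]

/-- The metric coefficient `g = ⟨P_z, P_z̄⟩` of `y`. -/
def metricY : BiPoly := [(1 / 2, 0, 0), (1 / 8, 2, 2), (2 / 9, 3, 3)]

/-- Null coordinates of the polynomial lift of `y` in the coordinate `1 / z`. -/
def liftYInf : Fin 8 → BiPoly :=
  ![[(1, 2, 2)], [(1 / 9, 0, 0), (1 / 4, 1, 1), (1, 3, 3)], [(1 / 2, 2, 1)], [(-1, 3, 2)],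
    [(1 / 3, 2, 0)], [(1 / 2, 1, 2)], [(-1, 2, 3)], [(1 / 3, 0, 2)]]

/-- The antiholomorphic section `v₁` of the complexified normal bundle of `y` in `1 / z`. -/
def secOneYInf : Fin 8 → BiPoly :=
  ![[], [(1, 0, 1)], [], [(-1 / 2, 0, 0)], [], [(1, 0, 2)], [], []]

/-- The antiholomorphic section `v₂` of the complexified normal bundle of `y` in `1 / z`. -/
def secTwoYInf : Fin 8 → BiPoly :=
  ![[], [(1, 0, 1)], [], [(-2 / 3, 0, 0)], [], [], [], [(1, 0, 3)]]

/-- The coefficient `α` of `v₁` in the identity for `g P_zz` of `y` in `1 / z`. -/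
def alphaYInf : BiPoly := [(-1 / 9, 0, 0), (1 / 2, 3, 3)]

/-- The coefficient `β` of `v₂` in the identity for `g P_zz` of `y` in `1 / z`. -/
def betaYInf : BiPoly := [(1 / 12, 0, 0), (1, 2, 2)]

/-- The common factor `k` of the normal part of `g P_zz` of `y` in `1 / z`. -/
def contentYInf : BiPoly := [(1, 0, 1)]

/-- The coefficient `e` of `P` in the identity for `g P_zz` of `y` in `1 / z`. -/
def residYInf : BiPoly := [(1 / 4, 0, 2), (3, 2, 4)]

/-- The metric coefficient `g = ⟨P_z, P_z̄⟩` of `y` in `1 / z`. -/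
def metricYInf : BiPoly := [(2 / 9, 1, 1), (1 / 8, 2, 2), (1 / 2, 4, 4)]

theorem polyDataH : PolyData Set.univ liftH secOneH secTwoH alphaH betaH contentH
    residH metricH where
  real z := by
    ext i
    fin_cases i <;> simp [liftH, nullConj, evv, ev_cons, ev_nil, map_ofNat] <;> ring
  pos z := by
    refine ⟨1 / 2 + 1 / 2 * (‖z‖ ^ 2) + 5 / 8 * (‖z‖ ^ 2) ^ 2 + 2 / 9 * (‖z‖ ^ 2) ^ 3 +
        1 / 72 * (‖z‖ ^ 2) ^ 4, by positivity, ?_⟩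
    push_cast
    rw [← Complex.mul_conj']
    simp only [liftH, ev_cons, ev_nil, Matrix.cons_val]
    ring
  null z := by
    simp only [liftH, evv, nullForm, ev_cons, ev_nil, Matrix.cons_val]
    ring
  conf z := by
    simp only [liftH, evv, nullForm, ev_cons, ev_nil, Matrix.cons_val, dZ_cons, dZ_nil,
    Nat.cast_ofNat, Nat.cast_one, Nat.cast_zero, Nat.reduceSub]
    ring
  metric z := by
    simp only [liftH, metricH, evv, nullForm, ev_cons, ev_nil, Matrix.cons_val, dW_cons, dW_nil,
    dZ_cons, dZ_nil, Nat.cast_ofNat, Nat.cast_one, Nat.cast_zero, Nat.reduceSub]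
    ring
  metric_ne z hz := by
    have h : ev metricH z = (1 / 2 + 2 * (‖z‖ ^ 2) + 1 / 8 * (‖z‖ ^ 2) ^ 2 + 1 / 9 * (‖z‖ ^ 2) ^ 3 +
        2 / 9 * (‖z‖ ^ 2) ^ 4 + 1 / 72 * (‖z‖ ^ 2) ^ 5 + 1 / 162 * (‖z‖ ^ 2) ^ 6 : ℝ) := by
      push_cast
      rw [← Complex.mul_conj']
      simp only [metricH, ev_cons, ev_nil]
      ring
    rw [h]
    refine Complex.ofReal_ne_zero.2 (ne_of_gt ?_)
    positivity
  anti₁ z := by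
    ext i
    fin_cases i <;> simp [secOneH, evv, ev_cons, ev_nil, dZ_cons, dZ_nil]
  anti₂ z := by
    ext i
    fin_cases i <;> simp [secTwoH, evv, ev_cons, ev_nil, dZ_cons, dZ_nil]
  iso z := by
    refine ⟨?_, ?_, ?_⟩ <;>
    simp only [secOneH, secTwoH, evv, nullForm, ev_cons, ev_nil, Matrix.cons_val] <;>
    ring
  orth z := by
    refine ⟨?_, ?_⟩ <;>
    simp only [liftH, secOneH, secTwoH, evv, nullForm, ev_cons, ev_nil, Matrix.cons_val] <;>
    ring
  orth' z := by
    refine ⟨?_, ?_⟩ <;>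
    simp only [liftH, secOneH, secTwoH, evv, nullForm, ev_cons, ev_nil, Matrix.cons_val, dW_cons,
    dW_nil, Nat.cast_ofNat, Nat.cast_one, Nat.cast_zero, Nat.reduceSub] <;>
    ring
  horiz z := by
    simp only [secOneH, secTwoH, evv, nullForm, ev_cons, ev_nil, Matrix.cons_val, dW_cons,
    dW_nil, Nat.cast_ofNat, Nat.cast_one, Nat.cast_zero, Nat.reduceSub]
    ring
  indep z hz a b h := by
    have h1 := congrFun h 6
    have h2 := congrFun h 7
    simp [secOneH, secTwoH, evv, ev_cons, ev_nil] at h1 h2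
    exact ⟨h1, h2⟩
  ne z hz := by
    by_contra! hc
    have h : z * ev alphaH z = (1 / 2 * (‖z‖ ^ 2) + 2 * (‖z‖ ^ 2) ^ 2 + 4 * (‖z‖ ^ 2) ^ 3 +
        5 / 18 * (‖z‖ ^ 2) ^ 4 + 2 / 9 * (‖z‖ ^ 2) ^ 5 - 1 / 324 * (‖z‖ ^ 2) ^ 7 : ℝ) := by
      push_cast
      rw [← Complex.mul_conj']; simp only [alphaH, ev_cons, ev_nil]; ring
    have k : ev betaH z = (1 - 1 / 2 * (‖z‖ ^ 2) ^ 2 - 10 / 9 * (‖z‖ ^ 2) ^ 3 -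
        1 / 16 * (‖z‖ ^ 2) ^ 4 - 1 / 18 * (‖z‖ ^ 2) ^ 5 - 2 / 81 * (‖z‖ ^ 2) ^ 6 : ℝ) := by
      push_cast
      rw [← Complex.mul_conj']; simp only [betaH, ev_cons, ev_nil]; ring
    rw [hc.1, mul_zero] at h
    rw [hc.2] at k
    have h' := Complex.ofReal_eq_zero.1 h.symm
    have k' := Complex.ofReal_eq_zero.1 k.symm
    -- a combination of `α` and `β` has positive coefficients, so that they have no common zero
    have hpos : 0 < 3 + 16 * (‖z‖ ^ 2) + 65 / 2 * (‖z‖ ^ 2) ^ 2 + 10 / 3 * (‖z‖ ^ 2) ^ 3 +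
        265 / 144 * (‖z‖ ^ 2) ^ 4 + 1 / 18 * (‖z‖ ^ 2) ^ 5 := by
      positivity
    have h0 : (‖z‖ ^ 2) * (3 + 16 * (‖z‖ ^ 2) + 65 / 2 * (‖z‖ ^ 2) ^ 2 + 10 / 3 * (‖z‖ ^ 2) ^ 3 +
        265 / 144 * (‖z‖ ^ 2) ^ 4 + 1 / 18 * (‖z‖ ^ 2) ^ 5) = 0 := by
      linear_combination 8 * h' - (‖z‖ ^ 2) * k'
    rcases mul_eq_zero.1 h0 with h0 | h0
    · rw [h0] at k'
      norm_num at k'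
    · exact hpos.ne' h0
  key z := by
    ext i
    simp only [Pi.smul_apply, Pi.add_apply, Pi.sub_apply, smul_eq_mul]
    fin_cases i <;>
    simp [liftH, secOneH, secTwoH, alphaH, betaH, contentH, residH, metricH, evv, ev_cons,
    ev_nil, dZ_cons, dZ_nil] <;>
    ring

theorem polyDataHInf : PolyData Set.univ liftHInf secOneHInf secTwoHInf alphaHInf betaHInf
    contentHInf residHInf metricHInf where
  real z := by
    ext i
    fin_cases i <;> simp [liftHInf, nullConj, evv, ev_cons, ev_nil, map_ofNat] <;> ring
  pos z := by
    refine ⟨1 / 72 + 2 / 9 * (‖z‖ ^ 2) + 5 / 8 * (‖z‖ ^ 2) ^ 2 + 1 / 2 * (‖z‖ ^ 2) ^ 3 +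
        1 / 2 * (‖z‖ ^ 2) ^ 4, by positivity, ?_⟩
    push_cast
    rw [← Complex.mul_conj']
    simp only [liftHInf, ev_cons, ev_nil, Matrix.cons_val]
    ring
  null z := by
    simp only [liftHInf, evv, nullForm, ev_cons, ev_nil, Matrix.cons_val]
    ring
  conf z := by
    simp only [liftHInf, evv, nullForm, ev_cons, ev_nil, Matrix.cons_val, dZ_cons, dZ_nil,
    Nat.cast_ofNat, Nat.cast_one, Nat.cast_zero, Nat.reduceSub]
    ring
  metric z := by
    simp only [liftHInf, metricHInf, evv, nullForm, ev_cons, ev_nil, Matrix.cons_val, dW_cons,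
    dW_nil, dZ_cons, dZ_nil, Nat.cast_ofNat, Nat.cast_one, Nat.cast_zero, Nat.reduceSub]
    ring
  metric_ne z hz := by
    have h : ev metricHInf z = (1 / 162 + 1 / 72 * (‖z‖ ^ 2) + 2 / 9 * (‖z‖ ^ 2) ^ 2 +
        1 / 9 * (‖z‖ ^ 2) ^ 3 + 1 / 8 * (‖z‖ ^ 2) ^ 4 + 2 * (‖z‖ ^ 2) ^ 5 +
        1 / 2 * (‖z‖ ^ 2) ^ 6 : ℝ) := by
      push_cast
      rw [← Complex.mul_conj']
      simp only [metricHInf, ev_cons, ev_nil]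
      ring
    rw [h]
    refine Complex.ofReal_ne_zero.2 (ne_of_gt ?_)
    positivity
  anti₁ z := by
    ext i
    fin_cases i <;> simp [secOneHInf, evv, ev_cons, ev_nil, dZ_cons, dZ_nil]
  anti₂ z := by
    ext i
    fin_cases i <;> simp [secTwoHInf, evv, ev_cons, ev_nil, dZ_cons, dZ_nil]
  iso z := by
    refine ⟨?_, ?_, ?_⟩ <;>
    simp only [secOneHInf, secTwoHInf, evv, nullForm, ev_cons, ev_nil, Matrix.cons_val] <;>
    ring
  orth z := by
    refine ⟨?_, ?_⟩ <;>
    simp only [liftHInf, secOneHInf, secTwoHInf, evv, nullForm, ev_cons, ev_nil,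
      Matrix.cons_val] <;>
    ring
  orth' z := by
    refine ⟨?_, ?_⟩ <;>
    simp only [liftHInf, secOneHInf, secTwoHInf, evv, nullForm, ev_cons, ev_nil, Matrix.cons_val,
    dW_cons, dW_nil, Nat.cast_ofNat, Nat.cast_one, Nat.cast_zero, Nat.reduceSub] <;>
    ring
  horiz z := by
    simp only [secOneHInf, secTwoHInf, evv, nullForm, ev_cons, ev_nil, Matrix.cons_val, dW_cons,
    dW_nil, Nat.cast_ofNat, Nat.cast_one, Nat.cast_zero, Nat.reduceSub]
    ring
  indep z hz a b h := by
    have h1 := congrFun h 4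
    have h2 := congrFun h 3
    simp [secOneHInf, secTwoHInf, evv, ev_cons, ev_nil] at h1 h2
    exact ⟨h1, h2⟩
  ne z hz := by
    by_contra! hc
    have h : ev alphaHInf z = (-1 / 324 + 2 / 9 * (‖z‖ ^ 2) ^ 2 + 5 / 18 * (‖z‖ ^ 2) ^ 3 +
        4 * (‖z‖ ^ 2) ^ 4 + 2 * (‖z‖ ^ 2) ^ 5 + 1 / 2 * (‖z‖ ^ 2) ^ 6 : ℝ) := by
      push_cast
      rw [← Complex.mul_conj']; simp only [alphaHInf, ev_cons, ev_nil]; ring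
    have k : z * ev betaHInf z = (-2 / 81 * (‖z‖ ^ 2) - 1 / 18 * (‖z‖ ^ 2) ^ 2 -
        1 / 16 * (‖z‖ ^ 2) ^ 3 - 10 / 9 * (‖z‖ ^ 2) ^ 4 - 1 / 2 * (‖z‖ ^ 2) ^ 5 +
        (‖z‖ ^ 2) ^ 7 : ℝ) := by
      push_cast
      rw [← Complex.mul_conj']; simp only [betaHInf, ev_cons, ev_nil]; ring
    rw [hc.1] at h
    rw [hc.2, mul_zero] at k
    have h' := Complex.ofReal_eq_zero.1 h.symm
    have k' := Complex.ofReal_eq_zero.1 k.symm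
    -- a combination of `α` and `β` has positive coefficients, so that they have no common zero
    have hpos : 0 < 1 / 18 + 265 / 144 * (‖z‖ ^ 2) + 10 / 3 * (‖z‖ ^ 2) ^ 2 +
        65 / 2 * (‖z‖ ^ 2) ^ 3 + 16 * (‖z‖ ^ 2) ^ 4 + 3 * (‖z‖ ^ 2) ^ 5 := by
      positivity
    have h0 : (‖z‖ ^ 2) ^ 2 * (1 / 18 + 265 / 144 * (‖z‖ ^ 2) + 10 / 3 * (‖z‖ ^ 2) ^ 2 +
        65 / 2 * (‖z‖ ^ 2) ^ 3 + 16 * (‖z‖ ^ 2) ^ 4 + 3 * (‖z‖ ^ 2) ^ 5) = 0 := by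
      linear_combination 8 * (‖z‖ ^ 2) * h' - k'
    rcases mul_eq_zero.1 h0 with h0 | h0
    · rw [pow_eq_zero_iff two_ne_zero |>.1 h0] at h'
      norm_num at h'
    · exact hpos.ne' h0
  key z := by
    ext i
    simp only [Pi.smul_apply, Pi.add_apply, Pi.sub_apply, smul_eq_mul]
    fin_cases i <;>
    simp [liftHInf, secOneHInf, secTwoHInf, alphaHInf, betaHInf, contentHInf, residHInf,
    metricHInf, evv, ev_cons, ev_nil, dZ_cons, dZ_nil] <;>
    ring

theorem polyDataY : PolyData Set.univ liftY secOneY secTwoY alphaY betaY contentY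
    residY metricY where
  real z := by
    ext i
    fin_cases i <;> simp [liftY, nullConj, evv, ev_cons, ev_nil, map_ofNat] <;> ring
  pos z := by
    refine ⟨1 / 2 + 1 / 2 * (‖z‖ ^ 2) + 1 / 8 * (‖z‖ ^ 2) ^ 2 +
        1 / 18 * (‖z‖ ^ 2) ^ 3, by positivity, ?_⟩
    push_cast
    rw [← Complex.mul_conj']
    simp only [liftY, ev_cons, ev_nil, Matrix.cons_val]
    ring
  null z := by
    simp only [liftY, evv, nullForm, ev_cons, ev_nil, Matrix.cons_val]
    ring
  conf z := by
    simp only [liftY, evv, nullForm, ev_cons, ev_nil, Matrix.cons_val, dZ_cons, dZ_nil,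
    Nat.cast_ofNat, Nat.cast_one, Nat.cast_zero, Nat.reduceSub]
    ring
  metric z := by
    simp only [liftY, metricY, evv, nullForm, ev_cons, ev_nil, Matrix.cons_val, dW_cons, dW_nil,
    dZ_cons, dZ_nil, Nat.cast_ofNat, Nat.cast_one, Nat.cast_zero, Nat.reduceSub]
    ring
  metric_ne z hz := by
    have h : ev metricY z = (1 / 2 + 1 / 8 * (‖z‖ ^ 2) ^ 2 + 2 / 9 * (‖z‖ ^ 2) ^ 3 : ℝ) := by
      push_cast
      rw [← Complex.mul_conj']
      simp only [metricY, ev_cons, ev_nil]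
      ring
    rw [h]
    refine Complex.ofReal_ne_zero.2 (ne_of_gt ?_)
    positivity
  anti₁ z := by
    ext i
    fin_cases i <;> simp [secOneY, evv, ev_cons, ev_nil, dZ_cons, dZ_nil]
  anti₂ z := by
    ext i
    fin_cases i <;> simp [secTwoY, evv, ev_cons, ev_nil, dZ_cons, dZ_nil]
  iso z := by
    refine ⟨?_, ?_, ?_⟩ <;>
    simp only [secOneY, secTwoY, evv, nullForm, ev_cons, ev_nil, Matrix.cons_val] <;>
    ring
  orth z := by
    refine ⟨?_, ?_⟩ <;>
    simp only [liftY, secOneY, secTwoY, evv, nullForm, ev_cons, ev_nil, Matrix.cons_val] <;>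
    ring
  orth' z := by
    refine ⟨?_, ?_⟩ <;>
    simp only [liftY, secOneY, secTwoY, evv, nullForm, ev_cons, ev_nil, Matrix.cons_val, dW_cons,
    dW_nil, Nat.cast_ofNat, Nat.cast_one, Nat.cast_zero, Nat.reduceSub] <;>
    ring
  horiz z := by
    simp only [secOneY, secTwoY, evv, nullForm, ev_cons, ev_nil, Matrix.cons_val, dW_cons,
    dW_nil, Nat.cast_ofNat, Nat.cast_one, Nat.cast_zero, Nat.reduceSub]
    ring
  indep z hz a b h := by
    have h1 := congrFun h 5
    have h2 := congrFun h 7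
    simp [secOneY, secTwoY, evv, ev_cons, ev_nil] at h1 h2
    exact ⟨h1, h2⟩
  ne z hz := by
    by_contra! hc
    have h : z * (1 + 1 / 12 * ‖z‖ ^ 4 : ℝ) = ev betaY z := by
      push_cast
      rw [show (‖z‖ : ℂ) ^ 4 = ((‖z‖ : ℂ) ^ 2) ^ 2 by ring, ← Complex.mul_conj']
      simp only [betaY, ev_cons, ev_nil]
      ring
    rw [hc.2] at h
    rcases mul_eq_zero.1 h with h | h
    · have := hc.1
      simp [alphaY, ev_cons, ev_nil, h] at this
    · exact absurd (Complex.ofReal_eq_zero.1 h) (by positivity)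
  key z := by
    ext i
    simp only [Pi.smul_apply, Pi.add_apply, Pi.sub_apply, smul_eq_mul]
    fin_cases i <;>
    simp [liftY, secOneY, secTwoY, alphaY, betaY, contentY, residY, metricY, evv, ev_cons,
    ev_nil, dZ_cons, dZ_nil] <;>
    ring

theorem polyDataYInf : PolyData {ζ | ζ ≠ 0} liftYInf secOneYInf secTwoYInf alphaYInf betaYInf
    contentYInf residYInf metricYInf where
  real z := by
    ext i
    fin_cases i <;> simp [liftYInf, nullConj, evv, ev_cons, ev_nil, map_ofNat] <;> ring
  pos z := by
    refine ⟨1 / 18 + 1 / 8 * (‖z‖ ^ 2) + 1 / 2 * (‖z‖ ^ 2) ^ 2 +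
        1 / 2 * (‖z‖ ^ 2) ^ 3, by positivity, ?_⟩
    push_cast
    rw [← Complex.mul_conj']
    simp only [liftYInf, ev_cons, ev_nil, Matrix.cons_val]
    ring
  null z := by
    simp only [liftYInf, evv, nullForm, ev_cons, ev_nil, Matrix.cons_val]
    ring
  conf z := by
    simp only [liftYInf, evv, nullForm, ev_cons, ev_nil, Matrix.cons_val, dZ_cons, dZ_nil,
    Nat.cast_ofNat, Nat.cast_one, Nat.cast_zero, Nat.reduceSub]
    ring
  metric z := by
    simp only [liftYInf, metricYInf, evv, nullForm, ev_cons, ev_nil, Matrix.cons_val, dW_cons,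
    dW_nil, dZ_cons, dZ_nil, Nat.cast_ofNat, Nat.cast_one, Nat.cast_zero, Nat.reduceSub]
    ring
  metric_ne z hz := by
    have h : ev metricYInf z = (2 / 9 * (‖z‖ ^ 2) + 1 / 8 * (‖z‖ ^ 2) ^ 2 +
        1 / 2 * (‖z‖ ^ 2) ^ 4 : ℝ) := by
      push_cast
      rw [← Complex.mul_conj']
      simp only [metricYInf, ev_cons, ev_nil]
      ring
    rw [h]
    refine Complex.ofReal_ne_zero.2 (ne_of_gt ?_)
    have : 0 < ‖z‖ := norm_pos_iff.2 hz
    positivity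
  anti₁ z := by
    ext i
    fin_cases i <;> simp [secOneYInf, evv, ev_cons, ev_nil, dZ_cons, dZ_nil]
  anti₂ z := by
    ext i
    fin_cases i <;> simp [secTwoYInf, evv, ev_cons, ev_nil, dZ_cons, dZ_nil]
  iso z := by
    refine ⟨?_, ?_, ?_⟩ <;>
    simp only [secOneYInf, secTwoYInf, evv, nullForm, ev_cons, ev_nil, Matrix.cons_val] <;>
    ring
  orth z := by
    refine ⟨?_, ?_⟩ <;>
    simp only [liftYInf, secOneYInf, secTwoYInf, evv, nullForm, ev_cons, ev_nil,
      Matrix.cons_val] <;>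
    ring
  orth' z := by
    refine ⟨?_, ?_⟩ <;>
    simp only [liftYInf, secOneYInf, secTwoYInf, evv, nullForm, ev_cons, ev_nil, Matrix.cons_val,
    dW_cons, dW_nil, Nat.cast_ofNat, Nat.cast_one, Nat.cast_zero, Nat.reduceSub] <;>
    ring
  horiz z := by
    simp only [secOneYInf, secTwoYInf, evv, nullForm, ev_cons, ev_nil, Matrix.cons_val, dW_cons,
    dW_nil, Nat.cast_ofNat, Nat.cast_one, Nat.cast_zero, Nat.reduceSub]
    ring
  indep z hz a b h := by
    have h1 := congrFun h 5
    have h2 := congrFun h 7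
    simp [show z ≠ 0 from hz, secOneYInf, secTwoYInf, evv, ev_cons, ev_nil] at h1 h2
    exact ⟨h1, h2⟩
  ne z hz := by
    right
    have h : ev betaYInf z = (1 / 12 + ‖z‖ ^ 4 : ℝ) := by
      push_cast
      rw [show (‖z‖ : ℂ) ^ 4 = ((‖z‖ : ℂ) ^ 2) ^ 2 by ring, ← Complex.mul_conj']
      simp only [betaYInf, ev_cons, ev_nil]
      ring
    rw [h]
    exact Complex.ofReal_ne_zero.2 (by positivity)
  key z := by
    ext i
    simp only [Pi.smul_apply, Pi.add_apply, Pi.sub_apply, smul_eq_mul]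
    fin_cases i <;>
    simp [liftYInf, secOneYInf, secTwoYInf, alphaYInf, betaYInf, contentYInf, residYInf,
    metricYInf, evv, ev_cons, ev_nil, dZ_cons, dZ_nil] <;>
    ring

/-! ### Maps on the Riemann sphere given in the two standard coordinates -/

/-- The map on the Riemann sphere given by `g₀` in the coordinate `z`, with value `g₁ 0` at `∞`. -/
def sphereMap (g₀ g₁ : ℂ → EuclideanSpace ℝ (Fin 7)) (p : OnePoint ℂ) : EuclideanSpace ℝ (Fin 7) :=
  Option.elim p (g₁ 0) g₀

theorem sphereMap_comp_coordInfty {g₀ g₁ : ℂ → EuclideanSpace ℝ (Fin 7)}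
    (h : ∀ ζ, ζ ≠ 0 → g₁ ζ = g₀ ζ⁻¹) : sphereMap g₀ g₁ ∘ coordInfty = g₁ := by
  ext1 ζ
  by_cases h0 : ζ = 0
  · subst h0
    simp only [Function.comp_apply, coordInfty, if_true]
    rfl
  · simp only [Function.comp_apply, coordInfty_of_ne h0, h ζ h0]
    rfl

theorem exists_coord_eq (p : OnePoint ℂ) : ∃ c ∈ coords, ∃ z, c z = p := by
  induction p using OnePoint.rec with
  | infty => exact ⟨coordInfty, by simp [coords], 0, by simp [coordInfty]⟩
  | coe z => exact ⟨coordZero, by simp [coords], z, rfl⟩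

theorem forall_coords {Q : (ℂ → OnePoint ℂ) → Prop} (h₀ : Q coordZero) (h₁ : Q coordInfty) :
    ∀ c ∈ coords, Q c := by
  rintro c (rfl | rfl)
  exacts [h₀, h₁]

theorem coordZero_ne_infty (z : ℂ) : coordZero z ≠ OnePoint.infty := OnePoint.coe_ne_infty z

theorem coordInfty_eq_infty {ζ : ℂ} : coordInfty ζ = OnePoint.infty ↔ ζ = 0 := by
  refine ⟨fun h => by_contra fun h0 => ?_, fun h => by simp [coordInfty, h]⟩
  rw [coordInfty_of_ne h0] at h
  exact coordZero_ne_infty _ h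

section

variable {f : OnePoint ℂ → EuclideanSpace ℝ (Fin 7)} {Ω : Set (OnePoint ℂ)}

theorem isConformalImmersionOn (H₀ : IsConformalSurface (f ∘ coordZero) (coordZero ⁻¹' Ω))
    (H₁ : IsConformalSurface (f ∘ coordInfty) (coordInfty ⁻¹' Ω)) : IsConformalImmersionOn Ω f :=
  forall_coords (fun z hz => by rw [dz_eq_wd]; exact ⟨H₀.conformal z hz, H₀.immersed z hz⟩)
    fun z hz => by rw [dz_eq_wd]; exact ⟨H₁.conformal z hz, H₁.immersed z hz⟩

variable {a₁ a₂ b₁ b₂ : ℂ → Fin 8 → ℂ} {α β n p q α' β' n' p' q' : ℂ → ℂ}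

theorem isHTotallyIsotropicOn
    (D₀ : IsotropicData (f ∘ coordZero) (coordZero ⁻¹' Ω) a₁ a₂ α β n p q)
    (D₁ : IsotropicData (f ∘ coordInfty) (coordInfty ⁻¹' Ω) b₁ b₂ α' β' n' p' q') :
    IsHTotallyIsotropicOn Ω f :=
  forall_coords
    (fun _ hz => ⟨fun j l _ _ => D₀.jets_isotropic hz j l, _, D₀.surf.isOpen.mem_nhds hz, _,
      D₀.isHIsotropicFrame⟩)
    fun _ hz => ⟨fun j l _ _ => D₁.jets_isotropic hz j l, _, D₁.surf.isOpen.mem_nhds hz, _,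
      D₁.isHIsotropicFrame⟩

theorem IsotropicData.isCritical {g : ℂ → EuclideanSpace ℝ (Fin 7)} {U : Set ℂ}
    (D : IsotropicData g U a₁ a₂ α β n p q) : IsCritical g U := fun _ hz =>
  D.isHIsotropicFrame.willmoreOp_real D.surf hz

theorem isWillmoreOn (D₀ : IsotropicData (f ∘ coordZero) (coordZero ⁻¹' Ω) a₁ a₂ α β n p q)
    (D₁ : IsotropicData (f ∘ coordInfty) (coordInfty ⁻¹' Ω) b₁ b₂ α' β' n' p' q') :
    IsWillmoreOn Ω f :=
  isWillmoreOn_of_isCritical D₀.surf D₁.surf D₀.isCritical D₁.isCritical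

end

theorem metricCoeff_eq {f : ℂ → EuclideanSpace ℝ (Fin 7)} (hf : ContDiff ℝ ∞ f) (z : ℂ) :
    (metricCoeff f z : ℂ) = confFactor f z := by
  have hd : DifferentiableAt ℝ (lightLift f) z :=
    ((contDiffOn_lightLift hf.contDiffOn).contDiffAt Filter.univ_mem).differentiableAt (by simp)
  have h1 : δw (lightLift f) z = conjVec (δz (lightLift f) z) := by
    have := wd_conjVec (s := Complex.I) hd
    rw [show (fun ζ => conjVec (lightLift f ζ)) = lightLift f from funext (conjVec_lightLift f)]
      at this
    simpa using this
  have h0 : δz (lightLift f) z 0 = 0 := by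
    rw [wd_apply hd 0]
    exact wd_const _ _ _
  have h2 : ∀ i : Fin 7, δz (lightLift f) z i.succ =
      dz (fun ζ => ((f ζ i : ℝ) : ℂ)) z := fun i => by
    rw [wd_apply hd i.succ, dz_eq_wd]
    rfl
  rw [confFactor, h1, lor, h0, metricCoeff]
  push_cast
  simp only [conjVec, h2, Complex.mul_conj']
  ring

/-! ### The maps `y` and `ŷ` -/

theorem projPoint_smul {X X' : ℂ → Fin 8 → ℂ} {z z' c : ℂ} (hc : c ≠ 0) (h : X z = c • X' z') :
    projPoint X z = projPoint X' z' := by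
  unfold projPoint
  simp only [h, Pi.smul_apply, smul_eq_mul, mul_div_mul_left _ _ hc]

theorem polyLift_smul {P Q : Fin 8 → BiPoly} {z z' c : ℂ} (l : ℂ)
    (h : evv P z = c • evv Q z') : polyLift l P z = c • polyLift l Q z' := by
  rw [polyLift, polyLift, h, map_smul]

theorem liftHInf_eq {ζ : ℂ} (h : ζ ≠ 0) :
    evv liftHInf ζ = (ζ * (starRingEnd ℂ) ζ) ^ 4 • evv liftH ζ⁻¹ := by
  have h' : (starRingEnd ℂ) ζ ≠ 0 := by simpa using h
  ext i
  fin_cases i <;>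
  simp [liftHInf, liftH, evv, ev_cons, ev_nil] <;>
  field_simp <;> ring

theorem liftYInf_eq {ζ : ℂ} (h : ζ ≠ 0) :
    evv liftYInf ζ = (ζ * (starRingEnd ℂ) ζ) ^ 3 • evv liftY ζ⁻¹ := by
  have h' : (starRingEnd ℂ) ζ ≠ 0 := by simpa using h
  ext i
  fin_cases i <;>
  simp [liftYInf, liftY, evv, ev_cons, ev_nil] <;>
  field_simp <;> ring

/-- The map `ŷ`, with parameter `l = λ`. -/
def surfH (l : ℂ) : OnePoint ℂ → EuclideanSpace ℝ (Fin 7) :=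
  sphereMap (projPoint (polyLift l liftH)) (projPoint (polyLift l liftHInf))

/-- The map `y`, with parameter `l = λ`. -/
def surfY (l : ℂ) : OnePoint ℂ → EuclideanSpace ℝ (Fin 7) :=
  sphereMap (projPoint (polyLift l liftY)) (projPoint (polyLift l liftYInf))

theorem surfH_coordZero (l : ℂ) : surfH l ∘ coordZero = projPoint (polyLift l liftH) := rfl

theorem surfY_coordZero (l : ℂ) : surfY l ∘ coordZero = projPoint (polyLift l liftY) := rfl

theorem mul_conj_ne_zero {ζ : ℂ} (h : ζ ≠ 0) : ζ * (starRingEnd ℂ) ζ ≠ 0 :=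
  mul_ne_zero h (by simpa using h)

theorem surfH_coordInfty (l : ℂ) : surfH l ∘ coordInfty = projPoint (polyLift l liftHInf) :=
  sphereMap_comp_coordInfty fun _ h => projPoint_smul (pow_ne_zero 4 (mul_conj_ne_zero h))
    (polyLift_smul l (liftHInf_eq h))

theorem surfY_coordInfty (l : ℂ) : surfY l ∘ coordInfty = projPoint (polyLift l liftYInf) :=
  sphereMap_comp_coordInfty fun _ h => projPoint_smul (pow_ne_zero 3 (mul_conj_ne_zero h))
    (polyLift_smul l (liftYInf_eq h))

variable {l : ℂ}

theorem isSmoothIntoSphereOn_of_lifts {f : OnePoint ℂ → EuclideanSpace ℝ (Fin 7)}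
    {X₀ X₁ : ℂ → Fin 8 → ℂ} (N₀ : IsRealLift X₀) (N₁ : IsRealLift X₁)
    (h₀ : f ∘ coordZero = projPoint X₀) (h₁ : f ∘ coordInfty = projPoint X₁) :
    IsSmoothIntoSphereOn Set.univ f := by
  refine ⟨forall_coords ?_ ?_, fun p _ => ?_⟩
  · rw [h₀]
    exact N₀.contDiff_projPoint.contDiffOn
  · rw [h₁]
    exact N₁.contDiff_projPoint.contDiffOn
  · obtain ⟨c, hc, z, rfl⟩ := exists_coord_eq p
    rcases hc with rfl | rfl
    · exact (congrArg norm (congrFun h₀ z)).trans (N₀.norm_projPoint z)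
    · exact (congrArg norm (congrFun h₁ z)).trans (N₁.norm_projPoint z)

theorem isSmoothIntoSphereOn_surfH (hl : ‖l‖ = 1) : IsSmoothIntoSphereOn Set.univ (surfH l) :=
  isSmoothIntoSphereOn_of_lifts (polyDataH.isRealLift hl) (polyDataHInf.isRealLift hl)
    (surfH_coordZero l) (surfH_coordInfty l)

theorem isSmoothIntoSphereOn_surfY (hl : ‖l‖ = 1) : IsSmoothIntoSphereOn Set.univ (surfY l) :=
  isSmoothIntoSphereOn_of_lifts (polyDataY.isRealLift hl) (polyDataYInf.isRealLift hl)
    (surfY_coordZero l) (surfY_coordInfty l)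

theorem isotropicData_surfH (hl : ‖l‖ = 1) :
    (∃ n p q, IsotropicData (surfH l ∘ coordZero) (coordZero ⁻¹' Set.univ) (polyLift l secOneH)
      (polyLift l secTwoH) (ev alphaH) (ev betaH) n p q) ∧
    ∃ n p q, IsotropicData (surfH l ∘ coordInfty) (coordInfty ⁻¹' Set.univ) (polyLift l secOneHInf)
      (polyLift l secTwoHInf) (ev alphaHInf) (ev betaHInf) n p q := by
  rw [surfH_coordZero, surfH_coordInfty]
  exact ⟨polyDataH.isotropicData hl isOpen_univ, polyDataHInf.isotropicData hl isOpen_univ⟩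

theorem coordZero_preimage_compl_infty : coordZero ⁻¹' {OnePoint.infty}ᶜ = Set.univ :=
  Set.eq_univ_of_forall coordZero_ne_infty

theorem coordInfty_preimage_compl_infty : coordInfty ⁻¹' {OnePoint.infty}ᶜ = {ζ | ζ ≠ 0} := by
  ext ζ
  exact not_congr coordInfty_eq_infty

theorem isotropicData_surfY (hl : ‖l‖ = 1) :
    (∃ n p q, IsotropicData (surfY l ∘ coordZero) (coordZero ⁻¹' {OnePoint.infty}ᶜ)
      (polyLift l secOneY) (polyLift l secTwoY) (ev alphaY) (ev betaY) n p q) ∧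
    ∃ n p q, IsotropicData (surfY l ∘ coordInfty) (coordInfty ⁻¹' {OnePoint.infty}ᶜ)
      (polyLift l secOneYInf) (polyLift l secTwoYInf) (ev alphaYInf) (ev betaYInf) n p q := by
  rw [surfY_coordZero, surfY_coordInfty, coordZero_preimage_compl_infty,
    coordInfty_preimage_compl_infty]
  exact ⟨polyDataY.isotropicData hl isOpen_univ,
    polyDataYInf.isotropicData hl (isOpen_ne (x := (0 : ℂ)))⟩

theorem isBranchPoint_surfY (hl : ‖l‖ = 1) : IsBranchPoint (surfY l) OnePoint.infty := by
  refine forall_coords (fun z h => absurd h (coordZero_ne_infty z)) fun z h => ?_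
  rw [coordInfty_eq_infty] at h
  subst h
  rw [surfY_coordInfty]
  have N := polyDataYInf.isRealLift hl
  refine ⟨fderiv_eq_zero_of_confFactor_eq_zero (N.contDiff_projPoint.differentiable (by simp) 0) ?_,
    ?_⟩
  · rw [polyDataYInf.confFactor_eq hl]
    simp [metricYInf, ev_cons, ev_nil]
  · obtain ⟨n, p, q, D⟩ := polyDataYInf.isotropicData hl (isOpen_ne (x := (0 : ℂ)))
    filter_upwards [self_mem_nhdsWithin] with ζ hζ
    exact D.surf.immersed ζ hζ

theorem metricCoeff_surfH (hl : ‖l‖ = 1) (z : ℂ) : metricCoeff (surfH l ∘ coordZero) z =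
    2 * (1 + 4 * ‖z‖ ^ 2 + ‖z‖ ^ 4 / 4 + 2 * ‖z‖ ^ 6 / 9 + 4 * ‖z‖ ^ 8 / 9 + ‖z‖ ^ 10 / 36
      + ‖z‖ ^ 12 / 81) /
    (1 + ‖z‖ ^ 2 + 5 * ‖z‖ ^ 4 / 4 + 4 * ‖z‖ ^ 6 / 9 + ‖z‖ ^ 8 / 36) ^ 2 := by
  have N := polyDataH.isRealLift hl
  apply Complex.ofReal_injective
  rw [surfH_coordZero, metricCoeff_eq N.contDiff_projPoint, polyDataH.confFactor_eq hl]
  have e1 : ev metricH z = (1 + 4 * ((‖z‖ : ℂ) ^ 2) + ((‖z‖ : ℂ) ^ 2) ^ 2 / 4 +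
      2 * ((‖z‖ : ℂ) ^ 2) ^ 3 / 9 + 4 * ((‖z‖ : ℂ) ^ 2) ^ 4 / 9 + ((‖z‖ : ℂ) ^ 2) ^ 5 / 36
      + ((‖z‖ : ℂ) ^ 2) ^ 6 / 81) / 2 := by
    rw [← Complex.mul_conj']
    simp only [metricH, ev_cons, ev_nil]
    ring
  have e2 : (ev (liftH 0) z + ev (liftH 1) z) / 2 = (1 + (‖z‖ : ℂ) ^ 2 +
      5 * ((‖z‖ : ℂ) ^ 2) ^ 2 / 4 + 4 * ((‖z‖ : ℂ) ^ 2) ^ 3 / 9 +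
        ((‖z‖ : ℂ) ^ 2) ^ 4 / 36) / 2 := by
    rw [← Complex.mul_conj']
    simp only [liftH, ev_cons, ev_nil, Matrix.cons_val]
    ring
  rw [e1, e2]
  push_cast
  simp only [← pow_mul, inv_div, div_pow]
  norm_num
  ring

theorem metricCoeff_surfY (hl : ‖l‖ = 1) (z : ℂ) : metricCoeff (surfY l ∘ coordZero) z =
    2 * (1 + ‖z‖ ^ 4 / 4 + 4 * ‖z‖ ^ 6 / 9) /
      (1 + ‖z‖ ^ 2 + ‖z‖ ^ 4 / 4 + ‖z‖ ^ 6 / 9) ^ 2 := by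
  have N := polyDataY.isRealLift hl
  apply Complex.ofReal_injective
  rw [surfY_coordZero, metricCoeff_eq N.contDiff_projPoint, polyDataY.confFactor_eq hl]
  have e1 : ev metricY z = (1 + ((‖z‖ : ℂ) ^ 2) ^ 2 / 4 + 4 * ((‖z‖ : ℂ) ^ 2) ^ 3 / 9) / 2 := by
    rw [← Complex.mul_conj']
    simp only [metricY, ev_cons, ev_nil]
    ring
  have e2 : (ev (liftY 0) z + ev (liftY 1) z) / 2 = (1 + (‖z‖ : ℂ) ^ 2 +
      ((‖z‖ : ℂ) ^ 2) ^ 2 / 4 + ((‖z‖ : ℂ) ^ 2) ^ 3 / 9) / 2 := by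
    rw [← Complex.mul_conj']
    simp only [liftY, ev_cons, ev_nil, Matrix.cons_val]
    ring
  rw [e1, e2]
  push_cast
  simp only [← pow_mul, inv_div, div_pow]
  norm_num
  ring

theorem norm_pow_eq (z : ℂ) : (‖z‖ : ℂ) ^ 2 = z * (starRingEnd ℂ) z ∧
    (‖z‖ : ℂ) ^ 4 = (z * (starRingEnd ℂ) z) ^ 2 ∧ (‖z‖ : ℂ) ^ 6 = (z * (starRingEnd ℂ) z) ^ 3 ∧
    (‖z‖ : ℂ) ^ 8 = (z * (starRingEnd ℂ) z) ^ 4 := by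
  rw [Complex.mul_conj']
  refine ⟨rfl, ?_, ?_, ?_⟩ <;> ring

theorem Yvec_eq (l z : ℂ) :
    Yvec l z = ((Real.sqrt 2 / |sigma z| : ℝ) : ℂ) • polyLift l liftY z := by
  obtain ⟨h2, h4, h6, -⟩ := norm_pow_eq z
  rw [show Real.sqrt 2 / |sigma z| = 2 * (Real.sqrt 2 / (2 * |sigma z|)) by ring]
  generalize hs : Real.sqrt 2 / (2 * |sigma z|) = s
  ext i
  simp only [Yvec, hs, h2, h4, h6, Pi.smul_apply, smul_eq_mul, polyLift, nullVec_apply]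
  fin_cases i <;> simp [liftY, evv, ev_cons, ev_nil] <;> ring

theorem Yhat_eq (l z : ℂ) :
    Yhat l z = ((Real.sqrt 2 / |sigma z| : ℝ) : ℂ) • polyLift l liftH z := by
  obtain ⟨h2, h4, h6, h8⟩ := norm_pow_eq z
  rw [show Real.sqrt 2 / |sigma z| = 2 * (Real.sqrt 2 / (2 * |sigma z|)) by ring]
  generalize hs : Real.sqrt 2 / (2 * |sigma z|) = s
  ext i
  simp only [Yhat, hs, h2, h4, h6, h8, Pi.smul_apply, smul_eq_mul, polyLift, nullVec_apply]
  fin_cases i <;> simp [liftH, evv, ev_cons, ev_nil] <;> ring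

theorem scale_ne_zero {z : ℂ} (h : sigma z ≠ 0) : ((Real.sqrt 2 / |sigma z| : ℝ) : ℂ) ≠ 0 :=
  Complex.ofReal_ne_zero.2 (div_ne_zero (by positivity) (abs_ne_zero.2 h))

theorem surfY_eq_Yvec (hl : ‖l‖ = 1) {z : ℂ} (h : sigma z ≠ 0) (i : Fin 7) :
    ((surfY l z i : ℝ) : ℂ) = Yvec l z i.succ / Yvec l z 0 := by
  rw [Yvec_eq, Pi.smul_apply, Pi.smul_apply, smul_eq_mul, smul_eq_mul,
    mul_div_mul_left _ _ (scale_ne_zero h)]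
  exact (polyDataY.isRealLift hl).ofReal_projPoint z i

theorem surfH_eq_Yhat (hl : ‖l‖ = 1) {z : ℂ} (h : sigma z ≠ 0) (i : Fin 7) :
    ((surfH l z i : ℝ) : ℂ) = Yhat l z i.succ / Yhat l z 0 := by
  rw [Yhat_eq, Pi.smul_apply, Pi.smul_apply, smul_eq_mul, smul_eq_mul,
    mul_div_mul_left _ _ (scale_ne_zero h)]
  exact (polyDataH.isRealLift hl).ofReal_projPoint z i

/-! ### Nonexistence of dual surfaces -/

theorem IsRealLift.gaussSpace_le {X : ℂ → Fin 8 → ℂ} (N : IsRealLift X) (z : ℂ) :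
    gaussSpace (projPoint X) z ≤ Submodule.span ℂ {X z, δz X z, δw X z, δz (δw X) z} := by
  set S := Submodule.span ℂ {X z, δz X z, δw X z, δz (δw X) z} with hS
  have m0 : X z ∈ S := Submodule.subset_span (by simp)
  have m1 : δz X z ∈ S := Submodule.subset_span (by simp)
  have m2 : δw X z ∈ S := Submodule.subset_span (by simp)
  have m3 : δz (δw X) z ∈ S := Submodule.subset_span (by simp)
  have sρ := N.contDiff_scale
  have dXz : DifferentiableAt ℝ (δz X) z :=
    (contDiff_wd N.smooth _).differentiable (by simp) z
  have dρz : DifferentiableAt ℝ (δz fun z => (X z 0)⁻¹) z :=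
    (contDiff_wd sρ _).differentiable (by simp) z
  rw [gaussSpace, Submodule.span_le, dz_eq_wd, dzbar_eq_wd, dzbar_eq_wd, N.wd_lift, N.wd_lift,
    N.lightLift_eq, wd_add_smul_smul (N.dρ z) dXz dρz (N.dX z),
    wd_comm isOpen_univ N.smooth.contDiffOn (Set.mem_univ z)]
  rintro x (rfl | rfl | rfl | rfl)
  · exact S.smul_mem _ m0
  · exact S.add_mem (S.smul_mem _ m1) (S.smul_mem _ m0)
  · exact S.add_mem (S.smul_mem _ m2) (S.smul_mem _ m0)
  · exact S.add_mem (S.add_mem (S.smul_mem _ m3) (S.smul_mem _ m1))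
      (S.add_mem (S.smul_mem _ m2) (S.smul_mem _ m0))

theorem IsotropicData.lor_gaussSpace {f : ℂ → EuclideanSpace ℝ (Fin 7)} {U : Set ℂ}
    {v₁ v₂ : ℂ → Fin 8 → ℂ} {α β n p q : ℂ → ℂ} (D : IsotropicData f U v₁ v₂ α β n p q) {z : ℂ}
    (hz : z ∈ U) {x : Fin 8 → ℂ} (hx : x ∈ gaussSpace f z) :
    lor x (v₁ z) = 0 ∧ lor x (v₂ z) = 0 := by
  have key : ∀ a b : ℂ, lor x (a • v₁ z + b • v₂ z) = 0 := fun a b => by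
    rw [gaussSpace, dz_eq_wd, dzbar_eq_wd, dzbar_eq_wd] at hx
    obtain ⟨h1, h2, h3, h4⟩ := D.normal_combo hz a b
    rw [lor_comm]
    refine lor_eq_zero_of_mem_span (fun y hy => ?_) hx
    rcases hy with rfl | rfl | rfl | rfl
    exacts [h1, h2, h3, h4]
  exact ⟨by simpa using key 1 0, by simpa using key 0 1⟩

/-- The derivatives of the antiholomorphic sections pair with `L` and `L_z` to zero. -/
theorem nullForm_dW_secH (z : ℂ) :
    nullForm (evv liftH z) (evv (fun i => dW (secOneH i)) z) = 0 ∧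
    nullForm (evv liftH z) (evv (fun i => dW (secTwoH i)) z) = 0 ∧
    nullForm (evv (fun i => dZ (liftH i)) z) (evv (fun i => dW (secOneH i)) z) = 0 ∧
    nullForm (evv (fun i => dZ (liftH i)) z) (evv (fun i => dW (secTwoH i)) z) = 0 := by
  refine ⟨?_, ?_, ?_, ?_⟩ <;>
  simp only [liftH, secOneH, secTwoH, evv, nullForm, ev_cons, ev_nil, Matrix.cons_val, dZ_cons,
    dZ_nil, dW_cons, dW_nil, Nat.cast_ofNat, Nat.cast_one, Nat.cast_zero, Nat.reduceSub] <;>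
  ring

/-- The derivatives of the antiholomorphic sections are nondegenerate on `Span {L_z̄, L_zz̄}`: the
determinant of the pairings is, up to sign, the coefficient of the metric. -/
theorem nullForm_dW_secH_det (z : ℂ) :
    nullForm (evv (fun i => dW (liftH i)) z) (evv (fun i => dW (secTwoH i)) z) *
      nullForm (evv (fun i => dZ (dW (liftH i))) z) (evv (fun i => dW (secOneH i)) z) -
    nullForm (evv (fun i => dW (liftH i)) z) (evv (fun i => dW (secOneH i)) z) *
      nullForm (evv (fun i => dZ (dW (liftH i))) z) (evv (fun i => dW (secTwoH i)) z) =
    ev metricH z := by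
  simp only [liftH, secOneH, secTwoH, metricH, evv, nullForm, ev_cons, ev_nil, Matrix.cons_val,
    dZ_cons, dZ_nil, dW_cons, dW_nil, Nat.cast_ofNat, Nat.cast_one, Nat.cast_zero, Nat.reduceSub]
  ring

/-- If a real lift `G` takes values in the conformal Gauss map of `ŷ` and so does its
`z̄`-derivative, then `G` represents the same point as `ŷ`. -/
theorem eq_surfH_of_mem_gaussSpace {l : ℂ} (hl : ‖l‖ = 1) {U : Set ℂ} (hU : IsOpen U)
    {g : ℂ → EuclideanSpace ℝ (Fin 7)} (hg : ContDiffOn ℝ ∞ g U)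
    (h0 : ∀ z ∈ U, lightLift g z ∈ gaussSpace (projPoint (polyLift l liftH)) z)
    (h1 : ∀ z ∈ U, δw (lightLift g) z ∈ gaussSpace (projPoint (polyLift l liftH)) z)
    {z : ℂ} (hz : z ∈ U) : g z = projPoint (polyLift l liftH) z := by
  have hl0 := ne_zero_of_norm hl
  have N := polyDataH.isRealLift hl
  obtain ⟨n, p, q, D⟩ := polyDataH.isotropicData hl isOpen_univ
  have sG := contDiffOn_lightLift hg
  have dG : DifferentiableAt ℝ (lightLift g) z :=
    (sG.contDiffAt (hU.mem_nhds hz)).differentiableAt (by simp)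
  have pair : ∀ v : Fin 8 → BiPoly, (∀ ζ ∈ U, lor (lightLift g ζ) (polyLift l v ζ) = 0) →
      lor (δw (lightLift g) z) (polyLift l v z) = 0 →
      lor (lightLift g z) (polyLift l (fun i => dW (v i)) z) = 0 := fun v hv hv' => by
    have e := wd_lor (s := Complex.I) dG
      ((contDiff_polyLift l v).differentiable (by simp) z)
    rw [wd_congr_of_isOpen hU hv hz, wd_const, hv', zero_add, dw_polyLift] at e
    exact e.symm
  have e1 := pair secOneH (fun ζ hζ => (D.lor_gaussSpace (Set.mem_univ ζ) (h0 ζ hζ)).1)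
    (D.lor_gaussSpace (Set.mem_univ z) (h1 z hz)).1
  have e2 := pair secTwoH (fun ζ hζ => (D.lor_gaussSpace (Set.mem_univ ζ) (h0 ζ hζ)).2)
    (D.lor_gaussSpace (Set.mem_univ z) (h1 z hz)).2
  have hm := N.gaussSpace_le z (h0 z hz)
  simp only [dz_polyLift, dw_polyLift, Submodule.mem_span_insert,
    Submodule.mem_span_singleton] at hm
  obtain ⟨a, y₁, ⟨b, y₂, ⟨c, y₃, ⟨d, rfl⟩, rfl⟩, rfl⟩, hG⟩ := hm
  obtain ⟨k1, k2, k3, k4⟩ := nullForm_dW_secH z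
  rw [hG] at e1 e2
  simp only [lor_add_left, lor_smul_left, polyLift, lor_nullVec hl0, k1, k2, k3, k4] at e1 e2
  have hdet := nullForm_dW_secH_det z
  have hmet := polyDataH.metric_ne z (Set.mem_univ z)
  have hc : c = 0 := by
    refine (mul_eq_zero.1 (?_ : c * ev metricH z = 0)).resolve_right hmet
    rw [← hdet]
    linear_combination nullForm (evv (fun i => dZ (dW (liftH i))) z)
      (evv (fun i => dW (secOneH i)) z) * e2 - nullForm (evv (fun i => dZ (dW (liftH i))) z)
      (evv (fun i => dW (secTwoH i)) z) * e1
  have hd : d = 0 := by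
    refine (mul_eq_zero.1 (?_ : d * ev metricH z = 0)).resolve_right hmet
    rw [← hdet]
    linear_combination nullForm (evv (fun i => dW (liftH i)) z)
      (evv (fun i => dW (secTwoH i)) z) * e1 - nullForm (evv (fun i => dW (liftH i)) z)
      (evv (fun i => dW (secOneH i)) z) * e2
  rw [hc, hd, zero_smul, zero_smul, add_zero, add_zero] at hG
  -- a real combination of `X` and `X_z` is a multiple of `X`
  have hXw : conjVec (δz (polyLift l liftH) z) = δw (polyLift l liftH) z := by
    have := wd_conjVec (s := Complex.I) (N.dX z)
    rw [show (fun ζ => conjVec (polyLift l liftH ζ)) = polyLift l liftH from funext N.real] at this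
    rw [this]
    simp
  have hself : ∀ s, lor (polyLift l liftH z) (wd s (polyLift l liftH) z) = 0 := fun s =>
    N.lor_self_wd s z
  have hb : b = 0 := by
    have t1 : lor (lightLift g z) (δz (polyLift l liftH) z) = 0 := by
      rw [hG, lor_add_left, lor_smul_left, lor_smul_left, hself, ← dz_polyLift, N.conf]
      ring
    have t2 : lor (lightLift g z) (δw (polyLift l liftH) z) = 0 := by
      rw [← hXw, ← conjVec_lightLift, lor_conjVec, t1, map_zero]
    rw [hG, lor_add_left, lor_smul_left, lor_smul_left, hself, dw_polyLift, polyLift, polyLift,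
      lor_nullVec hl0, polyDataH.metric, mul_zero, zero_add] at t2
    exact (mul_eq_zero.1 t2).resolve_right hmet
  rw [hb, zero_smul, add_zero] at hG
  have ha : a = (polyLift l liftH z 0)⁻¹ := by
    have t := congrFun hG 0
    rw [Pi.smul_apply, smul_eq_mul] at t
    exact eq_inv_of_mul_eq_one_left t.symm
  ext i
  apply Complex.ofReal_injective
  rw [N.ofReal_projPoint]
  have t := congrFun hG i.succ
  rw [Pi.smul_apply, smul_eq_mul, ha, ← div_eq_inv_mul] at t
  exact t

theorem wd_lightLift_mem_gaussSpace {f g : ℂ → EuclideanSpace ℝ (Fin 7)} {z : ℂ}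
    (hg : DifferentiableAt ℝ g z)
    (hc : lor (δz (lightLift g) z) (δz (lightLift g) z) = 0)
    (h : Function.Injective (fderiv ℝ g z) → gaussSpace g z = gaussSpace f z) :
    δw (lightLift g) z ∈ gaussSpace f z := by
  by_cases h0 : confFactor g z = 0
  · have hz := fderiv_eq_zero_of_confFactor_eq_zero hg h0
    have : δw (lightLift g) z = 0 := by
      rw [wd_lightLift, wd_spaceVec _ hg]
      simp [pd, hz]
    rw [this]
    exact Submodule.zero_mem _
  · rw [← h (injective_fderiv_of_confFactor_ne_zero hg hc h0), gaussSpace]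
    exact Submodule.subset_span (by simp [dzbar_eq_wd])

theorem exists_coordZero_mem {Ω : Set (OnePoint ℂ)} (hΩ : IsOpen Ω) (hne : Ω.Nonempty) :
    ∃ z, coordZero z ∈ Ω := by
  obtain ⟨p, hp⟩ := hne
  induction p using OnePoint.rec with
  | infty =>
    have hopen : IsOpen (coordInfty ⁻¹' Ω) := hΩ.preimage continuous_coordInfty
    have h0 : (0 : ℂ) ∈ coordInfty ⁻¹' Ω := by simpa [coordInfty] using hp
    obtain ⟨ζ, hζ, hne⟩ := (Filter.nonempty_of_mem
      (Filter.inter_mem (mem_nhdsWithin_of_mem_nhds (hopen.mem_nhds h0))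
        (self_mem_nhdsWithin (a := (0 : ℂ)) (s := {0}ᶜ))))
    exact ⟨ζ⁻¹, by rw [← coordInfty_of_ne hne]; exact hζ⟩
  | coe z => exact ⟨z, hp⟩

theorem not_isDualSurfaceOn_surfH {l : ℂ} (hl : ‖l‖ = 1) {Ω : Set (OnePoint ℂ)} (hΩ : IsOpen Ω)
    (hne : Ω.Nonempty) (g : OnePoint ℂ → EuclideanSpace ℝ (Fin 7)) :
    ¬ IsDualSurfaceOn Ω (surfH l) g := by
  rintro ⟨⟨hs, -⟩, hd, h⟩
  obtain ⟨z, hz⟩ := exists_coordZero_mem hΩ hne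
  have hc : coordZero ∈ coords := by simp [coords]
  have hU : IsOpen (coordZero ⁻¹' Ω) := hΩ.preimage continuous_coordZero
  have sg := hs coordZero hc
  refine hd _ hz (eq_surfH_of_mem_gaussSpace hl hU sg (fun ζ hζ => (h _ hc ζ hζ).1)
    (fun ζ hζ => ?_) hz)
  obtain ⟨-, h2, h3⟩ := h _ hc ζ hζ
  rw [dz_eq_wd] at h2
  exact wd_lightLift_mem_gaussSpace ((sg.contDiffAt (hU.mem_nhds hζ)).differentiableAt (by simp))
    h2 h3

/-! ### Minimal surfaces from isotropic holomorphic curves -/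

/-- The real vector `v + v̄`. -/
def doubleRe (n : ℕ) : (Fin n → ℂ) →L[ℝ] EuclideanSpace ℝ (Fin n) :=
  LinearMap.toContinuousLinearMap
    { toFun := fun v => WithLp.toLp 2 fun i => 2 * (v i).re
      map_add' := fun v w => by ext i; simp [mul_add]
      map_smul' := fun c v => by ext i; simp; ring }

theorem doubleRe_apply (n : ℕ) (v : Fin n → ℂ) (i : Fin n) : doubleRe n v i = 2 * (v i).re := rfl

theorem inner_doubleRe {n : ℕ} (v w : Fin n → ℂ) :
    ⟪doubleRe n v, doubleRe n w⟫ = 4 * ∑ i, (v i).re * (w i).re := by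
  rw [PiLp.inner_apply, Finset.mul_sum]
  refine Finset.sum_congr rfl fun i _ => ?_
  rw [doubleRe_apply, doubleRe_apply]
  simp only [RCLike.inner_apply, conj_trivial]
  ring

theorem eq_zero_of_doubleRe_eq_zero {n : ℕ} {v : Fin n → ℂ} (hv : ∑ i, v i * v i = 0)
    (h : doubleRe n v = 0) : v = 0 := by
  have hre : ∀ i, (v i).re = 0 := fun i => by
    have := congrArg (fun x : EuclideanSpace ℝ (Fin n) => x i) h
    simpa [doubleRe_apply] using this
  have him : ∑ i, (v i).im * (v i).im = 0 := by
    have := congrArg Complex.re hv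
    simpa [Complex.mul_re, hre] using this
  ext i
  refine Complex.ext (hre i) ?_
  have := (Finset.sum_eq_zero_iff_of_nonneg fun i _ => mul_self_nonneg (v i).im).1 him i
    (Finset.mem_univ i)
  simpa using this

theorem fderiv_doubleRe {n : ℕ} {Φ : ℂ → Fin n → ℂ} {d : Fin n → ℂ} {z : ℂ}
    (h : HasDerivAt Φ d z) (v : ℂ) : fderiv ℝ (fun ζ => doubleRe n (Φ ζ)) z v =
      doubleRe n (v • d) := by
  have := (doubleRe n).hasFDerivAt.comp z (h.hasFDerivAt.restrictScalars ℝ)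
  rw [show (fun ζ => doubleRe n (Φ ζ)) = doubleRe n ∘ Φ from rfl, this.fderiv]
  simp

/-- The Weierstrass representation: twice the real part of a holomorphic curve with isotropic
derivative `Φ' ≠ 0` is a minimal surface. -/
theorem isMinimalSurfaceOn_doubleRe {n : ℕ} {U : Set ℂ} (hU : IsOpen U) {Φ Φ' Φ'' : ℂ → Fin n → ℂ}
    (h : ∀ z ∈ U, HasDerivAt Φ (Φ' z) z) (h' : ∀ z ∈ U, HasDerivAt Φ' (Φ'' z) z)
    (iso : ∀ z ∈ U, ∑ i, Φ' z i * Φ' z i = 0) (ne : ∀ z ∈ U, Φ' z ≠ 0) :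
    IsMinimalSurfaceOn U fun z => doubleRe n (Φ z) := by
  refine ⟨?_, fun z hz => ⟨?_, ?_⟩⟩
  · have hd : DifferentiableOn ℂ Φ U := fun z hz => (h z hz).differentiableAt.differentiableWithinAt
    exact (doubleRe n).contDiff.comp_contDiffOn ((hd.contDiffOn (n := ∞) hU).restrict_scalars ℝ)
  · refine (injective_iff_map_eq_zero _).2 fun v hv => ?_
    rw [fderiv_doubleRe (h z hz)] at hv
    have h0 := eq_zero_of_doubleRe_eq_zero (v := v • Φ' z) (by
      have : ∀ i, (v • Φ' z) i * (v • Φ' z) i = v * v * (Φ' z i * Φ' z i) := fun i => by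
        rw [Pi.smul_apply, smul_eq_mul]; ring
      simp only [this]
      rw [← Finset.mul_sum, iso z hz, mul_zero]) hv
    exact (smul_eq_zero.1 h0).resolve_right (ne z hz)
  · have p0 : ∀ ζ ∈ U, pd 0 (fun z => doubleRe n (Φ z)) ζ = doubleRe n (Φ' ζ) := fun ζ hζ => by
      rw [pd, fderiv_doubleRe (h ζ hζ)]; simp
    have p1 : ∀ ζ ∈ U, pd 1 (fun z => doubleRe n (Φ z)) ζ = doubleRe n (Complex.I • Φ' ζ) :=
      fun ζ hζ => by
        rw [pd, fderiv_doubleRe (h ζ hζ)]; simp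
    have e0 : pd 0 (fun z => doubleRe n (Φ z)) =ᶠ[𝓝 z] fun ζ => doubleRe n (Φ' ζ) :=
      Filter.eventually_of_mem (hU.mem_nhds hz) p0
    have e1 : pd 1 (fun z => doubleRe n (Φ z)) =ᶠ[𝓝 z] fun ζ => doubleRe n (Complex.I • Φ' ζ) :=
      Filter.eventually_of_mem (hU.mem_nhds hz) p1
    have hI : HasDerivAt (fun ζ => Complex.I • Φ' ζ) (Complex.I • Φ'' z) z :=
      (h' z hz).const_smul Complex.I
    have p00 : pd 0 (pd 0 fun z => doubleRe n (Φ z)) z = doubleRe n (Φ'' z) := by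
      rw [pd, e0.fderiv_eq, fderiv_doubleRe (h' z hz)]; simp
    have p10 : pd 1 (pd 0 fun z => doubleRe n (Φ z)) z = doubleRe n (Complex.I • Φ'' z) := by
      rw [pd, e0.fderiv_eq, fderiv_doubleRe (h' z hz)]; simp
    have p01 : pd 0 (pd 1 fun z => doubleRe n (Φ z)) z = doubleRe n (Complex.I • Φ'' z) := by
      rw [pd, e1.fderiv_eq, fderiv_doubleRe hI]; simp
    have p11 : pd 1 (pd 1 fun z => doubleRe n (Φ z)) z = -doubleRe n (Φ'' z) := by
      rw [pd, e1.fderiv_eq, fderiv_doubleRe hI, ← map_neg]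
      simp [smul_smul]
    have hre := congrArg Complex.re (iso z hz)
    have him := congrArg Complex.im (iso z hz)
    simp only [Complex.re_sum, Complex.im_sum, Complex.mul_re, Complex.mul_im, Complex.zero_re,
      Complex.zero_im, Finset.sum_sub_distrib, Finset.sum_add_distrib] at hre him
    have i01 : ⟪doubleRe n (Φ' z), doubleRe n (Complex.I • Φ' z)⟫ = 0 := by
      rw [inner_doubleRe]
      simp only [Pi.smul_apply, smul_eq_mul, Complex.mul_re, Complex.I_re, Complex.I_im, zero_mul,
        one_mul, zero_sub, mul_neg, Finset.sum_neg_distrib]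
      have : ∑ i, (Φ' z i).im * (Φ' z i).re = ∑ i, (Φ' z i).re * (Φ' z i).im :=
        Finset.sum_congr rfl fun i _ => mul_comm _ _
      linarith
    have i11 : ⟪doubleRe n (Complex.I • Φ' z), doubleRe n (Complex.I • Φ' z)⟫ =
        ⟪doubleRe n (Φ' z), doubleRe n (Φ' z)⟫ := by
      rw [inner_doubleRe, inner_doubleRe]
      simp only [Pi.smul_apply, smul_eq_mul, Complex.mul_re, Complex.I_re, Complex.I_im, zero_mul,
        one_mul, zero_sub, neg_mul_neg]
      linarith
    rw [meanCurvature_eq _ _ (p10.trans p01.symm), p00, p01, p11, p0 z hz, p1 z hz, traceVec, i01,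
      i11]
    simp only [normalPart, inner_neg_left]
    module

/-! ### The minimal surface equivalent to `y` -/

/-- The holomorphic curve with `x = Φ + Φ̄`. -/
def minimalCurve (l z : ℂ) : Fin 6 → ℂ :=
  ![Complex.I * l⁻¹ * z, -l⁻¹ * z, 2 * Complex.I * l * z⁻¹, 2 * l * z⁻¹,
    2 * Complex.I / 3 * l⁻¹ * z ^ 2, -(2 / 3) * l⁻¹ * z ^ 2]

/-- The minimal surface `x`, with parameter `l = λ`. -/
def minimalSurf (l z : ℂ) : EuclideanSpace ℝ (Fin 6) := doubleRe 6 (minimalCurve l z)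

variable {l : ℂ}

theorem ofReal_minimalSurf (hl : ‖l‖ = 1) {z : ℂ} (hz : z ≠ 0) (i : Fin 6) :
    ((minimalSurf l z i : ℝ) : ℂ) = xvec l z i := by
  have hw : (starRingEnd ℂ) z ≠ 0 := by simpa using hz
  have hl0 := ne_zero_of_norm hl
  have h2 : ∀ v : ℂ, ((2 * v.re : ℝ) : ℂ) = v + (starRingEnd ℂ) v := fun v => by
    rw [Complex.add_conj]
  rw [minimalSurf, doubleRe_apply, h2]
  simp only [xvec, (norm_pow_eq z).1]
  fin_cases i <;>
  simp [minimalCurve, conj_eq_inv_of_norm hl, map_ofNat] <;>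
  field_simp <;> ring

theorem isMinimalSurfaceOn_minimalSurf (hl : ‖l‖ = 1) :
    IsMinimalSurfaceOn {z | z ≠ 0} (minimalSurf l) := by
  have hl0 := ne_zero_of_norm hl
  refine isMinimalSurfaceOn_doubleRe (isOpen_ne (x := (0 : ℂ)))
    (Φ' := fun z => ![Complex.I * l⁻¹, -l⁻¹, -2 * Complex.I * l * (z⁻¹) ^ 2, -2 * l * (z⁻¹) ^ 2,
      4 * Complex.I / 3 * l⁻¹ * z, -(4 / 3) * l⁻¹ * z])
    (Φ'' := fun z => ![0, 0, 4 * Complex.I * l * (z⁻¹) ^ 3, 4 * l * (z⁻¹) ^ 3,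
      4 * Complex.I / 3 * l⁻¹, -(4 / 3) * l⁻¹])
    (fun z hz => ?_) (fun z hz => ?_) (fun z _ => ?_) (fun z _ h => ?_)
  · have d1 := hasDerivAt_id z
    have d2 : HasDerivAt (fun ζ : ℂ => ζ⁻¹) (-(z⁻¹) ^ 2) z := by
      simpa using hasDerivAt_inv hz
    have d3 := d1.pow 2
    refine hasDerivAt_pi.2 fun i => ?_
    fin_cases i
    · exact (d1.const_mul (Complex.I * l⁻¹)).congr_deriv (by simp)
    · exact (d1.const_mul (-l⁻¹)).congr_deriv (by simp)
    · exact (d2.const_mul (2 * Complex.I * l)).congr_deriv (by simp)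
    · exact (d2.const_mul (2 * l)).congr_deriv (by simp)
    · exact (d3.const_mul (2 * Complex.I / 3 * l⁻¹)).congr_deriv (by simp; ring)
    · exact (d3.const_mul (-(2 / 3) * l⁻¹)).congr_deriv (by simp; ring)
  · have d1 := hasDerivAt_id z
    have d2 : HasDerivAt (fun ζ : ℂ => ζ⁻¹) (-(z⁻¹) ^ 2) z := by
      simpa using hasDerivAt_inv hz
    have d3 := d2.pow 2
    refine hasDerivAt_pi.2 fun i => ?_
    fin_cases i
    · exact hasDerivAt_const _ _
    · exact hasDerivAt_const _ _
    · exact (d3.const_mul (-2 * Complex.I * l)).congr_deriv (by simp; ring)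
    · exact (d3.const_mul (-2 * l)).congr_deriv (by simp; ring)
    · exact (d1.const_mul (4 * Complex.I / 3 * l⁻¹)).congr_deriv (by simp)
    · exact (d1.const_mul (-(4 / 3) * l⁻¹)).congr_deriv (by simp)
  · simp [Fin.sum_univ_six]
    linear_combination (l⁻¹ ^ 2 + 4 * l ^ 2 * (z⁻¹) ^ 4 + 16 / 9 * l⁻¹ ^ 2 * z ^ 2) * Complex.I_sq
  · have := congrFun h 1
    simp [hl0] at this

/-- The Lorentz transformation which takes `y` to the minimal surface; it exchanges, up to factors,
the two null coordinates `x₀ ± x₁`. -/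
def moebius : (Fin 8 → ℝ) →ₗ[ℝ] (Fin 8 → ℝ) where
  toFun x := ![-17 / 8 * x 0 + 15 / 8 * x 1, -15 / 8 * x 0 + 17 / 8 * x 1, x 2, x 3, x 4, x 5, x 6,
    x 7]
  map_add' x y := by ext i; fin_cases i <;> simp <;> ring
  map_smul' c x := by ext i; fin_cases i <;> simp <;> ring

theorem moebius_apply (x : Fin 8 → ℝ) : moebius x =
    ![-17 / 8 * x 0 + 15 / 8 * x 1, -15 / 8 * x 0 + 17 / 8 * x 1, x 2, x 3, x 4, x 5,
      x 6, x 7] := rfl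

theorem lor_moebius (x y : Fin 8 → ℝ) : lor (moebius x) (moebius y) = lor x y := by
  simp only [lor, moebius_apply, Fin.sum_univ_seven]
  simp
  ring

theorem norm_sq_minimalSurf (hl : ‖l‖ = 1) {z : ℂ} (hz : z ≠ 0) :
    ((‖minimalSurf l z‖ ^ 2 : ℝ) : ℂ) = 4 * (z * (starRingEnd ℂ) z) +
      16 / (z * (starRingEnd ℂ) z) + 16 / 9 * (z * (starRingEnd ℂ) z) ^ 2 := by
  have hw : (starRingEnd ℂ) z ≠ 0 := by simpa using hz
  have hl0 := ne_zero_of_norm hl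
  rw [EuclideanSpace.norm_sq_eq]
  simp only [Real.norm_eq_abs, sq_abs]
  push_cast
  simp only [ofReal_minimalSurf hl hz, Fin.sum_univ_six, xvec, (norm_pow_eq z).1]
  simp
  field_simp
  ring_nf
  simp only [Complex.I_sq]
  ring

theorem isMoebiusEquivalentOn_surfY (hl : ‖l‖ = 1) :
    IsMoebiusEquivalentOn {z | z ≠ 0} (surfY l ∘ coordZero) (minimalSurf l) := by
  refine ⟨LinearMap.toMatrix' moebius, fun a b => ?_, fun z hz => ?_⟩
  · rw [LinearMap.toMatrix'_mulVec, LinearMap.toMatrix'_mulVec, lor_moebius]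
  have hz' : z ≠ 0 := hz
  have hw : (starRingEnd ℂ) z ≠ 0 := by simpa using hz'
  have hl0 := ne_zero_of_norm hl
  have N := polyDataY.isRealLift hl
  have hT := N.time_ne_zero z
  have hc : ∀ i : Fin 7, ((surfY l (coordZero z) i : ℝ) : ℂ) =
      polyLift l liftY z i.succ / polyLift l liftY z 0 := N.ofReal_projPoint z
  refine ⟨-(‖z‖ ^ 2 / 4) / (polyLift l liftY z 0).re, ?_, ?_⟩
  · exact div_ne_zero (neg_ne_zero.2 (by positivity)) (N.pos z).ne'
  rw [LinearMap.toMatrix'_mulVec, moebius_apply]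
  ext i
  apply Complex.ofReal_injective
  have hx := fun i => ofReal_minimalSurf hl hz' i
  have hx0 := norm_sq_minimalSurf hl hz'
  have key : ∀ a b : ℂ, polyLift l liftY z 0 * a = -(z * (starRingEnd ℂ) z / 4) * b →
      a = -(z * (starRingEnd ℂ) z / 4) / polyLift l liftY z 0 * b := fun a b h => by
    field_simp
    linear_combination 4 * h
  rw [Pi.smul_apply, smul_eq_mul, Complex.ofReal_mul, Complex.ofReal_div, N.ofReal_re,
    Complex.ofReal_neg, Complex.ofReal_div, Complex.ofReal_pow, (norm_pow_eq z).1,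
    Complex.ofReal_ofNat]
  refine key _ _ ?_
  have hq : ∀ i : Fin 7, polyLift l liftY z 0 * ((surfY l (coordZero z) i : ℝ) : ℂ) =
      polyLift l liftY z i.succ := fun i => by rw [hc, mul_div_cancel₀ _ hT]
  refine Fin.cases ?_ (fun i => Fin.cases ?_ (fun i => ?_) i) i
  · have h1 := hq 0
    simp only [coneOfEuclidean, conePoint, Fin.cons_zero, Matrix.cons_val_zero,
      show (1 : Fin 8) = Fin.succ 0 from rfl, Fin.cons_succ, Function.comp_apply]
    push_cast at hx0 ⊢
    rw [mul_add, mul_left_comm _ (15 / 8 : ℂ), h1, hx0]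
    simp [polyLift, nullVec_apply, liftY, evv, ev_cons, ev_nil]
    field_simp
    ring
  · have h1 := hq 0
    simp only [coneOfEuclidean, conePoint, Fin.cons_zero,
      show (1 : Fin 8) = Fin.succ 0 from rfl, Fin.cons_succ, Function.comp_apply]
    push_cast at hx0 ⊢
    rw [mul_add, mul_left_comm _ (17 / 8 : ℂ), h1, hx0]
    simp [polyLift, nullVec_apply, liftY, evv, ev_cons, ev_nil]
    field_simp
    ring
  · have h1 := hq i.succ
    have hs : (![-17 / 8 * conePoint ((surfY l ∘ coordZero) z) 0 +
        15 / 8 * conePoint ((surfY l ∘ coordZero) z) 1,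
        -15 / 8 * conePoint ((surfY l ∘ coordZero) z) 0 +
        17 / 8 * conePoint ((surfY l ∘ coordZero) z) 1,
        conePoint ((surfY l ∘ coordZero) z) 2, conePoint ((surfY l ∘ coordZero) z) 3,
        conePoint ((surfY l ∘ coordZero) z) 4, conePoint ((surfY l ∘ coordZero) z) 5,
        conePoint ((surfY l ∘ coordZero) z) 6, conePoint ((surfY l ∘ coordZero) z) 7] :
          Fin 8 → ℝ) i.succ.succ = surfY l (coordZero z) i.succ := by
      fin_cases i <;> rfl
    rw [hs, h1, coneOfEuclidean, Fin.cons_succ, Fin.cons_succ, hx]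
    simp only [xvec, (norm_pow_eq z).1]
    fin_cases i <;>
    simp [polyLift, nullVec_apply, liftY, evv, ev_cons, ev_nil] <;>
    field_simp <;> ring

/-! ### The curve `σ = 0` -/

variable {l : ℂ}

theorem sigma_eq (z : ℂ) : (sigma z : ℂ) = 1 - (z * (starRingEnd ℂ) z) ^ 2 / 4 -
    2 * (z * (starRingEnd ℂ) z) ^ 3 / 9 := by
  obtain ⟨-, h4, h6, -⟩ := norm_pow_eq z
  rw [sigma, ← h4, ← h6]
  push_cast
  ring

theorem nullForm_liftY_liftH (z : ℂ) :
    nullForm (evv liftY z) (evv liftH z) = -(sigma z : ℂ) ^ 2 / 2 := by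
  rw [sigma_eq]
  simp only [liftY, liftH, evv, nullForm, ev_cons, ev_nil, Matrix.cons_val]
  ring

/-- Two real null vectors with vanishing scalar product are parallel. -/
theorem projPoint_eq_of_lor_eq_zero {X X' : ℂ → Fin 8 → ℂ} (N : IsRealLift X) (N' : IsRealLift X')
    {z : ℂ} (h : lor (X z) (X' z) = 0) : projPoint X z = projPoint X' z := by
  have h0 : lor (lightLift (projPoint X) z) (lightLift (projPoint X') z) = 0 := by
    rw [N.lightLift_eq, N'.lightLift_eq]
    simp only [lor_smul_left, lor_smul_right, h, mul_zero]
  have h1 : ∑ i : Fin 7, ((projPoint X z i : ℝ) : ℂ) * (projPoint X' z i : ℝ) = 1 := by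
    simp only [lor, lightLift, Fin.cons_zero, Fin.cons_succ] at h0
    linear_combination h0
  have h2 : inner ℝ (projPoint X z) (projPoint X' z) = 1 := by
    rw [PiLp.inner_apply]
    simp only [RCLike.inner_apply, conj_trivial]
    rw [← Complex.ofReal_inj]
    push_cast
    rw [← h1]
    exact Finset.sum_congr rfl fun i _ => mul_comm _ _
  exact (inner_eq_one_iff_of_norm_eq_one (N.norm_projPoint z) (N'.norm_projPoint z)).1 h2

theorem surfY_eq_surfH (hl : ‖l‖ = 1) {z : ℂ} (h : sigma z = 0) : surfY l z = surfH l z :=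
  projPoint_eq_of_lor_eq_zero (polyDataY.isRealLift hl) (polyDataH.isRealLift hl) (by
    rw [polyLift, polyLift, lor_nullVec (ne_zero_of_norm hl), nullForm_liftY_liftH, h]
    simp)

theorem continuous_sigma : Continuous sigma := by
  unfold sigma
  fun_prop

/-- The curve `σ = 0` has empty interior: on each ray, `σ` is negative beyond the curve. -/
theorem mem_closure_sigma_ne_zero {z₀ : ℂ} (h : sigma z₀ = 0) :
    z₀ ∈ closure {z | sigma z ≠ 0} := by
  have ht : Filter.Tendsto (fun s : ℝ => (s : ℂ) * z₀) (𝓝[>] 1) (𝓝 z₀) := by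
    have : Filter.Tendsto (fun s : ℝ => (s : ℂ) * z₀) (𝓝 1) (𝓝 ((1 : ℝ) * z₀)) :=
      (Complex.continuous_ofReal.mul continuous_const).tendsto 1
    rw [Complex.ofReal_one, one_mul] at this
    exact this.mono_left nhdsWithin_le_nhds
  refine mem_closure_of_tendsto ht ?_
  filter_upwards [self_mem_nhdsWithin] with s hs
  have hs' : (1 : ℝ) < s := hs
  have h4 : 1 < s ^ 4 := one_lt_pow₀ hs' (by norm_num)
  have h6 : 1 < s ^ 6 := one_lt_pow₀ hs' (by norm_num)
  have hn : ‖(s : ℂ) * z₀‖ = s * ‖z₀‖ := by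
    rw [norm_mul, Complex.norm_real, Real.norm_of_nonneg (by linarith)]
  refine ne_of_lt ?_
  simp only [sigma] at h ⊢
  rw [hn, mul_pow, mul_pow]
  have hz : 0 < ‖z₀‖ := by
    refine (norm_nonneg z₀).lt_of_ne fun h0 => ?_
    rw [← h0] at h
    norm_num at h
  nlinarith [mul_pos (sub_pos.2 h4) (pow_pos hz 4), mul_pos (sub_pos.2 h6) (pow_pos hz 6)]

/-- A component of `Y ∧ Ŷ` in null coordinates which is unbounded near the curve `σ = 0`. -/
theorem wedge_component (hl : ‖l‖ = 1) {z : ℂ} (h : sigma z ≠ 0) :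
    (sigma z : ℂ) * (wedge (Yvec l z) (Yhat l z) 0 3 + wedge (Yvec l z) (Yhat l z) 1 3 -
      Complex.I * (wedge (Yvec l z) (Yhat l z) 0 2 + wedge (Yvec l z) (Yhat l z) 1 2)) =
    l * (z * (starRingEnd ℂ) z ^ 2) := by
  have hl0 := ne_zero_of_norm hl
  have hs : (sigma z : ℂ) ≠ 0 := Complex.ofReal_ne_zero.2 h
  have hσ := sigma_eq z
  have hq : ((Real.sqrt 2 / |sigma z| : ℝ) : ℂ) ^ 2 * (sigma z : ℂ) ^ 2 = 2 := by
    rw [← Complex.ofReal_pow, ← Complex.ofReal_pow, ← Complex.ofReal_mul, div_pow,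
      Real.sq_sqrt (by norm_num), sq_abs, div_mul_cancel₀ _ (pow_ne_zero 2 h)]
    norm_num
  rw [Yvec_eq, Yhat_eq]
  generalize ((Real.sqrt 2 / |sigma z| : ℝ) : ℂ) = q at hq
  generalize (sigma z : ℂ) = s at hs hσ hq
  have e : wedge (q • polyLift l liftY z) (q • polyLift l liftH z) 0 3 +
      wedge (q • polyLift l liftY z) (q • polyLift l liftH z) 1 3 -
      Complex.I * (wedge (q • polyLift l liftY z) (q • polyLift l liftH z) 0 2 +
        wedge (q • polyLift l liftY z) (q • polyLift l liftH z) 1 2) =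
      q ^ 2 * (l * (ev (liftY 0) z * ev (liftH 2) z - ev (liftY 2) z * ev (liftH 0) z)) := by
    simp only [wedge, Pi.smul_apply, smul_eq_mul, polyLift, nullVec_apply, Matrix.cons_val, evv]
    ring_nf
    simp only [Complex.I_sq]
    ring
  have e2 : ev (liftY 0) z * ev (liftH 2) z - ev (liftY 2) z * ev (liftH 0) z =
      z * (starRingEnd ℂ) z ^ 2 * s / 2 := by
    rw [hσ]
    simp only [liftY, liftH, ev_cons, ev_nil, Matrix.cons_val]
    ring
  rw [e, e2]
  linear_combination l * (z * (starRingEnd ℂ) z ^ 2) / 2 * hq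

theorem not_tendsto_wedge (hl : ‖l‖ = 1) {z₀ : ℂ} (h : sigma z₀ = 0) :
    ¬ ∃ L : Fin 8 → Fin 8 → ℂ, Filter.Tendsto (fun z => wedge (Yvec l z) (Yhat l z))
      (𝓝[{z | sigma z ≠ 0}] z₀) (𝓝 L) := by
  rintro ⟨L, hL⟩
  have : (𝓝[{z | sigma z ≠ 0}] z₀).NeBot :=
    mem_closure_iff_nhdsWithin_neBot.1 (mem_closure_sigma_ne_zero h)
  have c : ∀ i j, Filter.Tendsto (fun z => wedge (Yvec l z) (Yhat l z) i j)
      (𝓝[{z | sigma z ≠ 0}] z₀) (𝓝 (L i j)) := fun i j =>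
    tendsto_pi_nhds.1 (tendsto_pi_nhds.1 hL i) j
  have hs : Filter.Tendsto (fun z => (sigma z : ℂ)) (𝓝[{z | sigma z ≠ 0}] z₀) (𝓝 0) := by
    have : Filter.Tendsto (fun z => (sigma z : ℂ)) (𝓝 z₀) (𝓝 (sigma z₀ : ℂ)) :=
      (Complex.continuous_ofReal.comp continuous_sigma).tendsto z₀
    rw [h, Complex.ofReal_zero] at this
    exact this.mono_left nhdsWithin_le_nhds
  have h1 := hs.mul (((c 0 3).add (c 1 3)).sub (((c 0 2).add (c 1 2)).const_mul Complex.I))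
  rw [zero_mul] at h1
  have h2 : Filter.Tendsto (fun z => l * (z * (starRingEnd ℂ) z ^ 2))
      (𝓝[{z | sigma z ≠ 0}] z₀) (𝓝 (l * (z₀ * (starRingEnd ℂ) z₀ ^ 2))) := by
    have : Continuous fun z => l * (z * (starRingEnd ℂ) z ^ 2) :=
      continuous_const.mul (continuous_id.mul (Complex.continuous_conj.pow 2))
    exact (this.tendsto z₀).mono_left nhdsWithin_le_nhds
  have h3 := tendsto_nhds_unique (h1.congr' (by
    filter_upwards [self_mem_nhdsWithin] with z hz
    exact wedge_component hl hz)) h2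
  have hz : z₀ ≠ 0 := by
    rintro rfl
    simp [sigma] at h
  exact mul_ne_zero (ne_zero_of_norm hl)
    (mul_ne_zero hz (pow_ne_zero 2 (by simpa using hz))) h3.symm

/-! ### The columns of the extended frame -/

/-- The first vector (up to scale) of the Gram-Schmidt basis of the isotropic space orthogonal to
`Y` and `Ŷ`. The basis is triangular with respect to the antiholomorphic basis which consists of the
conjugates of the columns `2, 3, 4` of `meroCol`, in reverse order. -/
def gramOne : Fin 8 → BiPoly :=
  ![[(1, 1, 2), (1 / 9, 4, 5)], [(1, 0, 1), (1 / 4, 2, 3), (2 / 9, 3, 4), (1 / 36, 5, 6),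
    (1 / 81, 6, 7)], [(1 / 2, 1, 3), (1 / 18, 4, 6)], [(-1 / 2, 0, 2), (-1 / 8, 2, 4),
    (-2 / 9, 3, 5)], [(1 / 3, 1, 4), (1 / 27, 4, 7)], [(1, 0, 0), (1 / 4, 2, 2), (-4 / 9, 3, 3),
    (1 / 9, 5, 5), (4 / 81, 6, 6)], [(-1, 1, 1), (-1 / 9, 4, 4)], [(2 / 3, 3, 2), (-1 / 12, 5, 4),
    (-1 / 27, 6, 5)]]

/-- The second vector of the Gram-Schmidt basis. -/
def gramTwo : Fin 8 → BiPoly :=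
  ![[(-1, 0, 1), (-4 / 9, 3, 4)], [(-1, 2, 3)], [(-1 / 2, 0, 2), (-2 / 9, 3, 5)], [(2 / 3, 2, 4)],
    [(-1 / 3, 0, 3), (-4 / 27, 3, 6)], [], [(1, 0, 0), (4 / 9, 3, 3)], [(-1, 2, 1)]]

/-- The third vector of the Gram-Schmidt basis. -/
def gramThree : Fin 8 → BiPoly :=
  ![[], [(1, 0, 2)], [], [(-2 / 3, 0, 3)], [], [], [], [(1, 0, 0)]]

/-- The complex conjugate of `gramOne`. -/
def gramOneConj : Fin 8 → BiPoly :=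
  ![[(1, 2, 1), (1 / 9, 5, 4)], [(1, 1, 0), (1 / 4, 3, 2), (2 / 9, 4, 3), (1 / 36, 6, 5),
    (1 / 81, 7, 6)], [(1, 0, 0), (1 / 4, 2, 2), (-4 / 9, 3, 3), (1 / 9, 5, 5), (4 / 81, 6, 6)],
    [(-1, 1, 1), (-1 / 9, 4, 4)], [(2 / 3, 2, 3), (-1 / 12, 4, 5), (-1 / 27, 5, 6)],
    [(1 / 2, 3, 1), (1 / 18, 6, 4)], [(-1 / 2, 2, 0), (-1 / 8, 4, 2), (-2 / 9, 5, 3)],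
    [(1 / 3, 4, 1), (1 / 27, 7, 4)]]

/-- The complex conjugate of `gramTwo`. -/
def gramTwoConj : Fin 8 → BiPoly :=
  ![[(-1, 1, 0), (-4 / 9, 4, 3)], [(-1, 3, 2)], [], [(1, 0, 0), (4 / 9, 3, 3)], [(-1, 1, 2)],
    [(-1 / 2, 2, 0), (-2 / 9, 5, 3)], [(2 / 3, 4, 2)], [(-1 / 3, 3, 0), (-4 / 27, 6, 3)]]

/-- The complex conjugate of `gramThree`. -/
def gramThreeConj : Fin 8 → BiPoly :=
  ![[], [(1, 2, 0)], [], [], [(1, 0, 0)], [], [(-2 / 3, 3, 0)], []]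

/-- The columns of the extended frame in null coordinates, before normalization. -/
def frameCol : Fin 8 → Fin 8 → BiPoly :=
  ![liftH, liftY, gramOneConj, gramTwoConj, gramThreeConj, gramOne, gramTwo, gramThree]

/-- The columns of the meromorphic frame `F₋` in null coordinates. -/
def meroCol : Fin 8 → Fin 8 → BiPoly :=
  ![![[(1, 0, 0)], [], [], [], [], [(1, 1, 0)], [], [(1, 2, 0)]],
    ![[], [(1, 0, 0)], [], [], [], [], [(-1, 1, 0)], []],
    ![[], [(1, 1, 0)], [(1, 0, 0)], [], [], [], [(-1 / 2, 2, 0)], []],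
    ![[(-1, 1, 0)], [], [], [(1, 0, 0)], [], [(-1 / 2, 2, 0)], [], [(-1 / 3, 3, 0)]],
    ![[], [(1, 2, 0)], [], [], [(1, 0, 0)], [], [(-2 / 3, 3, 0)], []],
    ![[], [], [], [], [], [(1, 0, 0)], [], []],
    ![[], [], [], [], [], [], [(1, 0, 0)], []],
    ![[], [], [], [], [], [], [], [(1, 0, 0)]]]

/-- The grading of the null coordinates: `λ` acts on the null coordinates with weights `deg`. -/
def deg : Fin 8 → ℤ := ![0, 0, 1, 1, 1, -1, -1, -1]

/-- The index of the null coordinate which is paired with a given one. -/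
def dual : Fin 8 → Fin 8 := ![1, 0, 5, 6, 7, 2, 3, 4]

/-- The first Gram determinant. -/
def gramDetOne (z : ℂ) : ℝ := 1 + 4 / 9 * (‖z‖ ^ 2) ^ 3

/-- The second Gram determinant. The third one is `σ ^ 2`. -/
def gramDetTwo (z : ℂ) : ℝ := 1 + 1 / 4 * (‖z‖ ^ 2) ^ 2 - 4 / 9 * (‖z‖ ^ 2) ^ 3 +
  1 / 9 * (‖z‖ ^ 2) ^ 5 + 4 / 81 * (‖z‖ ^ 2) ^ 6

theorem gramDetOne_pos (z : ℂ) : 0 < gramDetOne z := by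
  unfold gramDetOne
  positivity

theorem gramDetTwo_pos (z : ℂ) : 0 < gramDetTwo z := by
  have h : gramDetTwo z = (1 - 2 / 9 * (‖z‖ ^ 2) ^ 3) ^ 2 + ((‖z‖ ^ 2) ^ 2 / 4 +
      (‖z‖ ^ 2) ^ 5 / 9) := by
    unfold gramDetTwo
    ring
  rw [h]
  rcases eq_or_ne z 0 with rfl | hz
  · norm_num
  · have : 0 < ‖z‖ := norm_pos_iff.2 hz
    positivity

theorem ofReal_gramDetOne (z : ℂ) :
    (gramDetOne z : ℂ) = 1 + 4 / 9 * (z * (starRingEnd ℂ) z) ^ 3 := by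
  rw [gramDetOne, Complex.mul_conj']
  push_cast
  ring

theorem ofReal_gramDetTwo (z : ℂ) :
    (gramDetTwo z : ℂ) = 1 + 1 / 4 * (z * (starRingEnd ℂ) z) ^ 2 -
      4 / 9 * (z * (starRingEnd ℂ) z) ^ 3 + 1 / 9 * (z * (starRingEnd ℂ) z) ^ 5 +
      4 / 81 * (z * (starRingEnd ℂ) z) ^ 6 := by
  rw [gramDetTwo, Complex.mul_conj']
  push_cast
  ring

theorem nullForm_comm (x y : Fin 8 → ℂ) : nullForm x y = nullForm y x := by
  unfold nullForm
  ring

theorem nullForm_smul_left (c : ℂ) (x y : Fin 8 → ℂ) : nullForm (c • x) y = c * nullForm x y := by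
  simp only [nullForm, Pi.smul_apply, smul_eq_mul]
  ring

theorem nullForm_smul_right (c : ℂ) (x y : Fin 8 → ℂ) : nullForm x (c • y) = c * nullForm x y := by
  rw [nullForm_comm, nullForm_smul_left, nullForm_comm]

theorem nullForm_frameCol_zero (z : ℂ) (i j : Fin 8) (h : j ≠ dual i) :
    nullForm (evv (frameCol i) z) (evv (frameCol j) z) = 0 := by
  fin_cases i <;> fin_cases j <;>
  first
  | exact absurd rfl h
  | (simp only [nullForm, evv, Matrix.cons_val, Fin.zero_eta, Fin.mk_one, Fin.reduceFinMk, ev_cons,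
      ev_nil, frameCol, liftH, liftY, gramOne, gramTwo, gramThree, gramOneConj, gramTwoConj,
      gramThreeConj]
     ring)

theorem nullForm_frameCol_dual (z : ℂ) :
    nullForm (evv (frameCol 0) z) (evv (frameCol 1) z) = -((sigma z : ℂ) ^ 2) / 2 ∧
    nullForm (evv (frameCol 2) z) (evv (frameCol 5) z) =
      (gramDetTwo z : ℂ) * (sigma z : ℂ) ^ 2 / 2 ∧
    nullForm (evv (frameCol 3) z) (evv (frameCol 6) z) =
      (gramDetOne z : ℂ) * (gramDetTwo z : ℂ) / 2 ∧
    nullForm (evv (frameCol 4) z) (evv (frameCol 7) z) = (gramDetOne z : ℂ) / 2 := by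
  rw [ofReal_gramDetOne, ofReal_gramDetTwo, sigma_eq]
  refine ⟨?_, ?_, ?_, ?_⟩ <;>
  simp only [nullForm, evv, Matrix.cons_val, ev_cons, ev_nil, frameCol, liftH, liftY, gramOne,
    gramTwo, gramThree, gramOneConj, gramTwoConj, gramThreeConj] <;>
  ring

/-- The columns of degree `1` are holomorphic up to triangular combinations, those of degree `-1`
antiholomorphic: these relations say that the Maurer-Cartan form has no components of degrees `1`
and `± 2`. -/
theorem nullForm_frameCol_dZ (z : ℂ) (i j : Fin 8) (h : deg i + deg j = -1 ∨ deg i + deg j = 2 ∨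
    deg i + deg j = -2) :
    nullForm (evv (frameCol i) z) (evv (fun k => dZ (frameCol j k)) z) = 0 := by
  fin_cases i <;> fin_cases j <;>
  first
  | exact absurd h (by decide)
  | (simp only [nullForm, evv, Matrix.cons_val, Fin.zero_eta, Fin.mk_one, Fin.reduceFinMk, ev_cons,
      ev_nil, dZ_cons, dZ_nil, Nat.cast_ofNat, Nat.cast_one, Nat.cast_zero, Nat.reduceSub,
      frameCol, liftH, liftY, gramOne, gramTwo, gramThree, gramOneConj, gramTwoConj,
      gramThreeConj]
     ring)

/-- An order of the null coordinates with decreasing degrees, in which the passage from the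
meromorphic to the extended frame is upper triangular. -/
def rank : Fin 8 ≃ Fin 8 where
  toFun := ![3, 4, 2, 1, 0, 5, 6, 7]
  invFun := ![4, 3, 2, 0, 1, 5, 6, 7]
  left_inv := by decide
  right_inv := by decide

theorem nullForm_frameCol_meroCol (z : ℂ) (i j : Fin 8) (h : rank j < rank i) :
    nullForm (evv (frameCol (dual i)) z) (evv (meroCol j) z) = 0 := by
  fin_cases i <;> fin_cases j <;>
  first
  | exact absurd h (by decide)
  | (simp only [nullForm, evv, Matrix.cons_val, Fin.zero_eta, Fin.mk_one, Fin.reduceFinMk, ev_cons,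
      ev_nil, dual, meroCol, frameCol, liftH, liftY, gramOne, gramTwo, gramThree, gramOneConj,
      gramTwoConj, gramThreeConj]
     ring)

theorem nullForm_frameCol_meroCol_self (z : ℂ) (i : Fin 8) :
    nullForm (evv (frameCol (dual i)) z) (evv (meroCol i) z) =
      (![-sigma z / 2, -sigma z / 2, sigma z ^ 2 / 2, gramDetTwo z / 2, gramDetOne z / 2,
        gramDetTwo z / 2, gramDetOne z / 2, 1 / 2] i : ℝ) := by
  have h0 := sigma_eq z
  have h1 := ofReal_gramDetOne z
  have h2 := ofReal_gramDetTwo z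
  fin_cases i <;>
  (simp only [Matrix.cons_val, Fin.zero_eta, Fin.mk_one, Fin.reduceFinMk, Complex.ofReal_neg,
      Complex.ofReal_div, Complex.ofReal_pow, Complex.ofReal_one, Complex.ofReal_ofNat, h0, h1, h2]
   simp only [nullForm, evv, Matrix.cons_val, ev_cons,
      ev_nil, dual, meroCol, frameCol, liftH, liftY, gramOne, gramTwo, gramThree, gramOneConj,
      gramTwoConj, gramThreeConj]
   ring)

theorem nullForm_frameCol_meroCol_one (z : ℂ) :
    nullForm (evv (frameCol 1) z) (evv (meroCol 1) z) = 0 := by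
  simp only [nullForm, evv, Matrix.cons_val, ev_cons, ev_nil, meroCol, frameCol, liftY]
  ring

/-! ### Matrices in null coordinates -/

/-- The identification of the two index sets. -/
abbrev idxEquiv : Idx ≃ Fin 8 := finSumFinEquiv

/-- The matrix with columns `v`. -/
def toMat (v : Fin 8 → Fin 8 → ℂ) : Matrix Idx Idx ℂ :=
  Matrix.of fun i j => v (idxEquiv j) (idxEquiv i)

theorem toMat_apply (v : Fin 8 → Fin 8 → ℂ) (i j : Idx) :
    toMat v i j = v (idxEquiv j) (idxEquiv i) := rfl

theorem toMat_single : toMat (fun j => Pi.single j 1) = 1 := by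
  ext i j
  rw [toMat_apply, Matrix.one_apply, Pi.single_apply]
  simp only [EmbeddingLike.apply_eq_iff_eq]

theorem sum_idx (g : Fin 8 → ℂ) : ∑ i : Idx, g (idxEquiv i) = ∑ k, g k :=
  Equiv.sum_comp idxEquiv g

/-- The Gram matrix of the null coordinates. -/
def nullGram : Matrix Idx Idx ℂ :=
  Matrix.of fun i j => nullForm (Pi.single (idxEquiv i) 1) (Pi.single (idxEquiv j) 1)

theorem nullForm_single_single (i j : Fin 8) : nullForm (Pi.single i 1) (Pi.single j 1) =
    if j = dual i then (if deg i = 0 then -2⁻¹ else 2⁻¹) else 0 := by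
  fin_cases i <;> fin_cases j <;> simp [nullForm, dual, deg]

theorem dual_dual (i : Fin 8) : dual (dual i) = i := by
  revert i
  decide

theorem dual_injective : Function.Injective dual :=
  Function.LeftInverse.injective dual_dual

theorem deg_dual (i : Fin 8) : deg (dual i) = -deg i := by
  revert i
  decide

theorem nullForm_single_left (i : Fin 8) (y : Fin 8 → ℂ) :
    nullForm (Pi.single i 1) y = (if deg i = 0 then -2⁻¹ else 2⁻¹) * y (dual i) := by
  fin_cases i <;> simp [nullForm, dual, deg]

theorem nullForm_eq_sum (x y : Fin 8 → ℂ) :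
    nullForm x y = ∑ i, x i * nullForm (Pi.single i 1) y := by
  simp [Fin.sum_univ_eight, nullForm]
  ring

theorem nullGram_mul_toMat (w : Fin 8 → Fin 8 → ℂ) : nullGram * toMat w =
    Matrix.of fun i j => nullForm (Pi.single (idxEquiv i) 1) (w (idxEquiv j)) := by
  ext i j
  rw [Matrix.mul_apply, Matrix.of_apply, nullForm_comm _ (w _), nullForm_eq_sum,
    ← sum_idx fun k => w (idxEquiv j) k * nullForm (Pi.single k 1) (Pi.single (idxEquiv i) 1)]
  refine Finset.sum_congr rfl fun k _ => ?_
  rw [nullGram, Matrix.of_apply, toMat_apply, nullForm_comm, mul_comm]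

theorem transpose_mul_nullGram_mul (v w : Fin 8 → Fin 8 → ℂ) :
    (toMat v).transpose * nullGram * toMat w =
      Matrix.of fun i j => nullForm (v (idxEquiv i)) (w (idxEquiv j)) := by
  rw [Matrix.mul_assoc, nullGram_mul_toMat]
  ext i j
  rw [Matrix.mul_apply, Matrix.of_apply, nullForm_eq_sum,
    ← sum_idx fun k => v (idxEquiv i) k * nullForm (Pi.single k 1) (w (idxEquiv j))]
  rfl

theorem nullGram_mul_self : nullGram * nullGram = (4 : ℂ)⁻¹ • (1 : Matrix Idx Idx ℂ) := by
  have h : nullGram = toMat fun j i => nullForm (Pi.single j 1) (Pi.single i 1) := by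
    ext i j
    exact nullForm_comm _ _
  nth_rw 2 [h]
  rw [nullGram_mul_toMat]
  ext i j
  rw [Matrix.of_apply, nullForm_single_left, nullForm_single_single, Matrix.smul_apply,
    Matrix.one_apply, smul_eq_mul]
  by_cases h : i = j
  · subst h
    by_cases hd : deg (idxEquiv i) = 0 <;> simp only [hd, if_true, if_false] <;> norm_num
  · rw [if_neg h, if_neg fun hd => h (idxEquiv.injective (dual_injective hd))]
    simp

theorem idxEquiv_inl : idxEquiv (Sum.inl 0) = 0 ∧ idxEquiv (Sum.inl 1) = 1 := by decide

theorem idxEquiv_inr_ne (k : Fin 6) :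
    idxEquiv (Sum.inr k) ≠ 0 ∧ idxEquiv (Sum.inr k) ≠ 1 := by
  revert k
  decide

theorem I17_eq_diagonal (R : Type*) [CommRing R] :
    I17 R = Matrix.diagonal fun i => if idxEquiv i = 0 then -1 else 1 := by
  rw [I17, I11]
  ext i j
  rcases i with i | i <;> rcases j with j | j
  · fin_cases i <;> fin_cases j <;> simp [idxEquiv_inl]
  · simp
  · simp
  · simp only [Matrix.fromBlocks_apply₂₂, Matrix.one_apply, Matrix.diagonal_apply,
      (idxEquiv_inr_ne _).1, if_false, Sum.inr.injEq]

theorem lor_eq_sum (x y : Fin 8 → ℂ) :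
    lor x y = ∑ k, x k * (if k = 0 then -1 else 1) * y k := by
  rw [Fin.sum_univ_succ, lor]
  simp [Fin.succ_ne_zero]

theorem transpose_mul_lor_mul (v w : Fin 8 → Fin 8 → ℂ) :
    (toMat v).transpose * I17 ℂ * toMat w =
      Matrix.of fun i j => lor (v (idxEquiv i)) (w (idxEquiv j)) := by
  ext i j
  rw [I17_eq_diagonal, Matrix.mul_apply, Matrix.of_apply, lor_eq_sum,
    ← sum_idx fun k => v (idxEquiv i) k * (if k = 0 then -1 else 1) * w (idxEquiv j) k]
  simp only [Matrix.mul_diagonal, Matrix.transpose_apply, toMat_apply]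

theorem nullVec_eq_sum (l : ℂ) (x : Fin 8 → ℂ) :
    nullVec l x = ∑ k, x k • nullVec l (Pi.single k 1) := by
  conv_lhs => rw [pi_eq_sum_univ' x, map_sum]
  simp only [map_smul]

/-- The matrix of `nullVec l`. -/
def nullMat (l : ℂ) : Matrix Idx Idx ℂ := toMat fun j => nullVec l (Pi.single j 1)

theorem nullMat_mul_toMat (l : ℂ) (v : Fin 8 → Fin 8 → ℂ) :
    nullMat l * toMat v = toMat fun j => nullVec l (v j) := by
  ext i j
  rw [Matrix.mul_apply, toMat_apply, nullVec_eq_sum, Finset.sum_apply,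
    ← sum_idx fun k => (v (idxEquiv j) k • nullVec l (Pi.single k 1)) (idxEquiv i)]
  refine Finset.sum_congr rfl fun k _ => ?_
  rw [nullMat, toMat_apply, toMat_apply, Pi.smul_apply, smul_eq_mul, mul_comm]

theorem transpose_nullMat_mul {l : ℂ} (hl : l ≠ 0) :
    (nullMat l).transpose * I17 ℂ * nullMat l = nullGram := by
  rw [nullMat, transpose_mul_lor_mul]
  ext i j
  rw [Matrix.of_apply, lor_nullVec hl]
  rfl

/-- The inverse of the matrix `nullMat l`. -/
def nullMatInv (l : ℂ) : Matrix Idx Idx ℂ :=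
  (4 : ℂ) • (nullGram * (nullMat l).transpose * I17 ℂ)

theorem nullMatInv_mul {l : ℂ} (hl : l ≠ 0) : nullMatInv l * nullMat l = 1 := by
  rw [nullMatInv, Matrix.smul_mul, Matrix.mul_assoc nullGram, Matrix.mul_assoc nullGram,
    transpose_nullMat_mul hl, nullGram_mul_self, smul_smul]
  norm_num

theorem mul_nullMatInv {l : ℂ} (hl : l ≠ 0) : nullMat l * nullMatInv l = 1 :=
  mul_eq_one_comm.1 (nullMatInv_mul hl)

/-- The endomorphism of `ℂ⁸` whose matrix in null coordinates (with parameter `l`) is `M`. -/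
def nullConjugate (l : ℂ) (M : Matrix Idx Idx ℂ) : Matrix Idx Idx ℂ :=
  nullMat l * M * nullMatInv l

theorem nullConjugate_mul {l : ℂ} (hl : l ≠ 0) (A B : Matrix Idx Idx ℂ) :
    nullConjugate l A * nullConjugate l B = nullConjugate l (A * B) := by
  have : nullMat l * A * nullMatInv l * (nullMat l * B * nullMatInv l) =
      nullMat l * A * (nullMatInv l * nullMat l) * B * nullMatInv l := by
    simp only [Matrix.mul_assoc]
  rw [nullConjugate, nullConjugate, nullConjugate, this, nullMatInv_mul hl, Matrix.mul_one,
    Matrix.mul_assoc (nullMat l) A B]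

theorem nullConjugate_one {l : ℂ} (hl : l ≠ 0) : nullConjugate l 1 = 1 := by
  rw [nullConjugate, Matrix.mul_one, mul_nullMatInv hl]

theorem nullConjugate_mul_nullMat {l : ℂ} (hl : l ≠ 0) (M : Matrix Idx Idx ℂ) :
    nullConjugate l M * nullMat l = nullMat l * M := by
  rw [nullConjugate, Matrix.mul_assoc, nullMatInv_mul hl, Matrix.mul_one]

theorem det_nullConjugate {l : ℂ} (hl : l ≠ 0) (M : Matrix Idx Idx ℂ) :
    (nullConjugate l M).det = M.det := by
  have h := congrArg Matrix.det (mul_nullMatInv hl)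
  rw [Matrix.det_mul, Matrix.det_one] at h
  rw [nullConjugate, Matrix.det_mul, Matrix.det_mul]
  linear_combination M.det * h

theorem nullConjugate_add (l : ℂ) (A B : Matrix Idx Idx ℂ) :
    nullConjugate l (A + B) = nullConjugate l A + nullConjugate l B := by
  rw [nullConjugate, Matrix.mul_add, Matrix.add_mul, nullConjugate, nullConjugate]

theorem nullConjugate_smul (l c : ℂ) (A : Matrix Idx Idx ℂ) :
    nullConjugate l (c • A) = c • nullConjugate l A := by
  rw [nullConjugate, Matrix.mul_smul, Matrix.smul_mul, nullConjugate]

/-- A matrix which preserves the form in null coordinates is orthogonal. -/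
theorem nullConjugate_orthogonal {l : ℂ} (hl : l ≠ 0) {M : Matrix Idx Idx ℂ}
    (hM : M.transpose * nullGram * M = nullGram) :
    (nullConjugate l M).transpose * I17 ℂ * nullConjugate l M = I17 ℂ := by
  have e : (nullConjugate l M).transpose * I17 ℂ * nullConjugate l M =
      (nullMatInv l).transpose * (M.transpose * ((nullMat l).transpose * I17 ℂ * nullMat l) * M) *
        nullMatInv l := by
    simp only [nullConjugate, Matrix.transpose_mul, Matrix.mul_assoc]
  have e2 : (nullMatInv l).transpose * ((nullMat l).transpose * I17 ℂ * nullMat l) * nullMatInv l =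
      (nullMat l * nullMatInv l).transpose * I17 ℂ * (nullMat l * nullMatInv l) := by
    simp only [Matrix.transpose_mul, Matrix.mul_assoc]
  rw [e, transpose_nullMat_mul hl, hM, ← transpose_nullMat_mul hl, e2, mul_nullMatInv hl]
  simp

/-! ### The grading -/

/-- The matrix `M` after the rotation by `l`: its component of degree `d` is multiplied by `l ^ d`.
-/
def rotate (l : ℂ) (M : Matrix Idx Idx ℂ) : Matrix Idx Idx ℂ :=
  Matrix.of fun i j => l ^ (deg (idxEquiv i) - deg (idxEquiv j)) * M i j

theorem nullVec_mul_single {l m : ℂ} (hl : l ≠ 0) (hm : m ≠ 0) (j : Fin 8) :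
    nullVec (l * m) (Pi.single j 1) = m ^ deg j • nullVec l (Pi.single j 1) := by
  ext i
  fin_cases j <;> fin_cases i <;> simp [nullVec_apply, deg] <;> field_simp

theorem nullMat_mul {l m : ℂ} (hl : l ≠ 0) (hm : m ≠ 0) :
    nullMat (l * m) = nullMat l * Matrix.diagonal fun j => m ^ deg (idxEquiv j) := by
  ext i j
  rw [Matrix.mul_diagonal, nullMat, nullMat, toMat_apply, toMat_apply, nullVec_mul_single hl hm,
    Pi.smul_apply, smul_eq_mul, mul_comm]

theorem nullConjugate_mul_left {l m : ℂ} (hl : l ≠ 0) (hm : m ≠ 0) (M : Matrix Idx Idx ℂ) :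
    nullConjugate (l * m) M = nullConjugate l (rotate m M) := by
  have h : nullConjugate (l * m) M * nullMat (l * m) =
      nullConjugate l (rotate m M) * nullMat (l * m) := by
    rw [nullConjugate_mul_nullMat (mul_ne_zero hl hm), nullMat_mul hl hm, ← Matrix.mul_assoc,
      nullConjugate_mul_nullMat hl, Matrix.mul_assoc, Matrix.mul_assoc]
    congr 1
    ext i j
    rw [Matrix.mul_diagonal, Matrix.diagonal_mul, rotate, Matrix.of_apply, zpow_sub₀ hm]
    field_simp
  have h2 := congrArg (· * nullMatInv (l * m)) h
  simpa only [Matrix.mul_assoc, mul_nullMatInv (mul_ne_zero hl hm), Matrix.mul_one] using h2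

theorem nullConjugate_eq_rotate {l : ℂ} (hl : l ≠ 0) (M : Matrix Idx Idx ℂ) :
    nullConjugate l M = nullConjugate 1 (rotate l M) := by
  rw [← nullConjugate_mul_left one_ne_zero hl, one_mul]

theorem nullVec_neg_single (l : ℂ) (i j : Fin 8) : nullVec (-l) (Pi.single j 1) i =
    (if i = 0 ∨ i = 1 then 1 else -1) * nullVec l (Pi.single j 1) i := by
  fin_cases j <;> fin_cases i <;> simp [nullVec_apply] <;> ring

theorem invD_eq_diagonal : invD ℂ =
    Matrix.diagonal fun i => if idxEquiv i = 0 ∨ idxEquiv i = 1 then -1 else 1 := by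
  rw [invD]
  ext i j
  rcases i with i | i <;> rcases j with j | j
  · fin_cases i <;> fin_cases j <;> simp [idxEquiv_inl]
  · simp
  · simp
  · simp only [Matrix.fromBlocks_apply₂₂, Matrix.one_apply, Matrix.diagonal_apply,
      (idxEquiv_inr_ne _).1, (idxEquiv_inr_ne _).2, or_self, if_false, Sum.inr.injEq]

theorem invD_mul_nullMat (l : ℂ) : invD ℂ * nullMat l = -nullMat (-l) := by
  ext i j
  rw [invD_eq_diagonal, Matrix.diagonal_mul, Matrix.neg_apply, nullMat, nullMat, toMat_apply,
    toMat_apply, nullVec_neg_single]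
  split_ifs <;> ring

theorem invD_nullConjugate {l : ℂ} (hl : l ≠ 0) (M : Matrix Idx Idx ℂ) :
    invD ℂ * nullConjugate l M * invD ℂ = nullConjugate (-l) M := by
  have h : nullMatInv l * invD ℂ = -nullMatInv (-l) := by
    have h1 : nullMatInv l * invD ℂ * nullMat (-l) = -1 := by
      have := invD_mul_nullMat (-l)
      rw [neg_neg] at this
      rw [Matrix.mul_assoc, this, Matrix.mul_neg, nullMatInv_mul hl]
    have h2 := congrArg (· * nullMatInv (-l)) h1
    simpa only [Matrix.mul_assoc, mul_nullMatInv (neg_ne_zero.2 hl), Matrix.mul_one,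
      Matrix.neg_mul, Matrix.one_mul] using h2
  rw [nullConjugate, ← Matrix.mul_assoc, ← Matrix.mul_assoc, invD_mul_nullMat, Matrix.mul_assoc _ _
    (invD ℂ), h, nullConjugate]
  simp

theorem kPart_eq (A : Matrix Idx Idx ℂ) :
    kPart A = (2 : ℂ)⁻¹ • (A + invD ℂ * A * invD ℂ) := by
  obtain ⟨a, b, c, d, rfl⟩ : ∃ a b c d, A = Matrix.fromBlocks a b c d :=
    ⟨_, _, _, _, (Matrix.fromBlocks_toBlocks A).symm⟩
  rw [kPart, invD, Matrix.fromBlocks_multiply, Matrix.fromBlocks_multiply, Matrix.fromBlocks_add,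
    Matrix.fromBlocks_smul]
  simp [← two_smul ℂ, smul_smul]

theorem kPart_add_pPart (A : Matrix Idx Idx ℂ) : kPart A + pPart A = A := by
  rw [kPart, pPart, Matrix.fromBlocks_add]
  simp [Matrix.fromBlocks_toBlocks]

/-! ### Calculus of matrix valued maps -/

/-- Entrywise Wirtinger derivative of a matrix valued map. -/
def wdMat (s : ℂ) (M : ℂ → Matrix Idx Idx ℂ) (z : ℂ) : Matrix Idx Idx ℂ :=
  Matrix.of fun i j => wd s (fun ζ => M ζ i j) z

theorem dzMat_eq_wdMat (M : ℂ → Matrix Idx Idx ℂ) : dzMat M = wdMat (-Complex.I) M := by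
  ext z i j
  rw [dzMat, wdMat, Matrix.of_apply, Matrix.of_apply, dz_eq_wd]

theorem dzbarMat_eq_wdMat (M : ℂ → Matrix Idx Idx ℂ) : dzbarMat M = wdMat Complex.I M := rfl

theorem wd_sum {ι : Type*} {s : ℂ} {t : Finset ι} {f : ι → ℂ → ℂ} {z : ℂ}
    (h : ∀ i ∈ t, DifferentiableAt ℝ (f i) z) :
    wd s (fun ζ => ∑ i ∈ t, f i ζ) z = ∑ i ∈ t, wd s (f i) z := by
  classical
  induction t using Finset.induction_on with
  | empty => simpa using wd_const s (0 : ℂ) z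
  | insert a t ha ih =>
    simp only [Finset.sum_insert ha]
    rw [wd_add (h a (by simp)) (DifferentiableAt.fun_sum fun i hi => h i (by simp [hi])),
      ih fun i hi => h i (by simp [hi])]

theorem wdMat_mul {s : ℂ} {A B : ℂ → Matrix Idx Idx ℂ} {z : ℂ}
    (hA : ∀ i j, DifferentiableAt ℝ (fun ζ => A ζ i j) z)
    (hB : ∀ i j, DifferentiableAt ℝ (fun ζ => B ζ i j) z) :
    wdMat s (fun ζ => A ζ * B ζ) z = wdMat s A z * B z + A z * wdMat s B z := by
  ext i j
  simp only [wdMat, Matrix.of_apply, Matrix.add_apply, Matrix.mul_apply]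
  rw [wd_sum (f := fun k ζ => A ζ i k * B ζ k j) fun k _ => (hA i k).mul (hB k j),
    ← Finset.sum_add_distrib]
  refine Finset.sum_congr rfl fun k _ => ?_
  exact (wd_mul (hA i k) (hB k j)).trans (add_comm _ _)

theorem wdMat_const (s : ℂ) (A : Matrix Idx Idx ℂ) (z : ℂ) : wdMat s (fun _ => A) z = 0 := by
  ext i j
  exact wd_const s (A i j) z

theorem wdMat_congr {s : ℂ} {A B : ℂ → Matrix Idx Idx ℂ} {U : Set ℂ} (hU : IsOpen U)
    (h : ∀ z ∈ U, A z = B z) {z : ℂ} (hz : z ∈ U) : wdMat s A z = wdMat s B z := by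
  ext i j
  exact wd_congr_of_isOpen hU (fun ζ hζ => by rw [h ζ hζ]) hz

/-- Smoothness of a matrix valued map. -/
def SmoothMat (A : ℂ → Matrix Idx Idx ℂ) (U : Set ℂ) : Prop :=
  ∀ i j, ContDiffOn ℝ ∞ (fun z => A z i j) U

theorem SmoothMat.mul {A B : ℂ → Matrix Idx Idx ℂ} {U : Set ℂ} (hA : SmoothMat A U)
    (hB : SmoothMat B U) : SmoothMat (fun z => A z * B z) U := fun i j => by
  simp only [Matrix.mul_apply]
  exact ContDiffOn.sum fun k _ => (hA i k).mul (hB k j)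

theorem SmoothMat.const (A : Matrix Idx Idx ℂ) (U : Set ℂ) : SmoothMat (fun _ => A) U :=
  fun _ _ => contDiffOn_const

theorem SmoothMat.transpose {A : ℂ → Matrix Idx Idx ℂ} {U : Set ℂ} (hA : SmoothMat A U) :
    SmoothMat (fun z => (A z).transpose) U := fun i j => hA j i

theorem SmoothMat.wdMat {A : ℂ → Matrix Idx Idx ℂ} {U : Set ℂ} (hA : SmoothMat A U)
    (hU : IsOpen U) (s : ℂ) : SmoothMat (wdMat s A) U := fun i j => contDiffOn_wd hU (hA i j)

theorem SmoothMat.dAt {A : ℂ → Matrix Idx Idx ℂ} {U : Set ℂ} (hA : SmoothMat A U)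
    (hU : IsOpen U) {z : ℂ} (hz : z ∈ U) (i j : Idx) : DifferentiableAt ℝ (fun ζ => A ζ i j) z :=
  ((hA i j).contDiffAt (hU.mem_nhds hz)).differentiableAt (by simp)

theorem SmoothMat.nullConjugate {A : ℂ → Matrix Idx Idx ℂ} {U : Set ℂ} (hA : SmoothMat A U)
    (l : ℂ) : SmoothMat (fun z => nullConjugate l (A z)) U :=
  ((SmoothMat.const (nullMat l) U).mul hA).mul (SmoothMat.const (nullMatInv l) U)

theorem wdMat_nullConjugate {s l : ℂ} {A : ℂ → Matrix Idx Idx ℂ} {z : ℂ}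
    (hA : ∀ i j, DifferentiableAt ℝ (fun ζ => A ζ i j) z) :
    wdMat s (fun ζ => nullConjugate l (A ζ)) z = nullConjugate l (wdMat s A z) := by
  have hc : ∀ (B : Matrix Idx Idx ℂ) (i j : Idx), DifferentiableAt ℝ (fun _ : ℂ => B i j) z :=
    fun B i j => differentiableAt_const _
  have h1 : ∀ i j, DifferentiableAt ℝ (fun ζ => (nullMat l * A ζ) i j) z := fun i j => by
    simp only [Matrix.mul_apply]
    exact DifferentiableAt.fun_sum fun k _ => (hc (nullMat l) i k).mul (hA k j)
  unfold nullConjugate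
  rw [wdMat_mul (A := fun ζ => nullMat l * A ζ) (B := fun _ => nullMatInv l) h1 (hc _),
    wdMat_mul (A := fun _ => nullMat l) (hc _) hA, wdMat_const, wdMat_const]
  simp

/-- The Maurer-Cartan equation. -/
theorem maurerCartan {U : Set ℂ} (hU : IsOpen U) {F G : ℂ → Matrix Idx Idx ℂ} (hF : SmoothMat F U)
    (hG : SmoothMat G U) (h : ∀ z ∈ U, G z * F z = 1) {z : ℂ} (hz : z ∈ U) :
    wdMat (-Complex.I) (fun ζ => G ζ * wdMat Complex.I F ζ) z -
      wdMat Complex.I (fun ζ => G ζ * wdMat (-Complex.I) F ζ) z +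
      (G z * wdMat (-Complex.I) F z * (G z * wdMat Complex.I F z) -
        G z * wdMat Complex.I F z * (G z * wdMat (-Complex.I) F z)) = 0 := by
  have dG : ∀ s, wdMat s G z = -(G z * wdMat s F z * G z) := fun s => by
    have h1 := wdMat_mul (s := s) (hG.dAt hU hz) (hF.dAt hU hz)
    rw [wdMat_congr hU h hz, wdMat_const] at h1
    have h2 : F z * G z = 1 := mul_eq_one_comm.1 (h z hz)
    have h3 : wdMat s G z * F z = -(G z * wdMat s F z) := (neg_eq_of_add_eq_zero_left h1.symm).symm
    calc wdMat s G z = wdMat s G z * F z * G z := by rw [Matrix.mul_assoc, h2, Matrix.mul_one]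
      _ = _ := by rw [h3, Matrix.neg_mul]
  have hm : wdMat (-Complex.I) (wdMat Complex.I F) z =
      wdMat Complex.I (wdMat (-Complex.I) F) z := by
    ext i j
    exact wd_comm hU (hF i j) hz
  rw [wdMat_mul (hG.dAt hU hz) ((hF.wdMat hU _).dAt hU hz),
    wdMat_mul (hG.dAt hU hz) ((hF.wdMat hU _).dAt hU hz), dG, dG, hm]
  simp only [Matrix.neg_mul, Matrix.mul_assoc]
  abel

/-! ### Reality -/

/-- The permutation of the null coordinates induced by complex conjugation. -/
def swap : Fin 8 → Fin 8 := ![0, 1, 5, 6, 7, 2, 3, 4]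

theorem swap_swap (i : Fin 8) : swap (swap i) = i := by
  revert i
  decide

/-- The matrix of the permutation `swap`. -/
def swapMat : Matrix Idx Idx ℂ := toMat fun j => Pi.single (swap j) 1

theorem mul_swapMat (v : Fin 8 → Fin 8 → ℂ) : toMat v * swapMat = toMat fun j => v (swap j) := by
  ext i j
  have h : (toMat v * swapMat) i j =
      ∑ k, v k (idxEquiv i) * (Pi.single (swap (idxEquiv j)) (1 : ℂ) : Fin 8 → ℂ) k :=
    sum_idx fun k => v k (idxEquiv i) * (Pi.single (swap (idxEquiv j)) (1 : ℂ) : Fin 8 → ℂ) k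
  rw [h, toMat_apply]
  simp [Pi.single_apply]

theorem swapMat_mul (v : Fin 8 → Fin 8 → ℂ) :
    swapMat * toMat v = toMat fun j k => v j (swap k) := by
  ext i j
  have h : (swapMat * toMat v) i j =
      ∑ k, (Pi.single (swap k) (1 : ℂ) : Fin 8 → ℂ) (idxEquiv i) * v (idxEquiv j) k :=
    sum_idx fun k => (Pi.single (swap k) (1 : ℂ) : Fin 8 → ℂ) (idxEquiv i) * v (idxEquiv j) k
  have hs : ∀ k, idxEquiv i = swap k ↔ k = swap (idxEquiv i) := fun k =>
    ⟨fun h => by rw [h, swap_swap], fun h => by rw [h, swap_swap]⟩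
  rw [h, toMat_apply]
  simp [Pi.single_apply, hs]

theorem swapMat_mul_self : swapMat * swapMat = 1 := by
  nth_rw 1 [swapMat]
  rw [mul_swapMat]
  simp only [swap_swap]
  exact toMat_single

theorem nullConj_eq (x : Fin 8 → ℂ) (k : Fin 8) : nullConj x k = (starRingEnd ℂ) (x (swap k)) := by
  fin_cases k <;> rfl

theorem map_conj_nullMat {l : ℂ} (hl : ‖l‖ = 1) :
    (nullMat l).map (starRingEnd ℂ) = nullMat l * swapMat := by
  rw [nullMat, mul_swapMat]
  ext i j
  rw [Matrix.map_apply, toMat_apply, toMat_apply]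
  have h := congrFun (conjVec_nullVec hl (Pi.single (idxEquiv j) 1)) (idxEquiv i)
  rw [conjVec] at h
  rw [h]
  refine congrFun (congrArg (nullVec l) (funext fun k => ?_)) _
  rw [nullConj_eq, Pi.single_apply, Pi.single_apply]
  have : swap k = idxEquiv j ↔ k = swap (idxEquiv j) :=
    ⟨fun h => by rw [← h, swap_swap], fun h => by rw [h, swap_swap]⟩
  by_cases hk : k = swap (idxEquiv j)
  · rw [if_pos (this.2 hk), if_pos hk, map_one]
  · rw [if_neg fun h => hk (this.1 h), if_neg hk, map_zero]

theorem map_conj_mul (A B : Matrix Idx Idx ℂ) :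
    (A * B).map (starRingEnd ℂ) = A.map (starRingEnd ℂ) * B.map (starRingEnd ℂ) :=
  Matrix.map_mul

/-- Matrices which are compatible with the conjugation in null coordinates are real. -/
theorem map_conj_nullConjugate {l : ℂ} (hl : ‖l‖ = 1) {v : Fin 8 → Fin 8 → ℂ}
    (hv : ∀ j, nullConj (v j) = v (swap j)) :
    (nullConjugate l (toMat v)).map (starRingEnd ℂ) = nullConjugate l (toMat v) := by
  have h0 := ne_zero_of_norm hl
  have hM : (toMat v).map (starRingEnd ℂ) = swapMat * toMat v * swapMat := by
    rw [swapMat_mul, mul_swapMat]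
    ext i j
    rw [Matrix.map_apply, toMat_apply, toMat_apply, ← hv, nullConj_eq, swap_swap]
  have h1 : (nullConjugate l (toMat v)).map (starRingEnd ℂ) * nullMat l =
      nullConjugate l (toMat v) * nullMat l := by
    have h2 := congrArg (fun X : Matrix Idx Idx ℂ => X.map (starRingEnd ℂ))
      (nullConjugate_mul_nullMat h0 (toMat v))
    simp only [map_conj_mul, map_conj_nullMat hl, hM] at h2
    have h3 := congrArg (· * swapMat) h2
    simp only [Matrix.mul_assoc, swapMat_mul_self, Matrix.mul_one] at h3
    rw [← Matrix.mul_assoc swapMat, swapMat_mul_self, Matrix.one_mul] at h3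
    rw [h3, nullConjugate_mul_nullMat h0]
  have h2 := congrArg (· * nullMatInv l) h1
  simpa only [Matrix.mul_assoc, mul_nullMatInv h0, Matrix.mul_one] using h2

/-! ### Frames with graded Maurer-Cartan form -/

/-- A moving frame in null coordinates, with columns `v j`: it is orthonormal, real, and the
`dz`-part of its Maurer-Cartan form has components of degrees `0` and `-1` only. -/
structure IsGradedFrame (U : Set ℂ) (v : Fin 8 → ℂ → Fin 8 → ℂ) : Prop where
  isOpen : IsOpen U
  smooth : ∀ j, ContDiffOn ℝ ∞ (v j) U
  real : ∀ z ∈ U, ∀ j, nullConj (v j z) = v (swap j) z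
  pairing : ∀ z ∈ U, ∀ i j, nullForm (v i z) (v j z) = nullForm (Pi.single i 1) (Pi.single j 1)
  graded : ∀ z ∈ U, ∀ i j, deg i + deg j = -1 ∨ deg i + deg j = 2 ∨ deg i + deg j = -2 →
    nullForm (v i z) (δz (v j) z) = 0

/-- The matrix of a frame in null coordinates. -/
def frameMat (v : Fin 8 → ℂ → Fin 8 → ℂ) (z : ℂ) : Matrix Idx Idx ℂ := toMat fun j => v j z

/-- The inverse, with respect to the form, of an orthonormal frame in null coordinates. -/
def formInv (M : Matrix Idx Idx ℂ) : Matrix Idx Idx ℂ :=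
  (4 : ℂ) • (nullGram * M.transpose * nullGram)

theorem formInv_mul {M : Matrix Idx Idx ℂ} (h : M.transpose * nullGram * M = nullGram) :
    formInv M * M = 1 := by
  rw [formInv, Matrix.smul_mul, Matrix.mul_assoc nullGram, Matrix.mul_assoc nullGram, h,
    nullGram_mul_self, smul_smul]
  norm_num

theorem formInv_mul_toMat (v w : Fin 8 → Fin 8 → ℂ) (i j : Idx) :
    (formInv (toMat v) * toMat w) i j =
      (if deg (idxEquiv i) = 0 then -2 else 2) *
        nullForm (v (dual (idxEquiv i))) (w (idxEquiv j)) := by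
  have h : (toMat v).transpose * nullGram * toMat w =
      toMat fun j i => nullForm (v i) (w j) := transpose_mul_nullGram_mul v w
  rw [formInv, Matrix.smul_mul, Matrix.mul_assoc nullGram, Matrix.mul_assoc nullGram, h,
    nullGram_mul_toMat, Matrix.smul_apply, Matrix.of_apply, nullForm_single_left, smul_eq_mul]
  split_ifs <;> ring

/-- The complex extension of the frame with matrix `M` in null coordinates and parameter `l`. -/
def realFrame (M : ℂ → Matrix Idx Idx ℂ) (z l : ℂ) : Matrix Idx Idx ℝ :=
  (nullConjugate l (M z)).map Complex.re

namespace IsGradedFrame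

variable {U : Set ℂ} {v : Fin 8 → ℂ → Fin 8 → ℂ} {l z : ℂ}

theorem orthogonal (H : IsGradedFrame U v) (hz : z ∈ U) :
    (frameMat v z).transpose * nullGram * frameMat v z = nullGram := by
  rw [frameMat, transpose_mul_nullGram_mul]
  ext i j
  exact H.pairing z hz _ _

theorem smoothMat (H : IsGradedFrame U v) : SmoothMat (frameMat v) U := fun i j =>
  contDiffOn_pi.1 (H.smooth (idxEquiv j)) (idxEquiv i)

theorem ofReal_realFrame (H : IsGradedFrame U v) (hz : z ∈ U) (hl : ‖l‖ = 1) :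
    (realFrame (frameMat v) z l).map Complex.ofReal = nullConjugate l (frameMat v z) := by
  have h := map_conj_nullConjugate hl (v := fun j => v j z) (H.real z hz)
  ext i j
  exact Complex.conj_eq_iff_re.1 (congrFun (congrFun h i) j)

/-- The `dz`-part of the Maurer-Cartan form in null coordinates. -/
def mcNull (v : Fin 8 → ℂ → Fin 8 → ℂ) (z : ℂ) : Matrix Idx Idx ℂ :=
  formInv (frameMat v z) * wdMat (-Complex.I) (frameMat v) z

/-- The component of degree `d`. -/
def degPart (d : ℤ) (A : Matrix Idx Idx ℂ) : Matrix Idx Idx ℂ :=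
  Matrix.of fun i j => if deg (idxEquiv i) - deg (idxEquiv j) = d then A i j else 0

theorem wdMat_frameMat (H : IsGradedFrame U v) (hz : z ∈ U) (s : ℂ) :
    wdMat s (frameMat v) z = toMat fun j => wd s (v j) z := by
  ext i j
  exact (wd_apply (((H.smooth _).contDiffAt (H.isOpen.mem_nhds hz)).differentiableAt (by simp))
    _).symm

theorem deg_mem (i : Fin 8) : deg i = -1 ∨ deg i = 0 ∨ deg i = 1 := by
  revert i
  decide

theorem mcNull_eq (H : IsGradedFrame U v) (hz : z ∈ U) :
    mcNull v z = degPart 0 (mcNull v z) + degPart (-1) (mcNull v z) := by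
  ext i j
  rw [Matrix.add_apply, degPart, degPart, Matrix.of_apply, Matrix.of_apply]
  by_cases h0 : deg (idxEquiv i) - deg (idxEquiv j) = 0
  · rw [if_pos h0, if_neg (by omega), add_zero]
  by_cases h1 : deg (idxEquiv i) - deg (idxEquiv j) = -1
  · rw [if_neg h0, if_pos h1, zero_add]
  rw [if_neg h0, if_neg h1, add_zero, mcNull, H.wdMat_frameMat hz, frameMat, formInv_mul_toMat,
    H.graded z hz, mul_zero]
  rw [deg_dual]
  have := deg_mem (idxEquiv i)
  have := deg_mem (idxEquiv j)
  omega

theorem rotate_degPart (d : ℤ) (A : Matrix Idx Idx ℂ) :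
    rotate l (degPart d A) = l ^ d • degPart d A := by
  ext i j
  rw [rotate, Matrix.of_apply, Matrix.smul_apply, degPart, Matrix.of_apply, smul_eq_mul]
  split_ifs with h
  · rw [h]
  · simp

theorem nullConjugate_degPart (hl : l ≠ 0) (d : ℤ) (A : Matrix Idx Idx ℂ) :
    nullConjugate l (degPart d A) = l ^ d • nullConjugate 1 (degPart d A) := by
  rw [nullConjugate_eq_rotate hl, rotate_degPart, nullConjugate_smul]

theorem nullConjugate_mcNull (H : IsGradedFrame U v) (hz : z ∈ U) (hl : l ≠ 0) :
    nullConjugate l (mcNull v z) = nullConjugate 1 (degPart 0 (mcNull v z)) +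
      l⁻¹ • nullConjugate 1 (degPart (-1) (mcNull v z)) := by
  conv_lhs => rw [H.mcNull_eq hz, nullConjugate_add, nullConjugate_degPart hl,
    nullConjugate_degPart hl, zpow_zero, one_smul, zpow_neg_one]

theorem kPart_mcNull (H : IsGradedFrame U v) (hz : z ∈ U) (hl : l ≠ 0) :
    kPart (nullConjugate l (mcNull v z)) = nullConjugate 1 (degPart 0 (mcNull v z)) := by
  rw [kPart_eq, invD_nullConjugate hl, H.nullConjugate_mcNull hz hl,
    H.nullConjugate_mcNull hz (neg_ne_zero.2 hl), inv_neg]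
  module

theorem pPart_mcNull (H : IsGradedFrame U v) (hz : z ∈ U) (hl : l ≠ 0) :
    pPart (nullConjugate l (mcNull v z)) = l⁻¹ • nullConjugate 1 (degPart (-1) (mcNull v z)) := by
  have h := kPart_add_pPart (nullConjugate l (mcNull v z))
  rw [H.kPart_mcNull hz hl] at h
  rw [H.nullConjugate_mcNull hz hl] at h ⊢
  exact add_left_cancel h

theorem mcForm_realFrame (H : IsGradedFrame U v) (hz : z ∈ U) (hl : ‖l‖ = 1) :
    mcForm (fun ζ => realFrame (frameMat v) ζ l) z = nullConjugate l (mcNull v z) := by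
  have h0 := ne_zero_of_norm hl
  rw [mcForm, H.ofReal_realFrame hz hl, dzMat_eq_wdMat,
    wdMat_congr H.isOpen (fun ζ hζ => H.ofReal_realFrame hζ hl) hz,
    wdMat_nullConjugate (H.smoothMat.dAt H.isOpen hz), mcNull, ← nullConjugate_mul h0]
  congr 1
  refine Matrix.inv_eq_left_inv ?_
  rw [nullConjugate_mul h0, formInv_mul (H.orthogonal hz), nullConjugate_one h0]

theorem loopForm'_realFrame (H : IsGradedFrame U v) (hz : z ∈ U) (hl : ‖l‖ = 1) {μ : ℂ}
    (hμ : ‖μ‖ = 1) : loopForm' (fun ζ => realFrame (frameMat v) ζ l) μ z =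
      mcForm (fun ζ => realFrame (frameMat v) ζ (l * μ)) z := by
  have h0 := ne_zero_of_norm hl
  have h1 := ne_zero_of_norm hμ
  rw [loopForm', H.mcForm_realFrame hz hl,
    H.mcForm_realFrame hz (by rw [norm_mul, hl, hμ, one_mul]),
    H.kPart_mcNull hz h0, H.pPart_mcNull hz h0, H.nullConjugate_mcNull hz (mul_ne_zero h0 h1),
    smul_smul, mul_inv_rev]

theorem loopForm''_eq (F : ℂ → Matrix Idx Idx ℝ) {μ : ℂ} (hμ : ‖μ‖ = 1) (z : ℂ) :
    loopForm'' F μ z = (loopForm' F μ z).map (starRingEnd ℂ) := by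
  have h : (starRingEnd ℂ) μ⁻¹ = μ := by rw [map_inv₀, conj_eq_inv_of_norm hμ, inv_inv]
  ext i j
  simp [loopForm'', loopForm', h]

theorem map_conj_mcForm {F : ℂ → Matrix Idx Idx ℝ} {z : ℂ}
    (hF : ∀ i j, DifferentiableAt ℝ (fun ζ => ((F ζ i j : ℝ) : ℂ)) z) :
    (mcForm F z).map (starRingEnd ℂ) =
      ((F z).map Complex.ofReal)⁻¹ * wdMat Complex.I (fun ζ => (F ζ).map Complex.ofReal) z := by
  have hreal : ∀ A : Matrix Idx Idx ℝ, (A.map Complex.ofReal).map (starRingEnd ℂ) =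
      A.map Complex.ofReal := fun A => by
    ext i j
    simp
  have hinv : (((F z).map Complex.ofReal)⁻¹).map (starRingEnd ℂ) =
      ((F z).map Complex.ofReal)⁻¹ := by
    have h1 := RingHom.map_det (starRingEnd ℂ) ((F z).map Complex.ofReal)
    have h2 := RingHom.map_adjugate (starRingEnd ℂ) ((F z).map Complex.ofReal)
    rw [RingHom.mapMatrix_apply, hreal] at h1
    rw [RingHom.mapMatrix_apply, RingHom.mapMatrix_apply, hreal] at h2
    rw [Matrix.inv_def, Ring.inverse_eq_inv]
    ext i j
    have h3 := congrFun (congrFun h2 i) j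
    rw [Matrix.map_apply] at h3
    rw [Matrix.map_apply, Matrix.smul_apply, smul_eq_mul, map_mul, map_inv₀, h1, h3]
  rw [mcForm, map_conj_mul, hinv, dzMat_eq_wdMat]
  congr 1
  ext i j
  rw [Matrix.map_apply, wdMat, wdMat, Matrix.of_apply, Matrix.of_apply]
  have := wd_conj (s := Complex.I) (hF i j)
  simp only [Complex.conj_ofReal, Complex.conj_I] at this
  exact this.symm

theorem isHarmonicFrame (H : IsGradedFrame U v) (hl : ‖l‖ = 1) :
    IsHarmonicFrame U fun z => realFrame (frameMat v) z l := by
  intro z hz μ hμ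
  have hlm : ‖l * μ‖ = 1 := by rw [norm_mul, hl, hμ, one_mul]
  have h0 := ne_zero_of_norm hlm
  set F := fun ζ => nullConjugate (l * μ) (frameMat v ζ) with hF
  set G := fun ζ => nullConjugate (l * μ) (formInv (frameMat v ζ)) with hG
  have sF : SmoothMat F U := H.smoothMat.nullConjugate _
  have sG : SmoothMat G U := SmoothMat.nullConjugate (fun i j => by
    have := ((SmoothMat.const nullGram U).mul H.smoothMat.transpose).mul
      (SmoothMat.const nullGram U)
    exact contDiffOn_const.mul (this i j)) _
  have hGF : ∀ ζ ∈ U, G ζ * F ζ = 1 := fun ζ hζ => by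
    rw [hG, hF, nullConjugate_mul h0, formInv_mul (H.orthogonal hζ), nullConjugate_one h0]
  have hFr : ∀ ζ ∈ U, (realFrame (frameMat v) ζ (l * μ)).map Complex.ofReal = F ζ := fun ζ hζ =>
    H.ofReal_realFrame hζ hlm
  have e1 : ∀ ζ ∈ U, loopForm' (fun z => realFrame (frameMat v) z l) μ ζ =
      G ζ * wdMat (-Complex.I) F ζ := fun ζ hζ => by
    rw [H.loopForm'_realFrame hζ hl hμ, mcForm, dzMat_eq_wdMat, wdMat_congr H.isOpen hFr hζ,
      hFr ζ hζ, Matrix.inv_eq_left_inv (hGF ζ hζ)]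
  have e2 : ∀ ζ ∈ U, loopForm'' (fun z => realFrame (frameMat v) z l) μ ζ =
      G ζ * wdMat Complex.I F ζ := fun ζ hζ => by
    have hd : ∀ i j, DifferentiableAt ℝ
        (fun ζ => ((realFrame (frameMat v) ζ (l * μ) i j : ℝ) : ℂ)) ζ := fun i j =>
      (sF.dAt H.isOpen hζ i j).congr_of_eventuallyEq
        (Filter.eventually_of_mem (H.isOpen.mem_nhds hζ) fun ξ hξ =>
          congrFun (congrFun (hFr ξ hξ) i) j)
    rw [loopForm''_eq _ hμ, H.loopForm'_realFrame hζ hl hμ, map_conj_mcForm hd,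
      wdMat_congr H.isOpen hFr hζ, hFr ζ hζ, Matrix.inv_eq_left_inv (hGF ζ hζ)]
  rw [dzMat_eq_wdMat, dzbarMat_eq_wdMat, wdMat_congr H.isOpen e1 hz, wdMat_congr H.isOpen e2 hz,
    e1 z hz, e2 z hz]
  exact maurerCartan H.isOpen sF sG hGF hz

/-- The first two rows of `nullMat` only involve the coordinates of degree `0`. -/
theorem nullMat_inl (i : Fin 2) (k : Idx) (hk : deg (idxEquiv k) ≠ 0) :
    nullMat 1 (Sum.inl i) k = 0 := by
  rw [nullMat, toMat_apply]
  generalize idxEquiv k = k at hk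
  fin_cases i <;> fin_cases k <;> first | exact absurd rfl hk | simp [idxEquiv_inl, nullVec_apply]

theorem nullMatInv_mul_transpose :
    nullMatInv 1 * I17 ℂ * (nullMatInv 1).transpose = (4 : ℂ) • nullGram := by
  have hJ : nullGram.transpose = nullGram := by
    ext i j
    exact nullForm_comm _ _
  have hI : (I17 ℂ).transpose = I17 ℂ := by
    rw [I17_eq_diagonal, Matrix.diagonal_transpose]
  have hII : I17 ℂ * I17 ℂ = 1 := by
    rw [I17_eq_diagonal, Matrix.diagonal_mul_diagonal, ← Matrix.diagonal_one]
    congr 1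
    ext i
    split_ifs <;> norm_num
  have h : (nullMat 1).transpose * (I17 ℂ * (nullMat 1 * nullGram)) = nullGram * nullGram := by
    rw [← Matrix.mul_assoc, ← Matrix.mul_assoc, transpose_nullMat_mul one_ne_zero]
  rw [nullMatInv, Matrix.transpose_smul, Matrix.transpose_mul, Matrix.transpose_mul,
    Matrix.transpose_transpose, hJ, hI, Matrix.smul_mul, Matrix.smul_mul, Matrix.mul_smul,
    smul_smul,
    Matrix.mul_assoc _ (I17 ℂ) (I17 ℂ), hII, Matrix.mul_one, Matrix.mul_assoc nullGram,
    h, nullGram_mul_self, Matrix.mul_smul, Matrix.mul_one, smul_smul]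
  norm_num

/-- The product has degree `-2`, hence no entries in rows of degree `0`. -/
theorem degPart_mul_nullGram_mul (A : Matrix Idx Idx ℂ) {i : Idx} (j : Idx)
    (hi : deg (idxEquiv i) = 0) :
    (degPart (-1) A * nullGram * (degPart (-1) A).transpose) i j = 0 := by
  rw [Matrix.mul_apply]
  refine Finset.sum_eq_zero fun m _ => ?_
  rw [Matrix.mul_apply, Finset.sum_mul]
  refine Finset.sum_eq_zero fun k _ => ?_
  rw [Matrix.transpose_apply, degPart, Matrix.of_apply, Matrix.of_apply, nullGram, Matrix.of_apply,
    nullForm_single_single]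
  by_cases h1 : deg (idxEquiv i) - deg (idxEquiv k) = -1
  · by_cases h2 : idxEquiv m = dual (idxEquiv k)
    · have h3 : ¬ deg (idxEquiv j) - deg (idxEquiv m) = -1 := by
        rw [h2, deg_dual]
        have := deg_mem (idxEquiv j)
        omega
      rw [if_neg h3, mul_zero]
    · rw [if_neg h2, mul_zero, zero_mul]
  · rw [if_neg h1, zero_mul, zero_mul]

theorem isIsotropicFrame (H : IsGradedFrame U v) (hl : ‖l‖ = 1) :
    IsIsotropicFrame U fun z => realFrame (frameMat v) z l := by
  intro z hz
  have h0 := ne_zero_of_norm hl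
  set A := mcNull v z with hA
  set Q := nullConjugate 1 (degPart (-1) A) with hQ
  have hp : pPart (nullConjugate l A) = l⁻¹ • Q := H.pPart_mcNull hz h0
  have h11 : Q.toBlocks₁₁ = 0 := by
    have : (l⁻¹ • Q).toBlocks₁₁ = 0 := by rw [← hp, pPart, Matrix.toBlocks_fromBlocks₁₁]
    ext i j
    have := congrFun (congrFun this i) j
    exact (mul_eq_zero.1 this).resolve_left (inv_ne_zero h0)
  have h12 : (nullConjugate l A).toBlocks₁₂ = l⁻¹ • Q.toBlocks₁₂ := by
    have : (pPart (nullConjugate l A)).toBlocks₁₂ = (l⁻¹ • Q).toBlocks₁₂ := by rw [hp]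
    rwa [pPart, Matrix.toBlocks_fromBlocks₁₂] at this
  have hR : Q * I17 ℂ * Q.transpose = (4 : ℂ) • (nullMat 1 *
      (degPart (-1) A * nullGram * (degPart (-1) A).transpose) * (nullMat 1).transpose) := by
    have : Q * I17 ℂ * Q.transpose = nullMat 1 * degPart (-1) A *
        (nullMatInv 1 * I17 ℂ * (nullMatInv 1).transpose) *
        (degPart (-1) A).transpose * (nullMat 1).transpose := by
      simp only [hQ, nullConjugate, Matrix.transpose_mul, Matrix.mul_assoc]
    rw [this, nullMatInv_mul_transpose]
    simp only [Matrix.mul_assoc, Matrix.smul_mul, Matrix.mul_smul]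
  have hR11 : (Q * I17 ℂ * Q.transpose).toBlocks₁₁ = Q.toBlocks₁₂ * Q.toBlocks₁₂.transpose := by
    conv_lhs => rw [← Matrix.fromBlocks_toBlocks Q, h11, I17, Matrix.fromBlocks_transpose,
      Matrix.fromBlocks_multiply, Matrix.fromBlocks_multiply, Matrix.toBlocks_fromBlocks₁₁]
    simp
  rw [H.mcForm_realFrame hz hl, ← hA, h12, Matrix.transpose_smul, Matrix.smul_mul, Matrix.mul_smul,
    ← hR11, hR]
  ext i j
  suffices h : (nullMat 1 * (degPart (-1) A * nullGram * (degPart (-1) A).transpose) *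
      (nullMat 1).transpose) (Sum.inl i) (Sum.inl j) = 0 by
    rw [Matrix.smul_apply, Matrix.smul_apply, Matrix.toBlocks₁₁, Matrix.of_apply,
      Matrix.smul_apply, h]
    simp
  rw [Matrix.mul_assoc, Matrix.mul_apply]
  refine Finset.sum_eq_zero fun k _ => ?_
  by_cases hk : deg (idxEquiv k) = 0
  · rw [Matrix.mul_apply, Finset.sum_eq_zero fun m _ => by
      rw [degPart_mul_nullGram_mul A m hk, zero_mul], mul_zero]
  · rw [nullMat_inl i k hk, zero_mul]

end IsGradedFrame

/-! ### The extended frame -/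

/-- The factors which normalize the columns `frameCol`. -/
def frameScale (z : ℂ) : Fin 8 → ℝ :=
  let s := |sigma z|⁻¹
  let p := (Real.sqrt (gramDetOne z))⁻¹
  let q := (Real.sqrt (gramDetTwo z))⁻¹
  ![s, s, q * s, p * q, p, q * s, p * q, p]

/-- The columns of the extended frame in null coordinates. -/
def frameVec (j : Fin 8) (z : ℂ) : Fin 8 → ℂ := (frameScale z j : ℂ) • evv (frameCol j) z

theorem isOpen_sigma_ne_zero : IsOpen {z | sigma z ≠ 0} :=
  isOpen_ne_fun continuous_sigma continuous_const

theorem contDiffOn_frameScale (j : Fin 8) :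
    ContDiffOn ℝ ∞ (fun z => frameScale z j) {z | sigma z ≠ 0} := by
  have hn : ContDiff ℝ ∞ fun z : ℂ => ‖z‖ ^ 2 := contDiff_norm_sq ℝ
  have h0 : ContDiff ℝ ∞ sigma := by
    have : sigma = fun z => 1 - (‖z‖ ^ 2) ^ 2 / 4 - 2 * (‖z‖ ^ 2) ^ 3 / 9 := by
      ext z
      unfold sigma
      ring
    rw [this]
    fun_prop
  have h1 : ContDiff ℝ ∞ gramDetOne := by
    unfold gramDetOne
    fun_prop
  have h2 : ContDiff ℝ ∞ gramDetTwo := by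
    unfold gramDetTwo
    fun_prop
  have hs : ContDiffOn ℝ ∞ (fun z => |sigma z|⁻¹) {z | sigma z ≠ 0} :=
    (h0.contDiffOn.abs fun z hz => hz).inv fun z hz => abs_ne_zero.2 hz
  have hp : ContDiffOn ℝ ∞ (fun z => (Real.sqrt (gramDetOne z))⁻¹) {z | sigma z ≠ 0} :=
    (h1.contDiffOn.sqrt fun z _ => (gramDetOne_pos z).ne').inv fun z _ =>
      (Real.sqrt_pos.2 (gramDetOne_pos z)).ne'
  have hq : ContDiffOn ℝ ∞ (fun z => (Real.sqrt (gramDetTwo z))⁻¹) {z | sigma z ≠ 0} :=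
    (h2.contDiffOn.sqrt fun z _ => (gramDetTwo_pos z).ne').inv fun z _ =>
      (Real.sqrt_pos.2 (gramDetTwo_pos z)).ne'
  fin_cases j
  exacts [hs, hs, hq.mul hs, hp.mul hq, hp, hq.mul hs, hp.mul hq, hp]

theorem frameScale_swap (z : ℂ) (j : Fin 8) : frameScale z (swap j) = frameScale z j := by
  fin_cases j <;> rfl

theorem frameScale_dual (z : ℂ) (j : Fin 8) : frameScale z (dual j) = frameScale z j := by
  fin_cases j <;> rfl

theorem nullConj_frameCol (z : ℂ) (j : Fin 8) :
    nullConj (evv (frameCol j) z) = evv (frameCol (swap j)) z := by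
  ext k
  fin_cases j <;> fin_cases k <;>
  (simp only [nullConj, evv, swap, Matrix.cons_val, Fin.zero_eta, Fin.mk_one, Fin.reduceFinMk,
    ev_cons, ev_nil, frameCol, liftH, liftY, gramOne, gramTwo, gramThree, gramOneConj, gramTwoConj,
    gramThreeConj, map_add, map_mul, map_pow, map_neg, map_div₀, map_one, map_zero, map_ofNat,
    Complex.conj_conj]
   try ring)

theorem frameScale_sq {z : ℂ} (hz : sigma z ≠ 0) :
    |sigma z|⁻¹ ^ 2 * sigma z ^ 2 = 1 ∧ (Real.sqrt (gramDetOne z))⁻¹ ^ 2 * gramDetOne z = 1 ∧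
      (Real.sqrt (gramDetTwo z))⁻¹ ^ 2 * gramDetTwo z = 1 := by
  refine ⟨?_, ?_, ?_⟩
  · rw [inv_pow, sq_abs, inv_mul_cancel₀ (pow_ne_zero 2 hz)]
  · rw [inv_pow, Real.sq_sqrt (gramDetOne_pos z).le, inv_mul_cancel₀ (gramDetOne_pos z).ne']
  · rw [inv_pow, Real.sq_sqrt (gramDetTwo_pos z).le, inv_mul_cancel₀ (gramDetTwo_pos z).ne']

theorem nullForm_add_right (x y y' : Fin 8 → ℂ) :
    nullForm x (y + y') = nullForm x y + nullForm x y' := by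
  simp only [nullForm, Pi.add_apply]
  ring

theorem nullForm_frameVec {z : ℂ} (hz : sigma z ≠ 0) (i j : Fin 8) :
    nullForm (frameVec i z) (frameVec j z) = nullForm (Pi.single i 1) (Pi.single j 1) := by
  rw [frameVec, frameVec, nullForm_smul_left, nullForm_smul_right, nullForm_single_single]
  by_cases h : j = dual i
  · subst h
    rw [frameScale_dual, if_pos rfl]
    obtain ⟨a1, a2, a3, a4⟩ := nullForm_frameCol_dual z
    obtain ⟨b1, b2, b3⟩ := frameScale_sq hz
    have c1 := congrArg Complex.ofReal b1
    have c2 := congrArg Complex.ofReal b2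
    have c3 := congrArg Complex.ofReal b3
    push_cast at c1 c2 c3
    have e0 := nullForm_comm (evv (frameCol 1) z) (evv (frameCol 0) z)
    have e1 := nullForm_comm (evv (frameCol 5) z) (evv (frameCol 2) z)
    have e2 := nullForm_comm (evv (frameCol 6) z) (evv (frameCol 3) z)
    have e3 := nullForm_comm (evv (frameCol 7) z) (evv (frameCol 4) z)
    fin_cases i <;>
    simp only [frameScale, dual, deg, Matrix.cons_val, Fin.zero_eta, Fin.mk_one, Fin.reduceFinMk,
      e0, e1, e2, e3, a1, a2, a3, a4, reduceIte, Complex.ofReal_mul, Complex.ofReal_inv,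
      one_ne_zero,
      neg_eq_zero]
    · linear_combination (-1 / 2) * c1
    · linear_combination (-1 / 2) * c1
    · linear_combination (1 / 2) * ((|sigma z| : ℝ) : ℂ)⁻¹ ^ 2 * (sigma z : ℂ) ^ 2 * c3 +
        (1 / 2) * c1
    · linear_combination (1 / 2) * (Real.sqrt (gramDetTwo z) : ℂ)⁻¹ ^ 2 * (gramDetTwo z : ℂ) * c2 +
        (1 / 2) * c3
    · linear_combination (1 / 2) * c2
    · linear_combination (1 / 2) * ((|sigma z| : ℝ) : ℂ)⁻¹ ^ 2 * (sigma z : ℂ) ^ 2 * c3 +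
        (1 / 2) * c1
    · linear_combination (1 / 2) * (Real.sqrt (gramDetTwo z) : ℂ)⁻¹ ^ 2 * (gramDetTwo z : ℂ) * c2 +
        (1 / 2) * c3
    · linear_combination (1 / 2) * c2
  · rw [nullForm_frameCol_zero z i j h, if_neg h, mul_zero, mul_zero]

theorem isGradedFrame : IsGradedFrame {z | sigma z ≠ 0} frameVec where
  isOpen := isOpen_sigma_ne_zero
  smooth j := (Complex.ofRealCLM.contDiff.comp_contDiffOn (contDiffOn_frameScale j)).smul
    (contDiff_evv _).contDiffOn
  real z hz j := by
    rw [frameVec, frameVec, frameScale_swap, ← nullConj_frameCol]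
    ext k
    simp only [nullConj_eq, Pi.smul_apply, smul_eq_mul, map_mul, Complex.conj_ofReal]
  pairing z hz i j := nullForm_frameVec hz i j
  graded z hz i j h := by
    have hd : j ≠ dual i := by
      rintro rfl
      rw [deg_dual] at h
      omega
    have hs : DifferentiableAt ℝ (fun ζ => (frameScale ζ j : ℂ)) z :=
      ((Complex.ofRealCLM.contDiff.comp_contDiffOn (contDiffOn_frameScale j)).contDiffAt
        (isOpen_sigma_ne_zero.mem_nhds hz)).differentiableAt (by simp)
    have he : DifferentiableAt ℝ (evv (frameCol j)) z :=
      (contDiff_evv _).differentiable (by simp) z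
    have hw : δz (evv (frameCol j)) z = evv (fun k => dZ (frameCol j k)) z := by
      ext k
      rw [wd_apply he]
      exact congrFun (dz_ev _) z
    have : δz (frameVec j) z = _ := wd_smul hs he
    rw [this, hw, nullForm_add_right, frameVec, nullForm_smul_left, nullForm_smul_left,
      nullForm_smul_right, nullForm_smul_right, nullForm_frameCol_dZ z i j h,
      nullForm_frameCol_zero z i j hd]
    simp

/-! ### The meromorphic frame -/

/-- The meromorphic frame `F₋` in null coordinates. -/
def meroMat (z : ℂ) : Matrix Idx Idx ℂ := toMat fun j => evv (meroCol j) z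

/-- The determinant of a matrix which is upper triangular with respect to the order `rank`. -/
theorem det_toMat {w : Fin 8 → Fin 8 → ℂ} (h : ∀ i j, rank j < rank i → w j i = 0) :
    (toMat w).det = ∏ i, w i i := by
  rw [← Matrix.det_submatrix_equiv_self (rank.symm.trans idxEquiv.symm) (toMat w),
    Matrix.det_of_isUpperTriangular]
  · rw [← Equiv.prod_comp rank]
    simp [toMat_apply]
  · intro i j hij
    simp only [Matrix.submatrix_apply, toMat_apply, Equiv.trans_apply, Equiv.apply_symm_apply]
    exact h _ _ (by simpa using hij)

theorem meroMat_orthogonal (z : ℂ) : (meroMat z).transpose * nullGram * meroMat z = nullGram := by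
  rw [meroMat, transpose_mul_nullGram_mul]
  ext i j
  rw [nullGram, Matrix.of_apply, Matrix.of_apply, nullForm_single_single]
  generalize idxEquiv i = i
  generalize idxEquiv j = j
  fin_cases i <;> fin_cases j <;>
  (simp only [nullForm, evv, dual, deg, meroCol, Matrix.cons_val, Fin.zero_eta, Fin.mk_one,
    Fin.reduceFinMk, Fin.reduceEq, reduceIte, one_ne_zero, neg_eq_zero, ev_cons, ev_nil]
   try ring)

theorem det_meroMat (z : ℂ) : (meroMat z).det = 1 := by
  have h : (meroMat z).transpose = toMat fun j i => evv (meroCol i) z j := rfl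
  rw [← Matrix.det_transpose, h, det_toMat]
  · simp [Fin.prod_univ_eight, evv, meroCol, ev_cons, ev_nil]
  · intro i j hij
    fin_cases i <;> fin_cases j <;>
    first
    | exact absurd hij (by decide)
    | rfl

/-- The potential in null coordinates. -/
def potentialCol (z : ℂ) : Fin 8 → Fin 8 → ℂ :=
  ![![0, 0, 0, 0, 0, 1, 0, 2 * z], ![0, 0, 0, 0, 0, 0, -1, 0], ![0, 1, 0, 0, 0, 0, 0, 0],
    ![-1, 0, 0, 0, 0, 0, 0, 0], ![0, 2 * z, 0, 0, 0, 0, 0, 0], 0, 0, 0]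

theorem nullConjugate_potential {l : ℂ} (hl : l ≠ 0) (z : ℂ) :
    nullConjugate l (toMat (potentialCol z)) = l⁻¹ • etaOf (potential z) := by
  have h : nullMat l * toMat (potentialCol z) = (l⁻¹ • etaOf (potential z)) * nullMat l := by
    rw [nullMat_mul_toMat]
    ext i j
    rw [Matrix.smul_mul, Matrix.smul_apply, Matrix.mul_apply, Fintype.sum_sum_type,
      nullMat, toMat_apply]
    simp only [toMat_apply]
    generalize idxEquiv j = j
    rcases i with i | i <;> fin_cases i <;> fin_cases j <;>
    simp [nullVec_apply, potentialCol, etaOf, potential, I11, Fin.sum_univ_succ, finSumFinEquiv] <;>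
    (try field_simp) <;> (try ring_nf) <;> simp <;> ring_nf
  rw [nullConjugate, h, Matrix.mul_assoc, mul_nullMatInv hl, Matrix.mul_one]

theorem hasDerivAt_ev {P : BiPoly} (hP : ∀ m ∈ P, m.2.2 = 0) (z : ℂ) :
    HasDerivAt (ev P) (ev (dZ P) z) z := by
  induction P with
  | nil => exact hasDerivAt_const z 0
  | cons m P ih =>
    obtain ⟨c, i, j⟩ := m
    obtain rfl : j = 0 := hP (c, i, j) List.mem_cons_self
    have h := ((hasDerivAt_pow i z).const_mul c).add
      (ih fun m hm => hP m (List.mem_cons_of_mem _ hm))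
    have h1 : ev ((c, i, 0) :: P) = fun ζ => c * ζ ^ i + ev P ζ := by
      ext ζ
      simp [ev_cons]
    have h2 : ev (dZ ((c, i, 0) :: P)) z = c * (i * z ^ (i - 1)) + ev (dZ P) z := by
      simp [dZ_cons, ev_cons, mul_assoc]
    rw [h1, h2]
    exact h

theorem hasDerivAt_meroMat (z : ℂ) (i j : Idx) :
    HasDerivAt (fun ζ => meroMat ζ i j) ((meroMat z * toMat (potentialCol z)) i j) z := by
  have h : (meroMat z * toMat (potentialCol z)) i j =
      ev (dZ (meroCol (idxEquiv j) (idxEquiv i))) z := by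
    rw [Matrix.mul_apply, ← Equiv.sum_comp idxEquiv.symm]
    simp only [meroMat, toMat_apply, Equiv.apply_symm_apply, Fin.sum_univ_eight]
    generalize idxEquiv i = i
    generalize idxEquiv j = j
    fin_cases i <;> fin_cases j <;>
    (simp only [evv, meroCol, potentialCol, Fin.zero_eta, Fin.mk_one, Fin.reduceFinMk,
      Matrix.cons_val, Pi.zero_apply, ev_cons, ev_nil, dZ_cons, dZ_nil, Nat.cast_ofNat,
      Nat.cast_one, Nat.cast_zero, Nat.reduceSub]
     ring)
  rw [h]
  refine hasDerivAt_ev ?_ z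
  generalize idxEquiv i = i
  generalize idxEquiv j = j
  fin_cases i <;> fin_cases j <;> simp [meroCol]

theorem isMeromorphicFrame :
    IsMeromorphicFrame potential fun z l => nullConjugate l (meroMat z) := by
  intro l hl
  have h0 := ne_zero_of_norm hl
  refine ⟨?_, fun z i j => ?_⟩
  · have : meroMat 0 = 1 := by
      rw [meroMat, ← toMat_single]
      congr 1
      ext j k
      fin_cases j <;> fin_cases k <;> simp [evv, meroCol, ev_cons, ev_nil]
    change nullConjugate l (meroMat 0) = 1
    rw [this, nullConjugate_one h0]
  · rw [← Matrix.mul_smul, ← nullConjugate_potential h0, nullConjugate_mul h0]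
    simp only [nullConjugate, Matrix.mul_apply (M := nullMat l * _) (N := nullMatInv l),
      Matrix.mul_apply (M := nullMat l)]
    exact HasDerivAt.fun_sum fun k _ => HasDerivAt.mul_const
      (HasDerivAt.fun_sum fun m _ => (hasDerivAt_meroMat z m k).const_mul _) _

/-! ### The Iwasawa decomposition -/

/-- The columns of `F₊ = F⁻¹ F₋` in null coordinates. -/
def posCol (z : ℂ) (j i : Fin 8) : ℂ :=
  (if deg i = 0 then -2 else 2) * nullForm (frameVec (dual i) z) (evv (meroCol j) z)

/-- The matrix of `F₊` in null coordinates. -/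
def posMat (z : ℂ) : Matrix Idx Idx ℂ := toMat (posCol z)

theorem frameMat_mul_posMat {z : ℂ} (hz : sigma z ≠ 0) :
    frameMat frameVec z * posMat z = meroMat z := by
  have h : posMat z = formInv (frameMat frameVec z) * meroMat z := by
    ext i j
    rw [posMat, toMat_apply, posCol, frameMat, meroMat, formInv_mul_toMat]
  rw [h, ← Matrix.mul_assoc, mul_eq_one_comm.1 (formInv_mul (isGradedFrame.orthogonal hz)),
    Matrix.one_mul]

theorem posMat_orthogonal {z : ℂ} (hz : sigma z ≠ 0) :
    (posMat z).transpose * nullGram * posMat z = nullGram := by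
  have h := meroMat_orthogonal z
  rw [← frameMat_mul_posMat hz, Matrix.transpose_mul] at h
  have h' : (posMat z).transpose * ((frameMat frameVec z).transpose * nullGram *
      frameMat frameVec z) * posMat z = nullGram := by
    simpa only [Matrix.mul_assoc] using h
  rwa [isGradedFrame.orthogonal hz] at h'

theorem posCol_eq (z : ℂ) (j i : Fin 8) : posCol z j i = (if deg i = 0 then -2 else 2) *
    ((frameScale z i : ℂ) * nullForm (evv (frameCol (dual i)) z) (evv (meroCol j) z)) := by
  rw [posCol, frameVec, nullForm_smul_left, frameScale_dual]

theorem posCol_eq_zero (z : ℂ) {i j : Fin 8} (h : rank j < rank i) : posCol z j i = 0 := by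
  rw [posCol_eq, nullForm_frameCol_meroCol z i j h, mul_zero, mul_zero]

/-- `F₊` has no components of negative degree. -/
theorem posCol_eq_zero_of_deg (z : ℂ) {i j : Fin 8} (h : deg i < deg j) : posCol z j i = 0 := by
  refine posCol_eq_zero z ?_
  revert i j
  decide

/-- The diagonal of `F₊` in null coordinates. -/
def posDiag (z : ℂ) : Fin 8 → ℝ :=
  let s := |sigma z|⁻¹
  let p := (Real.sqrt (gramDetOne z))⁻¹
  let q := (Real.sqrt (gramDetTwo z))⁻¹
  ![s * sigma z, s * sigma z, q * s * sigma z ^ 2, p * q * gramDetTwo z, p * gramDetOne z,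
    q * s * gramDetTwo z, p * q * gramDetOne z, p]

theorem posCol_self (z : ℂ) (i : Fin 8) : posCol z i i = posDiag z i := by
  rw [posCol_eq, nullForm_frameCol_meroCol_self]
  fin_cases i <;> simp [deg, frameScale, posDiag] <;> ring

theorem det_posMat {z : ℂ} (hz : sigma z ≠ 0) : (posMat z).det = 1 := by
  rw [posMat, det_toMat fun i j => posCol_eq_zero z]
  simp only [posCol_self]
  rw [← Complex.ofReal_prod, Complex.ofReal_eq_one]
  obtain ⟨b1, b2, b3⟩ := frameScale_sq hz
  simp only [Fin.prod_univ_eight, posDiag, Matrix.cons_val]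
  generalize |sigma z|⁻¹ = s at *
  generalize (Real.sqrt (gramDetOne z))⁻¹ = p at *
  generalize (Real.sqrt (gramDetTwo z))⁻¹ = q at *
  calc _ = (s ^ 2 * sigma z ^ 2) ^ 2 * (p ^ 2 * gramDetOne z) ^ 2 * (q ^ 2 * gramDetTwo z) ^ 2 := by
        ring
    _ = 1 := by rw [b1, b2, b3]; norm_num

theorem det_frameMat {z : ℂ} (hz : sigma z ≠ 0) : (frameMat frameVec z).det = 1 := by
  have h := congrArg Matrix.det (frameMat_mul_posMat hz)
  rwa [Matrix.det_mul, det_posMat hz, det_meroMat, mul_one] at h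

/-- `F₊(z, λ)`, as a polynomial in `λ`. -/
def posLoop (z l : ℂ) : Matrix Idx Idx ℂ :=
  nullConjugate 1 (Matrix.of fun i j =>
    l ^ (deg (idxEquiv i) - deg (idxEquiv j)).toNat * posMat z i j)

theorem posLoop_eq (z : ℂ) {l : ℂ} (hl : l ≠ 0) : posLoop z l = nullConjugate l (posMat z) := by
  rw [nullConjugate_eq_rotate hl, posLoop, rotate]
  congr 1
  ext i j
  rw [Matrix.of_apply, Matrix.of_apply]
  rcases lt_or_ge (deg (idxEquiv i)) (deg (idxEquiv j)) with h | h
  · rw [posMat, toMat_apply, posCol_eq_zero_of_deg z h, mul_zero, mul_zero]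
  · rw [← zpow_natCast, Int.toNat_of_nonneg (by omega)]

theorem differentiable_posLoop (z : ℂ) (i j : Idx) : Differentiable ℂ fun l => posLoop z l i j := by
  simp only [posLoop, nullConjugate, Matrix.mul_apply, Matrix.of_apply]
  fun_prop

theorem continuous_posLoop (z : ℂ) : Continuous (posLoop z) :=
  continuous_matrix fun i j => (differentiable_posLoop z i j).continuous

theorem eq_of_eq_of_ne_zero {X : Type*} [TopologicalSpace X] [T2Space X] {f g : ℂ → X}
    (hf : Continuous f) (hg : Continuous g) (h : ∀ l, l ≠ 0 → f l = g l) (l : ℂ) : f l = g l :=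
  congrFun (Continuous.ext_on (dense_compl_singleton 0) hf hg fun l hl => h l hl) l

theorem isSOComplex_posLoop {z : ℂ} (hz : sigma z ≠ 0) (l : ℂ) : IsSOComplex (posLoop z l) := by
  have hc := continuous_posLoop z
  refine ⟨eq_of_eq_of_ne_zero ((hc.matrix_transpose.matrix_mul continuous_const).matrix_mul hc)
    continuous_const (fun l hl => ?_) l,
    eq_of_eq_of_ne_zero hc.matrix_det continuous_const (fun l hl => ?_) l⟩
  · rw [posLoop_eq z hl, nullConjugate_orthogonal hl (posMat_orthogonal hz)]
  · rw [posLoop_eq z hl, det_nullConjugate hl, det_posMat hz]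

theorem posLoop_neg (z l : ℂ) : posLoop z (-l) = invD ℂ * posLoop z l * invD ℂ := by
  have hc := continuous_posLoop z
  refine eq_of_eq_of_ne_zero (hc.comp continuous_neg)
    ((continuous_const.matrix_mul hc).matrix_mul continuous_const) (fun l hl => ?_) l
  rw [Function.comp_apply, posLoop_eq z hl, posLoop_eq z (neg_ne_zero.2 hl), invD_nullConjugate hl]

/-- The value of `F₊` at `λ = 0` in null coordinates: the component of degree `0`. -/
theorem posLoop_zero_mul (z : ℂ) (i j : Idx) : (posLoop z 0 * nullMat 1) i j =
    ∑ k, nullMat 1 i k * if deg (idxEquiv k) = deg (idxEquiv j) then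
      posCol z (idxEquiv j) (idxEquiv k) else 0 := by
  rw [posLoop, nullConjugate_mul_nullMat one_ne_zero, Matrix.mul_apply]
  refine Finset.sum_congr rfl fun k _ => ?_
  rw [Matrix.of_apply, posMat, toMat_apply]
  rcases lt_trichotomy (deg (idxEquiv k)) (deg (idxEquiv j)) with h | h | h
  · rw [posCol_eq_zero_of_deg z h, if_neg h.ne, mul_zero]
  · rw [if_pos h, h, sub_self, Int.toNat_zero, pow_zero, one_mul]
  · rw [if_neg h.ne', zero_pow (by omega), zero_mul]

theorem posLoop_zero_eq_fromBlocks (z : ℂ) : posLoop z 0 =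
    Matrix.fromBlocks (posLoop z 0).toBlocks₁₁ 0 0 (posLoop z 0).toBlocks₂₂ := by
  have h : kPart (posLoop z 0) = posLoop z 0 := by
    rw [kPart_eq, ← posLoop_neg, neg_zero, ← two_smul ℂ (posLoop z 0), smul_smul]
    norm_num
  exact h.symm

theorem nullMat_inl_inl (l : ℂ) : (nullMat l).toBlocks₁₁ = !![1 / 2, 1 / 2; 1 / 2, -1 / 2] := by
  ext i j
  rw [Matrix.toBlocks₁₁, Matrix.of_apply, nullMat, toMat_apply]
  fin_cases i <;> fin_cases j <;> simp [idxEquiv_inl, nullVec_apply, neg_div]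

theorem deg_inr_ne_zero (k : Fin 6) : deg (idxEquiv (Sum.inr k)) ≠ 0 := by
  revert k
  decide

theorem posLoop_zero_toBlocks₁₁ (z : ℂ) :
    (posLoop z 0).toBlocks₁₁ = ((|sigma z|⁻¹ * sigma z : ℝ) : ℂ) • 1 := by
  have h01 : posCol z 0 1 = 0 := posCol_eq_zero z (by decide)
  have h10 : posCol z 1 0 = 0 := by
    rw [posCol_eq, show dual 0 = 1 from rfl, nullForm_frameCol_meroCol_one, mul_zero, mul_zero]
  have h : (posLoop z 0).toBlocks₁₁ * (nullMat 1).toBlocks₁₁ =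
      ((|sigma z|⁻¹ * sigma z : ℝ) : ℂ) • (nullMat 1).toBlocks₁₁ := by
    ext i j
    have h1 := posLoop_zero_mul z (Sum.inl i) (Sum.inl j)
    rw [posLoop_zero_eq_fromBlocks, Matrix.mul_apply, Fintype.sum_sum_type, Fintype.sum_sum_type]
      at h1
    simp only [Matrix.fromBlocks_apply₁₁, Matrix.fromBlocks_apply₁₂, Matrix.zero_apply, zero_mul,
      Finset.sum_const_zero, add_zero, IsGradedFrame.nullMat_inl i (Sum.inr _) (deg_inr_ne_zero _)]
      at h1
    rw [Matrix.mul_apply, Matrix.smul_apply, smul_eq_mul]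
    refine h1.trans ?_
    rw [Fin.sum_univ_two]
    fin_cases j
    · simp [idxEquiv_inl, deg, h01, posCol_self, posDiag, Matrix.toBlocks₁₁, mul_comm]
    · simp [idxEquiv_inl, deg, h10, posCol_self, posDiag, Matrix.toBlocks₁₁, mul_comm]
  have h2 : (nullMat 1).toBlocks₁₁ * !![1, 1; 1, -1] = 1 := by
    rw [nullMat_inl_inl, Matrix.one_fin_two, Matrix.mul_fin_two]
    norm_num
  rw [← Matrix.mul_one (posLoop z 0).toBlocks₁₁, ← h2, ← Matrix.mul_assoc, h, Matrix.smul_mul, h2]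

/-- The index of the null coordinate `m_j`. -/
def isoIdx (j : Fin 3) : Fin 6 := Fin.natAdd 3 j

theorem nullMat_isoIdx (j : Fin 3) (k : Fin 6) :
    nullMat 1 (Sum.inr k) (Sum.inr (isoIdx j)) = (2 * Complex.I)⁻¹ * isoVec j k := by
  rw [nullMat, toMat_apply]
  have h : idxEquiv (Sum.inr (isoIdx j)) = ![5, 6, 7] j := by
    revert j
    decide
  have h' : idxEquiv (Sum.inr k) = Fin.natAdd 2 k := rfl
  rw [h, h']
  fin_cases j <;> fin_cases k <;> simp [nullVec_apply, isoVec] <;>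
    ring_nf <;> simp <;> norm_num

/-- The isotropic flag is invariant under `F₊(z, 0)`. -/
theorem posLoop_zero_mulVec (z : ℂ) (j : Fin 3) :
    (posLoop z 0).toBlocks₂₂.mulVec (isoVec j) =
      ∑ i, posCol z (![5, 6, 7] j) (![5, 6, 7] i) • isoVec i := by
  ext k
  have hidx : ∀ i, idxEquiv (Sum.inr (isoIdx i)) = ![5, 6, 7] i := by decide
  have hdeg : ∀ i, deg (![5, 6, 7] i) = -1 := by decide
  have hI : (2 * Complex.I) ≠ 0 := by simp
  have h1 := posLoop_zero_mul z (Sum.inr k) (Sum.inr (isoIdx j))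
  rw [posLoop_zero_eq_fromBlocks, Matrix.mul_apply, Fintype.sum_sum_type, Fintype.sum_sum_type,
    hidx, hdeg] at h1
  simp only [Matrix.fromBlocks_apply₂₁, Matrix.fromBlocks_apply₂₂, Matrix.zero_apply, zero_mul,
    Finset.sum_const_zero, zero_add, nullMat_isoIdx] at h1
  have h2 : ∀ g : Fin 6 → ℂ, ∑ m, g m = ∑ i : Fin 3, g (Fin.castAdd 3 i) + ∑ i, g (isoIdx i) :=
    fun g => Fin.sum_univ_add (a := 3) (b := 3) g
  have h3 : ∀ i : Fin 2, deg (idxEquiv (Sum.inl i)) ≠ -1 := by decide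
  have h4 : ∀ i : Fin 3, deg (idxEquiv (Sum.inr (Fin.castAdd 3 i))) ≠ -1 := by decide
  rw [h2 fun m => nullMat 1 _ _ * _] at h1
  simp only [h3, h4, hidx, hdeg, if_true, if_false, mul_zero, Finset.sum_const_zero, zero_add,
    nullMat_isoIdx] at h1
  rw [Matrix.mulVec, dotProduct, Finset.sum_apply]
  have h5 := congrArg ((2 * Complex.I) * ·) h1
  simp only [Finset.mul_sum] at h5
  refine (Finset.sum_congr rfl fun m _ => ?_).trans (h5.trans (Finset.sum_congr rfl fun m _ => ?_))
  · field_simp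
  · rw [Pi.smul_apply, smul_eq_mul]
    field_simp

theorem isSolvableFactor_posLoop {z : ℂ} (hz : sigma z ≠ 0) :
    IsSolvableFactor (posLoop z 0).toBlocks₂₂ := by
  obtain ⟨h1, h2⟩ := isSOComplex_posLoop hz 0
  obtain ⟨b1, -, -⟩ := frameScale_sq hz
  rw [posLoop_zero_eq_fromBlocks] at h1 h2
  refine ⟨?_, ?_, fun j => ?_⟩
  · have := congrArg Matrix.toBlocks₂₂ h1
    simpa [I17, Matrix.fromBlocks_transpose, Matrix.fromBlocks_multiply] using this
  · rw [Matrix.det_fromBlocks_zero₂₁, posLoop_zero_toBlocks₁₁, Matrix.det_smul, Matrix.det_one,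
      Fintype.card_fin, mul_one, ← Complex.ofReal_pow, mul_pow, b1, Complex.ofReal_one,
      one_mul] at h2
    exact h2
  · have hs := abs_pos.2 hz
    have hp := Real.sqrt_pos.2 (gramDetOne_pos z)
    have hq := Real.sqrt_pos.2 (gramDetTwo_pos z)
    have hp' := gramDetOne_pos z
    have hq' := gramDetTwo_pos z
    refine ⟨posDiag z (![5, 6, 7] j), ?_, ?_⟩
    · fin_cases j <;> simp only [posDiag, Matrix.cons_val, Fin.zero_eta, Fin.mk_one,
        Fin.reduceFinMk] <;>
      positivity
    · rw [posLoop_zero_mulVec, ← posCol_self]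
      rw [← Finset.sum_erase_add _ _ (Finset.mem_univ j), add_sub_cancel_right]
      refine Submodule.sum_mem _ fun i hi => ?_
      rcases lt_or_gt_of_ne (Finset.ne_of_mem_erase hi) with h | h
      · exact Submodule.smul_mem _ _ (Submodule.subset_span ⟨i, h, rfl⟩)
      · rw [posCol_eq_zero, zero_smul]
        · exact Submodule.zero_mem _
        · revert i j
          decide

theorem isInB_posLoop {z : ℂ} (hz : sigma z ≠ 0) : IsInB (posLoop z 0) := by
  have key : ∀ θ : ℝ, |sigma z|⁻¹ * sigma z = Real.cos θ → Real.sin θ = 0 → IsInB (posLoop z 0) :=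
    fun θ hc hs => by
    refine ⟨θ, _, isSolvableFactor_posLoop hz, ?_⟩
    conv_lhs => rw [posLoop_zero_eq_fromBlocks, posLoop_zero_toBlocks₁₁, hc]
    congr 1
    rw [hs]
    ext i j
    fin_cases i <;> fin_cases j <;> simp
  rcases lt_or_gt_of_ne hz with h | h
  · refine key Real.pi ?_ Real.sin_pi
    rw [abs_of_neg h, Real.cos_pi, inv_neg, neg_mul, inv_mul_cancel₀ hz]
  · refine key 0 ?_ Real.sin_zero
    rw [abs_of_pos h, Real.cos_zero, inv_mul_cancel₀ hz]

theorem isPositiveLoop_posLoop {z : ℂ} (hz : sigma z ≠ 0) : IsPositiveLoop (posLoop z) where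
  holomorphic i j := (differentiable_posLoop z i j).diffContOnCl
  mem l _ := isSOComplex_posLoop hz l
  twisted l _ := posLoop_neg z l
  value_zero := isInB_posLoop hz

/-- The extended frame `F(z, λ)`. -/
def extFrame (z l : ℂ) : Matrix Idx Idx ℝ := realFrame (frameMat frameVec) z l

variable {l z : ℂ}

theorem ofReal_extFrame (hl : ‖l‖ = 1) (hz : sigma z ≠ 0) :
    (extFrame z l).map Complex.ofReal = nullConjugate l (frameMat frameVec z) :=
  isGradedFrame.ofReal_realFrame hz hl

theorem map_ofReal_injective : Function.Injective
    fun A : Matrix Idx Idx ℝ => A.map Complex.ofReal :=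
  Matrix.map_injective Complex.ofReal_injective

theorem map_ofReal_mul (A B : Matrix Idx Idx ℝ) : (A * B).map Complex.ofReal =
    A.map Complex.ofReal * B.map Complex.ofReal :=
  Matrix.map_mul (f := Complex.ofRealHom)

theorem map_ofReal_I17 : (I17 ℝ).map Complex.ofReal = I17 ℂ := by
  rw [I17_eq_diagonal, I17_eq_diagonal, Matrix.diagonal_map Complex.ofReal_zero]
  congr 1
  ext i
  split_ifs <;> simp

theorem map_ofReal_invD : (invD ℝ).map Complex.ofReal = invD ℂ := by
  rw [invD, invD, Matrix.fromBlocks_map]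
  congr 1
  all_goals
    ext i j
    simp [Matrix.one_apply, apply_ite]

/-- The null lines `[Y]` and `[Ŷ]` are spanned by `e₀ ∓ ê₀`. -/
theorem extFrame_inl (hl : ‖l‖ = 1) (hz : sigma z ≠ 0) (i : Idx) :
    ((Real.sqrt 2 / 2 * (extFrame z l i (Sum.inl 0) - extFrame z l i (Sum.inl 1)) : ℝ) : ℂ) =
        Yvec l z (idxEquiv i) ∧
      ((Real.sqrt 2 / 2 * (extFrame z l i (Sum.inl 0) + extFrame z l i (Sum.inl 1)) : ℝ) : ℂ) =
        Yhat l z (idxEquiv i) := by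
  have h : (extFrame z l).map Complex.ofReal * nullMat l =
      toMat fun j => nullVec l (frameVec j z) := by
    rw [ofReal_extFrame hl hz, nullConjugate_mul_nullMat (ne_zero_of_norm hl), frameMat,
      nullMat_mul_toMat]
  have hj : ∀ j : Fin 2, ((extFrame z l i (Sum.inl 0) : ℝ) : ℂ) *
        nullMat l (Sum.inl 0) (Sum.inl j) +
      ((extFrame z l i (Sum.inl 1) : ℝ) : ℂ) * nullMat l (Sum.inl 1) (Sum.inl j) =
      nullVec l (frameVec (idxEquiv (Sum.inl j)) z) (idxEquiv i) := fun j => by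
    have h1 := congrFun (congrFun h i) (Sum.inl j)
    rw [Matrix.mul_apply, Fintype.sum_sum_type, Fin.sum_univ_two, toMat_apply,
      Finset.sum_eq_zero (s := (Finset.univ : Finset (Fin 6))), add_zero] at h1
    · exact h1
    · intro k _
      have : nullMat l (Sum.inr k) (Sum.inl j) = 0 := by
        rw [nullMat, toMat_apply]
        fin_cases j <;> fin_cases k <;>
        simp [nullVec_apply, finSumFinEquiv]
      rw [this, mul_zero]
  have n : ∀ a b, nullMat l (Sum.inl a) (Sum.inl b) =
      (!![1 / 2, 1 / 2; 1 / 2, -1 / 2] : Matrix (Fin 2) (Fin 2) ℂ) a b := fun a b =>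
    congrFun (congrFun (nullMat_inl_inl l) a) b
  have h0 := hj 0
  have h1 := hj 1
  rw [n, n, idxEquiv_inl.1, frameVec, map_smul, Pi.smul_apply, smul_eq_mul] at h0
  rw [n, n, idxEquiv_inl.2, frameVec, map_smul, Pi.smul_apply, smul_eq_mul] at h1
  rw [Yvec_eq, Yhat_eq, polyLift, polyLift, Pi.smul_apply, Pi.smul_apply, smul_eq_mul, smul_eq_mul]
  simp only [frameScale, frameCol, Matrix.of_apply, Matrix.cons_val] at h0 h1
  push_cast at h0 h1 ⊢
  exact ⟨by linear_combination (Real.sqrt 2 : ℂ) * h1, by linear_combination (Real.sqrt 2 : ℂ) * h0⟩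

theorem isSOPlus_extFrame (hl : ‖l‖ = 1) (hz : sigma z ≠ 0) : IsSOPlus (extFrame z l) := by
  have h0 := ne_zero_of_norm hl
  refine ⟨map_ofReal_injective ?_, Complex.ofReal_injective ?_, ?_⟩
  · change ((extFrame z l).transpose * I17 ℝ * extFrame z l).map Complex.ofReal =
      (I17 ℝ).map Complex.ofReal
    rw [map_ofReal_mul, map_ofReal_mul, Matrix.transpose_map, map_ofReal_I17,
      ofReal_extFrame hl hz, nullConjugate_orthogonal h0 (isGradedFrame.orthogonal hz)]
  · have : ((extFrame z l).det : ℂ) = ((extFrame z l).map Complex.ofReal).det :=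
      RingHom.map_det Complex.ofRealHom _
    rw [this, ofReal_extFrame hl hz, det_nullConjugate h0, det_frameMat hz, Complex.ofReal_one]
  · obtain ⟨h1, h2⟩ := extFrame_inl hl hz (Sum.inl 0)
    have h3 := congrArg Complex.re (congrArg₂ (· + ·) h1 h2)
    have hs : 0 < Real.sqrt 2 / |sigma z| := by positivity
    have p1 := (polyDataY.isRealLift hl).pos z
    have p2 := (polyDataH.isRealLift hl).pos z
    rw [Yvec_eq, Yhat_eq, idxEquiv_inl.1] at h3
    simp only [Pi.smul_apply, smul_eq_mul, Complex.add_re, Complex.ofReal_re, Complex.re_ofReal_mul]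
      at h3
    have h4 : 0 < Real.sqrt 2 * extFrame z l (Sum.inl 0) (Sum.inl 0) := by
      have := mul_pos hs p1
      have := mul_pos hs p2
      linarith
    exact pos_of_mul_pos_right h4 (Real.sqrt_nonneg 2)

theorem isTwistedLoop_extFrame (hz : sigma z ≠ 0) : IsTwistedLoop (extFrame z) where
  continuous := by
    have h : ContinuousOn (fun l => nullConjugate 1 (rotate l (frameMat frameVec z)))
        (Metric.sphere 0 1) := by
      refine ContinuousOn.mul (continuousOn_const.mul ?_) continuousOn_const
      refine continuousOn_pi.2 fun i => continuousOn_pi.2 fun j => ?_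
      exact (continuousOn_id.zpow₀ _ fun l hl =>
        Or.inl (ne_zero_of_norm (mem_sphere_zero_iff_norm.1 hl))).mul continuousOn_const
    refine ((continuous_id.matrix_map Complex.continuous_re).comp_continuousOn h).congr
      fun l hl => ?_
    rw [extFrame, realFrame, nullConjugate_eq_rotate
      (ne_zero_of_norm (mem_sphere_zero_iff_norm.1 hl))]
    rfl
  mem l hl := isSOPlus_extFrame hl hz
  twisted l hl := map_ofReal_injective (by
    change (extFrame z (-l)).map Complex.ofReal =
      (invD ℝ * extFrame z l * invD ℝ).map Complex.ofReal
    rw [map_ofReal_mul, map_ofReal_mul, map_ofReal_invD, ofReal_extFrame hl hz,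
      ofReal_extFrame (by rwa [norm_neg]) hz, invD_nullConjugate (ne_zero_of_norm hl)])

theorem sigma_zero : sigma 0 = 1 := by simp [sigma]

theorem frameMat_zero : frameMat frameVec 0 = 1 := by
  rw [frameMat, ← toMat_single]
  congr 1
  ext j k
  fin_cases j <;> fin_cases k <;>
  simp [frameVec, frameScale, sigma_zero, gramDetOne, gramDetTwo, evv, ev_cons, ev_nil, frameCol,
    liftH, liftY, gramOne, gramTwo, gramThree, gramOneConj, gramTwoConj, gramThreeConj]

/-- The Iwasawa decomposition `F₋ = F F₊`. -/
theorem isExtendedFrame : IsExtendedFrame potential {z | sigma z ≠ 0} extFrame where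
  smooth l _ i j :=
    Complex.reCLM.contDiff.comp_contDiffOn (isGradedFrame.smoothMat.nullConjugate l i j)
  base l hl := map_ofReal_injective (by
    have h : sigma 0 ≠ 0 := by simp [sigma_zero]
    change (extFrame 0 l).map Complex.ofReal = (1 : Matrix Idx Idx ℝ).map Complex.ofReal
    rw [ofReal_extFrame hl h, frameMat_zero, nullConjugate_one (ne_zero_of_norm hl),
      Matrix.map_one _ Complex.ofReal_zero Complex.ofReal_one])
  loop z hz := isTwistedLoop_extFrame hz
  iwasawa := ⟨_, isMeromorphicFrame, fun z hz => ⟨posLoop z,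
    isPositiveLoop_posLoop hz, fun l hl => by
    have h0 := ne_zero_of_norm hl
    rw [ofReal_extFrame hl hz, posLoop_eq z h0, nullConjugate_mul h0, frameMat_mul_posMat hz]⟩⟩

end WillmoreSphere

end

theorem mainTheorem3 :
    -- the extended frame obtained from the potential, and the associated family `Y ∧ Ŷ`
    (∃ F : ℂ → ℂ → Matrix WillmoreSphere.Idx WillmoreSphere.Idx ℝ,
      WillmoreSphere.IsExtendedFrame WillmoreSphere.potential {z | WillmoreSphere.sigma z ≠ 0} F ∧
      ∀ l : ℂ, ‖l‖ = 1 →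
        WillmoreSphere.IsHarmonicFrame {z | WillmoreSphere.sigma z ≠ 0} (fun z => F z l) ∧
        WillmoreSphere.IsIsotropicFrame {z | WillmoreSphere.sigma z ≠ 0} (fun z => F z l) ∧
        ∀ z : ℂ, WillmoreSphere.sigma z ≠ 0 →
          WillmoreSphere.mcForm (fun ζ => F ζ l) z =
            WillmoreSphere.loopForm' (fun ζ => F ζ 1) l z ∧
          ∀ i : WillmoreSphere.Idx,
            ((Real.sqrt 2 / 2 * (F z l i (Sum.inl 0) - F z l i (Sum.inl 1)) : ℝ) : ℂ) =
              WillmoreSphere.Yvec l z (finSumFinEquiv i) ∧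
            ((Real.sqrt 2 / 2 * (F z l i (Sum.inl 0) + F z l i (Sum.inl 1)) : ℝ) : ℂ) =
              WillmoreSphere.Yhat l z (finSumFinEquiv i)) ∧
    ∀ l : ℂ, ‖l‖ = 1 →
      -- `y = [Y]` and `ŷ = [Ŷ]` are well defined on the whole sphere
      ∃ y yh : OnePoint ℂ → EuclideanSpace ℝ (Fin 7),
        WillmoreSphere.IsSmoothIntoSphereOn Set.univ y ∧
        WillmoreSphere.IsSmoothIntoSphereOn Set.univ yh ∧
        (∀ z : ℂ, WillmoreSphere.sigma z ≠ 0 → ∀ i : Fin 7,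
          ((y z i : ℝ) : ℂ) = WillmoreSphere.Yvec l z i.succ / WillmoreSphere.Yvec l z 0 ∧
          ((yh z i : ℝ) : ℂ) = WillmoreSphere.Yhat l z i.succ / WillmoreSphere.Yhat l z 0) ∧
        -- `ŷ`
        WillmoreSphere.IsConformalImmersionOn Set.univ yh ∧
        WillmoreSphere.IsHTotallyIsotropicOn Set.univ yh ∧
        WillmoreSphere.IsWillmoreOn Set.univ yh ∧
        (∀ z : ℂ, WillmoreSphere.metricCoeff (yh ∘ WillmoreSphere.coordZero) z =
          2 * (1 + 4 * ‖z‖ ^ 2 + ‖z‖ ^ 4 / 4 + 2 * ‖z‖ ^ 6 / 9 + 4 * ‖z‖ ^ 8 / 9 + ‖z‖ ^ 10 / 36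
              + ‖z‖ ^ 12 / 81) /
            (1 + ‖z‖ ^ 2 + 5 * ‖z‖ ^ 4 / 4 + 4 * ‖z‖ ^ 6 / 9 + ‖z‖ ^ 8 / 36) ^ 2) ∧
        (∀ Ω : Set (OnePoint ℂ), IsOpen Ω → Ω.Nonempty →
          ¬ ∃ g : OnePoint ℂ → EuclideanSpace ℝ (Fin 7),
            WillmoreSphere.IsDualSurfaceOn Ω yh g) ∧
        -- `y`
        WillmoreSphere.IsConformalImmersionOn {OnePoint.infty}ᶜ y ∧
        WillmoreSphere.IsHTotallyIsotropicOn {OnePoint.infty}ᶜ y ∧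
        WillmoreSphere.IsWillmoreOn {OnePoint.infty}ᶜ y ∧
        WillmoreSphere.IsBranchPoint y OnePoint.infty ∧
        (∀ z : ℂ, WillmoreSphere.metricCoeff (y ∘ WillmoreSphere.coordZero) z =
          2 * (1 + ‖z‖ ^ 4 / 4 + 4 * ‖z‖ ^ 6 / 9) /
            (1 + ‖z‖ ^ 2 + ‖z‖ ^ 4 / 4 + ‖z‖ ^ 6 / 9) ^ 2) ∧
        (∃ x : ℂ → EuclideanSpace ℝ (Fin 6),
          (∀ z : ℂ, z ≠ 0 → ∀ i, ((x z i : ℝ) : ℂ) = WillmoreSphere.xvec l z i) ∧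
          WillmoreSphere.IsMinimalSurfaceOn {z | z ≠ 0} x ∧
          WillmoreSphere.IsMoebiusEquivalentOn {z | z ≠ 0} (y ∘ WillmoreSphere.coordZero) x) ∧
        -- on the curve `1 - r⁴/4 - 2 r⁶/9 = 0` the two points coincide and `Y ∧ Ŷ` has no limit
        ∀ z₀ : ℂ, WillmoreSphere.sigma z₀ = 0 →
          y z₀ = yh z₀ ∧
          ¬ ∃ L : Fin 8 → Fin 8 → ℂ,
            Filter.Tendsto
              (fun z => WillmoreSphere.wedge (WillmoreSphere.Yvec l z) (WillmoreSphere.Yhat l z))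
              (nhdsWithin z₀ {z | WillmoreSphere.sigma z ≠ 0}) (nhds L) := by
  open WillmoreSphere in
  refine ⟨⟨extFrame, isExtendedFrame, fun l hl =>
    ⟨isGradedFrame.isHarmonicFrame hl, isGradedFrame.isIsotropicFrame hl, fun z hz => ⟨?_, fun i =>
      extFrame_inl hl hz i⟩⟩⟩, fun l hl => ?_⟩
  · have h := isGradedFrame.loopForm'_realFrame hz norm_one hl
    rw [one_mul] at h
    exact h.symm
  · obtain ⟨⟨_, _, _, DH₀⟩, _, _, _, DH₁⟩ := isotropicData_surfH hl
    obtain ⟨⟨_, _, _, DY₀⟩, _, _, _, DY₁⟩ := isotropicData_surfY hl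
    exact ⟨surfY l, surfH l, isSmoothIntoSphereOn_surfY hl, isSmoothIntoSphereOn_surfH hl,
      fun z hz i => ⟨surfY_eq_Yvec hl hz i, surfH_eq_Yhat hl hz i⟩,
      isConformalImmersionOn DH₀.surf DH₁.surf, isHTotallyIsotropicOn DH₀ DH₁,
      isWillmoreOn DH₀ DH₁, metricCoeff_surfH hl,
      fun Ω hΩ hne ⟨g, hg⟩ => not_isDualSurfaceOn_surfH hl hΩ hne g hg,
      isConformalImmersionOn DY₀.surf DY₁.surf, isHTotallyIsotropicOn DY₀ DY₁,
      isWillmoreOn DY₀ DY₁, isBranchPoint_surfY hl, metricCoeff_surfY hl,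
      ⟨minimalSurf l, fun z hz i => ofReal_minimalSurf hl hz i, isMinimalSurfaceOn_minimalSurf hl,
        isMoebiusEquivalentOn_surfY hl⟩,
      fun z₀ h => ⟨surfY_eq_surfH hl h, not_tendsto_wedge hl h⟩⟩
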